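/- Let $d\ge 3$ and $k\in\mathbb N$. Two reservoirs $r\in\{I,II\}$ of free fermions in $\mathbb R^d$ with $k$ spin states are described on the antisymmetric Fock space over $L^2(\mathbb R^d)\otimes\mathbb C^k\otimes\mathbb C^2$. All creation and annihilation operators $a^*(X),a(X)$, $X=(x,s,r)$, anticommute as usual (also between the two reservoirs, by a Klein–Jordan–Wigner transformation), and $\mathcal F$ is the $C^*$-algebra generated by the smeared operators $a(f),a^*(f)$. Let $H^0=\bigoplus_n\sum_j(-\Delta_j)$, $\alpha^0_t(a)=e^{itH^0}ae^{-itH^0}$, let $\tau_x$ denote space translations, and, for $W=W^*\in\mathcal F$, $\alpha_t(a)=e^{it(H^0+W)}ae^{-it(H^0+W)}$. A family of kernels $w=(w_N)_{N\ge1}$ defines the operator $\sum_{N\ge 1}\int dX^{(N)}dY^{(N)}\,a^*(X_1)\cdots a^*(X_N)\,w_N(X^{(N)},Y^{(N)})\,a(Y_1)\cdots a(Y_N)$ (where $\int dX$ includes the sums over $s$ and $r$). For $f\in L^2(\mathbb R^M)$ and $y\in\mathbb R^M$ put $$\|f\|_{M,y}=2^{-3M/2}\Bigl[\int\overline{f}\,\prod_{i=1}^M\Bigl(-\frac{d^2}{dx_i^2}+(x_i-y_i)^2+1\Bigr)^3f\,dx\Bigr]^{1/2}$$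 (in the sense of the closed quadratic form, and $+\infty$ outside of its domain), $\|f\|'_M=\|f\|_{M,0}$, $\|f\|''_M=\inf_y\|f\|_{M,y}\le\|f\|_M'$, and $$\|w\|^{\sharp}=\sum_{N\ge1}N\,2^{(d+2)N}\sum_{s,s',r,r'}\|w_N((\cdot,s,r),(\cdot,s',r'))\|^{\sharp}_{2dN},\qquad \sharp\in\{\,',''\}.$$ If $\|a\|^\sharp$ is finite, the family of kernels $a$ defines a bounded operator, again denoted by $a$, in $\mathcal F$; one writes $\|W\|^\sharp$, $\|a\|^\sharp$ for the norms of the kernels. The automorphisms $\alpha^0_t$, $\alpha_t$, $\tau_x$ leave $\mathcal F$ invariant. Let $\sharp$ be either $'$ or $''$, let $W$ be self-adjoint with kernels $w$, and suppose that $\frac{8\pi d}{d-2}\|W\|^\sharp<1$. Then for either sign $\pm$ there is a $*$-endomorphism $\sigma_\pm$ of $\mathcal F$ such that: 1. $\lim_{t\to\pm\infty}\|\alpha^0_{-t}\alpha_t(a)-\sigma_\pm(a)\|=0$ for all $a\in\mathcal F$; in particular for every $a$ with $\|a\|^\sharp<\infty$. 2. If $\|a\|^\sharp<\infty$, then $\sigma_\pm(a)$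 is given by a norm-convergent Dyson series: with $W(t)=\alpha^0_{-t}(W)$, $D_0(t)a=a$ and $D_m(t)a=\int_0^t[W(s),D_{m-1}(s)a]\,ds$, i.e. $D_m(t)a=\int_{t>t_m>\dots>t_1>0}[W(t_m),\dots,[W(t_1),a]\dots]\,dt_1\cdots dt_m$ for $t>0$, the norm limits $D_m(\pm\infty)a=\lim_{t\to\pm\infty}D_m(t)a$ exist, $\sum_m\|D_m(\pm\infty)a\|<\infty$, and $\sigma_\pm(a)=\sum_{m\ge0}i^mD_m(\pm\infty)a$. 3. For every $a\in\mathcal F$ the limits $\lim_{t\to\pm\infty}\alpha^0_{-t}\alpha_t(\tau_x(a))=\sigma_\pm(\tau_x(a))$ are uniform in $x\in\mathbb R^d$. More generally, if $\alpha^{(y)}_t$ denotes the dynamics with $W$ replaced by $\tau_y(W)$, then $\alpha^0_{-t}\alpha^{(y)}_t(\tau_x(a))\to\tau_y\sigma_\pm(\tau_{x-y}(a))$ in norm, uniformly in $x,y\in\mathbb R^d$. -/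

import Mathlib

open MeasureTheory Filter Topology ComplexConjugate
open scoped ENNReal SchwartzMap FourierTransform LineDeriv

noncomputable section
namespace FermiJunction

/-- Internal index `(s, r)` of a fermion: its spin or species `s ∈ {1, …, k}`, and the reservoir
`r` (`false` for `I`, `true` for `II`) in which it lives. -/
abbrev Label (k : ℕ) : Type := Fin k × Bool
/-- Physical space `ℝ^d`. -/
abbrev Space (d : ℕ) : Type := EuclideanSpace ℝ (Fin d)
/-- Positions `(x_1, …, x_n)` of `n` particles in `ℝ^d`; `X (i, j)` is the `j`-th coordinate of
the `i`-th particle. -/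
abbrev Conf (d n : ℕ) : Type := EuclideanSpace ℝ (Fin n × Fin d)
/-- Complex `L²` with respect to Lebesgue measure. -/
abbrev L2 (V : Type) [MeasureSpace V] : Type := Lp ℂ 2 (volume : Measure V)
/-- `n`-particle wave functions `ψ(x_1, s_1, …, x_n, s_n)`, with no symmetry imposed. -/
abbrev Sector (d k n : ℕ) : Type := PiLp 2 (fun _ : Fin n → Label k => L2 (Conf d n))
/-- The Hilbert sum over `n` of the spaces of `n`-particle wave functions. -/
abbrev FullFock (d k : ℕ) : Type := lp (fun n => Sector d k n) 2

/-- The symbol `e^{it(2π|ξ|)²}` of `e^{-itΔ}`; the Fourier transform of Mathlib is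
`∫ e^{-2πi⟨x,ξ⟩} f(x) dx`, for which `-Δ` is multiplication by `(2π|ξ|)²`. -/
def freePhase {V : Type} [NormedAddCommGroup V] (t : ℝ) (ξ : V) : ℂ :=
  Complex.exp (((t * (2 * Real.pi * ‖ξ‖) ^ 2 : ℝ) : ℂ) * Complex.I)

lemma continuous_freePhase {V : Type} [NormedAddCommGroup V] (t : ℝ) :
    Continuous (freePhase t : V → ℂ) := by
  unfold freePhase
  fun_prop

lemma norm_freePhase {V : Type} [NormedAddCommGroup V] (t : ℝ) (ξ : V) :
    ‖freePhase t ξ‖ = 1 := by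
  rw [freePhase, Complex.norm_exp_ofReal_mul_I]

section L2maps

variable {V : Type} [NormedAddCommGroup V] [InnerProductSpace ℝ V] [FiniteDimensional ℝ V]
    [MeasurableSpace V] [BorelSpace V]

/-- `f ↦ f ∘ A` for a linear isometry `A`. -/
def precomp (A : V ≃ₗᵢ[ℝ] V) : L2 V →ₗᵢ[ℂ] L2 V :=
  Lp.compMeasurePreservingₗᵢ ℂ A A.measurePreserving

lemma precomp_coe (A : V ≃ₗᵢ[ℝ] V) (f : L2 V) : precomp A f =ᵐ[volume] fun x => f (A x) :=
  Lp.coeFn_compMeasurePreserving f A.measurePreserving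

/-- `f ↦ f(· - a)`. -/
def shift (a : V) : L2 V →ₗᵢ[ℂ] L2 V :=
  Lp.compMeasurePreservingₗᵢ ℂ (fun x => x - a) (measurePreserving_sub_right volume a)

lemma shift_coe (a : V) (f : L2 V) : shift a f =ᵐ[volume] fun x => f (x - a) :=
  Lp.coeFn_compMeasurePreserving f (measurePreserving_sub_right volume a)

lemma shift_precomp (A : V ≃ₗᵢ[ℝ] V) (a : V) (ha : A a = a) (f : L2 V) :
    shift a (precomp A f) = precomp A (shift a f) := by
  apply Lp.ext
  have h1 := (measurePreserving_sub_right (volume : Measure V) a).quasiMeasurePreserving.ae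
    (precomp_coe A f)
  have h2 := A.measurePreserving.quasiMeasurePreserving.ae (shift_coe a f)
  filter_upwards [shift_coe a (precomp A f), precomp_coe A (shift a f), h1, h2]
    with x e1 e2 e3 e4
  rw [e1, e2, e3, e4, map_sub, ha]

lemma memLp_phase {u : V → ℂ} (hu : Continuous u) (h1 : ∀ x, ‖u x‖ = 1) (f : L2 V) :
    MemLp (fun x => u x * f x) 2 (volume : Measure V) :=
  (Lp.memLp f).of_le (hu.aestronglyMeasurable.mul (Lp.aestronglyMeasurable f))
    (Eventually.of_forall fun x => by simp [h1 x])

/-- Multiplication by a continuous function of modulus one. -/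
def mulPhase (u : V → ℂ) (hu : Continuous u) (h1 : ∀ x, ‖u x‖ = 1) : L2 V →ₗᵢ[ℂ] L2 V where
  toFun f := (memLp_phase hu h1 f).toLp
  map_add' f g := by
    apply Lp.ext
    filter_upwards [(memLp_phase hu h1 (f + g)).coeFn_toLp, (memLp_phase hu h1 f).coeFn_toLp,
      (memLp_phase hu h1 g).coeFn_toLp, Lp.coeFn_add f g,
      Lp.coeFn_add (memLp_phase hu h1 f).toLp (memLp_phase hu h1 g).toLp] with x e1 e2 e3 e4 e5
    rw [e1, e5, Pi.add_apply, e2, e3, e4, Pi.add_apply, mul_add]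
  map_smul' c f := by
    apply Lp.ext
    filter_upwards [(memLp_phase hu h1 (c • f)).coeFn_toLp, (memLp_phase hu h1 f).coeFn_toLp,
      Lp.coeFn_smul c f, Lp.coeFn_smul c (memLp_phase hu h1 f).toLp] with x e1 e2 e3 e4
    rw [e1, RingHom.id_apply, e4, Pi.smul_apply, e2, e3, Pi.smul_apply]
    simp only [smul_eq_mul]
    ring
  norm_map' f := by
    change ‖(memLp_phase hu h1 f).toLp‖ = ‖f‖
    rw [Lp.norm_toLp, Lp.norm_def]
    congr 1
    exact eLpNorm_congr_norm_ae (Eventually.of_forall fun x => by simp [h1 x])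

lemma mulPhase_coe (u : V → ℂ) (hu : Continuous u) (h1 : ∀ x, ‖u x‖ = 1) (f : L2 V) :
    mulPhase u hu h1 f =ᵐ[volume] fun x => u x * f x :=
  (memLp_phase hu h1 f).coeFn_toLp

lemma mulPhase_precomp (u : V → ℂ) (hu : Continuous u) (h1 : ∀ x, ‖u x‖ = 1) (A : V ≃ₗᵢ[ℝ] V)
    (hA : ∀ x, u (A x) = u x) (f : L2 V) :
    mulPhase u hu h1 (precomp A f) = precomp A (mulPhase u hu h1 f) := by
  apply Lp.ext
  have h2 := A.measurePreserving.quasiMeasurePreserving.ae (mulPhase_coe u hu h1 f)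
  filter_upwards [mulPhase_coe u hu h1 (precomp A f), precomp_coe A (mulPhase u hu h1 f),
    precomp_coe A f, h2] with x e1 e2 e3 e4
  rw [e1, e2, e3, e4, hA]

lemma fourier_precomp (A : V ≃ₗᵢ[ℝ] V) (f : L2 V) :
    𝓕 (precomp A f) = precomp A (𝓕 f) := by
  let S : 𝓢(V, ℂ) → 𝓢(V, ℂ) :=
    SchwartzMap.compCLMOfContinuousLinearEquiv ℂ A.toContinuousLinearEquiv
  have hS : ∀ g : 𝓢(V, ℂ), precomp A (g.toLp 2) = (S g).toLp 2 := by
    intro g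
    apply Lp.ext
    have h2 := A.measurePreserving.quasiMeasurePreserving.ae (g.coeFn_toLp 2 volume)
    filter_upwards [precomp_coe A (g.toLp 2), (S g).coeFn_toLp 2 volume, h2] with x e1 e2 e3
    rw [e1, e2, e3]
    rfl
  have hF : ∀ g : 𝓢(V, ℂ), 𝓕 (S g) = S (𝓕 g) := by
    intro g
    ext x
    change 𝓕 ((g : V → ℂ) ∘ A) x = 𝓕 (g : V → ℂ) (A x)
    rw [Real.fourier_comp_linearIsometry]
  refine DenseRange.induction_on (p := fun f : L2 V => 𝓕 (precomp A f) = precomp A (𝓕 f))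
    (SchwartzMap.denseRange_toLpCLM (F := ℂ) (E := V) (p := 2) (μ := volume)
      ENNReal.ofNat_ne_top) f ?_ ?_
  · exact isClosed_eq
      ((Lp.fourierTransformₗᵢ V ℂ).continuous.comp (precomp A).continuous)
      ((precomp A).continuous.comp (Lp.fourierTransformₗᵢ V ℂ).continuous)
  · intro g
    change 𝓕 (precomp A (g.toLp 2)) = precomp A (𝓕 (g.toLp 2))
    rw [hS, SchwartzMap.toLp_fourier_eq, SchwartzMap.toLp_fourier_eq, hS, hF]

/-- The unitary `e^{-itΔ} = e^{it(-Δ)}` on `L²(V)`, as a Fourier multiplier. -/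
def expLaplacian (t : ℝ) : L2 V →ₗᵢ[ℂ] L2 V :=
  (Lp.fourierTransformₗᵢ V ℂ).symm.toLinearIsometry.comp
    ((mulPhase (freePhase t) (continuous_freePhase t) (norm_freePhase t)).comp
      (Lp.fourierTransformₗᵢ V ℂ).toLinearIsometry)

lemma expLaplacian_precomp (t : ℝ) (A : V ≃ₗᵢ[ℝ] V) (f : L2 V) :
    expLaplacian t (precomp A f) = precomp A (expLaplacian t f) := by
  let F := Lp.fourierTransformₗᵢ V ℂ
  let M := mulPhase (V := V) (freePhase t) (continuous_freePhase t) (norm_freePhase t)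
  have h1 : ∀ g, F (precomp A g) = precomp A (F g) := fourier_precomp A
  have h2 : ∀ g, M (precomp A g) = precomp A (M g) :=
    mulPhase_precomp _ _ _ A (fun x => by simp [freePhase])
  change F.symm (M (F (precomp A f))) = precomp A (F.symm (M (F f)))
  rw [h1, h2]
  apply F.injective
  rw [h1, F.apply_symm_apply, F.apply_symm_apply]

end L2maps

/-- `(x_1, …, x_n) ↦ (x_{π 1}, …, x_{π n})`. -/
def permute (d : ℕ) {n : ℕ} (π : Equiv.Perm (Fin n)) : Conf d n ≃ₗᵢ[ℝ] Conf d n :=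
  LinearIsometryEquiv.piLpCongrLeft 2 ℝ ℝ (Equiv.prodCongr π⁻¹ (Equiv.refl (Fin d)))

lemma permute_apply (d : ℕ) {n : ℕ} (π : Equiv.Perm (Fin n)) (x : Conf d n) (i : Fin n)
    (j : Fin d) : permute d π x (i, j) = x (π i, j) := by
  rfl

/-- Totally antisymmetric sequences of wave functions: `ψ_n(X ∘ π) = sign(π) ψ_n(X)`. -/
def fock (d k : ℕ) : Submodule ℂ (FullFock d k) where
  carrier := {ψ | ∀ (n : ℕ) (π : Equiv.Perm (Fin n)) (s : Fin n → Label k),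
    precomp (permute d π) (ψ n (s ∘ π)) = ((Equiv.Perm.sign π : ℤ) : ℂ) • ψ n s}
  add_mem' := by
    intro a b ha hb n π s
    simp [ha n π s, hb n π s]
  zero_mem' := by
    intro n π s
    simp
  smul_mem' := by
    intro c a ha n π s
    simp [ha n π s, smul_comm c]

/-- The fermionic Fock space over `L²(ℝ^d) ⊗ ℂ^k ⊗ ℂ²`, i.e. of the two reservoirs together. -/
def Fock (d k : ℕ) : Type := fock d k

instance (d k : ℕ) : NormedAddCommGroup (Fock d k) :=
  inferInstanceAs (NormedAddCommGroup (fock d k))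

instance (d k : ℕ) : InnerProductSpace ℂ (Fock d k) :=
  inferInstanceAs (InnerProductSpace ℂ (fock d k))

lemma continuous_component (d k n : ℕ) (s : Fin n → Label k) :
    Continuous fun ψ : FullFock d k => ψ n s := by
  have h1 : Continuous fun ψ : FullFock d k => ψ n :=
    (continuous_apply n).comp lp.uniformContinuous_coe.continuous
  exact (PiLp.continuous_apply 2 _ s).comp h1

instance (d k : ℕ) : CompleteSpace (Fock d k) := by
  have hc : IsClosed (fock d k : Set (FullFock d k)) := by
    have : (fock d k : Set (FullFock d k)) =
        ⋂ (n : ℕ) (π : Equiv.Perm (Fin n)) (s : Fin n → Label k),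
          {ψ | precomp (permute d π) (ψ n (s ∘ π)) = ((Equiv.Perm.sign π : ℤ) : ℂ) • ψ n s} := by
      ext ψ
      simp only [Set.mem_iInter, Set.mem_ofPred_eq]
      rfl
    rw [this]
    refine isClosed_iInter fun n => isClosed_iInter fun π => isClosed_iInter fun s => ?_
    have h := (continuous_component d k n s).const_smul ((Equiv.Perm.sign π : ℤ) : ℂ)
    exact isClosed_eq ((precomp (permute d π)).continuous.comp (continuous_component d k n _)) h
  exact hc.completeSpace_coe

/-- The `n`-particle component `ψ_n(·, s_1, …, s_n)` of a Fock vector. -/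
def amplitude {d k : ℕ} (ψ : Fock d k) (n : ℕ) (s : Fin n → Label k) : L2 (Conf d n) :=
  ψ.1 n s

/-- Bounded operators on Fock space. -/
abbrev Op (d k : ℕ) : Type := Fock d k →L[ℂ] Fock d k

section sectorwise

variable {d : ℕ} (k : ℕ) (T : ∀ n, L2 (Conf d n) →ₗᵢ[ℂ] L2 (Conf d n))

/-- Apply `T n` to every spin component. -/
def sectorMap (n : ℕ) (v : Sector d k n) : Sector d k n := WithLp.toLp 2 fun s => T n (v s)

lemma norm_sectorMap (n : ℕ) (v : Sector d k n) : ‖sectorMap k T n v‖ = ‖v‖ := by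
  simp [sectorMap, PiLp.norm_eq_of_L2]

/-- Apply `T n` to the `n`-particle component, for every `n`. -/
def fullFockMap : FullFock d k →ₗᵢ[ℂ] FullFock d k where
  toFun ψ := ⟨fun n => sectorMap k T n (ψ n), by
    have h := (memℓp_gen_iff (by norm_num)).1 (lp.memℓp ψ)
    have h' : Memℓp (E := fun n => Sector d k n) (fun n => sectorMap k T n (ψ n)) 2 :=
      memℓp_gen (by simpa only [norm_sectorMap] using h)
    exact h'⟩
  map_add' φ ψ := by
    ext n : 2
    apply PiLp.ext
    intro s
    exact map_add (T n) (φ n s) (ψ n s)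
  map_smul' c ψ := by
    ext n : 2
    apply PiLp.ext
    intro s
    exact map_smul (T n) c (ψ n s)
  norm_map' ψ := by
    have h2 : 0 < (2 : ℝ≥0∞).toReal := by norm_num
    rw [lp.norm_eq_tsum_rpow h2, lp.norm_eq_tsum_rpow h2]
    congr 2
    ext n
    exact congrArg (· ^ (2 : ℝ≥0∞).toReal) (norm_sectorMap k T n (ψ n))

/-- The operator `ψ ↦ (T n ψ_n)_n` on Fock space, for permutation-covariant `T n`. -/
def secondQuantize
    (hT : ∀ (n : ℕ) (π : Equiv.Perm (Fin n)) (f : L2 (Conf d n)),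
      T n (precomp (permute d π) f) = precomp (permute d π) (T n f)) : Op d k :=
  ((fullFockMap k T).toContinuousLinearMap.comp (fock d k).subtypeL).codRestrict (fock d k) (by
    intro ψ n π s
    change precomp (permute d π) (T n (ψ.1 n (s ∘ π)))
      = ((Equiv.Perm.sign π : ℤ) : ℂ) • T n (ψ.1 n s)
    rw [← hT, ψ.2 n π s, map_smul])

lemma secondQuantize_apply
    (hT : ∀ (n : ℕ) (π : Equiv.Perm (Fin n)) (f : L2 (Conf d n)),
      T n (precomp (permute d π) f) = precomp (permute d π) (T n f))
    (ψ : Fock d k) (n : ℕ) (s : Fin n → Label k) :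
    amplitude (secondQuantize k T hT ψ) n s = T n (amplitude ψ n s) := rfl

end sectorwise

/-- `e^{itH⁰}`, where `H⁰ = ⊕_n ∑_j (-Δ_j)`: on `n` particles `∑_j Δ_j` is the Laplacian of
`ℝ^{dn}`. -/
def freePropagator (d k : ℕ) (t : ℝ) : Op d k :=
  secondQuantize k (fun _ => expLaplacian t) (fun _ π f => expLaplacian_precomp t (permute d π) f)

/-- The configuration `(x, …, x)`. -/
def diagonal {d : ℕ} (n : ℕ) (x : Space d) : Conf d n := WithLp.toLp 2 fun p => x p.2

/-- The unitary implementing space translations, `ψ_n(x_1, …, x_n) ↦ ψ_n(x_1 - x, …, x_n - x)`. -/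
def translation (d k : ℕ) (x : Space d) : Op d k :=
  secondQuantize k (fun n => shift (diagonal n x))
    (fun _ π f => shift_precomp (permute d π) _ (by ext p; rfl) f)

/-- `U a U*`. -/
def Ad {d k : ℕ} (U a : Op d k) : Op d k := U * a * star U

/-- The space translation `τ_x(a)`. -/
def spaceTranslate {d k : ℕ} (x : Space d) (a : Op d k) : Op d k := Ad (translation d k x) a

/-- `U t = e^{it(H⁰ + W)}`: a strongly continuous one-parameter unitary group whose (Stone)
generator is `H⁰ + W` on the domain of `H⁰`. The vectors `ψ` in that domain are those for which
`t ↦ e^{itH⁰}ψ` is differentiable at `0`; the derivative `η` is then `iH⁰ψ`. -/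
structure IsPropagator {d k : ℕ} (W : Op d k) (U : ℝ → Op d k) : Prop where
  mem_unitary : ∀ t, U t ∈ unitary (Op d k)
  map_zero : U 0 = 1
  map_add : ∀ s t, U (s + t) = U s * U t
  strongly_continuous : ∀ ψ, Continuous fun t => U t ψ
  generator : ∀ ψ η : Fock d k, HasDerivAt (fun t => freePropagator d k t ψ) η 0 →
    HasDerivAt (fun t => U t ψ) (η + Complex.I • W ψ) 0

/-- The group `e^{it(H⁰ + W)}`. -/
def propagator {d k : ℕ} (W : Op d k) : ℝ → Op d k := Classical.epsilon (IsPropagator W)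

/-- `α⁰_t(a) = e^{itH⁰} a e^{-itH⁰}`. -/
def freeDynamics {d k : ℕ} (t : ℝ) (a : Op d k) : Op d k := Ad (freePropagator d k t) a

/-- `α_t(a) = e^{it(H⁰ + W)} a e^{-it(H⁰ + W)}`. -/
def dynamics {d k : ℕ} (W : Op d k) (t : ℝ) (a : Op d k) : Op d k := Ad (propagator W t) a

/-- The Dyson terms `D_m(t)a`: with `W(s) = α⁰_{-s}(W)`,
`D_0(t)a = a` and `D_{m+1}(t)a = ∫_0^t [W(s), D_m(s)a] ds`, so that, for `t > 0`,
`D_m(t)a = ∫_{t > t_m > … > t_1 > 0} [W(t_m), … [W(t_1), a] … ]`. -/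
def dysonTerm {d k : ℕ} (W : Op d k) (a : Op d k) : ℕ → ℝ → Op d k
  | 0, _ => a
  | m + 1, t => ∫ s in (0 : ℝ)..t, ⁅freeDynamics (-s) W, dysonTerm W a m s⁆

/-- `(x, x_1, …, x_n)`. -/
def cons {d n : ℕ} (x : Space d) (X : Conf d n) : Conf d (n + 1) :=
  WithLp.toLp 2 fun p => Fin.cases (x p.2) (fun i => X (i, p.2)) p.1

/-- `(x_1, …, x_N, z_1, …, z_m)`. -/
def append {d N m : ℕ} (X : Conf d N) (Z : Conf d m) : Conf d (N + m) :=
  WithLp.toLp 2 fun p => Fin.append (fun i => X (i, p.2)) (fun i => Z (i, p.2)) p.1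

/-- `(x_N, …, x_1)`. -/
def reverse {d N : ℕ} (X : Conf d N) : Conf d N := WithLp.toLp 2 fun p => X (p.1.rev, p.2)

/-- `T` is the annihilation operator `a(f)`:
`(a(f)ψ)_n(X) = √(n+1) ∑_{s,r} ∫ conj(f(x,s,r)) ψ_{n+1}((x,s,r), X) dx`. -/
def IsAnnihilation {d k : ℕ} (f : Label k → L2 (Space d)) (T : Op d k) : Prop :=
  ∀ (ψ : Fock d k) (n : ℕ) (s : Fin n → Label k), ∀ᵐ X : Conf d n,
    amplitude (T ψ) n s X = (√(n + 1) : ℂ) *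
      ∑ l : Label k, ∫ x : Space d,
        conj (f l x) * amplitude ψ (n + 1) (Fin.cons l s : Fin (n + 1) → Label k) (cons x X)

/-- The field algebra `𝓕`: the C*-algebra generated by the operators `a(f)`, `a*(f)`. -/
def fieldAlgebra (d k : ℕ) : StarSubalgebra ℂ (Op d k) :=
  (StarAlgebra.adjoin ℂ {T : Op d k | ∃ f, IsAnnihilation f T}).topologicalClosure

/-- Index set of the `2dN` real variables of an `N`-body kernel `w_N(X, Y)`. -/
abbrev KernelIndex (d N : ℕ) : Type := (Fin N × Fin d) ⊕ (Fin N × Fin d)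

/-- A family of kernels `w_N((·, s, r), (·, s', r'))`. Only the kernels with `N ≥ 1` are used. -/
abbrev Kernel (d k : ℕ) : Type :=
  ∀ N : ℕ, (Fin N → Label k) → (Fin N → Label k) → L2 (EuclideanSpace ℝ (KernelIndex d N))

/-- The point `(X, Y)` of `ℝ^{2dN}`. -/
def joined {d N : ℕ} (X Y : Conf d N) : EuclideanSpace ℝ (KernelIndex d N) :=
  WithLp.toLp 2 (Sum.elim X Y)

/-- The matrix element, between the `(N+m)`-particle components of `φ` and `ψ`, of
`W_N = ∫ dX ∫ dY a*(X_1) ⋯ a*(X_N) w_N(X, Y) a(Y_1) ⋯ a(Y_N)`. It is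
`∫ dX dY ⟨a(X_N) ⋯ a(X_1)φ, a(Y_1) ⋯ a(Y_N)ψ⟩ w_N(X, Y)`, and
`(a(Y_1) ⋯ a(Y_N)ψ)_m(Z) = √((N+m)!/m!) ψ_{N+m}(Y_N, …, Y_1, Z)`. -/
def wickForm {d k : ℕ} (w : Kernel d k) (N m : ℕ) (φ ψ : Fock d k) : ℂ :=
  ((N + m).descFactorial N : ℂ) *
    ∑ s : Fin N → Label k, ∑ s' : Fin N → Label k, ∑ u : Fin m → Label k,
      ∫ X : Conf d N, ∫ Y : Conf d N, ∫ Z : Conf d m,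
        conj (amplitude φ (N + m) (Fin.append s u) (append X Z)) * w N s s' (joined X Y) *
          amplitude ψ (N + m) (Fin.append (s' ∘ Fin.rev) u) (append (reverse Y) Z)

/-- `T` is the bounded operator `∑_{N ≥ 1} W_N` with kernels `w`. -/
def IsWickOperator {d k : ℕ} (w : Kernel d k) (T : Op d k) : Prop :=
  ∀ φ ψ : Fock d k,
    HasSum (fun p : ℕ × ℕ => wickForm w (p.1 + 1) p.2 φ ψ) (inner ℂ φ (T ψ))

section norms

variable {κ : Type} [Fintype κ]

/-- The operator `-d²/dx_i² + (x_i - y_i)² + 1` on Schwartz functions. -/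
def harmonic (y : κ → ℝ) (i : κ) :
    𝓢(EuclideanSpace ℝ κ, ℂ) →L[ℂ] 𝓢(EuclideanSpace ℝ κ, ℂ) :=
  letI := Classical.decEq κ
  let e : EuclideanSpace ℝ κ := EuclideanSpace.single i 1
  SchwartzMap.smulLeftCLM ℂ (fun x : EuclideanSpace ℝ κ => (((x i - y i) ^ 2 + 1 : ℝ) : ℂ)) -
    (LineDeriv.lineDerivOpCLM ℂ 𝓢(EuclideanSpace ℝ κ, ℂ) e).comp
      (LineDeriv.lineDerivOpCLM ℂ 𝓢(EuclideanSpace ℝ κ, ℂ) e)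

lemma harmonic_apply [DecidableEq κ] (y : κ → ℝ) (i : κ) (g : 𝓢(EuclideanSpace ℝ κ, ℂ))
    (x : EuclideanSpace ℝ κ) :
    harmonic y i g x =
      (((x i - y i) ^ 2 + 1 : ℝ) : ℂ) * g x -
        lineDeriv ℝ (fun z => lineDeriv ℝ g z (EuclideanSpace.single i 1)) x
          (EuclideanSpace.single i 1) := by
  have ht : (fun x : EuclideanSpace ℝ κ =>
      (((x i - y i) ^ 2 + 1 : ℝ) : ℂ)).HasTemperateGrowth := by
    have h0 : (fun x : EuclideanSpace ℝ κ => (x i : ℝ)).HasTemperateGrowth :=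
      (EuclideanSpace.proj (𝕜 := ℝ) i).hasTemperateGrowth
    fun_prop
  obtain rfl : ‹DecidableEq κ› = Classical.decEq κ := Subsingleton.elim _ _
  let _ := Classical.decEq κ
  change (SchwartzMap.smulLeftCLM ℂ _ g) x - _ = _
  rw [SchwartzMap.smulLeftCLM_apply_apply ht, smul_eq_mul]
  congr 1
  have h : ∀ (f : 𝓢(EuclideanSpace ℝ κ, ℂ)) (v : EuclideanSpace ℝ κ),
      ⇑(∂_{v} f : 𝓢(EuclideanSpace ℝ κ, ℂ)) = fun z => lineDeriv ℝ f z v :=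
    fun f v => funext fun z => SchwartzMap.lineDerivOp_apply v f z
  let e : EuclideanSpace ℝ κ := EuclideanSpace.single i 1
  have h2 := h (∂_{e} g : 𝓢(EuclideanSpace ℝ κ, ℂ)) e
  rw [h g] at h2
  exact congrFun h2 x

/-- `∫ conj(g) ∏_i (-d²/dx_i² + (x_i - y_i)² + 1)³ g dx`, for Schwartz functions `g` (the factors
commute). -/
def weightForm (y : κ → ℝ) (g : 𝓢(EuclideanSpace ℝ κ, ℂ)) : ℝ :=
  (∫ x, conj (g x) * ((Finset.univ.toList.map fun i => harmonic y i ^ 3).prod g) x).re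

/-- The norm `2^{-3M/2} [∫ conj(f) ∏_i (-d²/dx_i² + (x_i - y_i)² + 1)³ f dx]^{1/2}` on `L²(ℝ^M)`,
with value `∞` outside of the form domain. The quadratic form is given by the integral on Schwartz
functions, and is extended to `L²` as its closure, i.e. as its lower semicontinuous envelope:
the liminf over Schwartz functions `g` that tend to `f` in `L²`. -/
def weightedNorm (y : κ → ℝ) (f : L2 (EuclideanSpace ℝ κ)) : ℝ≥0∞ :=
  liminf (fun g : 𝓢(EuclideanSpace ℝ κ, ℂ) =>
      ENNReal.ofReal ((2 : ℝ) ^ (-(3 * (Fintype.card κ : ℝ) / 2)) * √(weightForm y g)))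
    (comap (fun g : 𝓢(EuclideanSpace ℝ κ, ℂ) => g.toLp 2 volume) (𝓝 f))

end norms

/-- `∑_{N ≥ 1} N 2^{(d+2)N} ∑ q(w_N)`, the inner sum over all spin and reservoir indices of `w_N`. -/
def kernelSum {d k : ℕ}
    (q : ∀ N : ℕ, L2 (EuclideanSpace ℝ (KernelIndex d N)) → ℝ≥0∞) (w : Kernel d k) : ℝ≥0∞ :=
  ∑' N : ℕ, (N : ℝ≥0∞) * 2 ^ ((d + 2) * N) *
    ∑ s : Fin N → Label k, ∑ s' : Fin N → Label k, q N (w N s s')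

/-- The norm of a family of kernels, with weights centred at the origin. -/
def kernelNorm {d k : ℕ} (w : Kernel d k) : ℝ≥0∞ := kernelSum (fun _ f => weightedNorm 0 f) w

/-- The translation-invariant version of `kernelNorm`: for each kernel the infimum over all centres
`y ∈ ℝ^{2dN}` of the weights. -/
def kernelNormInf {d k : ℕ} (w : Kernel d k) : ℝ≥0∞ :=
  kernelSum (fun _ f => ⨅ y, weightedNorm y f) w

end FermiJunction

end

open FermiJunction

set_option linter.unusedSectionVars false
noncomputable section
namespace FermiJunction

/-! ### Iterated integrals of an operator-valued function -/

section volterra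

/-! In the interaction picture, `α⁰_{-t} α_t` is conjugation by the unitary solution `wave` of `G' =
i W(t) G`, and its value on `a` is the Dyson series `∑ i^m D_m(t)a` (`hasSum_dysonTerm`). The task
is to pass to the limit `t → ±∞` in this series. The mechanism is dispersion: the commutator of
`W(u)` with a single field is integrable in `u` when `d ≥ 3`.

From kernels to words. A kernel with finite weighted norm is expanded in products of Hermite
functions, eigenfunctions of `-d²/dx² + (x-y)² + 1` with eigenvalues `2(n+1)`. Each such product is
the kernel of an ordered product of `2N` one-particle operators (`hasSum_wickOp`, `wickOp_eq`). In
one dimension the `L¹` norm of a Hermite function is at most `√(2π(n+1))` times its `L²` norm. After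
division by `∏ √(n_i+1)` the one-particle functions have `L²` norm at most `1` and `L¹` norm at most
`(2π)^{d/2}`. The coefficients must then be summable with the weight `∏ √(n_i+1)`; by Cauchy–Schwarz
this costs `√2` per coordinate and uses the third power of the oscillator (`tsum_coeff_le`).

Decay. The anticommutator of one normalized field with another one evolved for a time `t` is a
scalar, bounded by `1` and by `(4π|t|)^{-d/2} (2π)^d = (π/|t|)^{d/2}` (`norm_inner_waveOf_le`). The
smaller of the two bounds has integral `I = πd/(d-2)` over the half line.

The estimate. The `D_m` satisfy the Leibniz rule of a divided power of a derivation (`dyson_mul`).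
Let `T_m` be the supremum of `‖D_m(t)φ‖` over normalized fields `φ` and times `t ≥ 0`. Peel off the
earliest commutator: for an even word of length `L`, commuting with an evolved field produces `L`
terms, each a decaying scalar times a word of length `L-1`. So `T_{m+1}` is at most `I ∑ |c| L`
times the coefficient of `z^m` in `(∑ T_j z^j)^{L-1}`. The partial sums `S_M` of the `T_m` therefore
satisfy `S_{M+1} ≤ 1 + I ∑ |c| L S_M^{L-1}`, and they stay below `2` as soon as `I ∑ |c| L 2^{L-1} ≤
1` (`sum_fieldBound_le`). With `L = 2N` the weight is `N 2^{2N}`, and the Hermite sums contribute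
`2^{dN}`: this is the `N 2^{(d+2)N}` of the norm. A factor `2` pays for a nearly optimal centre of
the weights, so `2 I ‖W‖ ≤ 1` is enough.

Convergence. These bounds are summable majorants, so dominated convergence in the earliest time, in
the Hermite index and in the order `m` gives the limits, by induction on `m`. All of it is uniform
over the class of normalized fields. That class is translation invariant, whence the uniformity in
`x`. The elements with uniformly Cauchy evolution form a closed `*`-subalgebra, so that the
generators suffice (`fieldAlgebra_le_cauchySubalgebra`). Past times are future times of the
time-reversed system with interaction `-W`, and translations of `W` are removed by covariance
(`Ad_wave_spaceTranslate`). -/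

lemma integral_triangle_swap {E : Type*} [NormedAddCommGroup E] [NormedSpace ℝ E]
    {H : ℝ → ℝ → E} (hH : Continuous (Function.uncurry H)) {s t : ℝ} (hst : s ≤ t) :
    ∫ u in s..t, ∫ v in u..t, H u v = ∫ v in s..t, ∫ u in s..v, H u v := by
  let f : ℝ → ℝ → E := fun u v => if u < v then H u v else 0
  have hm : MeasurableSet {p : ℝ × ℝ | p.1 < p.2} := measurableSet_lt measurable_fst measurable_snd
  have hf : Integrable (Function.uncurry f)
      ((volume.restrict (Set.Ioc s t)).prod (volume.restrict (Set.Ioc s t))) := by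
    have h1 : Integrable (Function.uncurry H)
        ((volume.restrict (Set.Ioc s t)).prod (volume.restrict (Set.Ioc s t))) := by
      rw [Measure.prod_restrict]
      refine IntegrableOn.mono_set ?_
        (Set.prod_mono Set.Ioc_subset_Icc_self Set.Ioc_subset_Icc_self)
      exact hH.continuousOn.integrableOn_compact (isCompact_Icc.prod isCompact_Icc)
    refine (h1.indicator hm).congr (Eventually.of_forall fun p => ?_)
    simp [Set.indicator, f, Function.uncurry]
  rw [intervalIntegral.integral_of_le hst, intervalIntegral.integral_of_le hst]
  have e1 : ∀ u ∈ Set.Ioc s t, ∫ v in u..t, H u v = ∫ v in Set.Ioc s t, f u v := by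
    intro u hu
    rw [intervalIntegral.integral_of_le hu.2]
    have : f u = (Set.Ioi u).indicator (H u) := by
      ext v; simp [f, Set.indicator]
    rw [this, setIntegral_indicator measurableSet_Ioi]
    congr 2
    ext v
    simp only [Set.mem_Ioc, Set.mem_inter_iff, Set.mem_Ioi]
    constructor
    · rintro ⟨h1, h2⟩; exact ⟨⟨hu.1.trans h1, h2⟩, h1⟩
    · rintro ⟨⟨_, h2⟩, h1⟩; exact ⟨h1, h2⟩
  have e2 : ∀ v ∈ Set.Ioc s t, ∫ u in s..v, H u v = ∫ u in Set.Ioc s t, f u v := by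
    intro v hv
    rw [intervalIntegral.integral_of_le hv.1.le, integral_Ioc_eq_integral_Ioo]
    have : (fun u => f u v) = (Set.Iio v).indicator (fun u => H u v) := by
      ext u; simp [f, Set.indicator]
    rw [this, setIntegral_indicator measurableSet_Iio]
    congr 2
    ext u
    simp only [Set.mem_Ioo, Set.mem_inter_iff, Set.mem_Iio, Set.mem_Ioc]
    constructor
    · rintro ⟨h1, h2⟩; exact ⟨⟨h1, h2.le.trans hv.2⟩, h2⟩
    · rintro ⟨⟨h1, _⟩, h2⟩; exact ⟨h1, h2⟩
  rw [setIntegral_congr_fun measurableSet_Ioc e1, setIntegral_congr_fun measurableSet_Ioc e2]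
  exact integral_integral_swap hf

variable {B : Type*} [NormedRing B] [NormedAlgebra ℝ B] [CompleteSpace B]

/-- The iterated integrals `∫_{t > t_m > … > t_1 > s} K(t_m) ⋯ K(t_1)`. -/
def volterra (K : ℝ → B) : ℕ → ℝ → ℝ → B
  | 0, _, _ => 1
  | m + 1, s, t => ∫ u in s..t, K u * volterra K m s u

variable {K : ℝ → B}

lemma continuous_volterra (hK : Continuous K) (m : ℕ) :
    Continuous (fun p : ℝ × ℝ => volterra K m p.1 p.2) := by
  induction m with
  | zero => exact continuous_const
  | succ m ih =>
    have hc : Continuous (fun q : (ℝ × ℝ) × ℝ => K q.2 * volterra K m q.1.1 q.2) :=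
      (hK.comp continuous_snd).mul
        (ih.comp (by fun_prop : Continuous fun q : (ℝ × ℝ) × ℝ => (q.1.1, q.2)))
    have h1 := intervalIntegral.continuous_parametric_intervalIntegral_of_continuous
      (μ := volume) (a₀ := 0)
      (f := fun (p : ℝ × ℝ) u => K u * volterra K m p.1 u) hc continuous_snd
    have h2 := intervalIntegral.continuous_parametric_intervalIntegral_of_continuous
      (μ := volume) (a₀ := 0)
      (f := fun (p : ℝ × ℝ) u => K u * volterra K m p.1 u) hc continuous_fst
    -- Both ends of the interval move, so the integral is written as a difference of two integrals
    -- with fixed lower end `0`.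
    refine (h1.sub h2).congr fun p => ?_
    have hi : ∀ a b, IntervalIntegrable (fun u => K u * volterra K m p.1 u) volume a b :=
      fun a b => (hc.comp (by fun_prop : Continuous fun u : ℝ => (p, u))).intervalIntegrable a b
    exact intervalIntegral.integral_interval_sub_left (hi _ _) (hi _ _)

lemma continuous_volterra_right (hK : Continuous K) (m : ℕ) (s : ℝ) :
    Continuous (volterra K m s) :=
  (continuous_volterra hK m).comp (by fun_prop : Continuous fun t : ℝ => (s, t))

lemma continuous_volterra_left (hK : Continuous K) (m : ℕ) (t : ℝ) :
    Continuous (fun s => volterra K m s t) :=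
  (continuous_volterra hK m).comp (by fun_prop : Continuous fun s : ℝ => (s, t))

lemma volterra_self (m : ℕ) (s : ℝ) : volterra K (m + 1) s s = 0 := by
  simp [volterra]

lemma hasDerivAt_volterra (hK : Continuous K) (m : ℕ) (s t : ℝ) :
    HasDerivAt (volterra K (m + 1) s) (K t * volterra K m s t) t :=
  ((hK.mul (continuous_volterra_right hK m s)).integral_hasStrictDerivAt s t).hasDerivAt

/-- The recursion that integrates over the earliest time last. -/
lemma volterra_succ_left (hK : Continuous K) (m : ℕ) {s t : ℝ} (hst : s ≤ t) :
    volterra K (m + 1) s t = ∫ u in s..t, volterra K m u t * K u := by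
  induction m generalizing t with
  | zero => simp [volterra]
  | succ m ih =>
    have hc : Continuous (Function.uncurry fun u v => K v * volterra K m u v * K u) :=
      ((hK.comp continuous_snd).mul (continuous_volterra hK m)).mul (hK.comp continuous_fst)
    have e1 : ∫ u in s..t, volterra K (m + 1) u t * K u
        = ∫ u in s..t, ∫ v in u..t, K v * volterra K m u v * K u := by
      refine intervalIntegral.integral_congr fun u _ => ?_
      exact (((ContinuousLinearMap.mul ℝ B).flip (K u)).intervalIntegral_comp_comm
        ((hK.mul (continuous_volterra_right hK m u)).intervalIntegrable u t)).symm
    -- Fubini on the triangle `s < u < v < t` puts the earliest time innermost, where the induction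
    -- hypothesis applies with endpoint `v`.
    rw [e1, integral_triangle_swap hc hst]
    refine intervalIntegral.integral_congr fun v hv => ?_
    rw [Set.uIcc_of_le hst] at hv
    rw [ih hv.1]
    refine (((ContinuousLinearMap.mul ℝ B) (K v)).intervalIntegral_comp_comm
        (((continuous_volterra_left hK m v).mul hK).intervalIntegrable s v)).symm.trans ?_
    simp only [ContinuousLinearMap.mul_apply', Pi.mul_apply, mul_assoc]

/-- The ordered simplex of times has volume `t^m / m!`. The bound `‖1‖ ≤ 1` rather than an equality
leaves room for the zero algebra. -/
lemma norm_volterra_le (m : ℕ) {C T : ℝ} (hC : ∀ u ∈ Set.Icc 0 T, ‖K u‖ ≤ C)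
    (h1 : ‖(1 : B)‖ ≤ 1) {t : ℝ} (ht : t ∈ Set.Icc 0 T) :
    ‖volterra K m 0 t‖ ≤ (C * t) ^ m / m.factorial := by
  induction m generalizing t with
  | zero => simpa [volterra] using h1
  | succ m ih =>
    have hC0 : 0 ≤ C := (norm_nonneg _).trans (hC t ht)
    have hb : ‖∫ u in (0 : ℝ)..t, K u * volterra K m 0 u‖
        ≤ ∫ u in (0 : ℝ)..t, C * ((C * u) ^ m / m.factorial) := by
      refine intervalIntegral.norm_integral_le_of_norm_le ht.1 (Eventually.of_forall ?_)
        (by apply Continuous.intervalIntegrable; fun_prop)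
      intro u hu
      have hu' : u ∈ Set.Icc 0 T := ⟨hu.1.le, hu.2.trans ht.2⟩
      exact (norm_mul_le _ _).trans
        (mul_le_mul (hC u hu') (ih hu') (norm_nonneg _) hC0)
    refine hb.trans (le_of_eq ?_)
    have : (fun u : ℝ => C * ((C * u) ^ m / m.factorial))
        = fun u : ℝ => (C ^ (m + 1) / m.factorial) * u ^ m := by
      ext u; rw [mul_pow]; ring
    rw [this, intervalIntegral.integral_const_mul, integral_pow, Nat.factorial_succ]
    push_cast
    field_simp
    ring

end volterra

/-! ### Iterated commutators and their Leibniz rule -/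

section derivation

variable {A : Type*} [NormedRing A] [NormedAlgebra ℂ A] [CompleteSpace A]

/-- The inner derivation `a ↦ [w, a]`. -/
def commutatorCLM (w : A) : A →L[ℂ] A :=
  ContinuousLinearMap.mul ℂ A w - (ContinuousLinearMap.mul ℂ A).flip w

lemma commutatorCLM_apply (w a : A) : commutatorCLM w a = w * a - a * w := rfl

lemma commutatorCLM_mul (w a b : A) :
    commutatorCLM w (a * b) = commutatorCLM w a * b + a * commutatorCLM w b := by
  simp only [commutatorCLM_apply]; noncomm_ring

lemma continuous_commutatorCLM : Continuous (commutatorCLM : A → A →L[ℂ] A) :=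
  (ContinuousLinearMap.mul ℂ A).continuous.sub (ContinuousLinearMap.mul ℂ A).flip.continuous

/-- The iterated commutators `∫_{t > t_m > … > t_1 > s} [w(t_m), … [w(t_1), a] … ]`. -/
def dyson (w : ℝ → A) (m : ℕ) (s t : ℝ) : A →L[ℂ] A :=
  volterra (fun u => commutatorCLM (w u)) m s t

variable {w : ℝ → A}

lemma continuous_dyson (hw : Continuous w) (m : ℕ) :
    Continuous (fun p : ℝ × ℝ => dyson w m p.1 p.2) :=
  continuous_volterra (continuous_commutatorCLM.comp hw) m

lemma dyson_zero (s t : ℝ) (a : A) : dyson w 0 s t a = a := rfl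

lemma continuous_dyson_apply (hw : Continuous w) (m : ℕ) (s : ℝ) (a : A) :
    Continuous (fun t => dyson w m s t a) :=
  ((continuous_dyson hw m).comp (by fun_prop : Continuous fun t : ℝ => (s, t))).clm_apply
    continuous_const

lemma dyson_succ (hw : Continuous w) (m : ℕ) (s t : ℝ) (a : A) :
    dyson w (m + 1) s t a = ∫ u in s..t, commutatorCLM (w u) (dyson w m s u a) := by
  have hc : Continuous fun u => commutatorCLM (w u) * dyson w m s u :=
    (continuous_commutatorCLM.comp hw).mul
      ((continuous_dyson hw m).comp (by fun_prop : Continuous fun t : ℝ => (s, t)))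
  exact ContinuousLinearMap.intervalIntegral_apply (hc.intervalIntegrable s t) a

/-- The earliest commutator is peeled off. This makes the estimates recursive: `[w(u), a]` can be
computed exactly when `a` is a field, and the remaining `m` commutators then act on the result. -/
lemma dyson_succ_left (hw : Continuous w) (m : ℕ) {s t : ℝ} (hst : s ≤ t) (a : A) :
    dyson w (m + 1) s t a = ∫ u in s..t, dyson w m u t (commutatorCLM (w u) a) := by
  have hK : Continuous fun u => commutatorCLM (w u) := continuous_commutatorCLM.comp hw
  have hc : Continuous fun u => dyson w m u t * commutatorCLM (w u) :=
    ((continuous_dyson hw m).comp (by fun_prop : Continuous fun s : ℝ => (s, t))).mul hK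
  rw [dyson, volterra_succ_left hK m hst]
  exact ContinuousLinearMap.intervalIntegral_apply (hc.intervalIntegrable s t) a

lemma hasDerivAt_dyson (hw : Continuous w) (m : ℕ) (s t : ℝ) (a : A) :
    HasDerivAt (fun t => dyson w (m + 1) s t a) (commutatorCLM (w t) (dyson w m s t a)) t :=
by
  have h : HasDerivAt (fun t => dyson w (m + 1) s t) (commutatorCLM (w t) * dyson w m s t) t :=
    hasDerivAt_volterra (continuous_commutatorCLM.comp hw) m s t
  exact (((ContinuousLinearMap.apply ℂ A a).restrictScalars ℝ).hasFDerivAt.comp_hasDerivAt t h)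

/-- Leibniz rule for the Dyson terms. -/
lemma dyson_mul (hw : Continuous w) (m : ℕ) (s t : ℝ) (a b : A) :
    dyson w m s t (a * b)
      = ∑ p ∈ Finset.HasAntidiagonal.antidiagonal m, dyson w p.1 s t a * dyson w p.2 s t b := by
  induction m generalizing t with
  | zero => simp [dyson_zero]
  | succ m ih =>
    let R : ℝ → A := fun t =>
      ∑ p ∈ Finset.HasAntidiagonal.antidiagonal (m + 1), dyson w p.1 s t a * dyson w p.2 s t b
    have hd : ∀ (i : ℕ) (x : A) (t : ℝ), HasDerivAt (fun t => dyson w i s t x)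
        (if i = 0 then 0 else commutatorCLM (w t) (dyson w (i - 1) s t x)) t := by
      intro i x t
      cases i with
      | zero => simpa [dyson_zero] using hasDerivAt_const t x
      | succ i => simpa using hasDerivAt_dyson hw i s t x
    -- Differentiating either factor lowers its order by one; the two shifted sums recombine,
    -- because a commutator is a derivation, into the commutator with the sum of order `m`. So both
    -- sides of the claim have the same derivative.
    have hR : ∀ t, HasDerivAt R (commutatorCLM (w t) (dyson w m s t (a * b))) t := by
      intro t
      have h := HasDerivAt.fun_sum (u := Finset.HasAntidiagonal.antidiagonal (m + 1))
        (A := fun p t => dyson w p.1 s t a * dyson w p.2 s t b)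
        (fun p _ => (hd p.1 a t).mul (hd p.2 b t))
      refine h.congr_deriv ?_
      rw [ih t, map_sum, Finset.sum_add_distrib]
      simp only [commutatorCLM_mul]
      rw [Finset.sum_add_distrib, Finset.Nat.sum_antidiagonal_succ]
      rw [Finset.Nat.sum_antidiagonal_succ']
      simp
    have hL := hasDerivAt_dyson hw m s
    have hD : ∀ t, HasDerivAt (fun t => dyson w (m + 1) s t (a * b) - R t) 0 t := fun t =>
      ((hL t (a * b)).sub (hR t)).congr_deriv (sub_self _)
    have hconst := is_const_of_deriv_eq_zero (fun t => (hD t).differentiableAt)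
      (fun t => (hD t).deriv) t s
    -- At `t = s` all terms of positive order vanish, and no pair on the antidiagonal of `m + 1` is
    -- `(0, 0)`; this fixes the constant of integration.
    have h0 : ∀ (i : ℕ) (x : A), dyson w (i + 1) s s x = 0 := by
      intro i x; simp [dyson, volterra_self]
    have hRs : R s = 0 := by
      refine Finset.sum_eq_zero fun p hp => ?_
      rcases p with ⟨i, j⟩
      rw [Finset.HasAntidiagonal.mem_antidiagonal] at hp
      rcases i with _ | i
      · rcases j with _ | j
        · simp at hp
        · simp [h0]
      · simp [h0]
    rw [h0, hRs, sub_zero, sub_eq_zero] at hconst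
    exact hconst

lemma dyson_one (hw : Continuous w) (m : ℕ) {s t : ℝ} (hst : s ≤ t) :
    dyson w m s t (1 : A) = if m = 0 then 1 else 0 := by
  cases m with
  | zero => simp [dyson_zero]
  | succ m =>
    rw [dyson_succ_left hw m hst]
    simp [commutatorCLM_apply]

end derivation

/-! ### Scattering by a dispersive perturbation in a Banach algebra -/

section convolution

/-- The coefficient of `X^m` in `(∑ T_j X^j)^n`. -/
def convPow (T : ℕ → ℝ≥0∞) : ℕ → ℕ → ℝ≥0∞
  | 0, m => if m = 0 then 1 else 0
  | n + 1, m => ∑ p ∈ Finset.HasAntidiagonal.antidiagonal m, T p.1 * convPow T n p.2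

/-- The triangle `i + j < M` lies in the square `i, j < M`. Working with truncated sums gives bounds
on powers of a generating series before its convergence is known. -/
lemma sum_range_antidiagonal_le (f g : ℕ → ℝ≥0∞) (M : ℕ) :
    ∑ m ∈ Finset.range M, ∑ p ∈ Finset.HasAntidiagonal.antidiagonal m, f p.1 * g p.2
      ≤ (∑ m ∈ Finset.range M, f m) * ∑ m ∈ Finset.range M, g m := by
  rw [Finset.sum_mul_sum, ← Finset.sum_product', Finset.sum_sigma',
    ← Finset.sum_image (s := (Finset.range M).sigma Finset.HasAntidiagonal.antidiagonal)
      (f := fun p : ℕ × ℕ => f p.1 * g p.2) (g := Sigma.snd)]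
  · refine Finset.sum_le_sum_of_subset fun p hp => ?_
    simp only [Finset.mem_image, Finset.mem_sigma, Finset.mem_range,
      Finset.HasAntidiagonal.mem_antidiagonal] at hp
    obtain ⟨⟨m, q⟩, ⟨hm, hq⟩, rfl⟩ := hp
    simp only [Finset.mem_product, Finset.mem_range]
    simp only at hm hq
    omega
  · rintro ⟨m, p⟩ h ⟨m', p'⟩ h' e
    simp only [Finset.coe_sigma, Set.mem_sigma_iff, Finset.mem_coe,
      Finset.HasAntidiagonal.mem_antidiagonal] at h h'
    obtain rfl : p = p' := e
    obtain rfl : m = m' := h.2.symm.trans h'.2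
    rfl

lemma sum_range_convPow_le (T : ℕ → ℝ≥0∞) (n M : ℕ) :
    ∑ m ∈ Finset.range M, convPow T n m ≤ (∑ m ∈ Finset.range M, T m) ^ n := by
  induction n with
  | zero =>
    simp only [convPow, pow_zero]
    rw [Finset.sum_ite_eq']
    split_ifs <;> simp
  | succ n ih =>
    rw [pow_succ']
    exact (sum_range_antidiagonal_le T (convPow T n) M).trans (by gcongr)

end convolution

/-- Carry `x` through the word letter by letter: each passage flips the sign and leaves a scalar
with that letter deleted. For a word of even length the left side is a genuine commutator, which is
why fermionic interactions have to be even. -/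
lemma exists_commutator_word {A Φ : Type*} [NormedRing A] [NormedAlgebra ℂ A] (field : Φ → A)
    (x : A) {b : ℝ}
    (h : ∀ i, ∃ c : ℂ, ‖c‖ ≤ b ∧ field i * x + x * field i = c • (1 : A)) (L : List Φ) :
    ∃ s : Fin L.length → ℂ, (∀ j, ‖s j‖ ≤ b) ∧
      (L.map field).prod * x - (-1 : ℂ) ^ L.length • (x * (L.map field).prod)
        = ∑ j, s j • ((L.eraseIdx j).map field).prod := by
  induction L with
  | nil => exact ⟨fun j => 0, fun j => j.elim0, by simp⟩
  | cons i L ih =>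
    obtain ⟨s, hs, e⟩ := ih
    obtain ⟨c, hc, ec⟩ := h i
    -- With `ℓ` the length of the tail `L`, the identity is `i L x - (-1)^{ℓ+1} x i L = i (L x -
    -- (-1)^ℓ x L) + (-1)^ℓ (i x + x i) L`.
    refine ⟨Fin.cons ((-1) ^ L.length * c) s, fun j => ?_, ?_⟩
    · refine Fin.cases ?_ (fun j => ?_) j
      · simpa using hc
      · simpa using hs j
    · change _ = ∑ j : Fin (L.length + 1), _
      rw [Fin.sum_univ_succ]
      simp only [Fin.cons_zero, Fin.cons_succ, Fin.val_zero, List.eraseIdx_cons_zero,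
        Fin.val_succ, List.eraseIdx_cons_succ, List.map_cons, List.prod_cons, List.length_cons]
      have e2 : ∑ j : Fin L.length, s j • (field i * ((L.eraseIdx j).map field).prod)
          = field i * ∑ j, s j • ((L.eraseIdx j).map field).prod := by
        rw [Finset.mul_sum]
        simp
      rw [e2, ← e, mul_smul]
      have e3 : c • (L.map field).prod = (field i * x + x * field i) * (L.map field).prod := by
        rw [ec, smul_mul_assoc, one_mul]
      rw [e3, pow_succ]
      simp only [mul_neg, mul_one, neg_smul, sub_neg_eq_add, add_mul, smul_add, mul_sub,
        mul_smul_comm, mul_assoc]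
      abel

/-- A one-parameter group of isometric automorphisms of a Banach algebra, a family of fields whose
time-dependent anticommutators are integrable scalars, and a perturbation which is an absolutely
convergent sum of even words in these fields. -/
structure DispersiveSystem (A Φ ι : Type*) [NormedRing A] [NormedAlgebra ℂ A] where
  evol : ℝ → A →L[ℂ] A
  evol_mul : ∀ t a b, evol t (a * b) = evol t a * evol t b
  evol_add : ∀ s t a, evol (s + t) a = evol s (evol t a)
  evol_zero : ∀ a, evol 0 a = a
  norm_evol : ∀ t a, ‖evol t a‖ = ‖a‖
  norm_one_le : ‖(1 : A)‖ ≤ 1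
  field : Φ → A
  norm_field_le : ∀ i, ‖field i‖ ≤ 1
  decay : ℝ → ℝ
  measurable_decay : Measurable decay
  decay_ne_top : ∫⁻ u in Set.Ioi 0, ENNReal.ofReal (decay u) ≠ ⊤
  anticommutator : ∀ i j t, ∃ c : ℂ, ‖c‖ ≤ decay |t| ∧
    field i * evol t (field j) + evol t (field j) * field i = c • (1 : A)
  perturb : A
  continuous_perturb : Continuous fun t => evol t perturb
  coeff : ι → ℂ
  word : ι → List Φ
  even_word : ∀ i, Even (word i).length
  hasSum_perturb : HasSum (fun i => coeff i • ((word i).map field).prod) perturb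
  -- Not a consequence of `small`: if the decay integral vanishes, its product with `⊤` is `0`.
  sum_ne_top : ∑' i, ‖coeff i‖ₑ * ((word i).length * 2 ^ ((word i).length - 1)) ≠ ⊤
  small : (∫⁻ u in Set.Ioi 0, ENNReal.ofReal (decay u)) *
    ∑' i, ‖coeff i‖ₑ * ((word i).length * 2 ^ ((word i).length - 1)) ≤ 1

/-! ### Bounds on the Dyson terms, uniform in time -/

namespace DispersiveSystem

variable {A Φ ι : Type*} [NormedRing A] [NormedAlgebra ℂ A] [CompleteSpace A]
  (S : DispersiveSystem A Φ ι)

/-- The perturbation in the interaction picture. -/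
def pert (t : ℝ) : A := S.evol (-t) S.perturb

lemma continuous_pert : Continuous S.pert := S.continuous_perturb.comp continuous_neg

/-- The Dyson terms. -/
def dys (m : ℕ) (s t : ℝ) : A →L[ℂ] A := dyson S.pert m s t

/-- The ordered product of fields. -/
def mon (L : List Φ) : A := (L.map S.field).prod

/-- Since `evol (-u)` carries `pert (v - u)` to `pert v`, the initial time `u` can be moved to `0`.
As the evolution is isometric, bounds for terms starting at `0` then serve for every starting time.
-/
lemma dys_evol (m : ℕ) (u t : ℝ) (a : A) :
    S.dys m u t (S.evol (-u) a) = S.evol (-u) (S.dys m 0 (t - u) a) := by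
  induction m generalizing t with
  | zero => rfl
  | succ m ih =>
    rw [dys, dyson_succ S.continuous_pert, dys, dyson_succ S.continuous_pert]
    have hc : Continuous fun v =>
        commutatorCLM (S.pert v) (dyson S.pert m 0 v a) :=
      (continuous_commutatorCLM.comp S.continuous_pert).clm_apply
        (continuous_dyson_apply S.continuous_pert m 0 a)
    rw [← (S.evol (-u)).intervalIntegral_comp_comm (hc.intervalIntegrable _ _)]
    have := intervalIntegral.integral_comp_sub_right (a := u) (b := t)
      (fun v => S.evol (-u) (commutatorCLM (S.pert v) (dyson S.pert m 0 v a))) u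
    rw [sub_self] at this
    rw [← this]
    refine intervalIntegral.integral_congr fun v _ => ?_
    have e := ih v
    rw [dys] at e
    rw [e, commutatorCLM_apply, commutatorCLM_apply, map_sub, S.evol_mul, S.evol_mul]
    have : S.evol (-u) (S.pert (v - u)) = S.pert v := by
      rw [pert, ← S.evol_add, pert]; congr 2; ring
    rw [this, dys]

/-- Uniform bounds on the Dyson terms of a single field. -/
def fieldBound (m : ℕ) : ℝ≥0∞ := ⨆ (i : Φ) (t : ℝ) (_ : 0 ≤ t), ‖S.dys m 0 t (S.field i)‖ₑ

lemma enorm_dys_field_le (m : ℕ) (i : Φ) {t : ℝ} (ht : 0 ≤ t) :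
    ‖S.dys m 0 t (S.field i)‖ₑ ≤ S.fieldBound m :=
  le_iSup_of_le i (le_iSup_of_le t (le_iSup_of_le ht le_rfl))

/-- By the Leibniz rule the sequence of bounds of a product is the Cauchy product of those of its
factors, so a word of length `n` is controlled by the `n`-th power of the generating series of a
single field. -/
lemma enorm_dys_mon_le (m : ℕ) (L : List Φ) {t : ℝ} (ht : 0 ≤ t) :
    ‖S.dys m 0 t (S.mon L)‖ₑ ≤ convPow S.fieldBound L.length m := by
  induction L generalizing m with
  | nil =>
    simp only [mon, List.map_nil, List.prod_nil, List.length_nil, convPow]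
    rw [dys, dyson_one S.continuous_pert m ht]
    split_ifs
    · rw [← ofReal_norm]
      exact ENNReal.ofReal_le_one.2 S.norm_one_le
    · simp
  | cons i L ih =>
    have e : S.mon (i :: L) = S.field i * S.mon L := by simp [mon]
    rw [e, dys, dyson_mul S.continuous_pert]
    refine (enorm_sum_le _ _).trans (Finset.sum_le_sum fun p _ => ?_)
    refine le_trans ?_ (mul_le_mul' (S.enorm_dys_field_le _ i ht) (ih p.2))
    rw [← ofReal_norm, ← ofReal_norm, ← ofReal_norm, ← ENNReal.ofReal_mul (norm_nonneg _)]
    exact ENNReal.ofReal_le_ofReal (norm_mul_le _ _)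

/-- The commutator of the perturbation with a freely evolved field. -/
lemma hasSum_commutator (j : Φ) (u : ℝ) (hu : 0 ≤ u) :
    ∃ s : (i : ι) → Fin (S.word i).length → ℂ, (∀ i k, ‖s i k‖ ≤ S.decay u) ∧
      HasSum (fun i => S.coeff i • ∑ k, s i k • S.mon ((S.word i).eraseIdx k))
        (commutatorCLM S.perturb (S.evol u (S.field j))) := by
  have h := fun i => exists_commutator_word S.field (S.evol u (S.field j))
    (fun i => by simpa [abs_of_nonneg hu] using S.anticommutator i j u) (S.word i)
  choose s hs e using h
  refine ⟨s, hs, ?_⟩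
  let C : A →L[ℂ] A := (ContinuousLinearMap.mul ℂ A).flip (S.evol u (S.field j)) -
    ContinuousLinearMap.mul ℂ A (S.evol u (S.field j))
  refine (C.hasSum S.hasSum_perturb).congr_fun fun i => ?_
  have e' := e i
  rw [(S.even_word i).neg_one_pow, one_smul] at e'
  rw [map_smul]
  exact congrArg _ e'.symm

/-- All the time dependence is moved onto the field, so that only the anticommutators of the letters
of the perturbation with one evolved field are needed. -/
lemma commutator_pert (j : Φ) (u : ℝ) : commutatorCLM (S.pert u) (S.field j)
    = S.evol (-u) (commutatorCLM S.perturb (S.evol u (S.field j))) := by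
  rw [commutatorCLM_apply, commutatorCLM_apply, map_sub, S.evol_mul, S.evol_mul, ← S.evol_add,
    neg_add_cancel, S.evol_zero, pert]

/-- The expansion of `D_m [w(u), φ]`. -/
lemma hasSum_dys_commutator (j : Φ) {u : ℝ} (hu : 0 ≤ u) :
    ∃ s : (i : ι) → Fin (S.word i).length → ℂ, (∀ i k, ‖s i k‖ ≤ S.decay u) ∧ ∀ m t,
      HasSum (fun i => S.coeff i • ∑ k, s i k •
          S.evol (-u) (S.dys m 0 (t - u) (S.mon ((S.word i).eraseIdx k))))
        (S.dys m u t (commutatorCLM (S.pert u) (S.field j))) := by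
  obtain ⟨s, hs, h⟩ := S.hasSum_commutator j u hu
  refine ⟨s, hs, fun m t => ?_⟩
  rw [commutator_pert, dys_evol]
  refine ((S.evol (-u)).comp (S.dys m 0 (t - u))).hasSum h |>.congr_fun fun i => ?_
  simp [map_sum]

lemma enorm_evol_dys_erase_le (m : ℕ) {u t : ℝ} (hut : u ≤ t) (L : List Φ) (k : Fin L.length) :
    ‖S.evol (-u) (S.dys m 0 (t - u) (S.mon (L.eraseIdx k)))‖ₑ
      ≤ convPow S.fieldBound (L.length - 1) m := by
  have e : ‖S.evol (-u) (S.dys m 0 (t - u) (S.mon (L.eraseIdx k)))‖ₑ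
      = ‖S.dys m 0 (t - u) (S.mon (L.eraseIdx k))‖ₑ := by
    rw [← ofReal_norm, ← ofReal_norm, S.norm_evol]
  rw [e]
  refine (S.enorm_dys_mon_le m _ (sub_nonneg.2 hut)).trans (le_of_eq ?_)
  rw [List.length_eraseIdx_of_lt k.2]

lemma enorm_sum_erase_le (m : ℕ) {u t : ℝ} (hut : u ≤ t) (L : List Φ)
    (s : Fin L.length → ℂ) {b : ℝ} (hs : ∀ k, ‖s k‖ ≤ b) :
    ‖∑ k, s k • S.evol (-u) (S.dys m 0 (t - u) (S.mon (L.eraseIdx k)))‖ₑ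
      ≤ ENNReal.ofReal b * (L.length * convPow S.fieldBound (L.length - 1) m) := by
  refine (enorm_sum_le _ _).trans ?_
  have : ∀ k ∈ (Finset.univ : Finset (Fin L.length)),
      ‖s k • S.evol (-u) (S.dys m 0 (t - u) (S.mon (L.eraseIdx k)))‖ₑ
        ≤ ENNReal.ofReal b * convPow S.fieldBound (L.length - 1) m := by
    intro k _
    rw [enorm_smul]
    refine mul_le_mul' ?_ (S.enorm_evol_dys_erase_le m hut L k)
    rw [← ofReal_norm]
    exact ENNReal.ofReal_le_ofReal (hs k)
  refine (Finset.sum_le_sum this).trans (le_of_eq ?_)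
  rw [Finset.sum_const, Finset.card_univ, Fintype.card_fin, nsmul_eq_mul]
  ring

lemma enorm_dys_commutator_le (m : ℕ) (j : Φ) {u t : ℝ} (hu : 0 ≤ u) (hut : u ≤ t) :
    ‖S.dys m u t (commutatorCLM (S.pert u) (S.field j))‖ₑ ≤ ENNReal.ofReal (S.decay u) *
      ∑' i, ‖S.coeff i‖ₑ *
        ((S.word i).length * convPow S.fieldBound ((S.word i).length - 1) m) := by
  obtain ⟨s, hs, h⟩ := S.hasSum_dys_commutator j hu
  rw [← (h m t).tsum_eq, ← ENNReal.tsum_mul_left]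
  refine (enorm_tsum_le_tsum_enorm).trans (ENNReal.tsum_le_tsum fun i => ?_)
  rw [enorm_smul, mul_left_comm]
  gcongr
  exact S.enorm_sum_erase_le m hut _ _ (hs i)

/-- The recursion that carries the estimate. Each of the `L` letters of a word can be contracted
with the evolved field, at the price `decay u`; a word of length `L - 1` is left for the later `m`
commutators. Integrating over the earliest time `u` gives the integral of the decay. -/
lemma fieldBound_succ_le (m : ℕ) : S.fieldBound (m + 1) ≤
    (∫⁻ u in Set.Ioi 0, ENNReal.ofReal (S.decay u)) * ∑' i, ‖S.coeff i‖ₑ *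
      ((S.word i).length * convPow S.fieldBound ((S.word i).length - 1) m) := by
  refine iSup_le fun j => iSup_le fun t => iSup_le fun ht => ?_
  rw [dys, dyson_succ_left S.continuous_pert m ht, intervalIntegral.integral_of_le ht]
  refine (enorm_integral_le_lintegral_enorm _).trans ?_
  rw [← lintegral_mul_const _ (by exact S.measurable_decay.ennreal_ofReal)]
  refine (setLIntegral_mono' measurableSet_Ioc fun u hu =>
    S.enorm_dys_commutator_le m j hu.1.le hu.2).trans ?_
  exact lintegral_mono_set Set.Ioc_subset_Ioi_self

/-- Order zero contributes at most `1`. If the sum over the first `M` orders is at most `2`, the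
recursion bounds the orders `1, …, M` together by the integral of the decay times `∑ |c| L 2^{L-1}`,
which `small` makes at most `1`. The induction needs no prior finiteness of `fieldBound`. -/
lemma sum_fieldBound_le (M : ℕ) : ∑ m ∈ Finset.range M, S.fieldBound m ≤ 2 := by
  induction M with
  | zero => simp
  | succ M ih =>
    rw [Finset.sum_range_succ']
    have h0 : S.fieldBound 0 ≤ 1 := by
      refine iSup_le fun j => iSup_le fun t => iSup_le fun _ => ?_
      rw [dys, dyson_zero, ← ofReal_norm]
      exact ENNReal.ofReal_le_one.2 (S.norm_field_le j)
    have h1 : ∑ m ∈ Finset.range M, S.fieldBound (m + 1) ≤ 1 := by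
      refine (Finset.sum_le_sum fun m _ => S.fieldBound_succ_le m).trans ?_
      rw [← Finset.mul_sum, ← Summable.tsum_finsetSum fun _ _ => ENNReal.summable]
      refine le_trans ?_ S.small
      gcongr with i
      rw [← Finset.mul_sum, ← Finset.mul_sum]
      gcongr
      exact (sum_range_convPow_le _ _ _).trans (by gcongr)
    calc _ ≤ (1 : ℝ≥0∞) + 1 := add_le_add h1 h0
      _ = 2 := one_add_one_eq_two

lemma sum_convPow_fieldBound_le (n M : ℕ) :
    ∑ m ∈ Finset.range M, convPow S.fieldBound n m ≤ 2 ^ n :=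
  (sum_range_convPow_le _ _ _).trans (by gcongr; exact S.sum_fieldBound_le M)

lemma convPow_fieldBound_le (n m : ℕ) : convPow S.fieldBound n m ≤ 2 ^ n :=
  (Finset.single_le_sum (f := convPow S.fieldBound n) (fun _ _ => zero_le)
    (Finset.self_mem_range_succ m)).trans (S.sum_convPow_fieldBound_le n (m + 1))

lemma tsum_convPow_fieldBound_le (n : ℕ) : ∑' m, convPow S.fieldBound n m ≤ 2 ^ n := by
  rw [ENNReal.tsum_eq_iSup_nat]
  exact iSup_le fun M => S.sum_convPow_fieldBound_le n M

end DispersiveSystem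

lemma tendsto_tsum_of_dominated {α β G : Type*} {l : Filter α} [NormedAddCommGroup G]
    [CompleteSpace G] {f : α → β → G} {g : β → G} {bound : β → ℝ} (h_sum : Summable bound)
    (hab : ∀ k, Tendsto (fun x => f x k) l (𝓝 (g k)))
    (h_bound : ∀ᶠ n in l, ∀ k, ‖f n k‖ ≤ bound k) :
    Tendsto (fun x => ∑' k, f x k) l (𝓝 (∑' k, g k)) :=
  tendsto_tsum_of_dominated_convergence h_sum hab h_bound

/-! ### Convergence of the Dyson terms at large times -/

namespace DispersiveSystem

variable {A Φ ι : Type*} [NormedRing A] [NormedAlgebra ℂ A] [CompleteSpace A]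
  (S : DispersiveSystem A Φ ι)

/-- Only orders up to `m` of single fields enter order `m` of a word, which is what the induction on
the order in `exists_tendsto_dys_field` can supply. -/
lemma exists_tendsto_mon (m : ℕ)
    (h : ∀ n ≤ m, ∀ i, ∃ l, Tendsto (fun t => S.dys n 0 t (S.field i)) atTop (𝓝 l))
    (L : List Φ) : ∃ l, Tendsto (fun t => S.dys m 0 t (S.mon L)) atTop (𝓝 l) := by
  induction L generalizing m with
  | nil =>
    refine ⟨if m = 0 then 1 else 0, tendsto_const_nhds.congr' ?_⟩
    filter_upwards [eventually_ge_atTop 0] with t ht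
    exact (dyson_one S.continuous_pert m ht).symm
  | cons i L ih =>
    have e : S.mon (i :: L) = S.field i * S.mon L := by simp [mon]
    -- The condition `n ≤ m` stands under the existential so that the limits form a function on all
    -- orders; the value `0` beyond `m` is never used.
    have h1 : ∀ n : ℕ, ∃ l, n ≤ m → Tendsto (fun t => S.dys n 0 t (S.field i)) atTop (𝓝 l) := by
      intro n
      by_cases hn : n ≤ m
      · obtain ⟨l, hl⟩ := h n hn i; exact ⟨l, fun _ => hl⟩
      · exact ⟨0, fun h => absurd h hn⟩
    have h2 : ∀ n : ℕ, ∃ l, n ≤ m → Tendsto (fun t => S.dys n 0 t (S.mon L)) atTop (𝓝 l) := by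
      intro n
      by_cases hn : n ≤ m
      · obtain ⟨l, hl⟩ := ih n (fun k hk => h k (hk.trans hn)); exact ⟨l, fun _ => hl⟩
      · exact ⟨0, fun h => absurd h hn⟩
    choose l1 h1 using h1
    choose l2 h2 using h2
    refine ⟨∑ p ∈ Finset.HasAntidiagonal.antidiagonal m, l1 p.1 * l2 p.2, ?_⟩
    have : (fun t => S.dys m 0 t (S.mon (i :: L))) = fun t =>
        ∑ p ∈ Finset.HasAntidiagonal.antidiagonal m,
          S.dys p.1 0 t (S.field i) * S.dys p.2 0 t (S.mon L) := by
      ext t; rw [e, dys, dyson_mul S.continuous_pert]; rfl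
    rw [this]
    refine tendsto_finsetSum _ fun p hp => ?_
    rw [Finset.HasAntidiagonal.mem_antidiagonal] at hp
    exact (h1 p.1 (by omega)).mul (h2 p.2 (by omega))

/-- The domain of integration no longer depends on `t`, so dominated convergence in `t` becomes
available. -/
lemma dys_succ_eq_integral (m : ℕ) {t : ℝ} (ht : 0 ≤ t) (a : A) :
    S.dys (m + 1) 0 t a = ∫ u in Set.Ioi 0,
      (Set.Iic t).indicator (fun u => S.dys m u t (commutatorCLM (S.pert u) a)) u := by
  rw [dys, dyson_succ_left S.continuous_pert m ht, intervalIntegral.integral_of_le ht,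
    setIntegral_indicator measurableSet_Iic, Set.Ioi_inter_Iic]
  rfl

lemma continuous_dys_commutator (m : ℕ) (t : ℝ) (a : A) :
    Continuous fun u => S.dys m u t (commutatorCLM (S.pert u) a) :=
  ((continuous_dyson S.continuous_pert m).comp (by fun_prop : Continuous fun s : ℝ => (s, t))).clm_apply
    ((continuous_commutatorCLM.comp S.continuous_pert).clm_apply continuous_const)

/-- The total weight of the terms that enter `D_m [w, φ]`. -/
def commWeight (m : ℕ) (i : ι) : ℝ≥0∞ :=
  ‖S.coeff i‖ₑ * ((S.word i).length * convPow S.fieldBound ((S.word i).length - 1) m)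

lemma tsum_commWeight_ne_top (m : ℕ) : ∑' i, S.commWeight m i ≠ ⊤ := by
  refine ne_top_of_le_ne_top S.sum_ne_top (ENNReal.tsum_le_tsum fun i => ?_)
  unfold commWeight
  gcongr
  exact S.convPow_fieldBound_le _ _

/-- The Dyson terms of a field have limits, uniformly in the field. -/
lemma tendsto_dys_commutator_sub (m : ℕ)
    (h : ∀ L, ∃ l, Tendsto (fun t => S.dys m 0 t (S.mon L)) atTop (𝓝 l)) {u : ℝ} (hu : 0 < u) :
    Tendsto (fun p : (ℝ × ℝ) × Φ =>
      (Set.Iic p.1.1).indicator (fun u => S.dys m u p.1.1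
          (commutatorCLM (S.pert u) (S.field p.2))) u -
        (Set.Iic p.1.2).indicator (fun u => S.dys m u p.1.2
          (commutatorCLM (S.pert u) (S.field p.2))) u)
      ((atTop ×ˢ atTop) ×ˢ ⊤) (𝓝 0) := by
  -- The source of uniformity in the field: only the scalars depend on the field `j`, and they are
  -- bounded by `decay u`, whereas the words left after a contraction are the same for all fields.
  choose s hs e using fun j => S.hasSum_dys_commutator j hu.le
  let D : ℝ → List Φ → A := fun t L => S.evol (-u) (S.dys m 0 (t - u) (S.mon L))
  have hD : ∀ L, ∃ l, Tendsto (fun t => D t L) atTop (𝓝 l) := by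
    intro L
    obtain ⟨l, hl⟩ := h L
    exact ⟨_, ((S.evol (-u)).continuous.tendsto l).comp
      (hl.comp (tendsto_atTop_add_const_right _ (-u) tendsto_id))⟩
  have f1 : Tendsto (fun p : (ℝ × ℝ) × Φ => p.1.1) ((atTop ×ˢ atTop) ×ˢ ⊤) atTop :=
    tendsto_fst.comp tendsto_fst
  have f2 : Tendsto (fun p : (ℝ × ℝ) × Φ => p.1.2) ((atTop ×ˢ atTop) ×ˢ ⊤) atTop :=
    tendsto_snd.comp tendsto_fst
  have hD0 : ∀ L, Tendsto (fun p : (ℝ × ℝ) × Φ => D p.1.1 L - D p.1.2 L)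
      ((atTop ×ˢ atTop) ×ˢ ⊤) (𝓝 0) := by
    intro L
    obtain ⟨l, hl⟩ := hD L
    simpa using (hl.comp f1).sub (hl.comp f2)
  have hev : ∀ᶠ p : (ℝ × ℝ) × Φ in (atTop ×ˢ atTop) ×ˢ ⊤, u ≤ p.1.1 ∧ u ≤ p.1.2 :=
    (f1.eventually_ge_atTop u).and (f2.eventually_ge_atTop u)
  have key : Tendsto (fun p : (ℝ × ℝ) × Φ => ∑' i, S.coeff i • ∑ k, s p.2 i k •
      (D p.1.1 ((S.word i).eraseIdx k) - D p.1.2 ((S.word i).eraseIdx k)))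
      ((atTop ×ˢ atTop) ×ˢ ⊤) (𝓝 (∑' i : ι, 0)) := by
    refine tendsto_tsum_of_dominated
      (bound := fun i => 2 * (ENNReal.ofReal (S.decay u) * S.commWeight m i).toReal) ?_ ?_ ?_
    · refine Summable.mul_left _ (ENNReal.summable_toReal ?_)
      rw [ENNReal.tsum_mul_left]
      exact ENNReal.mul_ne_top ENNReal.ofReal_ne_top (S.tsum_commWeight_ne_top m)
    · intro i
      suffices h : Tendsto _ _ (𝓝 (S.coeff i • ∑ _k : Fin (S.word i).length, (0 : A))) by
        simpa using h
      refine (tendsto_finsetSum _ fun k _ => ?_).const_smul _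
      refine squeeze_zero_norm (a := fun p : (ℝ × ℝ) × Φ => S.decay u *
        ‖D p.1.1 ((S.word i).eraseIdx k) - D p.1.2 ((S.word i).eraseIdx k)‖) (fun p => ?_) ?_
      · rw [norm_smul]; gcongr; exact hs _ _ _
      · simpa using ((hD0 ((S.word i).eraseIdx k)).norm).const_mul (S.decay u)
    · filter_upwards [hev] with p hp i
      have hb : ∀ t, u ≤ t → ‖S.coeff i • ∑ k, s p.2 i k • D t ((S.word i).eraseIdx k)‖
          ≤ (ENNReal.ofReal (S.decay u) * S.commWeight m i).toReal := by
        intro t ht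
        rw [← toReal_enorm]
        refine ENNReal.toReal_mono ?_ ?_
        · exact ENNReal.mul_ne_top ENNReal.ofReal_ne_top
            (ENNReal.ne_top_of_tsum_ne_top (S.tsum_commWeight_ne_top m) i)
        · rw [enorm_smul, commWeight, mul_left_comm]
          gcongr
          exact S.enorm_sum_erase_le m ht _ _ (hs _ i)
      have e : S.coeff i • ∑ k, s p.2 i k •
          (D p.1.1 ((S.word i).eraseIdx k) - D p.1.2 ((S.word i).eraseIdx k))
          = S.coeff i • (∑ k, s p.2 i k • D p.1.1 ((S.word i).eraseIdx k)) -
            S.coeff i • ∑ k, s p.2 i k • D p.1.2 ((S.word i).eraseIdx k) := by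
        simp only [smul_sub, Finset.sum_sub_distrib]
      rw [e, two_mul]
      exact (norm_sub_le _ _).trans (add_le_add (hb _ hp.1) (hb _ hp.2))
  rw [tsum_zero] at key
  refine key.congr' ?_
  filter_upwards [hev] with p hp
  rw [Set.indicator_of_mem (by exact hp.1), Set.indicator_of_mem (by exact hp.2)]
  rw [← ((e p.2 m p.1.1).sub (e p.2 m p.1.2)).tsum_eq]
  refine tsum_congr fun i => ?_
  simp only [smul_sub, Finset.sum_sub_distrib]
  rfl

lemma norm_dys_commutator_le (m : ℕ) (j : Φ) {u t : ℝ} (hu : 0 ≤ u) (hut : u ≤ t) :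
    ‖S.dys m u t (commutatorCLM (S.pert u) (S.field j))‖
      ≤ (ENNReal.ofReal (S.decay u) * ∑' i, S.commWeight m i).toReal := by
  rw [← toReal_enorm]
  exact ENNReal.toReal_mono
    (ENNReal.mul_ne_top ENNReal.ofReal_ne_top (S.tsum_commWeight_ne_top m))
    (S.enorm_dys_commutator_le m j hu hut)

/-- Dominated convergence in the earliest time, with a multiple of `decay` as majorant for all times
and fields. The filter `(atTop ×ˢ atTop) ×ˢ ⊤` expresses the Cauchy property uniformly in the field.
-/
lemma tendsto_dys_succ_sub (m : ℕ)
    (h : ∀ L, ∃ l, Tendsto (fun t => S.dys m 0 t (S.mon L)) atTop (𝓝 l)) :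
    Tendsto (fun p : (ℝ × ℝ) × Φ =>
      S.dys (m + 1) 0 p.1.1 (S.field p.2) - S.dys (m + 1) 0 p.1.2 (S.field p.2))
      ((atTop ×ˢ atTop) ×ˢ ⊤) (𝓝 0) := by
  have hev : ∀ᶠ p : (ℝ × ℝ) × Φ in (atTop ×ˢ atTop) ×ˢ ⊤, 0 ≤ p.1.1 ∧ 0 ≤ p.1.2 :=
    ((tendsto_fst.comp tendsto_fst).eventually_ge_atTop 0).and
      ((tendsto_snd.comp tendsto_fst).eventually_ge_atTop 0)
  let B : ℝ → ℝ := fun u => (ENNReal.ofReal (S.decay u) * ∑' i, S.commWeight m i).toReal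
  have hBm : Measurable fun u => ENNReal.ofReal (S.decay u) * ∑' i, S.commWeight m i :=
    S.measurable_decay.ennreal_ofReal.mul_const _
  have hB : Integrable B (volume.restrict (Set.Ioi 0)) := by
    refine integrable_toReal_of_lintegral_ne_top hBm.aemeasurable ?_
    rw [lintegral_mul_const _ S.measurable_decay.ennreal_ofReal]
    exact ENNReal.mul_ne_top S.decay_ne_top (S.tsum_commWeight_ne_top m)
  have hI : ∀ (t : ℝ) (j : Φ), Integrable ((Set.Iic t).indicator
      (fun u => S.dys m u t (commutatorCLM (S.pert u) (S.field j))))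
      (volume.restrict (Set.Ioi 0)) := by
    intro t j
    refine hB.mono' ((S.continuous_dys_commutator m t _).aestronglyMeasurable.indicator
      measurableSet_Iic) ?_
    filter_upwards [ae_restrict_mem measurableSet_Ioi] with u hu
    by_cases hut : u ≤ t
    · rw [Set.indicator_of_mem (by exact hut)]
      exact S.norm_dys_commutator_le m j (le_of_lt hu) hut
    · rw [Set.indicator_of_notMem (by exact hut), norm_zero]
      exact ENNReal.toReal_nonneg
  have key := tendsto_integral_filter_of_dominated_convergence
    (μ := volume.restrict (Set.Ioi 0)) (l := ((atTop ×ˢ atTop) ×ˢ (⊤ : Filter Φ)))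
    (F := fun (p : (ℝ × ℝ) × Φ) u => (Set.Iic p.1.1).indicator (fun u => S.dys m u p.1.1
          (commutatorCLM (S.pert u) (S.field p.2))) u -
        (Set.Iic p.1.2).indicator (fun u => S.dys m u p.1.2
          (commutatorCLM (S.pert u) (S.field p.2))) u)
    (f := fun _ => 0) (fun u => B u + B u)
    (Eventually.of_forall fun p => ((hI _ _).sub (hI _ _)).aestronglyMeasurable) ?_
    (hB.add hB) ?_
  · rw [integral_zero] at key
    refine key.congr' ?_
    filter_upwards [hev] with p hp
    rw [integral_sub (hI _ _) (hI _ _), ← S.dys_succ_eq_integral m hp.1,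
      ← S.dys_succ_eq_integral m hp.2]
  · refine Eventually.of_forall fun p => ?_
    filter_upwards [ae_restrict_mem measurableSet_Ioi] with u hu
    have hb : ∀ t, ‖(Set.Iic t).indicator
        (fun u => S.dys m u t (commutatorCLM (S.pert u) (S.field p.2))) u‖ ≤ B u := by
      intro t
      by_cases hut : u ≤ t
      · rw [Set.indicator_of_mem (by exact hut)]
        exact S.norm_dys_commutator_le m _ (le_of_lt hu) hut
      · rw [Set.indicator_of_notMem (by exact hut), norm_zero]
        exact ENNReal.toReal_nonneg
    exact (norm_sub_le _ _).trans (add_le_add (hb _) (hb _))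
  · filter_upwards [ae_restrict_mem measurableSet_Ioi] with u hu
    exact S.tendsto_dys_commutator_sub m h hu

lemma exists_tendsto_of_tendsto_sub {E : Type*} [NormedAddCommGroup E] [CompleteSpace E]
    {f : ℝ → E} (h : Tendsto (fun q : ℝ × ℝ => f q.1 - f q.2) (atTop ×ˢ atTop) (𝓝 0)) :
    ∃ l, Tendsto f atTop (𝓝 l) := by
  refine cauchy_map_iff_exists_tendsto.1 (cauchy_map_iff.2 ⟨inferInstance, ?_⟩)
  rw [tendsto_uniformity_iff_dist_tendsto_zero]
  simpa [dist_eq_norm] using h.norm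

/-- Strong induction: order `m + 1` of a field needs order `m` of words, which needs orders up to
`m` of all fields. -/
lemma exists_tendsto_dys_field (m : ℕ) (i : Φ) :
    ∃ l, Tendsto (fun t => S.dys m 0 t (S.field i)) atTop (𝓝 l) := by
  induction m using Nat.strong_induction_on generalizing i with
  | _ m ih =>
    cases m with
    | zero => exact ⟨S.field i, tendsto_const_nhds⟩
    | succ m =>
      have h := S.tendsto_dys_succ_sub m
        (S.exists_tendsto_mon m fun n hn i => ih n (by omega) i)
      have hi : Tendsto (fun q : ℝ × ℝ => (q, i)) (atTop ×ˢ atTop) ((atTop ×ˢ atTop) ×ˢ ⊤) :=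
        Tendsto.prodMk tendsto_id tendsto_top
      have h' := h.comp hi
      simp only [Function.comp_def] at h'
      exact exists_tendsto_of_tendsto_sub h'

lemma exists_tendsto_dys_mon (m : ℕ) (L : List Φ) :
    ∃ l, Tendsto (fun t => S.dys m 0 t (S.mon L)) atTop (𝓝 l) :=
  S.exists_tendsto_mon m (fun n _ i => S.exists_tendsto_dys_field n i) L

lemma tendsto_dys_sub (m : ℕ) :
    Tendsto (fun p : (ℝ × ℝ) × Φ =>
      S.dys m 0 p.1.1 (S.field p.2) - S.dys m 0 p.1.2 (S.field p.2))
      ((atTop ×ˢ atTop) ×ˢ ⊤) (𝓝 0) := by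
  cases m with
  | zero =>
    simp only [dys, dyson_zero, sub_self]
    exact tendsto_const_nhds
  | succ m => exact S.tendsto_dys_succ_sub m (S.exists_tendsto_dys_mon m)

lemma fieldBound_le (m : ℕ) : S.fieldBound m ≤ 2 :=
  (Finset.single_le_sum (f := S.fieldBound) (fun _ _ => zero_le)
    (Finset.self_mem_range_succ m)).trans (S.sum_fieldBound_le (m + 1))

/-- The interacting evolution of a field, in the interaction picture, converges uniformly in the
field. -/
theorem tendsto_sum_dys_sub {γ : ℝ → A → A}
    (hγ : ∀ t, 0 ≤ t → ∀ i, HasSum (fun m => Complex.I ^ m • S.dys m 0 t (S.field i))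
      (γ t (S.field i))) :
    Tendsto (fun p : (ℝ × ℝ) × Φ => γ p.1.1 (S.field p.2) - γ p.1.2 (S.field p.2))
      ((atTop ×ˢ atTop) ×ˢ ⊤) (𝓝 0) := by
  have hev : ∀ᶠ p : (ℝ × ℝ) × Φ in (atTop ×ˢ atTop) ×ˢ ⊤, 0 ≤ p.1.1 ∧ 0 ≤ p.1.2 :=
    ((tendsto_fst.comp tendsto_fst).eventually_ge_atTop 0).and
      ((tendsto_snd.comp tendsto_fst).eventually_ge_atTop 0)
  have key := tendsto_tsum_of_dominated
    (l := ((atTop ×ˢ atTop) ×ˢ (⊤ : Filter Φ)))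
    (f := fun (p : (ℝ × ℝ) × Φ) m => Complex.I ^ m • S.dys m 0 p.1.1 (S.field p.2) -
      Complex.I ^ m • S.dys m 0 p.1.2 (S.field p.2)) (g := fun _ => 0)
    (bound := fun m => 2 * (S.fieldBound m).toReal) ?_ ?_ ?_
  · rw [tsum_zero] at key
    refine key.congr' ?_
    filter_upwards [hev] with p hp
    exact ((hγ _ hp.1 _).sub (hγ _ hp.2 _)).tsum_eq
  · refine Summable.mul_left _ (ENNReal.summable_toReal (ne_top_of_le_ne_top ENNReal.ofNat_ne_top
      (b := 2) ?_))
    rw [ENNReal.tsum_eq_iSup_nat]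
    exact iSup_le fun M => S.sum_fieldBound_le M
  · intro m
    simpa [smul_sub] using (S.tendsto_dys_sub m).const_smul (Complex.I ^ m)
  · filter_upwards [hev] with p hp m
    have hb : ∀ t, 0 ≤ t → ‖Complex.I ^ m • S.dys m 0 t (S.field p.2)‖
        ≤ (S.fieldBound m).toReal := by
      intro t ht
      rw [norm_smul, norm_pow, Complex.norm_I, one_pow, one_mul, ← toReal_enorm]
      exact ENNReal.toReal_mono (ne_top_of_le_ne_top ENNReal.ofNat_ne_top (S.fieldBound_le m))
        (S.enorm_dys_field_le m _ ht)
    rw [two_mul]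
    exact (norm_sub_le _ _).trans (add_le_add (hb _ hp.1) (hb _ hp.2))

/-- The limit of the Dyson series of an absolutely convergent sum of words. -/
theorem hasSum_limit_dys {κ : Type*} {a : A} {c : κ → ℂ} {L : κ → List Φ}
    (hc : ∑' k, ‖c k‖ₑ * 2 ^ (L k).length ≠ ⊤) (ha : HasSum (fun k => c k • S.mon (L k)) a)
    {γ : ℝ → A} (hγ : ∀ t, 0 ≤ t → HasSum (fun m => Complex.I ^ m • S.dys m 0 t a) (γ t)) {b : A}
    (hb : Tendsto γ atTop (𝓝 b)) :
    ∃ D : ℕ → A, (∀ m, Tendsto (fun t => S.dys m 0 t a) atTop (𝓝 (D m))) ∧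
      (Summable fun m => ‖D m‖) ∧ HasSum (fun m => Complex.I ^ m • D m) b := by
  choose l hl using S.exists_tendsto_dys_mon
  let β : ℕ → ℝ≥0∞ := fun m => ∑' k, ‖c k‖ₑ * convPow S.fieldBound (L k).length m
  -- Summing over the order first turns the powers of the generating series into at most `2 ^ (L
  -- k).length`.
  have hβ : ∑' m, β m ≠ ⊤ := by
    refine ne_top_of_le_ne_top hc ?_
    rw [ENNReal.tsum_comm]
    refine ENNReal.tsum_le_tsum fun k => ?_
    rw [ENNReal.tsum_mul_left]
    gcongr
    exact S.tsum_convPow_fieldBound_le _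
  have hβm : ∀ m, β m ≠ ⊤ := ENNReal.ne_top_of_tsum_ne_top hβ
  have hs : ∀ m t, HasSum (fun k => c k • S.dys m 0 t (S.mon (L k))) (S.dys m 0 t a) := by
    intro m t
    simpa using (S.dys m 0 t).hasSum ha
  have hbd : ∀ m t, 0 ≤ t → ∀ k, ‖c k • S.dys m 0 t (S.mon (L k))‖ₑ
      ≤ ‖c k‖ₑ * convPow S.fieldBound (L k).length m := by
    intro m t ht k
    rw [enorm_smul]
    gcongr
    exact S.enorm_dys_mon_le m _ ht
  have hn : ∀ m t, 0 ≤ t → ‖S.dys m 0 t a‖ ≤ (β m).toReal := by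
    intro m t ht
    rw [← toReal_enorm]
    refine ENNReal.toReal_mono (hβm m) ?_
    rw [← (hs m t).tsum_eq]
    exact enorm_tsum_le_tsum_enorm.trans (ENNReal.tsum_le_tsum fun k => hbd m t ht k)
  have hD : ∀ m, Tendsto (fun t => S.dys m 0 t a) atTop (𝓝 (∑' k, c k • l m (L k))) := by
    intro m
    have := tendsto_tsum_of_dominated (l := (atTop : Filter ℝ))
      (f := fun t k => c k • S.dys m 0 t (S.mon (L k))) (g := fun k => c k • l m (L k))
      (bound := fun k => (‖c k‖ₑ * convPow S.fieldBound (L k).length m).toReal)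
      (ENNReal.summable_toReal (hβm m)) (fun k => (hl m (L k)).const_smul (c k)) ?_
    · exact this.congr fun t => (hs m t).tsum_eq
    · filter_upwards [eventually_ge_atTop 0] with t ht k
      rw [← toReal_enorm]
      exact ENNReal.toReal_mono (ENNReal.ne_top_of_tsum_ne_top (hβm m) k) (hbd m t ht k)
  have hDn : ∀ m, ‖∑' k, c k • l m (L k)‖ ≤ (β m).toReal := fun m =>
    le_of_tendsto (hD m).norm (by
      filter_upwards [eventually_ge_atTop 0] with t ht using hn m t ht)
  have hβs : Summable fun m => (β m).toReal := ENNReal.summable_toReal hβ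
  have hDs : Summable fun m => ‖∑' k, c k • l m (L k)‖ :=
    hβs.of_nonneg_of_le (fun _ => norm_nonneg _) hDn
  refine ⟨fun m => ∑' k, c k • l m (L k), hD, hDs, ?_⟩
  have hI : ∀ m (x : A), ‖Complex.I ^ m • x‖ = ‖x‖ := fun m x => by
    rw [norm_smul, norm_pow, Complex.norm_I, one_pow, one_mul]
  have hsum : Summable fun m => Complex.I ^ m • ∑' k, c k • l m (L k) :=
    Summable.of_norm (by simpa only [hI] using hDs)
  have key := tendsto_tsum_of_dominated (l := (atTop : Filter ℝ))
    (f := fun t m => Complex.I ^ m • S.dys m 0 t a)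
    (g := fun m => Complex.I ^ m • ∑' k, c k • l m (L k)) hβs
    (fun m => (hD m).const_smul _) (by
      filter_upwards [eventually_ge_atTop 0] with t ht m
      rw [hI]; exact hn m t ht)
  -- The series of the limits is the limit of the series by domination; uniqueness of limits
  -- identifies it with `b`.
  have : b = ∑' m, Complex.I ^ m • ∑' k, c k • l m (L k) := by
    refine tendsto_nhds_unique (hb.congr' ?_) key
    filter_upwards [eventually_ge_atTop 0] with t ht
    exact (hγ t ht).tsum_eq.symm
  rw [this]
  exact hsum.hasSum

end DispersiveSystem

/-! ### Hermite functions -/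

section gaussian

variable {V : Type*} [NormedAddCommGroup V] [InnerProductSpace ℝ V]

lemma pow_mul_exp_neg_sq_le (b : ℝ) (hb : 0 < b) (k : ℕ) :
    ∃ C : ℝ, 0 ≤ C ∧ ∀ r : ℝ, 0 ≤ r → (1 + r) ^ k * Real.exp (-b * r ^ 2) ≤ C := by
  refine ⟨k.factorial * Real.exp (1 + 1 / (4 * b)), by positivity, fun r hr => ?_⟩
  have h1 : (1 + r) ^ k ≤ k.factorial * Real.exp (1 + r) := by
    have := Real.pow_div_factorial_le_exp (1 + r) (by positivity) k
    rwa [div_le_iff₀ (by positivity), mul_comm] at this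
  have h2 : 1 + r + -b * r ^ 2 ≤ 1 + 1 / (4 * b) := by
    have : 0 ≤ b * (r - 1 / (2 * b)) ^ 2 := by positivity
    have e : b * (r - 1 / (2 * b)) ^ 2 = b * r ^ 2 - r + 1 / (4 * b) := by
      field_simp; ring
    linarith
  calc (1 + r) ^ k * Real.exp (-b * r ^ 2)
      ≤ (k.factorial * Real.exp (1 + r)) * Real.exp (-b * r ^ 2) := by gcongr
    _ = k.factorial * Real.exp (1 + r + -b * r ^ 2) := by rw [mul_assoc, ← Real.exp_add]
    _ ≤ _ := by gcongr

/-- The Gaussian `exp(-b|x|²)`. -/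
def gaussianSchwartz (b : ℝ) (hb : 0 < b) : 𝓢(V, ℝ) where
  toFun x := Real.exp (-b * ‖x‖ ^ 2)
  smooth' := Real.contDiff_exp.comp (contDiff_const.mul (contDiff_norm_sq ℝ))
  decay' k n := by
    have hf : (fun x : V => -b * ‖x‖ ^ 2).HasTemperateGrowth :=
      (Function.HasTemperateGrowth.const (-b)).mul (Function.hasTemperateGrowth_norm_sq V)
    obtain ⟨l, C, hC, hl⟩ := hf.norm_iteratedFDeriv_le_uniform n
    obtain ⟨M, hM, hM'⟩ := pow_mul_exp_neg_sq_le b hb (k + l * n)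
    refine ⟨n.factorial * (1 + C) ^ n * M, fun x => ?_⟩
    -- Derivatives of the exponent grow polynomially, and those of `exp` are `exp` again, so the
    -- composition bound gives a polynomial times the Gaussian. `D` is at least `1`, which is why it
    -- also dominates the first derivative's bound to any power.
    have h := norm_iteratedFDeriv_comp_le (𝕜 := ℝ) (n := n) (N := n) (g := Real.exp)
      (f := fun x : V => -b * ‖x‖ ^ 2) Real.contDiff_exp
      (contDiff_const.mul (contDiff_norm_sq ℝ)) le_rfl x
      (C := Real.exp (-b * ‖x‖ ^ 2)) (D := (1 + C) * (1 + ‖x‖) ^ l) ?_ ?_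
    · have h' : ‖iteratedFDeriv ℝ n (fun x : V => Real.exp (-b * ‖x‖ ^ 2)) x‖
          ≤ n.factorial * Real.exp (-b * ‖x‖ ^ 2) * ((1 + C) * (1 + ‖x‖) ^ l) ^ n := h
      calc ‖x‖ ^ k * ‖iteratedFDeriv ℝ n (fun x : V => Real.exp (-b * ‖x‖ ^ 2)) x‖
          ≤ (1 + ‖x‖) ^ k *
            (n.factorial * Real.exp (-b * ‖x‖ ^ 2) * ((1 + C) * (1 + ‖x‖) ^ l) ^ n) := by
            gcongr; linarith
        _ = n.factorial * (1 + C) ^ n *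
            ((1 + ‖x‖) ^ (k + l * n) * Real.exp (-b * ‖x‖ ^ 2)) := by
            rw [mul_pow, pow_add, pow_mul]; ring
        _ ≤ _ := by gcongr; exact hM' _ (norm_nonneg _)
    · intro i _
      rw [norm_iteratedFDeriv_eq_norm_iteratedDeriv, iteratedDeriv_eq_iterate,
        Real.iter_deriv_exp, Real.norm_of_nonneg (Real.exp_nonneg _)]
    · intro i hi hin
      refine (hl i hin x).trans ?_
      refine le_trans ?_ (le_self_pow₀ ?_ (by omega))
      · gcongr; linarith
      · have : 1 ≤ (1 + ‖x‖) ^ l := one_le_pow₀ (by linarith [norm_nonneg x])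
        nlinarith

lemma gaussianSchwartz_apply (b : ℝ) (hb : 0 < b) (x : V) :
    gaussianSchwartz b hb x = Real.exp (-b * ‖x‖ ^ 2) := rfl

end gaussian

/-! ### Hermite functions on the line -/

section hermite1d

/-- The (physicists') Hermite polynomials. -/
def hermitePoly : ℕ → ℝ → ℝ
  | 0, _ => 1
  | 1, x => 2 * x
  | n + 2, x => 2 * x * hermitePoly (n + 1) x - 2 * (n + 1) * hermitePoly n x

lemma hermitePoly_hasTemperateGrowth : ∀ n, (hermitePoly n).HasTemperateGrowth
  | 0 => Function.HasTemperateGrowth.const 1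
  | 1 => (Function.HasTemperateGrowth.const 2).mul Function.HasTemperateGrowth.id'
  | n + 2 =>
    (((Function.HasTemperateGrowth.const 2).mul Function.HasTemperateGrowth.id').mul
      (hermitePoly_hasTemperateGrowth (n + 1))).sub
      ((Function.HasTemperateGrowth.const (2 * (n + 1 : ℝ))).mul
        (hermitePoly_hasTemperateGrowth n))

/-- The (unnormalized) Hermite functions. -/
def hermiteFun (n : ℕ) (x : ℝ) : ℝ := hermitePoly n x * Real.exp (-(1 / 2) * x ^ 2)

lemma hermiteFun_zero (x : ℝ) : hermiteFun 0 x = Real.exp (-(1 / 2) * x ^ 2) := by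
  simp [hermiteFun, hermitePoly]

lemma hermiteFun_one (x : ℝ) : hermiteFun 1 x = 2 * x * hermiteFun 0 x := by
  simp [hermiteFun, hermitePoly]

lemma hermiteFun_add_two (n : ℕ) (x : ℝ) :
    hermiteFun (n + 2) x = 2 * x * hermiteFun (n + 1) x - 2 * (n + 1) * hermiteFun n x := by
  simp only [hermiteFun, hermitePoly]; ring

/-- The creation operator `x - d/dx` raises the index. For polynomials defined by a three-term
recursion this comes by strong induction, differentiating the recursion. -/
lemma hasDerivAt_hermiteFun (n : ℕ) (x : ℝ) :
    HasDerivAt (hermiteFun n) (x * hermiteFun n x - hermiteFun (n + 1) x) x := by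
  have h0 : ∀ x, HasDerivAt (hermiteFun 0) (-x * hermiteFun 0 x) x := by
    intro x
    have : HasDerivAt (fun x : ℝ => Real.exp (-(1 / 2) * x ^ 2))
        (Real.exp (-(1 / 2) * x ^ 2) * (-(1 / 2) * (2 * x ^ 1))) x :=
      (((hasDerivAt_pow 2 x).const_mul (-(1 / 2) : ℝ)).exp)
    refine (this.congr_deriv (by rw [hermiteFun_zero]; ring)).congr_of_eventuallyEq
      (Eventually.of_forall fun z => hermiteFun_zero z)
  induction n using Nat.strong_induction_on generalizing x with
  | _ n ih =>
    match n, ih with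
    | 0, _ => exact (h0 x).congr_deriv (by rw [hermiteFun_one]; ring)
    | 1, _ =>
      have : HasDerivAt (fun x => 2 * x * hermiteFun 0 x)
          ((2 * 1) * hermiteFun 0 x + 2 * x * (-x * hermiteFun 0 x)) x :=
        ((hasDerivAt_id x).const_mul 2).mul (h0 x)
      refine (this.congr_deriv ?_).congr_of_eventuallyEq
        (Eventually.of_forall fun z => hermiteFun_one z)
      rw [hermiteFun_add_two, hermiteFun_one]; push_cast; ring
    | n + 2, ih =>
      have : HasDerivAt (fun x => 2 * x * hermiteFun (n + 1) x - 2 * (n + 1) * hermiteFun n x)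
          (((2 * 1) * hermiteFun (n + 1) x +
            2 * x * (x * hermiteFun (n + 1) x - hermiteFun (n + 1 + 1) x)) -
            2 * (n + 1) * (x * hermiteFun n x - hermiteFun (n + 1) x)) x :=
        (((hasDerivAt_id x).const_mul 2).mul (ih (n + 1) (by omega) x)).sub
          ((ih n (by omega) x).const_mul _)
      refine (this.congr_deriv ?_).congr_of_eventuallyEq
        (Eventually.of_forall fun z => hermiteFun_add_two n z)
      rw [show n + 2 + 1 = (n + 1) + 2 from rfl, hermiteFun_add_two (n + 1),
        hermiteFun_add_two n]
      push_cast
      ring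

/-- The derivative of a Hermite function. -/
def hermiteFunDeriv (n : ℕ) (x : ℝ) : ℝ := x * hermiteFun n x - hermiteFun (n + 1) x

/-- The eigenvalue equation of `-d²/dx² + x² + 1`, with eigenvalue `2n + 2`. -/
lemma hasDerivAt_hermiteFunDeriv (n : ℕ) (x : ℝ) :
    HasDerivAt (hermiteFunDeriv n) ((x ^ 2 + 1 - (2 * n + 2)) * hermiteFun n x) x := by
  have := ((hasDerivAt_id x).mul (hasDerivAt_hermiteFun n x)).sub (hasDerivAt_hermiteFun (n + 1) x)
  refine this.congr_deriv ?_
  rw [show n + 1 + 1 = n + 2 from rfl, hermiteFun_add_two]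
  simp only [id]
  ring

/-- Makes the span of the Hermite functions stable under multiplication by coordinates. At `n = 0`
the truncated index `n - 1` carries the coefficient `0`. -/
lemma mul_hermiteFun (n : ℕ) (x : ℝ) :
    x * hermiteFun n x = (1 / 2) * hermiteFun (n + 1) x + n * hermiteFun (n - 1) x := by
  cases n with
  | zero => rw [hermiteFun_one]; push_cast; ring
  | succ n =>
    rw [show n + 1 + 1 = n + 2 from rfl, hermiteFun_add_two, Nat.add_sub_cancel]
    push_cast; ring

/-- The Hermite functions as Schwartz functions on the line. -/
def hermiteSchwartz (n : ℕ) : 𝓢(ℝ, ℝ) :=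
  SchwartzMap.smulLeftCLM ℝ (hermitePoly n) (gaussianSchwartz (1 / 2) (by norm_num))

lemma hermiteSchwartz_apply (n : ℕ) (x : ℝ) : hermiteSchwartz n x = hermiteFun n x := by
  rw [hermiteSchwartz, SchwartzMap.smulLeftCLM_apply_apply (hermitePoly_hasTemperateGrowth n),
    gaussianSchwartz_apply, hermiteFun, smul_eq_mul, Real.norm_eq_abs, sq_abs]

lemma deriv_hermiteFun (n : ℕ) : deriv (hermiteFun n) = hermiteFunDeriv n :=
  funext fun x => (hasDerivAt_hermiteFun n x).deriv

lemma coe_hermiteSchwartz (n : ℕ) : ⇑(hermiteSchwartz n) = hermiteFun n :=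
  funext (hermiteSchwartz_apply n)

lemma integrable_mul_schwartz {V : Type*} [NormedAddCommGroup V] [NormedSpace ℝ V]
    [FiniteDimensional ℝ V] [MeasurableSpace V] [BorelSpace V] (μ : Measure V)
    [μ.HasTemperateGrowth] (f g : 𝓢(V, ℝ)) : Integrable (fun x => f x * g x) μ := by
  have h := (SchwartzMap.smulLeftCLM ℝ (⇑f) g).integrable (μ := μ)
  refine h.congr (Eventually.of_forall fun x => ?_)
  simp [SchwartzMap.smulLeftCLM_apply_apply f.hasTemperateGrowth]

/-- Pair the eigenvalue equation with the Hermite function itself and integrate by parts: the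
kinetic term is nonnegative and can be dropped. -/
lemma integral_weight_hermiteFun_le (n : ℕ) :
    Integrable (fun x => (x ^ 2 + 1) * hermiteFun n x ^ 2) ∧
    ∫ x, (x ^ 2 + 1) * hermiteFun n x ^ 2 ≤ (2 * n + 2) * ∫ x, hermiteFun n x ^ 2 := by
  let h := hermiteSchwartz n
  have hh : ∀ x, h x = hermiteFun n x := hermiteSchwartz_apply n
  let h' := SchwartzMap.derivCLM ℝ ℝ h
  have hh' : ∀ x, h' x = hermiteFunDeriv n x := fun x => by
    rw [SchwartzMap.derivCLM_apply, coe_hermiteSchwartz, deriv_hermiteFun]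
  let h'' := SchwartzMap.derivCLM ℝ ℝ h'
  have hh'' : ∀ x, h'' x = (x ^ 2 + 1 - (2 * n + 2)) * hermiteFun n x := fun x => by
    rw [SchwartzMap.derivCLM_apply, show ⇑h' = hermiteFunDeriv n from funext hh',
      (hasDerivAt_hermiteFunDeriv n x).deriv]
  have hi := SchwartzMap.integral_mul_deriv_eq_neg_deriv_mul h h'
  have i1 : Integrable (fun x => h x * h'' x) := integrable_mul_schwartz volume h h''
  have i2 : Integrable (fun x => h x * h x) := integrable_mul_schwartz volume h h
  have e : (fun x => (x ^ 2 + 1) * hermiteFun n x ^ 2)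
      = fun x => h x * h'' x + (2 * n + 2) * (h x * h x) := by
    ext x; rw [hh, hh'']; ring
  have e2 : ∫ x, hermiteFun n x ^ 2 = ∫ x, h x * h x := by
    congr 1; ext x; rw [hh, sq]
  rw [e, e2]
  refine ⟨i1.add (i2.const_mul _), ?_⟩
  rw [integral_add i1 (i2.const_mul _), integral_const_mul]
  have e3 : ∫ x, h x * h'' x = -∫ x, h' x * h' x := by
    have a1 : (fun x => h x * h'' x) = fun x => h x * deriv (⇑h') x := by
      ext x; rw [← SchwartzMap.derivCLM_apply ℝ h']
    have a2 : (fun x => h' x * h' x) = fun x => deriv (⇑h) x * h' x := by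
      ext x; rw [← SchwartzMap.derivCLM_apply ℝ h]
    rw [a1, a2]; exact hi
  have : 0 ≤ ∫ x, h' x * h' x := integral_nonneg fun x => mul_self_nonneg _
  linarith

lemma hermiteFun_integrable (n : ℕ) : Integrable (hermiteFun n) := by
  rw [← coe_hermiteSchwartz]; exact (hermiteSchwartz n).integrable

lemma hermiteFun_sq_integrable (n : ℕ) : Integrable (fun x => hermiteFun n x ^ 2) := by
  refine (integrable_mul_schwartz volume (hermiteSchwartz n) (hermiteSchwartz n)).congr
    (Eventually.of_forall fun x => ?_)
  simp only [hermiteSchwartz_apply, sq]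

/-- The `L¹` norm of a Hermite function in terms of its `L²` norm. -/
lemma integral_abs_hermiteFun_sq_le (n : ℕ) :
    (∫ x, |hermiteFun n x|) ^ 2 ≤ 2 * Real.pi * (n + 1) * ∫ x, hermiteFun n x ^ 2 := by
  obtain ⟨hi, hle⟩ := integral_weight_hermiteFun_le n
  have hp : Integrable (fun x : ℝ => (1 + x ^ 2)⁻¹) := integrable_inv_one_add_sq
  -- Cauchy–Schwarz through a quadratic polynomial
  set a := ∫ x, |hermiteFun n x|
  set b := ∫ x, (x ^ 2 + 1) * hermiteFun n x ^ 2
  have hab : ∀ s : ℝ, 2 * s * a ≤ s ^ 2 * Real.pi + b := by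
    intro s
    rw [← integral_univ_inv_one_add_sq, ← integral_const_mul, ← integral_const_mul,
      ← integral_add (hp.const_mul _) hi]
    refine integral_mono ((hermiteFun_integrable n).abs.const_mul _) ((hp.const_mul _).add hi)
      fun x => ?_
    have h1 : 0 < 1 + x ^ 2 := by positivity
    have h2 : 0 ≤ (1 + x ^ 2)⁻¹ * (s - (1 + x ^ 2) * |hermiteFun n x|) ^ 2 := by positivity
    have e : (1 + x ^ 2)⁻¹ * (s - (1 + x ^ 2) * |hermiteFun n x|) ^ 2
        = s ^ 2 * (1 + x ^ 2)⁻¹ + (x ^ 2 + 1) * |hermiteFun n x| ^ 2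
          - 2 * s * |hermiteFun n x| := by
      field_simp; ring
    rw [sq_abs] at e
    simp only
    linarith
  have hpi := Real.pi_pos
  -- The optimal `s`. It yields `a² ≤ π b`, where `π` is the integral of `1/(1+x²)`, and `b` is at
  -- most `2n + 2` times the squared `L²` norm.
  have h := hab (a / Real.pi)
  have e1 : 2 * (a / Real.pi) * a = 2 * (a ^ 2 / Real.pi) := by ring
  have e2 : (a / Real.pi) ^ 2 * Real.pi = a ^ 2 / Real.pi := by field_simp
  have h3 : a ^ 2 / Real.pi ≤ b := by linarith
  rw [div_le_iff₀ hpi] at h3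
  nlinarith

/-- If one of them vanished identically, the derivative relation would make the next one vanish, and
then the recursion the preceding one. -/
lemma exists_hermiteFun_ne_zero (n : ℕ) : ∃ x, hermiteFun n x ≠ 0 := by
  induction n with
  | zero => exact ⟨0, by rw [hermiteFun_zero]; exact (Real.exp_pos _).ne'⟩
  | succ n ih =>
    by_contra! h
    have h1 : hermiteFun (n + 1) = fun _ => 0 := funext h
    have h2 : ∀ x, hermiteFun (n + 2) x = 0 := by
      intro x
      have := (hasDerivAt_hermiteFun (n + 1) x).deriv
      rw [h1] at this
      simpa using this.symm
    obtain ⟨x, hx⟩ := ih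
    have := hermiteFun_add_two n x
    rw [h2, h, mul_zero, zero_sub, eq_comm, neg_eq_zero] at this
    rcases mul_eq_zero.1 this with h | h
    · have : (0 : ℝ) < 2 * (n + 1) := by positivity
      exact this.ne' h
    · exact hx h

lemma continuous_hermiteFun (n : ℕ) : Continuous (hermiteFun n) := by
  rw [← coe_hermiteSchwartz]; exact (hermiteSchwartz n).continuous

lemma integral_hermiteFun_sq_pos (n : ℕ) : 0 < ∫ x, hermiteFun n x ^ 2 := by
  rw [integral_pos_iff_support_of_nonneg (fun x => sq_nonneg _) (hermiteFun_sq_integrable n)]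
  refine IsOpen.measure_pos _ ?_ ?_
  · exact ((continuous_hermiteFun n).pow 2).isOpen_support
  · obtain ⟨x, hx⟩ := exists_hermiteFun_ne_zero n
    exact ⟨x, pow_ne_zero 2 hx⟩

end hermite1d

/-! ### Products of Hermite functions and the harmonic oscillator -/

section hermite

variable {κ : Type} [Fintype κ]

/-- The product of Hermite polynomials centred at `y`. -/
def hermitePolyProd (y : κ → ℝ) (n : κ → ℕ) (x : EuclideanSpace ℝ κ) : ℝ :=
  ∏ i, hermitePoly (n i) (x i - y i)

lemma coord_sub_hasTemperateGrowth (y : κ → ℝ) (i : κ) :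
    (fun x : EuclideanSpace ℝ κ => x i - y i).HasTemperateGrowth :=
  ((EuclideanSpace.proj (𝕜 := ℝ) i).hasTemperateGrowth).sub
    (Function.HasTemperateGrowth.const (y i))

lemma hermitePolyProd_hasTemperateGrowth (y : κ → ℝ) (n : κ → ℕ) :
    (hermitePolyProd y n).HasTemperateGrowth := by
  classical
  have h : ∀ s : Finset κ, (fun x : EuclideanSpace ℝ κ =>
      ∏ i ∈ s, hermitePoly (n i) (x i - y i)).HasTemperateGrowth := by
    intro s
    induction s using Finset.induction_on with
    | empty => simp
    | insert i s hi ih =>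
      simp only [Finset.prod_insert hi]
      exact ((hermitePoly_hasTemperateGrowth (n i)).comp
        (coord_sub_hasTemperateGrowth y i)).mul ih
  exact h Finset.univ

/-- The product `∏_i h_{n_i}(x_i - y_i)` of Hermite functions. -/
def hermite (y : κ → ℝ) (n : κ → ℕ) : 𝓢(EuclideanSpace ℝ κ, ℂ) :=
  SchwartzMap.postcompCLM (𝕜 := ℝ) Complex.ofRealCLM
    (SchwartzMap.smulLeftCLM ℝ (hermitePolyProd y n)
      (SchwartzMap.compSubConstCLM ℝ (WithLp.toLp 2 y) (gaussianSchwartz (1 / 2) (by norm_num))))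

lemma hermite_apply (y : κ → ℝ) (n : κ → ℕ) (x : EuclideanSpace ℝ κ) :
    hermite y n x = ∏ i, (hermiteFun (n i) (x i - y i) : ℂ) := by
  rw [hermite, SchwartzMap.postcompCLM_apply,
    SchwartzMap.smulLeftCLM_apply_apply (hermitePolyProd_hasTemperateGrowth y n),
    SchwartzMap.compSubConstCLM_apply, gaussianSchwartz_apply, EuclideanSpace.norm_sq_eq,
    Finset.mul_sum, Real.exp_sum]
  simp only [hermitePolyProd, smul_eq_mul, hermiteFun, ← Finset.prod_mul_distrib]
  simp

lemma lineDeriv_prod_single [DecidableEq κ] (g g' : κ → ℝ → ℂ) (i : κ)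
    (x : EuclideanSpace ℝ κ) (h : HasDerivAt (g i) (g' i (x i)) (x i)) :
    lineDeriv ℝ (fun x : EuclideanSpace ℝ κ => ∏ j, g j (x j)) x (EuclideanSpace.single i 1)
      = g' i (x i) * ∏ j ∈ Finset.univ.erase i, g j (x j) := by
  have e : (fun t : ℝ => ∏ j, g j ((x + t • EuclideanSpace.single i (1 : ℝ) :
      EuclideanSpace ℝ κ) j))
      = fun t : ℝ => g i (x i + t) * ∏ j ∈ Finset.univ.erase i, g j (x j) := by
    ext t
    rw [← Finset.mul_prod_erase _ _ (Finset.mem_univ i)]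
    congr 1
    · simp
    · refine Finset.prod_congr rfl fun j hj => ?_
      simp [(Finset.mem_erase.1 hj).1]
  rw [lineDeriv, e]
  have h1 : HasDerivAt (fun t : ℝ => g i (x i + t)) (g' i (x i)) 0 := by
    have h' : HasDerivAt (g i) (g' i (x i)) (x i + 0) := by simpa using h
    exact h'.comp_const_add (x i) 0
  exact (h1.mul_const _).deriv

/-- The operator sees only the `i`-th factor of the product, so the one-dimensional eigenvalue
equation applies. -/
lemma harmonic_hermite (y : κ → ℝ) (i : κ) (n : κ → ℕ) :
    harmonic y i (hermite y n) = ((2 * n i + 2 : ℝ) : ℂ) • hermite y n := by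
  classical
  let g : κ → ℝ → ℂ := fun j x => (hermiteFun (n j) (x - y j) : ℂ)
  let g1 : κ → ℝ → ℂ := fun j x => (hermiteFunDeriv (n j) (x - y j) : ℂ)
  let g2 : κ → ℝ → ℂ := fun j x =>
    (((x - y j) ^ 2 + 1 - (2 * n j + 2)) * hermiteFun (n j) (x - y j) : ℝ)
  have hg : ∀ j x, HasDerivAt (g j) (g1 j x) x := fun j x =>
    ((hasDerivAt_hermiteFun (n j) (x - y j)).comp_sub_const x (y j)).ofReal_comp
  have hg1 : ∀ j x, HasDerivAt (g1 j) (g2 j x) x := fun j x =>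
    ((hasDerivAt_hermiteFunDeriv (n j) (x - y j)).comp_sub_const x (y j)).ofReal_comp
  have e0 : (⇑(hermite y n)) = fun x : EuclideanSpace ℝ κ => ∏ j, g j (x j) :=
    funext fun x => hermite_apply y n x
  ext x
  rw [harmonic_apply, e0]
  -- The first derivative is again a product, with the `i`-th factor replaced; the same product rule
  -- then gives the second derivative.
  have e1 : (fun z => lineDeriv ℝ (fun x : EuclideanSpace ℝ κ => ∏ j, g j (x j)) z
      (EuclideanSpace.single i 1)) = fun z => ∏ j, (Function.update g i (g1 i)) j (z j) := by
    ext z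
    rw [lineDeriv_prod_single g g1 i z (hg i _), ← Finset.mul_prod_erase _ _ (Finset.mem_univ i)]
    simp only [Function.update_self]
    congr 1
    refine Finset.prod_congr rfl fun j hj => ?_
    rw [Function.update_of_ne (Finset.mem_erase.1 hj).1]
  rw [e1, lineDeriv_prod_single _ (fun _ => g2 i) i x (by
    rw [Function.update_self]; exact hg1 i _)]
  have e2 : ∏ j ∈ Finset.univ.erase i, Function.update g i (g1 i) j (x j)
      = ∏ j ∈ Finset.univ.erase i, g j (x j) := by
    refine Finset.prod_congr rfl fun j hj => ?_
    rw [Function.update_of_ne (Finset.mem_erase.1 hj).1]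
  rw [e2]
  change _ = ((2 * n i + 2 : ℝ) : ℂ) • hermite y n x
  have e3 : ∏ j, g j (x j) = g i (x i) * ∏ j ∈ Finset.univ.erase i, g j (x j) :=
    (Finset.mul_prod_erase _ _ (Finset.mem_univ i)).symm
  rw [show hermite y n x = ∏ j, g j (x j) from hermite_apply y n x]
  simp only [e3]
  simp only [g, g2, smul_eq_mul]
  push_cast
  ring

/-- The sesquilinear pairing of two Schwartz functions. -/
def spair (f g : 𝓢(EuclideanSpace ℝ κ, ℂ)) : ℂ := ∫ x, conj (f x) * g x

lemma spair_eq_inner (f g : 𝓢(EuclideanSpace ℝ κ, ℂ)) :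
    spair f g = inner ℂ (f.toLp 2) (g.toLp 2) := by
  rw [SchwartzMap.inner_toL2_toL2_eq f g volume]
  simp only [spair, RCLike.inner_apply, mul_comm]

lemma spair_conj (f g : 𝓢(EuclideanSpace ℝ κ, ℂ)) : conj (spair f g) = spair g f := by
  rw [spair_eq_inner, spair_eq_inner, inner_conj_symm]

lemma spair_lineDeriv (f g : 𝓢(EuclideanSpace ℝ κ, ℂ)) (v : EuclideanSpace ℝ κ) :
    spair f (LineDeriv.lineDerivOp v g) = -spair (LineDeriv.lineDerivOp v f) g :=
  SchwartzMap.integral_bilinear_lineDerivOp_right_eq_neg_left f g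
    ((ContinuousLinearMap.mul ℝ ℂ).comp (Complex.conjCLE : ℂ →L[ℝ] ℂ)) v

lemma spair_sub_right (f g h : 𝓢(EuclideanSpace ℝ κ, ℂ)) :
    spair f (g - h) = spair f g - spair f h := by
  simp only [spair_eq_inner, ← SchwartzMap.toLpCLM_apply (𝕜 := ℂ), map_sub, inner_sub_right]

lemma spair_smul_right (f g : 𝓢(EuclideanSpace ℝ κ, ℂ)) (c : ℂ) :
    spair f (c • g) = c * spair f g := by
  simp only [spair_eq_inner, ← SchwartzMap.toLpCLM_apply (𝕜 := ℂ), map_smul, inner_smul_right]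

lemma spair_smul_left (f g : 𝓢(EuclideanSpace ℝ κ, ℂ)) (c : ℂ) :
    spair (c • f) g = conj c * spair f g := by
  rw [← spair_conj, spair_smul_right, map_mul, spair_conj]

/-- Multiplication by a real function is symmetric, and two integrations by parts cancel each
other's sign. -/
lemma spair_harmonic (y : κ → ℝ) (i : κ) (f g : 𝓢(EuclideanSpace ℝ κ, ℂ)) :
    spair f (harmonic y i g) = spair (harmonic y i f) g := by
  classical
  have ht : (fun x : EuclideanSpace ℝ κ =>
      (((x i - y i) ^ 2 + 1 : ℝ) : ℂ)).HasTemperateGrowth := by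
    have h0 : (fun x : EuclideanSpace ℝ κ => (x i : ℝ)).HasTemperateGrowth :=
      (EuclideanSpace.proj (𝕜 := ℝ) i).hasTemperateGrowth
    fun_prop
  let m := SchwartzMap.smulLeftCLM ℂ (fun x : EuclideanSpace ℝ κ =>
    (((x i - y i) ^ 2 + 1 : ℝ) : ℂ))
  obtain ⟨v, hv⟩ : ∃ v : EuclideanSpace ℝ κ, ∀ g : 𝓢(EuclideanSpace ℝ κ, ℂ),
      harmonic y i g = m g - LineDeriv.lineDerivOp v (LineDeriv.lineDerivOp v g) :=
    ⟨_, fun g => rfl⟩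
  have hm : spair f (m g) = spair (m f) g := by
    simp only [spair, m, SchwartzMap.smulLeftCLM_apply_apply ht, smul_eq_mul, map_mul,
      Complex.conj_ofReal]
    congr 1; ext x; ring
  have h2 : spair f (LineDeriv.lineDerivOp v (LineDeriv.lineDerivOp v g))
      = spair (LineDeriv.lineDerivOp v (LineDeriv.lineDerivOp v f)) g := by
    rw [spair_lineDeriv, spair_lineDeriv, neg_neg]
  rw [hv, hv, spair_sub_right, ← spair_conj g, spair_sub_right, map_sub, spair_conj, spair_conj,
    hm, h2]

/-- Eigenvectors of a symmetric operator with different eigenvalues: pick a coordinate in which the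
indices differ. -/
lemma hermite_orthogonal (y : κ → ℝ) {n m : κ → ℕ} (h : n ≠ m) :
    spair (hermite y n) (hermite y m) = 0 := by
  obtain ⟨i, hi⟩ := Function.ne_iff.1 h
  have e := spair_harmonic y i (hermite y n) (hermite y m)
  rw [harmonic_hermite, harmonic_hermite, spair_smul_right, spair_smul_left, Complex.conj_ofReal,
    ← sub_eq_zero, ← sub_mul, mul_eq_zero] at e
  refine e.resolve_left fun h' => hi ?_
  have : ((2 * m i + 2 : ℝ) : ℂ) = ((2 * n i + 2 : ℝ) : ℂ) := sub_eq_zero.1 h'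
  rw [Complex.ofReal_inj] at this
  have h2 : (n i : ℝ) = m i := by linarith
  exact_mod_cast h2

lemma integral_prod_coord (y : κ → ℝ) (f : κ → ℝ → ℝ) :
    ∫ x : EuclideanSpace ℝ κ, ∏ i, f i (x i - y i) = ∏ i, ∫ x, f i x := by
  have h := (PiLp.volume_preserving_ofLp κ).integral_comp
    (MeasurableEquiv.toLp 2 (κ → ℝ)).symm.measurableEmbedding (fun x => ∏ i, f i (x i - y i))
  refine h.trans ?_
  rw [volume_pi, integral_fintype_prod_eq_prod (𝕜 := ℝ) (fun i x => f i (x - y i))]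
  exact Finset.prod_congr rfl fun i _ => integral_sub_right_eq_self (f i) (y i)

lemma integral_norm_hermite (y : κ → ℝ) (n : κ → ℕ) :
    ∫ x, ‖hermite y n x‖ = ∏ i, ∫ x, |hermiteFun (n i) x| := by
  rw [← integral_prod_coord y]
  simp [hermite_apply]

lemma norm_hermite_sq (y : κ → ℝ) (n : κ → ℕ) :
    ‖(hermite y n).toLp 2‖ ^ 2 = ∏ i, ∫ x, hermiteFun (n i) x ^ 2 := by
  have h1 : spair (hermite y n) (hermite y n) = ((‖(hermite y n).toLp 2‖ ^ 2 : ℝ) : ℂ) := by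
    rw [spair_eq_inner, inner_self_eq_norm_sq_to_K]; simp
  rw [← Complex.ofReal_inj, ← h1, ← integral_prod_coord y, spair, ← integral_complex_ofReal]
  congr 1
  ext x
  rw [hermite_apply, map_prod, ← Finset.prod_mul_distrib]
  push_cast
  refine Finset.prod_congr rfl fun i _ => ?_
  rw [Complex.conj_ofReal, sq]

lemma norm_hermite_pos (y : κ → ℝ) (n : κ → ℕ) : 0 < ‖(hermite y n).toLp 2‖ := by
  have : 0 < ‖(hermite y n).toLp 2‖ ^ 2 := by
    rw [norm_hermite_sq]
    exact Finset.prod_pos fun i _ => integral_hermiteFun_sq_pos _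
  exact lt_of_le_of_ne (norm_nonneg _) fun h => by rw [← h] at this; simp at this

/-- The `L¹` norm of a Hermite function in terms of its `L²` norm. -/
lemma integral_norm_hermite_le (y : κ → ℝ) (n : κ → ℕ) :
    ∫ x, ‖hermite y n x‖ ≤ √((2 * Real.pi) ^ Fintype.card κ) * √(∏ i, (n i + 1 : ℝ)) *
      ‖(hermite y n).toLp 2‖ := by
  refine le_of_sq_le_sq ?_ (by positivity)
  rw [mul_pow, mul_pow, Real.sq_sqrt (by positivity), Real.sq_sqrt (by positivity),
    norm_hermite_sq, integral_norm_hermite, ← Finset.prod_pow, ← Finset.card_univ,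
    ← Finset.prod_const, ← Finset.prod_mul_distrib, ← Finset.prod_mul_distrib]
  exact Finset.prod_le_prod (fun i _ => sq_nonneg _) fun i _ => integral_abs_hermiteFun_sq_le _

lemma integrable_schwartz_mul_L2 (u : 𝓢(EuclideanSpace ℝ κ, ℂ)) (f : L2 (EuclideanSpace ℝ κ)) :
    Integrable fun x => u x * f x :=
  (u.memLp 2).integrable_mul (Lp.memLp f)

lemma integral_hermite_mul (y : κ → ℝ) (n : κ → ℕ) (f : L2 (EuclideanSpace ℝ κ)) :
    ∫ x, hermite y n x * f x = inner ℂ ((hermite y n).toLp 2) f := by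
  rw [L2.inner_def]
  refine integral_congr_ae ?_
  filter_upwards [(hermite y n).coeFn_toLp 2 volume] with x hx
  rw [hx, RCLike.inner_apply, mul_comm, hermite_apply, map_prod]
  congr 1
  exact Finset.prod_congr rfl fun i _ => (Complex.conj_ofReal _).symm

/-- Multiplication by `∑ ξ_i (x_i - y_i)`. -/
def mulLinear (y ξ : EuclideanSpace ℝ κ) : 𝓢(EuclideanSpace ℝ κ, ℂ) →L[ℂ] 𝓢(EuclideanSpace ℝ κ, ℂ) :=
  SchwartzMap.smulLeftCLM ℂ (fun x : EuclideanSpace ℝ κ => ((inner ℝ ξ (x - y) : ℝ) : ℂ))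

lemma mulLinear_apply (y ξ : EuclideanSpace ℝ κ) (u : 𝓢(EuclideanSpace ℝ κ, ℂ))
    (x : EuclideanSpace ℝ κ) : mulLinear y ξ u x = ((inner ℝ ξ (x - y) : ℝ) : ℂ) * u x := by
  have ht : (fun x : EuclideanSpace ℝ κ => ((inner ℝ ξ (x - y) : ℝ) : ℂ)).HasTemperateGrowth := by
    have h0 : (fun x : EuclideanSpace ℝ κ => inner ℝ ξ (x - y)).HasTemperateGrowth := by
      simp only [inner_sub_right]
      exact (Function.hasTemperateGrowth_inner_right ξ).sub (Function.HasTemperateGrowth.const _)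
    fun_prop
  rw [mulLinear, SchwartzMap.smulLeftCLM_apply_apply ht, smul_eq_mul]

lemma mulLinear_hermite_mem (y ξ : EuclideanSpace ℝ κ) (n : κ → ℕ) :
    mulLinear y ξ (hermite y n) ∈ Submodule.span ℂ (Set.range (hermite y)) := by
  classical
  have e : mulLinear y ξ (hermite y n) = ∑ i, (ξ i : ℂ) •
      ((1 / 2 : ℂ) • hermite y (Function.update n i (n i + 1)) +
        (n i : ℂ) • hermite y (Function.update n i (n i - 1))) := by
    ext x
    have hu : ∀ i k, hermite y (Function.update n i k) x = (hermiteFun k (x i - y i) : ℂ) *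
        ∏ j ∈ Finset.univ.erase i, (hermiteFun (n j) (x j - y j) : ℂ) := by
      intro i k
      rw [hermite_apply, ← Finset.mul_prod_erase _ _ (Finset.mem_univ i), Function.update_self]
      congr 1
      refine Finset.prod_congr rfl fun j hj => ?_
      rw [Function.update_of_ne (Finset.mem_erase.1 hj).1]
    rw [mulLinear_apply, PiLp.inner_apply, sum_apply]
    push_cast
    rw [Finset.sum_mul]
    refine Finset.sum_congr rfl fun i _ => ?_
    rw [Pi.smul_apply, Pi.add_apply, Pi.smul_apply, Pi.smul_apply, hu, hu, hermite_apply, ← Finset.mul_prod_erase _ _ (Finset.mem_univ i)]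
    have h := congrArg (fun r : ℝ => (r : ℂ)) (mul_hermiteFun (n i) (x i - y i))
    push_cast at h
    simp only [smul_eq_mul, PiLp.sub_apply, RCLike.inner_apply, conj_trivial]
    push_cast
    linear_combination (ξ i : ℂ) * (∏ j ∈ Finset.univ.erase i,
      (hermiteFun (n j) (x j - y j) : ℂ)) * h
  rw [e]
  exact Submodule.sum_mem _ fun i _ => Submodule.smul_mem _ _ (Submodule.add_mem _
    (Submodule.smul_mem _ _ (Submodule.subset_span ⟨_, rfl⟩))
    (Submodule.smul_mem _ _ (Submodule.subset_span ⟨_, rfl⟩)))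

lemma mulLinear_mem (y ξ : EuclideanSpace ℝ κ) {u : 𝓢(EuclideanSpace ℝ κ, ℂ)}
    (hu : u ∈ Submodule.span ℂ (Set.range (hermite y))) :
    mulLinear y ξ u ∈ Submodule.span ℂ (Set.range (hermite y)) := by
  induction hu using Submodule.span_induction with
  | mem u hu => obtain ⟨n, rfl⟩ := hu; exact mulLinear_hermite_mem y ξ n
  | zero => rw [map_zero]; exact Submodule.zero_mem _
  | add u v _ _ hu hv => rw [map_add]; exact Submodule.add_mem _ hu hv
  | smul c u _ hu => rw [map_smul]; exact Submodule.smul_mem _ _ hu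

/-- A power of a linear form times the Gaussian lies in the span of the Hermite functions. These are
the Taylor coefficients of the Fourier transform of the Gaussian times `f`. -/
lemma integral_moment_eq_zero (y ξ : EuclideanSpace ℝ κ) (f : L2 (EuclideanSpace ℝ κ))
    (hf : ∀ n, inner ℂ ((hermite y n).toLp 2) f = 0) (k : ℕ) :
    ∫ x, ((inner ℝ ξ (x - y) : ℝ) : ℂ) ^ k * (hermite y 0 x * f x) = 0 := by
  have h1 : ∀ u ∈ Submodule.span ℂ (Set.range (hermite (y : κ → ℝ))), ∫ x, u x * f x = 0 := by
    intro u hu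
    induction hu using Submodule.span_induction with
    | mem u hu => obtain ⟨n, rfl⟩ := hu; rw [integral_hermite_mul, hf]
    | zero => simp
    | add u v _ _ hu hv =>
      simp only [add_apply, add_mul]
      rw [integral_add (integrable_schwartz_mul_L2 u f) (integrable_schwartz_mul_L2 v f), hu, hv,
        add_zero]
    | smul c u _ hu =>
      simp only [smul_apply, smul_eq_mul, mul_assoc]
      rw [integral_const_mul, hu, mul_zero]
  have h2 : ∃ u ∈ Submodule.span ℂ (Set.range (hermite (y : κ → ℝ))), ∀ x,
      u x = ((inner ℝ ξ (x - y) : ℝ) : ℂ) ^ k * hermite y 0 x := by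
    induction k with
    | zero => exact ⟨_, Submodule.subset_span ⟨0, rfl⟩, by simp⟩
    | succ k ih =>
      obtain ⟨u, hu, e⟩ := ih
      exact ⟨_, mulLinear_mem y ξ hu, fun x => by rw [mulLinear_apply, e]; ring⟩
  obtain ⟨u, hu, e⟩ := h2
  rw [← h1 u hu]
  congr 1; ext x; rw [e]; ring

end hermite

/-! ### Completeness of the Hermite functions and the weighted quadratic form -/

section hermiteBasis

variable {κ : Type} [Fintype κ]

/-- Completing the square: `‖ξ‖ r - r²/4 ≤ ‖ξ‖²`. A quarter of the Gaussian exponent survives and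
dominates the exponential series of a plane wave. -/
lemma norm_exp_mul_hermite_zero_le (y ξ x : EuclideanSpace ℝ κ) :
    Real.exp (‖ξ‖ * ‖x - y‖) * ‖hermite y 0 x‖
      ≤ Real.exp (‖ξ‖ ^ 2) * Real.exp (-(1 / 4) * ‖x - y‖ ^ 2) := by
  have e : ‖hermite y 0 x‖ = Real.exp (-(1 / 2) * ‖x - y‖ ^ 2) := by
    rw [hermite_apply, norm_prod, EuclideanSpace.norm_sq_eq, Finset.mul_sum, Real.exp_sum]
    refine Finset.prod_congr rfl fun i _ => ?_
    rw [Pi.zero_apply, hermiteFun_zero, Complex.norm_real, Real.norm_eq_abs,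
      abs_of_pos (Real.exp_pos _)]
    simp
  rw [e, ← Real.exp_add, ← Real.exp_add]
  refine Real.exp_le_exp.2 ?_
  nlinarith [sq_nonneg (‖ξ‖ - ‖x - y‖ / 2)]

lemma integrable_exp_mul_hermite (y ξ : EuclideanSpace ℝ κ) (f : L2 (EuclideanSpace ℝ κ)) :
    Integrable fun x => Real.exp (‖ξ‖ * ‖x - y‖) * ‖hermite y 0 x * f x‖ := by
  let γ : 𝓢(EuclideanSpace ℝ κ, ℂ) := SchwartzMap.postcompCLM (𝕜 := ℝ) Complex.ofRealCLM
    (SchwartzMap.compSubConstCLM ℝ y (gaussianSchwartz (1 / 4) (by norm_num)))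
  have hγ : ∀ x, ‖γ x‖ = Real.exp (-(1 / 4) * ‖x - y‖ ^ 2) := fun x => by
    rw [show γ x = ((Real.exp (-(1 / 4) * ‖x - y‖ ^ 2) : ℝ) : ℂ) from rfl, Complex.norm_real,
      Real.norm_eq_abs, abs_of_pos (Real.exp_pos _)]
  have hm : AEStronglyMeasurable (fun x => Real.exp (‖ξ‖ * ‖x - y‖) * ‖hermite y 0 x * f x‖)
      volume := by
    refine AEStronglyMeasurable.mul ?_ (integrable_schwartz_mul_L2 _ f).aestronglyMeasurable.norm
    exact (by fun_prop : Continuous fun x => Real.exp (‖ξ‖ * ‖x - y‖)).aestronglyMeasurable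
  refine Integrable.mono' ((integrable_schwartz_mul_L2 γ f).norm.const_mul (Real.exp (‖ξ‖ ^ 2)))
    hm (Eventually.of_forall fun x => ?_)
  simp only [norm_mul, norm_norm, hγ]
  rw [Real.norm_eq_abs, Real.abs_exp, ← mul_assoc, ← mul_assoc]
  exact mul_le_mul_of_nonneg_right (norm_exp_mul_hermite_zero_le y ξ x) (norm_nonneg _)

/-- Expand the plane wave into its power series and integrate term by term; each term is a vanishing
moment. -/
lemma fourier_hermite_mul_eq_zero (y : EuclideanSpace ℝ κ) (f : L2 (EuclideanSpace ℝ κ))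
    (hf : ∀ n, inner ℂ ((hermite y n).toLp 2) f = 0) (ξ : EuclideanSpace ℝ κ) :
    ∫ x, Complex.exp (((inner ℝ ξ (x - y) : ℝ) : ℂ) * Complex.I) * (hermite y 0 x * f x) = 0 := by
  let F : ℕ → EuclideanSpace ℝ κ → ℂ := fun k x =>
    (((inner ℝ ξ (x - y) : ℝ) : ℂ) * Complex.I) ^ k / k.factorial * (hermite y 0 x * f x)
  have hF : ∀ k, ∫ x, F k x = 0 := by
    intro k
    have e : F k = fun x => (Complex.I ^ k / k.factorial) *
        (((inner ℝ ξ (x - y) : ℝ) : ℂ) ^ k * (hermite y 0 x * f x)) := by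
      ext x; simp only [F, mul_pow]; ring
    rw [e, integral_const_mul, integral_moment_eq_zero y ξ f hf k, mul_zero]
  let bound : ℕ → EuclideanSpace ℝ κ → ℝ := fun k x =>
    (‖ξ‖ * ‖x - y‖) ^ k / k.factorial * ‖hermite y 0 x * f x‖
  have hb : ∀ x, HasSum (fun k => bound k x)
      (Real.exp (‖ξ‖ * ‖x - y‖) * ‖hermite y 0 x * f x‖) := by
    intro x
    have := NormedSpace.expSeries_div_hasSum_exp (‖ξ‖ * ‖x - y‖)
    rw [← Real.exp_eq_exp_ℝ] at this
    exact this.mul_right _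
  have h := hasSum_integral_of_dominated_convergence (F := F) (μ := volume)
    (f := fun x => Complex.exp (((inner ℝ ξ (x - y) : ℝ) : ℂ) * Complex.I) *
      (hermite y 0 x * f x)) bound ?_ ?_ ?_ ?_ ?_
  · simp only [hF] at h
    exact h.unique hasSum_zero
  · intro k
    refine AEStronglyMeasurable.mul ?_ (integrable_schwartz_mul_L2 _ f).aestronglyMeasurable
    exact Continuous.aestronglyMeasurable (by fun_prop)
  · intro k
    refine Eventually.of_forall fun x => ?_
    simp only [F, bound]
    rw [norm_mul, norm_div, norm_pow, norm_mul, Complex.norm_I, mul_one, Complex.norm_real,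
      Complex.norm_natCast]
    gcongr
    exact norm_inner_le_norm _ _
  · exact Eventually.of_forall fun x => (hb x).summable
  · simp only [fun x => (hb x).tsum_eq]
    exact integrable_exp_mul_hermite y ξ f
  · refine Eventually.of_forall fun x => ?_
    have := NormedSpace.expSeries_div_hasSum_exp (((inner ℝ ξ (x - y) : ℝ) : ℂ) * Complex.I)
    rw [← Complex.exp_eq_exp_ℂ] at this
    exact this.mul_right _

/-- The Fourier transform of the Gaussian times `f` vanishes. By the exchange formula this product
then annihilates all test functions, hence is zero, and the Gaussian has no zeros. -/
lemma eq_zero_of_forall_inner_hermite (y : EuclideanSpace ℝ κ) (f : L2 (EuclideanSpace ℝ κ))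
    (hf : ∀ n, inner ℂ ((hermite y n).toLp 2) f = 0) : f = 0 := by
  let g : EuclideanSpace ℝ κ → ℂ := fun x => hermite y 0 x * f x
  have hg : Integrable g := integrable_schwartz_mul_L2 _ f
  have h1 : ∀ w, 𝓕 g w = 0 := by
    intro w
    rw [Real.fourier_eq']
    have e := fourier_hermite_mul_eq_zero y f hf ((-2 * Real.pi) • w)
    have e2 : (fun v => Complex.exp (((-2 * Real.pi * inner ℝ v w : ℝ) : ℂ) * Complex.I) • g v)
        = fun v => Complex.exp (((-2 * Real.pi * inner ℝ y w : ℝ) : ℂ) * Complex.I) *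
          (Complex.exp (((inner ℝ ((-2 * Real.pi) • w) (v - y) : ℝ) : ℂ) * Complex.I) *
            (hermite y 0 v * f v)) := by
      ext v
      rw [← mul_assoc, ← Complex.exp_add, smul_eq_mul, inner_smul_left, inner_sub_right,
        real_inner_comm v w, real_inner_comm y w]
      congr 2
      simp only [conj_trivial]
      push_cast
      ring
    rw [e2, integral_const_mul, e, mul_zero]
  have h2 : ∀ φ : 𝓢(EuclideanSpace ℝ κ, ℂ), ∫ x, g x * φ x = 0 := by
    intro φ
    let ψ : 𝓢(EuclideanSpace ℝ κ, ℂ) := 𝓕⁻ φ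
    have h := VectorFourier.integral_fourierIntegral_smul_eq_flip (μ := volume) (ν := volume)
      (L := innerₗ (EuclideanSpace ℝ κ)) (f := g) (g := ⇑ψ) Real.continuous_fourierChar
      continuous_inner hg ψ.integrable
    have e1 : ∀ w, VectorFourier.fourierIntegral Real.fourierChar volume
        (innerₗ (EuclideanSpace ℝ κ)) g w = 0 := h1
    have e2 : ∀ x, VectorFourier.fourierIntegral Real.fourierChar volume
        (innerₗ (EuclideanSpace ℝ κ)).flip (⇑ψ) x = φ x := by
      intro x
      rw [flip_innerₗ]
      have : 𝓕 ψ = φ := FourierTransform.fourier_fourierInv_eq φ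
      conv_rhs => rw [← this]
      rfl
    simp only [e1, e2, smul_eq_mul, zero_mul, integral_zero] at h
    exact h.symm
  have h3 := ae_eq_zero_of_integral_contDiff_smul_eq_zero (μ := volume) hg.locallyIntegrable
    (fun φ hφ hc => by
      have := h2 (SchwartzMap.postcompCLM (𝕜 := ℝ) Complex.ofRealCLM (hc.toSchwartzMap hφ))
      rw [← this]
      congr 1
      ext x
      rw [SchwartzMap.postcompCLM_apply, Complex.real_smul, mul_comm]
      rfl)
  refine Lp.ext ?_
  filter_upwards [h3, Lp.coeFn_zero ℂ 2 (volume : Measure (EuclideanSpace ℝ κ))] with x hx h0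
  rw [h0]
  refine (mul_eq_zero.1 hx).resolve_left ?_
  rw [hermite_apply]
  refine Finset.prod_ne_zero_iff.2 fun i _ => ?_
  rw [Pi.zero_apply, hermiteFun_zero]
  exact_mod_cast (Real.exp_pos _).ne'

/-- The normalized Hermite functions. -/
def hermiteUnit (y : κ → ℝ) (n : κ → ℕ) : 𝓢(EuclideanSpace ℝ κ, ℂ) :=
  ((‖(hermite y n).toLp 2‖ : ℂ)⁻¹) • hermite y n

lemma toLp_smul (c : ℂ) (f : 𝓢(EuclideanSpace ℝ κ, ℂ)) :
    (c • f).toLp 2 volume = c • f.toLp 2 volume := by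
  simp only [← SchwartzMap.toLpCLM_apply (𝕜 := ℂ), map_smul]

lemma norm_hermiteUnit (y : κ → ℝ) (n : κ → ℕ) : ‖(hermiteUnit y n).toLp 2‖ = 1 := by
  rw [hermiteUnit, toLp_smul, norm_smul, norm_inv, Complex.norm_real, norm_norm,
    inv_mul_cancel₀ (norm_hermite_pos y n).ne']

lemma orthonormal_hermiteUnit (y : κ → ℝ) :
    Orthonormal ℂ fun n => (hermiteUnit y n).toLp 2 volume := by
  refine ⟨norm_hermiteUnit y, fun n m h => ?_⟩
  beta_reduce
  rw [← spair_eq_inner, hermiteUnit, hermiteUnit, spair_smul_left, spair_smul_right,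
    hermite_orthogonal y h, mul_zero, mul_zero]

/-- The Hilbert basis of Hermite functions. -/
def hermiteBasis (y : κ → ℝ) : HilbertBasis (κ → ℕ) ℂ (L2 (EuclideanSpace ℝ κ)) :=
  HilbertBasis.mkOfOrthogonalEqBot (orthonormal_hermiteUnit y) (by
    rw [Submodule.eq_bot_iff]
    intro f hf
    refine eq_zero_of_forall_inner_hermite (WithLp.toLp 2 y) f fun n => ?_
    have h := (Submodule.mem_orthogonal _ f).1 hf _ (Submodule.subset_span ⟨n, rfl⟩)
    beta_reduce at h
    rw [hermiteUnit, toLp_smul, inner_smul_left, mul_eq_zero] at h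
    refine h.resolve_left ?_
    rw [map_inv₀, Complex.conj_ofReal, inv_eq_zero, Complex.ofReal_eq_zero]
    exact (norm_hermite_pos y n).ne')

lemma hermiteBasis_apply (y : κ → ℝ) (n : κ → ℕ) :
    hermiteBasis y n = (hermiteUnit y n).toLp 2 := by
  rw [hermiteBasis, HilbertBasis.coe_mkOfOrthogonalEqBot]

lemma spair_prod_harmonic (y : κ → ℝ) (n : κ → ℕ) (l : List κ) (g : 𝓢(EuclideanSpace ℝ κ, ℂ)) :
    spair (hermite y n) ((l.map fun i => harmonic y i ^ 3).prod g)
      = (((l.map fun i => (2 * n i + 2 : ℝ) ^ 3).prod : ℝ) : ℂ) * spair (hermite y n) g := by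
  have h1 : ∀ i g, spair (hermite y n) (harmonic y i g)
      = ((2 * n i + 2 : ℝ) : ℂ) * spair (hermite y n) g := by
    intro i g
    rw [spair_harmonic, harmonic_hermite, spair_smul_left, Complex.conj_ofReal]
  induction l with
  | nil => simp
  | cons i l ih =>
    rw [List.map_cons, List.prod_cons, List.map_cons, List.prod_cons]
    have : (harmonic y i ^ 3 * (l.map fun i => harmonic y i ^ 3).prod) g
      = harmonic y i (harmonic y i (harmonic y i ((l.map fun i => harmonic y i ^ 3).prod g))) := rfl
    rw [this, h1, h1, h1, ih]
    push_cast
    ring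

/-- Parseval in the Hermite basis, where the symmetric operators of the weight are diagonal. -/
lemma hasSum_weightForm (y : κ → ℝ) (g : 𝓢(EuclideanSpace ℝ κ, ℂ)) :
    HasSum (fun n : κ → ℕ => (∏ i, (2 * n i + 2 : ℝ) ^ 3) *
      ‖inner ℂ (hermiteBasis y n) (g.toLp 2)‖ ^ 2) (weightForm y g) := by
  let T := (Finset.univ.toList.map fun i => harmonic y i ^ 3).prod
  have h := (hermiteBasis y).hasSum_inner_mul_inner (g.toLp 2) ((T g).toLp 2)
  have h' := Complex.reCLM.hasSum h
  have e : weightForm y g = Complex.reCLM (inner ℂ (g.toLp 2) ((T g).toLp 2)) := by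
    rw [← spair_eq_inner]; rfl
  rw [e]
  refine h'.congr_fun fun n => ?_
  rw [hermiteBasis_apply, ← spair_eq_inner, ← spair_eq_inner, ← spair_eq_inner]
  have e2 : spair (hermiteUnit y n) (T g) = ((∏ i, (2 * n i + 2 : ℝ) ^ 3 : ℝ) : ℂ) *
      spair (hermiteUnit y n) g := by
    rw [hermiteUnit, spair_smul_left, spair_prod_harmonic, spair_smul_left, mul_left_comm,
      Finset.prod_map_toList]
  rw [e2, ← spair_conj (hermiteUnit y n) g, mul_left_comm, ← Complex.normSq_eq_conj_mul_self,
    Complex.normSq_eq_norm_sq]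
  rw [Complex.reCLM_apply, ← Complex.ofReal_mul, Complex.ofReal_re]

end hermiteBasis

/-! ### Summability of Hermite coefficients -/

section expansion

variable {κ : Type} [Fintype κ]

/-- Telescoping with remainder `1/(K+1)`. This constant `2`, one for each coordinate, is the origin
of the factor `2^{dN}` in the norm of kernels. -/
lemma sum_inv_sq_le (K : ℕ) : ∑ k ∈ Finset.range K, ((k + 1 : ℝ) ^ 2)⁻¹ ≤ 2 := by
  have h : ∀ K : ℕ, ∑ k ∈ Finset.range (K + 1), ((k + 1 : ℝ) ^ 2)⁻¹ ≤ 2 - 1 / (K + 1) := by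
    intro K
    induction K with
    | zero => norm_num
    | succ K ih =>
      rw [Finset.sum_range_succ]
      have : (((K + 1 : ℕ) + 1 : ℝ) ^ 2)⁻¹ ≤ 1 / (K + 1) - 1 / ((K + 1 : ℕ) + 1) := by
        push_cast
        rw [div_sub_div _ _ (by positivity) (by positivity), inv_eq_one_div,
          div_le_div_iff₀ (by positivity) (by positivity)]
        nlinarith
      linarith
  cases K with
  | zero => simp
  | succ K =>
    have h1 := h K
    have : (0 : ℝ) ≤ 1 / (K + 1) := by positivity
    linarith

lemma sum_prod_inv_sq_le (s : Finset (κ → ℕ)) :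
    ∑ n ∈ s, ∏ i, ((n i + 1 : ℝ) ^ 2)⁻¹ ≤ 2 ^ Fintype.card κ := by
  classical
  -- A crude bound above all coordinates of the finitely many indices; the sum over the resulting
  -- box factorizes.
  let K : ℕ := ∑ n ∈ s, ∑ i, (n i + 1)
  have hs : s ⊆ Fintype.piFinset fun _ : κ => Finset.range K := by
    intro n hn
    rw [Fintype.mem_piFinset]
    intro i
    rw [Finset.mem_range]
    have h1 : n i + 1 ≤ ∑ i, (n i + 1) :=
      Finset.single_le_sum (f := fun i => n i + 1) (fun _ _ => Nat.zero_le _) (Finset.mem_univ i)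
    have h2 : ∑ i, (n i + 1) ≤ K :=
      Finset.single_le_sum (f := fun n : κ → ℕ => ∑ i, (n i + 1)) (fun _ _ => Nat.zero_le _) hn
    omega
  refine (Finset.sum_le_sum_of_subset_of_nonneg hs fun n _ _ =>
    Finset.prod_nonneg fun i _ => by positivity).trans ?_
  rw [← Finset.prod_univ_sum (fun _ : κ => Finset.range K) fun _ k => ((k + 1 : ℝ) ^ 2)⁻¹,
    ← Finset.card_univ, ← Finset.prod_const]
  exact Finset.prod_le_prod (fun i _ => Finset.sum_nonneg fun k _ => by positivity)
    fun i _ => sum_inv_sq_le K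

/-- A truncation of the weighted norm. -/
def truncNorm (y : κ → ℝ) (s : Finset (κ → ℕ)) (f : L2 (EuclideanSpace ℝ κ)) : ℝ :=
  √(∑ n ∈ s, (∏ i, (n i + 1 : ℝ) ^ 3) * ‖inner ℂ (hermiteBasis y n) f‖ ^ 2)

/-- The eigenvalues `(2n_i+2)³` exceed `(n_i+1)³` by a factor `2³` per coordinate, exactly what the
normalization `2^{-3M/2}` removes. -/
lemma truncNorm_le (y : κ → ℝ) (s : Finset (κ → ℕ)) (g : 𝓢(EuclideanSpace ℝ κ, ℂ)) :
    truncNorm y s (g.toLp 2) ≤ (2 : ℝ) ^ (-(3 * (Fintype.card κ : ℝ) / 2)) * √(weightForm y g) := by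
  have h := sum_le_hasSum s (fun n _ => mul_nonneg
    (Finset.prod_nonneg fun i _ => by positivity) (sq_nonneg _)) (hasSum_weightForm y g)
  have e : ∀ n : κ → ℕ, ∏ i, (2 * n i + 2 : ℝ) ^ 3
      = 2 ^ (3 * Fintype.card κ) * ∏ i, (n i + 1 : ℝ) ^ 3 := by
    intro n
    rw [pow_mul, ← Finset.card_univ, ← Finset.prod_const, ← Finset.prod_mul_distrib]
    refine Finset.prod_congr rfl fun i _ => ?_
    rw [← mul_pow, mul_add, mul_one]
  simp only [e, mul_assoc] at h
  rw [← Finset.mul_sum] at h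
  have hp : (0 : ℝ) < 2 ^ (3 * Fintype.card κ) := by positivity
  have e2 : (2 : ℝ) ^ (-(3 * (Fintype.card κ : ℝ) / 2)) = √((2 ^ (3 * Fintype.card κ))⁻¹) := by
    rw [Real.sqrt_eq_rpow, ← Real.rpow_natCast, ← Real.rpow_neg (by norm_num),
      ← Real.rpow_mul (by norm_num)]
    congr 1
    push_cast
    ring
  rw [e2, ← Real.sqrt_mul (by positivity), truncNorm]
  refine Real.sqrt_le_sqrt ?_
  rw [le_inv_mul_iff₀ hp]
  exact h

lemma continuous_truncNorm (y : κ → ℝ) (s : Finset (κ → ℕ)) : Continuous (truncNorm y s) := by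
  unfold truncNorm
  fun_prop

/-- A finite truncation is continuous on `L²`, so the inequality for Schwartz functions survives the
liminf that closes the form. Density of Schwartz functions makes the filter nontrivial. -/
lemma truncNorm_le_weightedNorm (y : κ → ℝ) (s : Finset (κ → ℕ)) (f : L2 (EuclideanSpace ℝ κ)) :
    ENNReal.ofReal (truncNorm y s f) ≤ weightedNorm y f := by
  have hd : DenseRange fun g : 𝓢(EuclideanSpace ℝ κ, ℂ) => g.toLp 2 volume :=
    SchwartzMap.denseRange_toLpCLM (F := ℂ) (E := EuclideanSpace ℝ κ) (p := 2) (μ := volume)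
      ENNReal.ofNat_ne_top
  have hne : (comap (fun g : 𝓢(EuclideanSpace ℝ κ, ℂ) => g.toLp 2 volume) (𝓝 f)).NeBot :=
    comap_neBot_iff.2 fun t ht => by
      obtain ⟨g, hg⟩ := hd.exists_mem_open (isOpen_interior) ⟨f, mem_interior_iff_mem_nhds.2 ht⟩
      exact ⟨g, interior_subset hg⟩
  have ht : Tendsto (fun g : 𝓢(EuclideanSpace ℝ κ, ℂ) =>
      ENNReal.ofReal (truncNorm y s (g.toLp 2)))
      (comap (fun g : 𝓢(EuclideanSpace ℝ κ, ℂ) => g.toLp 2 volume) (𝓝 f))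
      (𝓝 (ENNReal.ofReal (truncNorm y s f))) :=
    ((ENNReal.continuous_ofReal.comp (continuous_truncNorm y s)).tendsto f).comp tendsto_comap
  rw [← ht.liminf_eq]
  exact liminf_le_liminf (Eventually.of_forall fun g =>
    ENNReal.ofReal_le_ofReal (truncNorm_le y s g))

/-- The Hermite coefficients of a function are summable with weights, by Cauchy–Schwarz. -/
lemma tsum_coeff_le (y : κ → ℝ) (f : L2 (EuclideanSpace ℝ κ)) :
    ∑' n : κ → ℕ, ‖inner ℂ (hermiteBasis y n) f‖ₑ * ENNReal.ofReal √(∏ i, (n i + 1 : ℝ))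
      ≤ ENNReal.ofReal √(2 ^ Fintype.card κ) * weightedNorm y f := by
  rw [ENNReal.tsum_eq_iSup_sum]
  refine iSup_le fun s => ?_
  refine le_trans ?_ (mul_le_mul_right (truncNorm_le_weightedNorm y s f) _)
  rw [← ENNReal.ofReal_mul (Real.sqrt_nonneg _)]
  have e : ∀ n ∈ s, ‖inner ℂ (hermiteBasis y n) f‖ₑ * ENNReal.ofReal √(∏ i, (n i + 1 : ℝ))
      = ENNReal.ofReal (‖inner ℂ (hermiteBasis y n) f‖ * √(∏ i, (n i + 1 : ℝ))) := by
    intro n _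
    rw [ENNReal.ofReal_mul (norm_nonneg _), ofReal_norm]
  rw [Finset.sum_congr rfl e, ← ENNReal.ofReal_sum_of_nonneg fun n _ => by positivity]
  refine ENNReal.ofReal_le_ofReal ?_
  -- The split for Cauchy–Schwarz: `(n+1)^{1/2} = (n+1)^{-1} (n+1)^{3/2}`. The third power in the
  -- norm is what leaves a summable square.
  have e2 : ∀ n ∈ s, ‖inner ℂ (hermiteBasis y n) f‖ * √(∏ i, (n i + 1 : ℝ))
      = √(∏ i, ((n i + 1 : ℝ) ^ 2)⁻¹) *
        (√(∏ i, (n i + 1 : ℝ) ^ 3) * ‖inner ℂ (hermiteBasis y n) f‖) := by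
    intro n _
    have h1 : √(∏ i, ((n i + 1 : ℝ) ^ 2)⁻¹) * √(∏ i, (n i + 1 : ℝ) ^ 3)
        = √(∏ i, (n i + 1 : ℝ)) := by
      rw [← Real.sqrt_mul (Finset.prod_nonneg fun i _ => by positivity)
        (∏ i, (n i + 1 : ℝ) ^ 3), ← Finset.prod_mul_distrib]
      refine congrArg Real.sqrt (Finset.prod_congr rfl fun i _ => ?_)
      have : (n i + 1 : ℝ) ≠ 0 := by positivity
      field_simp
    rw [← mul_assoc, h1, mul_comm]
  rw [Finset.sum_congr rfl e2]
  refine le_of_sq_le_sq ?_ (by unfold truncNorm; positivity)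
  refine (Finset.sum_mul_sq_le_sq_mul_sq s _ _).trans ?_
  rw [mul_pow, Real.sq_sqrt (by positivity), truncNorm, Real.sq_sqrt (Finset.sum_nonneg fun n _ =>
    mul_nonneg (Finset.prod_nonneg fun i _ => by positivity) (sq_nonneg _))]
  have e3 : ∀ n : κ → ℕ, √(∏ i, ((n i + 1 : ℝ) ^ 2)⁻¹) ^ 2 = ∏ i, ((n i + 1 : ℝ) ^ 2)⁻¹ :=
    fun n => Real.sq_sqrt (Finset.prod_nonneg fun i _ => by positivity)
  have e4 : ∀ n : κ → ℕ, √(∏ i, (n i + 1 : ℝ) ^ 3) ^ 2 = ∏ i, (n i + 1 : ℝ) ^ 3 :=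
    fun n => Real.sq_sqrt (Finset.prod_nonneg fun i _ => by positivity)
  simp only [mul_pow, e3, e4]
  exact mul_le_mul_of_nonneg_right (sum_prod_inv_sq_le s) (Finset.sum_nonneg fun n _ =>
      mul_nonneg (Finset.prod_nonneg fun i _ => by positivity) (sq_nonneg _))

/-- A function with finite weighted norm (for some centre) is a well summable series of Hermite
functions. -/
lemma exists_center_tsum_coeff_le (f : L2 (EuclideanSpace ℝ κ)) :
    ∃ y : κ → ℝ, ∑' n : κ → ℕ,
      ‖inner ℂ (hermiteBasis y n) f‖ₑ * ENNReal.ofReal √(∏ i, (n i + 1 : ℝ))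
      ≤ ENNReal.ofReal √(2 ^ Fintype.card κ) * (2 * ⨅ y, weightedNorm y f) := by
  set C := ENNReal.ofReal √(2 ^ Fintype.card κ)
  set I := ⨅ y : κ → ℝ, weightedNorm y f with hI
  have hle : ∀ y, ‖f‖ₑ ≤ C * weightedNorm y f := by
    intro y
    refine le_trans ?_ (tsum_coeff_le y f)
    have h1 := congrArg enorm ((hermiteBasis y).hasSum_repr f).tsum_eq
    refine h1.symm.le.trans (enorm_tsum_le_tsum_enorm.trans (ENNReal.tsum_le_tsum fun n => ?_))
    rw [enorm_smul, hermiteBasis_apply, (hermiteBasis y).repr_apply_apply, hermiteBasis_apply,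
      ← ofReal_norm (SchwartzMap.toLp _ _ _), norm_hermiteUnit]
    gcongr
    refine Real.le_sqrt_of_sq_le ?_
    calc (1 : ℝ) ^ 2 = ∏ _i : κ, (1 : ℝ) := by simp
      _ ≤ ∏ i, (n i + 1 : ℝ) := Finset.prod_le_prod (fun _ _ => zero_le_one) fun i _ => by
        have : (0 : ℝ) ≤ n i := Nat.cast_nonneg _
        linarith
  -- The infimum need not be attained, so a factor `2` is given away. If it is `0`, then `f = 0` by
  -- `hle`; if it is `⊤`, any centre will do; otherwise `I < 2 I` provides a centre.
  by_cases h0 : I = 0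
  · have : ‖f‖ₑ = 0 := by
      rw [← nonpos_iff_eq_zero]
      calc ‖f‖ₑ ≤ ⨅ y, C * weightedNorm y f := le_iInf hle
        _ = C * I := (ENNReal.mul_iInf_of_ne (by
            rw [Ne, ENNReal.ofReal_eq_zero, not_le]; positivity) ENNReal.ofReal_ne_top).symm
        _ = 0 := by rw [h0, mul_zero]
    rw [enorm_eq_zero] at this
    refine ⟨0, ?_⟩
    simp [this]
  by_cases h1 : I = ⊤
  · refine ⟨0, (tsum_coeff_le 0 f).trans ?_⟩
    have : weightedNorm 0 f = ⊤ := by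
      rw [hI, iInf_eq_top] at h1; exact h1 0
    have hC : C ≠ 0 := by
      rw [Ne, ENNReal.ofReal_eq_zero, not_le]; positivity
    rw [this, h1, ENNReal.mul_top two_ne_zero]
  · have : I < 2 * I := by
      rw [two_mul]
      exact ENNReal.lt_add_right h1 h0
    obtain ⟨y, hy⟩ := iInf_lt_iff.1 this
    exact ⟨y, (tsum_coeff_le y f).trans (by gcongr)⟩

end expansion

/-! ### Tensor products and contractions of wave functions -/

section tensor

variable {κ κ₁ κ₂ κ₃ κ₁₂ κ₂₃ : Type} [Fintype κ] [Fintype κ₁] [Fintype κ₂] [Fintype κ₃]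
  [Fintype κ₁₂] [Fintype κ₂₃]

/-- Concatenation of coordinates. -/
def glue (e : κ₁ ⊕ κ₂ ≃ κ) :
    (EuclideanSpace ℝ κ₁ × EuclideanSpace ℝ κ₂) ≃ᵐ EuclideanSpace ℝ κ :=
  (MeasurableEquiv.prodCongr (MeasurableEquiv.toLp 2 (κ₁ → ℝ)).symm
    (MeasurableEquiv.toLp 2 (κ₂ → ℝ)).symm).trans
  ((MeasurableEquiv.sumPiEquivProdPi fun _ : κ₁ ⊕ κ₂ => ℝ).symm.trans
  ((MeasurableEquiv.piCongrLeft (fun _ => ℝ) e).trans (MeasurableEquiv.toLp 2 (κ → ℝ))))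

lemma glue_inl (e : κ₁ ⊕ κ₂ ≃ κ) (p : EuclideanSpace ℝ κ₁ × EuclideanSpace ℝ κ₂) (i : κ₁) :
    glue e p (e (Sum.inl i)) = p.1 i :=
  MeasurableEquiv.piCongrLeft_apply_apply (β := fun _ => ℝ) e _ (Sum.inl i)

lemma glue_inr (e : κ₁ ⊕ κ₂ ≃ κ) (p : EuclideanSpace ℝ κ₁ × EuclideanSpace ℝ κ₂) (i : κ₂) :
    glue e p (e (Sum.inr i)) = p.2 i :=
  MeasurableEquiv.piCongrLeft_apply_apply (β := fun _ => ℝ) e _ (Sum.inr i)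

lemma eq_glue (e : κ₁ ⊕ κ₂ ≃ κ) (p : EuclideanSpace ℝ κ₁ × EuclideanSpace ℝ κ₂)
    (x : EuclideanSpace ℝ κ) (h1 : ∀ i, x (e (Sum.inl i)) = p.1 i)
    (h2 : ∀ i, x (e (Sum.inr i)) = p.2 i) : x = glue e p := by
  ext i
  obtain ⟨i, rfl⟩ := e.surjective i
  cases i with
  | inl i => rw [h1, glue_inl]
  | inr i => rw [h2, glue_inr]

lemma measurePreserving_glue (e : κ₁ ⊕ κ₂ ≃ κ) : MeasurePreserving (glue e) :=
  (PiLp.volume_preserving_toLp κ).comp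
    ((volume_measurePreserving_piCongrLeft (fun _ => ℝ) e).comp
      ((volume_measurePreserving_sumPiEquivProdPi_symm fun _ : κ₁ ⊕ κ₂ => ℝ).comp
        ((EuclideanSpace.volume_preserving_symm_measurableEquiv_toLp κ₁).prod
          (EuclideanSpace.volume_preserving_symm_measurableEquiv_toLp κ₂))))

lemma sum_glue (e : κ₁ ⊕ κ₂ ≃ κ) {M : Type} [AddCommMonoid M] (F : κ → M) :
    ∑ i, F i = ∑ i, F (e (Sum.inl i)) + ∑ i, F (e (Sum.inr i)) := by
  rw [← e.sum_comp, Fintype.sum_sum_type]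

lemma prod_glue (e : κ₁ ⊕ κ₂ ≃ κ) {M : Type} [CommMonoid M] (F : κ → M) :
    ∏ i, F i = (∏ i, F (e (Sum.inl i))) * ∏ i, F (e (Sum.inr i)) := by
  rw [← e.prod_comp, Fintype.prod_sum_type]

lemma inner_glue (e : κ₁ ⊕ κ₂ ≃ κ) (p q : EuclideanSpace ℝ κ₁ × EuclideanSpace ℝ κ₂) :
    inner ℝ (glue e p) (glue e q) = inner ℝ p.1 q.1 + inner ℝ p.2 q.2 := by
  simp only [PiLp.inner_apply, sum_glue e, glue_inl, glue_inr]

lemma norm_glue_sq (e : κ₁ ⊕ κ₂ ≃ κ) (p : EuclideanSpace ℝ κ₁ × EuclideanSpace ℝ κ₂) :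
    ‖glue e p‖ ^ 2 = ‖p.1‖ ^ 2 + ‖p.2‖ ^ 2 := by
  simp only [← real_inner_self_eq_norm_sq, inner_glue]

lemma ae_glue_iff (e : κ₁ ⊕ κ₂ ≃ κ) {P : EuclideanSpace ℝ κ → Prop} :
    (∀ᵐ x, P x) ↔ ∀ᵐ p : EuclideanSpace ℝ κ₁ × EuclideanSpace ℝ κ₂, P (glue e p) := by
  refine ⟨fun h => (measurePreserving_glue e).quasiMeasurePreserving.ae h, fun h => ?_⟩
  have := ((measurePreserving_glue e).symm (glue e)).quasiMeasurePreserving.ae h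
  simpa using this

lemma memLp_mul_prod {α β : Type} [MeasureSpace α] [MeasureSpace β]
    [SigmaFinite (volume : Measure α)] [SigmaFinite (volume : Measure β)] (f : L2 α) (g : L2 β) :
    MemLp (fun p : α × β => f p.1 * g p.2) 2 volume := by
  have hm : AEStronglyMeasurable (fun p : α × β => f p.1 * g p.2) volume :=
    (((Lp.stronglyMeasurable f).comp_measurable measurable_fst).mul
      ((Lp.stronglyMeasurable g).comp_measurable measurable_snd)).aestronglyMeasurable
  rw [memLp_two_iff_integrable_sq_norm hm]
  simp only [norm_mul, mul_pow]
  exact ((memLp_two_iff_integrable_sq_norm (Lp.aestronglyMeasurable f)).1 (Lp.memLp f)).mul_prod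
    ((memLp_two_iff_integrable_sq_norm (Lp.aestronglyMeasurable g)).1 (Lp.memLp g))

lemma memLp_tprod (e : κ₁ ⊕ κ₂ ≃ κ) (f : L2 (EuclideanSpace ℝ κ₁))
    (g : L2 (EuclideanSpace ℝ κ₂)) :
    MemLp ((fun p => f p.1 * g p.2) ∘ (glue e).symm) 2 volume :=
  (memLp_mul_prod f g).comp_measurePreserving ((measurePreserving_glue e).symm (glue e))

/-- The function `(x, y) ↦ f x * g y`. -/
def tprodFun (e : κ₁ ⊕ κ₂ ≃ κ) (f : L2 (EuclideanSpace ℝ κ₁))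
    (g : L2 (EuclideanSpace ℝ κ₂)) : L2 (EuclideanSpace ℝ κ) :=
  (memLp_tprod e f g).toLp

lemma tprodFun_coe (e : κ₁ ⊕ κ₂ ≃ κ) (f : L2 (EuclideanSpace ℝ κ₁))
    (g : L2 (EuclideanSpace ℝ κ₂)) :
    ∀ᵐ p : EuclideanSpace ℝ κ₁ × EuclideanSpace ℝ κ₂, tprodFun e f g (glue e p) = f p.1 * g p.2 := by
  have h := (measurePreserving_glue e).quasiMeasurePreserving.ae (memLp_tprod e f g).coeFn_toLp
  filter_upwards [h] with p hp
  rw [tprodFun, hp, Function.comp_apply, MeasurableEquiv.symm_apply_apply]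

lemma eq_tprodFun (e : κ₁ ⊕ κ₂ ≃ κ) {f : L2 (EuclideanSpace ℝ κ₁)}
    {g : L2 (EuclideanSpace ℝ κ₂)} {h : L2 (EuclideanSpace ℝ κ)}
    (hh : ∀ᵐ p : EuclideanSpace ℝ κ₁ × EuclideanSpace ℝ κ₂, h (glue e p) = f p.1 * g p.2) :
    h = tprodFun e f g := by
  apply Lp.ext
  rw [EventuallyEq, ae_glue_iff e]
  filter_upwards [hh, tprodFun_coe e f g] with p h1 h2
  rw [h1, h2]

lemma ae_fst {α β : Type} [MeasureSpace α] [MeasureSpace β] [SFinite (volume : Measure β)]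
    {P : α → Prop} (h : ∀ᵐ x, P x) : ∀ᵐ p : α × β, P p.1 :=
  Measure.quasiMeasurePreserving_fst.ae h

lemma ae_snd {α β : Type} [MeasureSpace α] [MeasureSpace β] [SFinite (volume : Measure β)]
    {P : β → Prop} (h : ∀ᵐ x, P x) : ∀ᵐ p : α × β, P p.2 :=
  Measure.quasiMeasurePreserving_snd.ae h

lemma inner_tprodFun (e : κ₁ ⊕ κ₂ ≃ κ) (f f' : L2 (EuclideanSpace ℝ κ₁))
    (g g' : L2 (EuclideanSpace ℝ κ₂)) :
    inner ℂ (tprodFun e f g) (tprodFun e f' g') = inner ℂ f f' * inner ℂ g g' := by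
  rw [L2.inner_def, ← (measurePreserving_glue e).integral_comp' (f := glue e), L2.inner_def,
    L2.inner_def, ← integral_prod_mul]
  refine integral_congr_ae ?_
  filter_upwards [tprodFun_coe e f g, tprodFun_coe e f' g'] with p h1 h2
  rw [h1, h2]
  simp only [RCLike.inner_apply, map_mul]
  ring

lemma norm_tprodFun (e : κ₁ ⊕ κ₂ ≃ κ) (f : L2 (EuclideanSpace ℝ κ₁))
    (g : L2 (EuclideanSpace ℝ κ₂)) : ‖tprodFun e f g‖ = ‖f‖ * ‖g‖ := by
  have h := inner_tprodFun e f f g g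
  simp only [inner_self_eq_norm_sq_to_K] at h
  have h2 : ‖tprodFun e f g‖ ^ 2 = (‖f‖ * ‖g‖) ^ 2 := by
    rw [mul_pow]
    exact_mod_cast h
  exact (pow_left_inj₀ (norm_nonneg _) (by positivity) two_ne_zero).1 h2

/-- The tensor product of two wave functions, as a bounded bilinear map. -/
def tprod (e : κ₁ ⊕ κ₂ ≃ κ) : L2 (EuclideanSpace ℝ κ₁) →L[ℂ]
    L2 (EuclideanSpace ℝ κ₂) →L[ℂ] L2 (EuclideanSpace ℝ κ) :=
  LinearMap.mkContinuous₂
    (LinearMap.mk₂ ℂ (tprodFun e)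
      (fun f f' g => (eq_tprodFun e (by
        filter_upwards [tprodFun_coe e f g, tprodFun_coe e f' g,
          (measurePreserving_glue e).quasiMeasurePreserving.ae
            (Lp.coeFn_add (tprodFun e f g) (tprodFun e f' g)),
          ae_fst (β := EuclideanSpace ℝ κ₂) (Lp.coeFn_add f f')] with p h1 h2 h3 h4
        rw [h3, h4, Pi.add_apply, Pi.add_apply, h1, h2, add_mul])).symm)
      (fun c f g => (eq_tprodFun e (by
        filter_upwards [tprodFun_coe e f g,
          (measurePreserving_glue e).quasiMeasurePreserving.ae
            (Lp.coeFn_smul c (tprodFun e f g)),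
          ae_fst (β := EuclideanSpace ℝ κ₂) (Lp.coeFn_smul c f)] with p h1 h3 h4
        rw [h3, h4, Pi.smul_apply, Pi.smul_apply, h1, smul_mul_assoc])).symm)
      (fun f g g' => (eq_tprodFun e (by
        filter_upwards [tprodFun_coe e f g, tprodFun_coe e f g',
          (measurePreserving_glue e).quasiMeasurePreserving.ae
            (Lp.coeFn_add (tprodFun e f g) (tprodFun e f g')),
          ae_snd (α := EuclideanSpace ℝ κ₁) (Lp.coeFn_add g g')] with p h1 h2 h3 h4
        rw [h3, h4, Pi.add_apply, Pi.add_apply, h1, h2, mul_add])).symm)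
      (fun c f g => (eq_tprodFun e (by
        filter_upwards [tprodFun_coe e f g,
          (measurePreserving_glue e).quasiMeasurePreserving.ae
            (Lp.coeFn_smul c (tprodFun e f g)),
          ae_snd (α := EuclideanSpace ℝ κ₁) (Lp.coeFn_smul c g)] with p h1 h3 h4
        rw [h3, h4, Pi.smul_apply, Pi.smul_apply, h1, mul_smul_comm])).symm))
    1 (fun f g => by
      rw [one_mul]
      exact (norm_tprodFun e f g).le)

lemma tprod_coe (e : κ₁ ⊕ κ₂ ≃ κ) (f : L2 (EuclideanSpace ℝ κ₁))
    (g : L2 (EuclideanSpace ℝ κ₂)) :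
    ∀ᵐ p : EuclideanSpace ℝ κ₁ × EuclideanSpace ℝ κ₂, tprod e f g (glue e p) = f p.1 * g p.2 :=
  tprodFun_coe e f g

lemma eq_tprod (e : κ₁ ⊕ κ₂ ≃ κ) {f : L2 (EuclideanSpace ℝ κ₁)}
    {g : L2 (EuclideanSpace ℝ κ₂)} {h : L2 (EuclideanSpace ℝ κ)}
    (hh : ∀ᵐ p : EuclideanSpace ℝ κ₁ × EuclideanSpace ℝ κ₂, h (glue e p) = f p.1 * g p.2) :
    h = tprod e f g :=
  eq_tprodFun e hh

lemma inner_tprod (e : κ₁ ⊕ κ₂ ≃ κ) (f f' : L2 (EuclideanSpace ℝ κ₁))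
    (g g' : L2 (EuclideanSpace ℝ κ₂)) :
    inner ℂ (tprod e f g) (tprod e f' g') = inner ℂ f f' * inner ℂ g g' :=
  inner_tprodFun e f f' g g'

lemma norm_tprod (e : κ₁ ⊕ κ₂ ≃ κ) (f : L2 (EuclideanSpace ℝ κ₁))
    (g : L2 (EuclideanSpace ℝ κ₂)) : ‖tprod e f g‖ = ‖f‖ * ‖g‖ :=
  norm_tprodFun e f g

lemma ae_triple_iff (e₁ : κ₁ ⊕ κ₂₃ ≃ κ) (e₂ : κ₂ ⊕ κ₃ ≃ κ₂₃) {P : EuclideanSpace ℝ κ → Prop} :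
    (∀ᵐ x, P x) ↔ ∀ᵐ q : EuclideanSpace ℝ κ₁ × (EuclideanSpace ℝ κ₂ × EuclideanSpace ℝ κ₃),
      P (glue e₁ (q.1, glue e₂ q.2)) := by
  let E : EuclideanSpace ℝ κ₁ × (EuclideanSpace ℝ κ₂ × EuclideanSpace ℝ κ₃) ≃ᵐ
      EuclideanSpace ℝ κ := (MeasurableEquiv.prodCongr (MeasurableEquiv.refl _) (glue e₂)).trans (glue e₁)
  have hE : MeasurePreserving E := (measurePreserving_glue e₁).comp
    ((MeasurePreserving.id volume).prod (measurePreserving_glue e₂))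
  refine ⟨fun h => hE.quasiMeasurePreserving.ae h, fun h => ?_⟩
  have := (hE.symm E).quasiMeasurePreserving.ae (p := fun q => P (E q)) h
  simpa using this

lemma tprod_tprod_coe (e₁ : κ₁ ⊕ κ₂₃ ≃ κ) (e₂ : κ₂ ⊕ κ₃ ≃ κ₂₃)
    (f₁ : L2 (EuclideanSpace ℝ κ₁)) (f₂ : L2 (EuclideanSpace ℝ κ₂))
    (f₃ : L2 (EuclideanSpace ℝ κ₃)) :
    ∀ᵐ q : EuclideanSpace ℝ κ₁ × (EuclideanSpace ℝ κ₂ × EuclideanSpace ℝ κ₃),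
      tprod e₁ f₁ (tprod e₂ f₂ f₃) (glue e₁ (q.1, glue e₂ q.2))
        = f₁ q.1 * (f₂ q.2.1 * f₃ q.2.2) := by
  have h1 := ((MeasurePreserving.id (volume : Measure (EuclideanSpace ℝ κ₁))).prod
    (measurePreserving_glue e₂)).quasiMeasurePreserving.ae (tprod_coe e₁ f₁ (tprod e₂ f₂ f₃))
  filter_upwards [h1, ae_snd (α := EuclideanSpace ℝ κ₁) (tprod_coe e₂ f₂ f₃)] with q h1 h2
  rw [← h2]
  exact h1

/-- Commutativity of the tensor product, up to a permutation `A` of the coordinates. -/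
lemma precomp_tprod_tprod (A : EuclideanSpace ℝ κ ≃ₗᵢ[ℝ] EuclideanSpace ℝ κ)
    {κ₁₃ : Type} [Fintype κ₁₃]
    (e₁ : κ₁ ⊕ κ₂₃ ≃ κ) (e₂ : κ₂ ⊕ κ₃ ≃ κ₂₃) (e₃ : κ₂ ⊕ κ₁₃ ≃ κ) (e₄ : κ₁ ⊕ κ₃ ≃ κ₁₃)
    (h : ∀ x y z, A (glue e₃ (y, glue e₄ (x, z))) = glue e₁ (x, glue e₂ (y, z)))
    (f₁ : L2 (EuclideanSpace ℝ κ₁)) (f₂ : L2 (EuclideanSpace ℝ κ₂))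
    (f₃ : L2 (EuclideanSpace ℝ κ₃)) :
    precomp A (tprod e₁ f₁ (tprod e₂ f₂ f₃)) = tprod e₃ f₂ (tprod e₄ f₁ f₃) := by
  apply Lp.ext
  rw [EventuallyEq, ae_triple_iff e₃ e₄]
  have hs : MeasurePreserving (fun q : EuclideanSpace ℝ κ₂ × (EuclideanSpace ℝ κ₁ ×
      EuclideanSpace ℝ κ₃) => (q.2.1, (q.1, q.2.2))) :=
    (measurePreserving_prodAssoc _ _ _).comp
      ((Measure.measurePreserving_swap.prod (MeasurePreserving.id _)).comp
        (measurePreserving_prodAssoc _ _ _).symm)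
  filter_upwards [(ae_triple_iff e₃ e₄).1 (precomp_coe A (tprod e₁ f₁ (tprod e₂ f₂ f₃))),
    hs.quasiMeasurePreserving.ae (tprod_tprod_coe e₁ e₂ f₁ f₂ f₃),
    tprod_tprod_coe e₃ e₄ f₂ f₁ f₃] with q h1 h2 h3
  rw [h1, h, h2, h3]
  ring

lemma tprod_assoc (e₁ : κ₁ ⊕ κ₂₃ ≃ κ) (e₂ : κ₂ ⊕ κ₃ ≃ κ₂₃) (e₃ : κ₁₂ ⊕ κ₃ ≃ κ)
    (e₄ : κ₁ ⊕ κ₂ ≃ κ₁₂)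
    (h : ∀ x y z, glue e₃ (glue e₄ (x, y), z) = glue e₁ (x, glue e₂ (y, z)))
    (f₁ : L2 (EuclideanSpace ℝ κ₁)) (f₂ : L2 (EuclideanSpace ℝ κ₂))
    (f₃ : L2 (EuclideanSpace ℝ κ₃)) :
    tprod e₁ f₁ (tprod e₂ f₂ f₃) = tprod e₃ (tprod e₄ f₁ f₂) f₃ := by
  apply Lp.ext
  rw [EventuallyEq, ae_triple_iff e₁ e₂]
  have hs : MeasurePreserving (fun q : EuclideanSpace ℝ κ₁ × (EuclideanSpace ℝ κ₂ ×
      EuclideanSpace ℝ κ₃) => ((q.1, q.2.1), q.2.2)) :=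
    (measurePreserving_prodAssoc _ _ _).symm
  have h3 := (((measurePreserving_glue e₄).prod (MeasurePreserving.id _)).comp
    hs).quasiMeasurePreserving.ae (tprod_coe e₃ (tprod e₄ f₁ f₂) f₃)
  filter_upwards [tprod_tprod_coe e₁ e₂ f₁ f₂ f₃, h3,
    hs.quasiMeasurePreserving.ae (ae_fst (tprod_coe e₄ f₁ f₂))] with q h1 h2 h4
  rw [h1, ← h, ← mul_assoc, ← h4]
  exact h2.symm

lemma precomp_tprod (A : EuclideanSpace ℝ κ ≃ₗᵢ[ℝ] EuclideanSpace ℝ κ)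
    (A₁ : EuclideanSpace ℝ κ₁ ≃ₗᵢ[ℝ] EuclideanSpace ℝ κ₁)
    (A₂ : EuclideanSpace ℝ κ₂ ≃ₗᵢ[ℝ] EuclideanSpace ℝ κ₂) (e : κ₁ ⊕ κ₂ ≃ κ)
    (h : ∀ x y, A (glue e (x, y)) = glue e (A₁ x, A₂ y)) (f : L2 (EuclideanSpace ℝ κ₁))
    (g : L2 (EuclideanSpace ℝ κ₂)) :
    precomp A (tprod e f g) = tprod e (precomp A₁ f) (precomp A₂ g) := by
  refine eq_tprod e ?_
  filter_upwards [(ae_glue_iff e).1 (precomp_coe A (tprod e f g)),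
    (A₁.measurePreserving.prod A₂.measurePreserving).quasiMeasurePreserving.ae (tprod_coe e f g),
    ae_fst (precomp_coe A₁ f), ae_snd (precomp_coe A₂ g)] with p h1 h2 h3 h4
  rw [h1, h3, h4]
  refine Eq.trans ?_ h2
  exact congrArg _ (h p.1 p.2)

lemma shift_tprod (e : κ₁ ⊕ κ₂ ≃ κ) (a : EuclideanSpace ℝ κ₁) (b : EuclideanSpace ℝ κ₂)
    (c : EuclideanSpace ℝ κ) (hc : c = glue e (a, b)) (f : L2 (EuclideanSpace ℝ κ₁))
    (g : L2 (EuclideanSpace ℝ κ₂)) :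
    shift c (tprod e f g) = tprod e (shift a f) (shift b g) := by
  refine eq_tprod e ?_
  filter_upwards [(ae_glue_iff e).1 (shift_coe c (tprod e f g)),
    ((measurePreserving_sub_right volume a).prod
      (measurePreserving_sub_right volume b)).quasiMeasurePreserving.ae (tprod_coe e f g),
    ae_fst (shift_coe a f), ae_snd (shift_coe b g)] with p h1 h2 h3 h4
  rw [h1, h3, h4]
  refine Eq.trans (congrArg _ ?_) h2
  refine eq_glue e _ _ (fun i => ?_) fun i => ?_
  · rw [PiLp.sub_apply, hc, glue_inl, glue_inl]; rfl
  · rw [PiLp.sub_apply, hc, glue_inr, glue_inr]; rfl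

/-- Contraction with `f` in the first variables. -/
def contract (e : κ₁ ⊕ κ₂ ≃ κ) (f : L2 (EuclideanSpace ℝ κ₁)) :
    L2 (EuclideanSpace ℝ κ) →L[ℂ] L2 (EuclideanSpace ℝ κ₂) :=
  ContinuousLinearMap.adjoint (tprod e f)

lemma integrable_contract (e : κ₁ ⊕ κ₂ ≃ κ) (f : L2 (EuclideanSpace ℝ κ₁))
    (g : L2 (EuclideanSpace ℝ κ₂)) (h : L2 (EuclideanSpace ℝ κ)) :
    Integrable (fun p : EuclideanSpace ℝ κ₁ × EuclideanSpace ℝ κ₂ =>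
      conj (f p.1 * g p.2) * h (glue e p)) := by
  have h1 : MemLp (fun p : EuclideanSpace ℝ κ₁ × EuclideanSpace ℝ κ₂ => h (glue e p)) 2 volume :=
    (Lp.memLp h).comp_measurePreserving (measurePreserving_glue e)
  exact (memLp_mul_prod f g).star.integrable_mul h1

/-- Contraction is defined as the adjoint of tensoring with `f`. Pairing with `f` times the
indicator of a set of finite measure identifies it with the partial integral almost everywhere. -/
lemma contract_coe (e : κ₁ ⊕ κ₂ ≃ κ) (f : L2 (EuclideanSpace ℝ κ₁))
    (h : L2 (EuclideanSpace ℝ κ)) :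
    ∀ᵐ y : EuclideanSpace ℝ κ₂,
      contract e f h y = ∫ x : EuclideanSpace ℝ κ₁, conj (f x) * h (glue e (x, y)) := by
  have key : ∀ s : Set (EuclideanSpace ℝ κ₂), MeasurableSet s → ∀ hs : volume s ≠ ⊤,
      IntegrableOn (fun y => ∫ x : EuclideanSpace ℝ κ₁, conj (f x) * h (glue e (x, y))) s ∧
      ∫ y in s, contract e f h y
        = ∫ y in s, ∫ x : EuclideanSpace ℝ κ₁, conj (f x) * h (glue e (x, y)) := by
    intro s hs hv
    have hi := (integrable_contract e f (indicatorConstLp 2 hs hv 1) h)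
    have e1 : ∀ᵐ y : EuclideanSpace ℝ κ₂, (∫ x : EuclideanSpace ℝ κ₁,
        conj (f x * (indicatorConstLp 2 hs hv (1 : ℂ) : L2 _) y) * h (glue e (x, y)))
        = s.indicator (fun y => ∫ x : EuclideanSpace ℝ κ₁, conj (f x) * h (glue e (x, y))) y := by
      filter_upwards [indicatorConstLp_coeFn (p := 2) (hs := hs) (hμs := hv) (c := (1 : ℂ))]
        with y hy
      rw [hy]
      by_cases hys : y ∈ s <;> simp [hys]
    constructor
    · rw [← integrable_indicator_iff hs]
      exact hi.integral_prod_right.congr e1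
    · rw [← L2.inner_indicatorConstLp_one hs hv, contract,
        ContinuousLinearMap.adjoint_inner_right, L2.inner_def,
        ← (measurePreserving_glue e).integral_comp' (f := glue e), ← integral_indicator hs,
        ← integral_congr_ae e1, ← integral_prod_symm _ hi]
      refine integral_congr_ae ?_
      filter_upwards [tprod_coe e f (indicatorConstLp 2 hs hv 1)] with p hp
      rw [hp, RCLike.inner_apply, mul_comm]
  exact ae_eq_of_forall_setIntegral_eq_of_sigmaFinite
    (fun s hs hv => integrableOn_Lp_of_measure_ne_top _ one_le_two hv.ne)
    (fun s hs hv => (key s hs hv.ne).1) (fun s hs hv => (key s hs hv.ne).2)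

/-- Products of Hermite functions are Hermite functions. -/
lemma hermite_glue (e : κ₁ ⊕ κ₂ ≃ κ) (y : κ → ℝ) (n : κ → ℕ)
    (p : EuclideanSpace ℝ κ₁ × EuclideanSpace ℝ κ₂) :
    hermite y n (glue e p) = hermite (fun i => y (e (Sum.inl i))) (fun i => n (e (Sum.inl i))) p.1
      * hermite (fun i => y (e (Sum.inr i))) (fun i => n (e (Sum.inr i))) p.2 := by
  simp only [hermite_apply, prod_glue e, glue_inl, glue_inr]

lemma hermite_toLp_eq_tprod (e : κ₁ ⊕ κ₂ ≃ κ) (y : κ → ℝ) (n : κ → ℕ) :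
    (hermite y n).toLp 2
      = tprod e ((hermite (fun i => y (e (Sum.inl i))) (fun i => n (e (Sum.inl i)))).toLp 2)
        ((hermite (fun i => y (e (Sum.inr i))) (fun i => n (e (Sum.inr i)))).toLp 2) := by
  refine eq_tprod e ?_
  filter_upwards [(ae_glue_iff e).1 ((hermite y n).coeFn_toLp 2 volume),
    ae_fst (SchwartzMap.coeFn_toLp
      (hermite (fun i => y (e (Sum.inl i))) (fun i => n (e (Sum.inl i)))) 2 volume),
    ae_snd (SchwartzMap.coeFn_toLp
      (hermite (fun i => y (e (Sum.inr i))) (fun i => n (e (Sum.inr i)))) 2 volume)]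
    with p h1 h2 h3
  rw [h1, h2, h3, hermite_glue]

lemma hermiteUnit_toLp_eq_tprod (e : κ₁ ⊕ κ₂ ≃ κ) (y : κ → ℝ) (n : κ → ℕ) :
    (hermiteUnit y n).toLp 2
      = tprod e ((hermiteUnit (fun i => y (e (Sum.inl i))) (fun i => n (e (Sum.inl i)))).toLp 2)
        ((hermiteUnit (fun i => y (e (Sum.inr i))) (fun i => n (e (Sum.inr i)))).toLp 2) := by
  rw [hermiteUnit, hermiteUnit, hermiteUnit, toLp_smul, toLp_smul, toLp_smul,
    hermite_toLp_eq_tprod e, norm_tprod]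
  simp only [map_smul, smul_apply, smul_smul]
  push_cast
  rw [mul_inv, mul_comm]

/-- The Hermite functions as elements of `L²`. -/
def hermiteL2 (n : κ → ℕ) : L2 (EuclideanSpace ℝ κ) := (hermite 0 n).toLp 2

lemma ext_hermiteL2 {F : Type} [NormedAddCommGroup F] [NormedSpace ℂ F]
    {S T : L2 (EuclideanSpace ℝ κ) →L[ℂ] F} (h : ∀ n, S (hermiteL2 n) = T (hermiteL2 n)) :
    S = T := by
  refine ContinuousLinearMap.ext_on (s := Set.range (hermiteBasis (κ := κ) 0))
    (Submodule.dense_iff_topologicalClosure_eq_top.2 (hermiteBasis (κ := κ) 0).dense_span) ?_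
  rintro _ ⟨n, rfl⟩
  rw [hermiteBasis_apply, hermiteUnit, toLp_smul, map_smul, map_smul]
  exact congrArg _ (h n)

lemma hermiteL2_eq_tprod (e : κ₁ ⊕ κ₂ ≃ κ) (n : κ → ℕ) :
    hermiteL2 n = tprod e (hermiteL2 fun i => n (e (Sum.inl i))) (hermiteL2 fun i => n (e (Sum.inr i))) :=
  hermite_toLp_eq_tprod e 0 n

/-- The free evolution acts on tensor factors separately. -/
lemma fourier_tprod (e : κ₁ ⊕ κ₂ ≃ κ) (f : L2 (EuclideanSpace ℝ κ₁))
    (g : L2 (EuclideanSpace ℝ κ₂)) : 𝓕 (tprod e f g) = tprod e (𝓕 f) (𝓕 g) := by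
  let F := (Lp.fourierTransformₗᵢ (EuclideanSpace ℝ κ) ℂ).toContinuousLinearEquiv.toContinuousLinearMap
  let F₁ := (Lp.fourierTransformₗᵢ (EuclideanSpace ℝ κ₁) ℂ).toContinuousLinearEquiv.toContinuousLinearMap
  let F₂ := (Lp.fourierTransformₗᵢ (EuclideanSpace ℝ κ₂) ℂ).toContinuousLinearEquiv.toContinuousLinearMap
  -- For Hermite functions both transforms are honest integrals and Fubini factorizes them; totality
  -- then extends the identity to one factor at a time.
  have base : ∀ (m : κ₁ → ℕ) (n : κ₂ → ℕ), 𝓕 (tprod e (hermiteL2 m) (hermiteL2 n))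
      = tprod e (𝓕 (hermiteL2 m)) (𝓕 (hermiteL2 n)) := by
    intro m n
    let k : κ → ℕ := Sum.elim m n ∘ e.symm
    have hm : (fun i => k (e (Sum.inl i))) = m := by simp [k]
    have hn : (fun i => k (e (Sum.inr i))) = n := by simp [k]
    have h1 : tprod e (hermiteL2 m) (hermiteL2 n) = hermiteL2 k := by
      rw [hermiteL2_eq_tprod e, hm, hn]
    rw [h1, hermiteL2, hermiteL2, hermiteL2, SchwartzMap.toLp_fourier_eq,
      SchwartzMap.toLp_fourier_eq, SchwartzMap.toLp_fourier_eq]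
    refine eq_tprod e ?_
    filter_upwards [(ae_glue_iff e).1 (SchwartzMap.coeFn_toLp (𝓕 (hermite 0 k)) 2 volume),
      ae_fst (SchwartzMap.coeFn_toLp (𝓕 (hermite 0 m)) 2 volume),
      ae_snd (SchwartzMap.coeFn_toLp (𝓕 (hermite 0 n)) 2 volume)] with p h1 h2 h3
    rw [h1, h2, h3]
    simp only [SchwartzMap.fourier_coe, Real.fourier_eq]
    rw [← (measurePreserving_glue e).integral_comp' (f := glue e), ← integral_prod_mul]
    refine integral_congr_ae (Eventually.of_forall fun q => ?_)
    have hk := hermite_glue e 0 k q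
    rw [hm, hn] at hk
    simp only [inner_glue, Circle.smul_def, smul_eq_mul, neg_add, AddChar.map_add_eq_mul,
      Circle.coe_mul]
    rw [hk]
    simp only [Pi.zero_apply]
    change _ * (hermite 0 m q.1 * hermite 0 n q.2) = _
    ring
  have h1 : ∀ m : κ₁ → ℕ, F.comp (tprod e (hermiteL2 m))
      = (tprod e (𝓕 (hermiteL2 m))).comp F₂ := fun m => ext_hermiteL2 (base m)
  have h2 : F.comp ((tprod e).flip g) = ((tprod e).flip (𝓕 g)).comp F₁ :=
    ext_hermiteL2 fun m => DFunLike.congr_fun (h1 m) g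
  exact DFunLike.congr_fun h2 f

lemma freePhase_glue (e : κ₁ ⊕ κ₂ ≃ κ) (t : ℝ) (p : EuclideanSpace ℝ κ₁ × EuclideanSpace ℝ κ₂) :
    freePhase t (glue e p) = freePhase t p.1 * freePhase t p.2 := by
  simp only [freePhase, ← Complex.exp_add, ← add_mul, ← Complex.ofReal_add]
  congr 3
  rw [mul_pow, norm_glue_sq, mul_pow, mul_pow]
  ring

/-- The symbol factorizes because the squared norm of the momentum is additive over the two groups
of coordinates. -/
lemma expLaplacian_tprod (e : κ₁ ⊕ κ₂ ≃ κ) (t : ℝ) (f : L2 (EuclideanSpace ℝ κ₁))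
    (g : L2 (EuclideanSpace ℝ κ₂)) :
    expLaplacian t (tprod e f g) = tprod e (expLaplacian t f) (expLaplacian t g) := by
  have hm : ∀ (f : L2 (EuclideanSpace ℝ κ₁)) (g : L2 (EuclideanSpace ℝ κ₂)),
      mulPhase (freePhase t) (continuous_freePhase t) (norm_freePhase t) (tprod e f g)
      = tprod e (mulPhase (freePhase t) (continuous_freePhase t) (norm_freePhase t) f)
        (mulPhase (freePhase t) (continuous_freePhase t) (norm_freePhase t) g) := by
    intro f g
    refine eq_tprod e ?_
    filter_upwards [(ae_glue_iff e).1 (mulPhase_coe (freePhase t) (continuous_freePhase t)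
      (norm_freePhase t) (tprod e f g)), tprod_coe e f g,
      ae_fst (mulPhase_coe (freePhase t) (continuous_freePhase t) (norm_freePhase t) f),
      ae_snd (mulPhase_coe (freePhase t) (continuous_freePhase t) (norm_freePhase t) g)]
      with p h1 h2 h3 h4
    rw [h1, h2, h3, h4, freePhase_glue]
    ring
  apply (Lp.fourierTransformₗᵢ (EuclideanSpace ℝ κ) ℂ).injective
  have h0 : ∀ {κ' : Type} [Fintype κ'] (h : L2 (EuclideanSpace ℝ κ')), 𝓕 (expLaplacian t h)
      = mulPhase (freePhase t) (continuous_freePhase t) (norm_freePhase t) (𝓕 h) :=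
    fun h => (Lp.fourierTransformₗᵢ _ ℂ).apply_symm_apply _
  change 𝓕 (expLaplacian t (tprod e f g)) = 𝓕 (tprod e (expLaplacian t f) (expLaplacian t g))
  rw [fourier_tprod, h0, h0, h0, fourier_tprod, hm]

end tensor

/-! ### Antisymmetry, creation and contraction on fixed particle number -/

section sectors

variable {d k : ℕ}

/-- One-particle wave functions. -/
abbrev OneParticle (d k : ℕ) : Type := PiLp 2 (fun _ : Label k => L2 (Space d))

/-- The coordinates of `cons x X`. -/
def consIdx (d n : ℕ) : Fin d ⊕ (Fin n × Fin d) ≃ Fin (n + 1) × Fin d where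
  toFun := Sum.elim (fun j => (0, j)) (fun p => (p.1.succ, p.2))
  invFun p := Fin.cases (Sum.inl p.2) (fun i => Sum.inr (i, p.2)) p.1
  left_inv := by rintro (j | ⟨i, j⟩) <;> rfl
  right_inv := by
    rintro ⟨i, j⟩
    cases i using Fin.cases <;> rfl

lemma cons_eq_glue {n : ℕ} (x : Space d) (X : Conf d n) : cons x X = glue (consIdx d n) (x, X) :=
  eq_glue _ _ _ (fun _ => rfl) (fun _ => rfl)

lemma sum_cons {n : ℕ} {M : Type} [AddCommMonoid M] (F : (Fin (n + 1) → Label k) → M) :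
    ∑ s, F s = ∑ l : Label k, ∑ s : Fin n → Label k, F (Fin.cons l s) := by
  rw [← (Fin.consEquiv fun _ => Label k).sum_comp, Fintype.sum_prod_type]
  rfl

/-- `v ↦ f ⊗ v`. -/
def raiseFun {n : ℕ} (f : OneParticle d k) (v : Sector d k n) : Sector d k (n + 1) :=
  WithLp.toLp 2 fun s => tprod (consIdx d n) (f (s 0)) (v (Fin.tail s))

lemma inner_raiseFun {n : ℕ} (f g : OneParticle d k) (v w : Sector d k n) :
    inner ℂ (raiseFun f v) (raiseFun g w) = inner ℂ f g * inner ℂ v w := by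
  simp only [PiLp.inner_apply, sum_cons, raiseFun, inner_tprod, Finset.sum_mul_sum, Fin.cons_zero,
    Fin.tail_cons]

lemma norm_raiseFun {n : ℕ} (f : OneParticle d k) (v : Sector d k n) :
    ‖raiseFun f v‖ = ‖f‖ * ‖v‖ := by
  have h := inner_raiseFun f f v v
  simp only [inner_self_eq_norm_sq_to_K] at h
  have h2 : ‖raiseFun f v‖ ^ 2 = (‖f‖ * ‖v‖) ^ 2 := by
    rw [mul_pow]
    exact_mod_cast h
  exact (pow_left_inj₀ (norm_nonneg _) (by positivity) two_ne_zero).1 h2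

/-- Tensoring with a one-particle function, as a bounded bilinear map. -/
def raise (n : ℕ) : OneParticle d k →L[ℂ] Sector d k n →L[ℂ] Sector d k (n + 1) :=
  LinearMap.mkContinuous₂
    (LinearMap.mk₂ ℂ raiseFun
      (fun f f' g => by ext1 s; simp [raiseFun])
      (fun c f g => by ext1 s; simp [raiseFun])
      (fun f g g' => by ext1 s; simp [raiseFun])
      (fun c f g => by ext1 s; simp [raiseFun]))
    1 (fun f g => by
      rw [one_mul]
      exact (norm_raiseFun f g).le)

lemma raise_apply {n : ℕ} (f : OneParticle d k) (v : Sector d k n) (s : Fin (n + 1) → Label k) :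
    raise n f v s = tprod (consIdx d n) (f (s 0)) (v (Fin.tail s)) := rfl

lemma inner_raise {n : ℕ} (f g : OneParticle d k) (v w : Sector d k n) :
    inner ℂ (raise n f v) (raise n g w) = inner ℂ f g * inner ℂ v w :=
  inner_raiseFun f g v w

/-- Contraction with a one-particle function. -/
def lower (n : ℕ) (f : OneParticle d k) : Sector d k (n + 1) →L[ℂ] Sector d k n :=
  ContinuousLinearMap.adjoint (raise n f)

lemma lower_apply {n : ℕ} (f : OneParticle d k) (v : Sector d k (n + 1)) (s : Fin n → Label k) :
    lower n f v s = ∑ l : Label k, contract (consIdx d n) (f l) (v (Fin.cons l s)) := by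
  let u : Sector d k n := WithLp.toLp 2 fun s =>
    ∑ l : Label k, contract (consIdx d n) (f l) (v (Fin.cons l s))
  have : lower n f v = u := by
    refine ext_inner_left ℂ fun w => ?_
    rw [lower, ContinuousLinearMap.adjoint_inner_right]
    simp only [PiLp.inner_apply, sum_cons, u, raise_apply, inner_sum, contract,
      ContinuousLinearMap.adjoint_inner_right, Fin.cons_zero, Fin.tail_cons]
    rw [Finset.sum_comm]
  rw [this]

lemma lower_raise {n : ℕ} (f g : OneParticle d k) (v : Sector d k n) :
    lower n f (raise n g v) = (inner ℂ f g : ℂ) • v := by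
  refine ext_inner_left ℂ fun w => ?_
  rw [lower, ContinuousLinearMap.adjoint_inner_right, inner_raise, inner_smul_right]

/-- The vectors `f ⊗ v` are total. -/
lemma ext_raise {n : ℕ} {F : Type} [NormedAddCommGroup F] [NormedSpace ℂ F]
    {S T : Sector d k (n + 1) →L[ℂ] F} (h : ∀ f v, S (raise n f v) = T (raise n f v)) : S = T := by
  classical
  have h1 : ∀ s : Fin (n + 1) → Label k, ∀ u : L2 (Conf d (n + 1)),
      S (WithLp.toLp 2 (Pi.single s u)) = T (WithLp.toLp 2 (Pi.single s u)) := by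
    intro s
    let ι : L2 (Conf d (n + 1)) →L[ℂ] Sector d k (n + 1) :=
      (PiLp.continuousLinearEquiv 2 ℂ _).symm.toContinuousLinearMap.comp
        (ContinuousLinearMap.single ℂ (fun _ : Fin (n + 1) → Label k => L2 (Conf d (n + 1))) s)
    have : S.comp ι = T.comp ι := by
      refine ext_hermiteL2 fun m => ?_
      -- A Hermite function placed in one spin component is an elementary tensor, in the positions
      -- as well as in the labels.
      have : ι (hermiteL2 m) = raise n
          (WithLp.toLp 2 (Pi.single (s 0) (hermiteL2 fun j => m (0, j))))
          (WithLp.toLp 2 (Pi.single (Fin.tail s) (hermiteL2 fun p => m (p.1.succ, p.2)))) := by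
        ext1 s'
        rw [raise_apply]
        change (Pi.single s (hermiteL2 m) : (Fin (n + 1) → Label k) → L2 (Conf d (n + 1))) s'
          = tprod (consIdx d n) ((Pi.single (s 0) _ : Label k → L2 (Space d)) (s' 0))
            ((Pi.single (Fin.tail s) _ : (Fin n → Label k) → L2 (Conf d n)) (Fin.tail s'))
        by_cases h0 : s' 0 = s 0
        · by_cases h1 : Fin.tail s' = Fin.tail s
          · have : s' = s := by rw [← Fin.cons_self_tail s', h0, h1, Fin.cons_self_tail]
            subst this
            rw [Pi.single_eq_same, Pi.single_eq_same, Pi.single_eq_same,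
              hermiteL2_eq_tprod (consIdx d n)]
            rfl
          · have : s' ≠ s := fun h => h1 (by rw [h])
            rw [Pi.single_eq_of_ne this, Pi.single_eq_of_ne h1, map_zero]
        · have : s' ≠ s := fun h => h0 (by rw [h])
          rw [Pi.single_eq_of_ne this, Pi.single_eq_of_ne h0, map_zero, zero_apply]
      change S (ι _) = T (ι _)
      rw [this, h]
    exact fun u => DFunLike.congr_fun this u
  ext1 v
  have hv : v = ∑ s, WithLp.toLp 2 (Pi.single s (v s)) := by
    ext1 s'
    simp
  rw [hv, map_sum, map_sum]
  exact Finset.sum_congr rfl fun s _ => h1 s _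

/-- The action of permutations on wave functions. -/
def permFun {n : ℕ} (π : Equiv.Perm (Fin n)) (v : Sector d k n) : Sector d k n :=
  WithLp.toLp 2 fun s => precomp (permute d π) (v (s ∘ π))

lemma norm_permFun {n : ℕ} (π : Equiv.Perm (Fin n)) (v : Sector d k n) : ‖permFun π v‖ = ‖v‖ := by
  rw [PiLp.norm_eq_of_L2, PiLp.norm_eq_of_L2]
  congr 1
  simp only [permFun, LinearIsometry.norm_map]
  exact (Equiv.arrowCongr π⁻¹ (Equiv.refl (Label k))).sum_comp fun s => ‖v s‖ ^ 2

/-- The action of permutations on wave functions, as isometries. -/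
def perm {n : ℕ} (π : Equiv.Perm (Fin n)) : Sector d k n →ₗᵢ[ℂ] Sector d k n where
  toFun := permFun π
  map_add' v w := by ext1 s; simp [permFun]
  map_smul' c w := by ext1 s; simp [permFun]
  norm_map' := norm_permFun π

lemma perm_apply {n : ℕ} (π : Equiv.Perm (Fin n)) (v : Sector d k n) (s : Fin n → Label k) :
    perm π v s = precomp (permute d π) (v (s ∘ π)) := rfl

lemma precomp_precomp {V : Type} [NormedAddCommGroup V] [InnerProductSpace ℝ V]
    [FiniteDimensional ℝ V] [MeasurableSpace V] [BorelSpace V] (A B C : V ≃ₗᵢ[ℝ] V)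
    (h : ∀ x, B (A x) = C x) (f : L2 V) : precomp A (precomp B f) = precomp C f := by
  apply Lp.ext
  filter_upwards [precomp_coe A (precomp B f), precomp_coe C f,
    A.measurePreserving.quasiMeasurePreserving.ae (precomp_coe B f)] with x h1 h2 h3
  rw [h1, h2, h3, h]

lemma perm_mul {n : ℕ} (π ρ : Equiv.Perm (Fin n)) (v : Sector d k n) :
    perm (π * ρ) v = perm π (perm ρ v) := by
  ext1 s
  rw [perm_apply, perm_apply, perm_apply, Function.comp_assoc, ← Equiv.Perm.coe_mul,
    precomp_precomp (permute d π) (permute d ρ) (permute d (π * ρ)) fun x => by ext p; rfl]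

lemma perm_one {n : ℕ} (v : Sector d k n) : perm 1 v = v := by
  have h := perm_mul (1 : Equiv.Perm (Fin n)) 1 v
  rw [mul_one] at h
  exact ((perm 1).injective h).symm

lemma inner_perm_left {n : ℕ} (π : Equiv.Perm (Fin n)) (v w : Sector d k n) :
    inner ℂ (perm π v) w = inner ℂ v (perm π⁻¹ w) := by
  rw [← (perm π).inner_map_map v, ← perm_mul, mul_inv_cancel, perm_one]

lemma inner_perm_right {n : ℕ} (π : Equiv.Perm (Fin n)) (v w : Sector d k n) :
    inner ℂ v (perm π w) = inner ℂ (perm π⁻¹ v) w := by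
  rw [inner_perm_left, inv_inv]

/-- The permutation that fixes `0` and acts as `π` on the successors. -/
def liftPerm {n : ℕ} (π : Equiv.Perm (Fin n)) : Equiv.Perm (Fin (n + 1)) :=
  Equiv.Perm.decomposeFin.symm (0, π)

lemma liftPerm_zero {n : ℕ} (π : Equiv.Perm (Fin n)) : liftPerm π 0 = 0 := by
  simp [liftPerm]

lemma liftPerm_succ {n : ℕ} (π : Equiv.Perm (Fin n)) (i : Fin n) :
    liftPerm π i.succ = (π i).succ := by
  simp [liftPerm]

lemma sign_liftPerm {n : ℕ} (π : Equiv.Perm (Fin n)) :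
    Equiv.Perm.sign (liftPerm π) = Equiv.Perm.sign π := by
  simp [liftPerm]

lemma liftPerm_inv {n : ℕ} (π : Equiv.Perm (Fin n)) : liftPerm π⁻¹ = (liftPerm π)⁻¹ := by
  rw [eq_inv_iff_mul_eq_one]
  ext1 i
  cases i using Fin.cases <;> simp [liftPerm_zero, liftPerm_succ]

lemma perm_liftPerm_raise {n : ℕ} (π : Equiv.Perm (Fin n)) (f : OneParticle d k)
    (v : Sector d k n) : perm (liftPerm π) (raise n f v) = raise n f (perm π v) := by
  ext1 s
  rw [perm_apply, raise_apply, raise_apply, perm_apply,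
    precomp_tprod (permute d (liftPerm π)) (LinearIsometryEquiv.refl ℝ _) (permute d π)]
  · congr 2
    · rw [Function.comp_apply, liftPerm_zero]
      apply Lp.ext
      filter_upwards [precomp_coe (LinearIsometryEquiv.refl ℝ (Space d)) (f (s 0))] with x hx
      exact hx
  · intro x y
    refine eq_glue _ _ _ (fun j => ?_) fun p => ?_
    · change permute d (liftPerm π) _ (0, j) = _
      rw [permute_apply, liftPerm_zero]
      exact glue_inl (consIdx d n) _ j
    · change permute d (liftPerm π) _ (p.1.succ, p.2) = _
      rw [permute_apply, liftPerm_succ]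
      exact glue_inr (consIdx d n) _ (π p.1, p.2)

/-- The only exchange of tensor factors computed by hand; the exchange relations for contractions
are deduced from it through adjoints. -/
lemma perm_swap_raise_raise {n : ℕ} (f g : OneParticle d k) (v : Sector d k n) :
    perm (Equiv.swap 0 1) (raise (n + 1) f (raise n g v)) = raise (n + 1) g (raise n f v) := by
  ext1 s
  simp only [perm_apply, raise_apply]
  rw [precomp_tprod_tprod (permute d (Equiv.swap 0 1)) (consIdx d (n + 1)) (consIdx d n)
    (consIdx d (n + 1)) (consIdx d n)]
  · have h0 : (s ∘ (Equiv.swap 0 1 : Equiv.Perm (Fin (n + 2)))) 0 = Fin.tail s 0 := by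
      simp [Fin.tail]
    have h1 : Fin.tail (s ∘ (Equiv.swap 0 1 : Equiv.Perm (Fin (n + 2)))) 0 = s 0 := by
      simp [Fin.tail]
    have h2 : Fin.tail (Fin.tail (s ∘ (Equiv.swap 0 1 : Equiv.Perm (Fin (n + 2)))))
        = Fin.tail (Fin.tail s) := by
      ext1 i
      simp only [Fin.tail, Function.comp_apply]
      rw [Equiv.swap_apply_of_ne_of_ne (Fin.succ_ne_zero _)]
      rw [Ne, ← Fin.succ_zero_eq_one, Fin.succ_inj]
      exact Fin.succ_ne_zero _
    rw [h0, h1, h2]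
  · intro x y z
    refine eq_glue _ _ _ (fun j => ?_) fun p => ?_
    · change permute d (Equiv.swap 0 1) _ (0, j) = _
      rw [permute_apply, Equiv.swap_apply_left]
      exact (glue_inr (consIdx d (n + 1)) _ ((0 : Fin (n + 1)), j)).trans
        (glue_inl (consIdx d n) _ j)
    · change permute d (Equiv.swap 0 1) _ (p.1.succ, p.2) = _
      obtain ⟨i, j⟩ := p
      rw [permute_apply]
      cases i using Fin.cases with
      | zero =>
        rw [Fin.succ_zero_eq_one, Equiv.swap_apply_right]
        exact (glue_inl (consIdx d (n + 1)) _ j).trans (glue_inl (consIdx d n) (y, z) j).symm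
      | succ i =>
        rw [Equiv.swap_apply_of_ne_of_ne (Fin.succ_ne_zero _) (by
          rw [Ne, ← Fin.succ_zero_eq_one, Fin.succ_inj]; exact Fin.succ_ne_zero _)]
        exact ((glue_inr (consIdx d (n + 1)) _ (i.succ, j)).trans
          (glue_inr (consIdx d n) _ (i, j))).trans (glue_inr (consIdx d n) (y, z) (i, j)).symm

lemma lower_perm_liftPerm {n : ℕ} (π : Equiv.Perm (Fin n)) (f : OneParticle d k)
    (v : Sector d k (n + 1)) : lower n f (perm (liftPerm π) v) = perm π (lower n f v) := by
  refine ext_inner_left ℂ fun w => ?_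
  rw [lower, ContinuousLinearMap.adjoint_inner_right, inner_perm_right, inner_perm_right,
    ContinuousLinearMap.adjoint_inner_right, ← liftPerm_inv, perm_liftPerm_raise]

lemma lower_lower_perm_swap {n : ℕ} (f g : OneParticle d k) (v : Sector d k (n + 2)) :
    lower n f (lower (n + 1) g (perm (Equiv.swap 0 1) v)) = lower n g (lower (n + 1) f v) := by
  refine ext_inner_left ℂ fun w => ?_
  rw [lower, lower, lower, lower]
  simp only [ContinuousLinearMap.adjoint_inner_right, inner_perm_right, Equiv.swap_inv,
    perm_swap_raise_raise]

/-- The swap hides `g` behind the first factor of `v`, so the contraction acts on `v` alone. It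
suffices to test this on elementary tensors `h ⊗ w`. -/
lemma lower_perm_swap_raise {n : ℕ} (f g : OneParticle d k) (v : Sector d k (n + 1)) :
    lower (n + 1) f (perm (Equiv.swap 0 1) (raise (n + 1) g v)) = raise n g (lower n f v) := by
  have : ((lower (n + 1) f).comp (perm (Equiv.swap 0 1)).toContinuousLinearMap).comp
      (raise (n + 1) g) = (raise n g).comp (lower n f) := by
    refine ext_raise fun h w => ?_
    change lower (n + 1) f (perm (Equiv.swap 0 1) (raise (n + 1) g (raise n h w)))
      = raise n g (lower n f (raise n h w))
    rw [perm_swap_raise_raise, lower_raise, lower_raise, map_smul]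
  exact DFunLike.congr_fun this v

/-- The sign of a permutation, as a complex number. -/
def sgn {n : ℕ} (π : Equiv.Perm (Fin n)) : ℂ := ((Equiv.Perm.sign π : ℤ) : ℂ)

lemma sgn_mul {n : ℕ} (π ρ : Equiv.Perm (Fin n)) : sgn (π * ρ) = sgn π * sgn ρ := by
  simp [sgn]

lemma sgn_mul_self {n : ℕ} (π : Equiv.Perm (Fin n)) : sgn π * sgn π = 1 := by
  rw [sgn, ← Int.cast_mul, ← Units.val_mul, Int.units_mul_self, Units.val_one, Int.cast_one]

lemma sgn_inv {n : ℕ} (π : Equiv.Perm (Fin n)) : sgn π⁻¹ = sgn π := by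
  simp [sgn]

lemma conj_sgn {n : ℕ} (π : Equiv.Perm (Fin n)) : conj (sgn π) = sgn π := by
  rw [sgn, map_intCast]

lemma sgn_liftPerm {n : ℕ} (π : Equiv.Perm (Fin n)) : sgn (liftPerm π) = sgn π := by
  rw [sgn, sgn, sign_liftPerm]

lemma sgn_swap_succ {n : ℕ} (i : Fin n) : sgn (Equiv.swap 0 i.succ) = -1 := by
  rw [sgn, Equiv.Perm.sign_swap (Fin.succ_ne_zero i).symm]
  simp

/-- Total antisymmetry. -/
def IsAntisymm {n : ℕ} (v : Sector d k n) : Prop :=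
  ∀ π : Equiv.Perm (Fin n), perm π v = sgn π • v

/-- The antisymmetrized tensor product of `f` and `v`. -/
def wedge (n : ℕ) (f : OneParticle d k) (v : Sector d k n) : Sector d k (n + 1) :=
  ∑ j : Fin (n + 1), sgn (Equiv.swap 0 j) • perm (Equiv.swap 0 j) (raise n f v)

lemma IsAntisymm.lower {n : ℕ} {v : Sector d k (n + 1)} (hv : IsAntisymm v)
    (f : OneParticle d k) : IsAntisymm (lower n f v) := by
  intro π
  rw [← lower_perm_liftPerm, hv, map_smul, sgn_liftPerm]

lemma exists_liftPerm {n : ℕ} (π : Equiv.Perm (Fin (n + 1))) :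
    ∃ ρ : Equiv.Perm (Fin n), π = Equiv.swap 0 (π 0) * liftPerm ρ := by
  obtain ⟨⟨q, ρ⟩, rfl⟩ := Equiv.Perm.decomposeFin.symm.surjective π
  refine ⟨ρ, ?_⟩
  ext1 i
  cases i using Fin.cases <;> simp [liftPerm_zero, liftPerm_succ]

/-- The transpositions `(0 j)` represent the cosets of the permutations that fix `0`. Left
multiplication by `π` permutes these cosets by `j ↦ π j`, and the leftover permutation acts on the
antisymmetric `v` by its sign. -/
lemma IsAntisymm.wedge {n : ℕ} {v : Sector d k n} (hv : IsAntisymm v)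
    (f : OneParticle d k) : IsAntisymm (wedge n f v) := by
  intro π
  rw [FermiJunction.wedge, map_sum, Finset.smul_sum]
  refine Fintype.sum_equiv π _ _ fun j => ?_
  obtain ⟨ρ, hρ⟩ := exists_liftPerm (π * Equiv.swap 0 j)
  rw [Equiv.Perm.mul_apply, Equiv.swap_apply_left] at hρ
  have hs : sgn π * sgn (Equiv.swap 0 j) = sgn (Equiv.swap 0 (π j)) * sgn ρ := by
    rw [← sgn_mul, hρ, sgn_mul, sgn_liftPerm]
  rw [map_smul, ← perm_mul, hρ, perm_mul, perm_liftPerm_raise, hv, map_smul, map_smul, smul_smul,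
    smul_smul]
  congr 1
  linear_combination (-sgn (Equiv.swap 0 j) * sgn (Equiv.swap 0 (π j))) * hs
    + (sgn π * sgn (Equiv.swap 0 (π j))) * sgn_mul_self (Equiv.swap 0 j)
    - (sgn (Equiv.swap 0 j) * sgn ρ) * sgn_mul_self (Equiv.swap 0 (π j))

/-- Against an antisymmetric vector all `n + 1` terms of the antisymmetrization give the same value.
-/
lemma inner_wedge {n : ℕ} (f : OneParticle d k) (v : Sector d k n) {w : Sector d k (n + 1)}
    (hw : IsAntisymm w) : inner ℂ (wedge n f v) w = (n + 1 : ℂ) * inner ℂ v (lower n f w) := by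
  rw [FermiJunction.lower, ContinuousLinearMap.adjoint_inner_right, wedge, sum_inner]
  have : ∀ j : Fin (n + 1), inner ℂ (sgn (Equiv.swap 0 j) • perm (Equiv.swap 0 j) (raise n f v)) w
      = inner ℂ (raise n f v) w := by
    intro j
    rw [inner_smul_left, inner_perm_left, hw, inner_smul_right, conj_sgn, sgn_inv, ← mul_assoc,
      sgn_mul_self, one_mul]
  rw [Finset.sum_congr rfl fun j _ => this j]
  simp

/-- Conjugation reduces every transposition to `(0 1)`, the one for which contraction has been
computed; the conjugating permutations fix `0` and pass through. -/
lemma swap_zero_succ {n : ℕ} (i : Fin (n + 1)) : (Equiv.swap 0 i.succ : Equiv.Perm (Fin (n + 2)))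
    = liftPerm (Equiv.swap 0 i) * Equiv.swap 0 1 * liftPerm (Equiv.swap 0 i) := by
  have h : (liftPerm (Equiv.swap 0 i))⁻¹ = liftPerm (Equiv.swap 0 i) := by
    rw [← liftPerm_inv, Equiv.swap_inv]
  nth_rewrite 2 [← h]
  rw [← Equiv.swap_apply_apply, liftPerm_zero, ← Fin.succ_zero_eq_one, liftPerm_succ,
    Equiv.swap_apply_left]

lemma lower_wedge_zero (f g : OneParticle d k) (v : Sector d k 0) :
    lower 0 f (wedge 0 g v) = (inner ℂ f g : ℂ) • v := by
  rw [wedge, Fin.sum_univ_one, Equiv.swap_self, ← Equiv.Perm.one_def, perm_one, map_smul,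
    lower_raise]
  simp [sgn]

/-- The anticommutation relation up to normalization. The term `j = 0` contracts `f` with `g`; in
all others `f` is contracted into `v`, and the sign of the transposition gives the minus. -/
lemma lower_wedge_succ {n : ℕ} (f g : OneParticle d k) {v : Sector d k (n + 1)}
    (hv : IsAntisymm v) :
    lower (n + 1) f (wedge (n + 1) g v) = (inner ℂ f g : ℂ) • v - wedge n g (lower n f v) := by
  rw [wedge, Fin.sum_univ_succ, Equiv.swap_self, ← Equiv.Perm.one_def, perm_one, map_add, map_smul,
    lower_raise, map_sum, sub_eq_add_neg, wedge, ← Finset.sum_neg_distrib]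
  congr 1
  · simp [sgn]
  · refine Finset.sum_congr rfl fun i _ => ?_
    rw [sgn_swap_succ, map_smul, swap_zero_succ, perm_mul, perm_mul, perm_liftPerm_raise, hv,
      lower_perm_liftPerm, map_smul, map_smul, map_smul, map_smul, lower_perm_swap_raise,
      neg_one_smul]

end sectors

/-! ### Annihilation operators on Fock space and the anticommutation relations -/

section fock

variable {d k : ℕ}

/-- The `n`-particle component of a Fock vector. -/
def comp (ψ : Fock d k) (n : ℕ) : Sector d k n := ψ.1 n

lemma comp_apply (ψ : Fock d k) (n : ℕ) (s : Fin n → Label k) : comp ψ n s = amplitude ψ n s := rfl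

lemma fock_ext {φ ψ : Fock d k} (h : ∀ n, comp φ n = comp ψ n) : φ = ψ := by
  apply Subtype.ext
  ext n : 2
  exact h n

lemma comp_add (φ ψ : Fock d k) (n : ℕ) : comp (φ + ψ) n = comp φ n + comp ψ n := rfl

lemma comp_sub (φ ψ : Fock d k) (n : ℕ) : comp (φ - ψ) n = comp φ n - comp ψ n := rfl

lemma comp_smul (c : ℂ) (ψ : Fock d k) (n : ℕ) : comp (c • ψ) n = c • comp ψ n := rfl

lemma comp_zero (n : ℕ) : comp (0 : Fock d k) n = 0 := rfl

lemma isAntisymm_comp (ψ : Fock d k) (n : ℕ) : IsAntisymm (comp ψ n) := by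
  intro π
  ext1 s
  exact ψ.2 n π s

lemma mem_fock {ψ : FullFock d k} (h : ∀ n, IsAntisymm (ψ n)) : ψ ∈ fock d k := by
  intro n π s
  exact congrArg (fun v : Sector d k n => v s) (h n π)

lemma hasSum_inner_comp (φ ψ : Fock d k) :
    HasSum (fun n => inner ℂ (comp φ n) (comp ψ n)) (inner ℂ φ ψ) :=
  lp.hasSum_inner φ.1 ψ.1

lemma hasSum_norm_comp_sq (ψ : Fock d k) : HasSum (fun n => ‖comp ψ n‖ ^ 2) (‖ψ‖ ^ 2) := by
  have h := hasSum_inner_comp ψ ψ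
  simp only [inner_self_eq_norm_sq_to_K] at h
  exact_mod_cast h

/-- A Fock vector with only an `n`-particle component. -/
def ofSector (n : ℕ) {v : Sector d k n} (hv : IsAntisymm v) : Fock d k :=
  ⟨lp.single 2 n v, mem_fock fun m => by
    by_cases h : m = n
    · subst h
      rw [lp.single_apply_self]
      exact hv
    · rw [lp.single_apply_ne _ _ _ h]
      intro π
      rw [map_zero, smul_zero]⟩

lemma inner_ofSector {n : ℕ} {v : Sector d k n} (hv : IsAntisymm v) (ψ : Fock d k) :
    inner ℂ (ofSector n hv) ψ = inner ℂ v (comp ψ n) :=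
  lp.inner_single_left n v ψ.1

lemma comp_ofSector_self {n : ℕ} {v : Sector d k n} (hv : IsAntisymm v) :
    comp (ofSector n hv) n = v :=
  lp.single_apply_self _ _ _

lemma comp_ofSector_ne {n m : ℕ} {v : Sector d k n} (hv : IsAntisymm v) (h : m ≠ n) :
    comp (ofSector n hv) m = 0 :=
  lp.single_apply_ne _ _ _ h

/-- The anticommutation relation gives `‖f ∧ v‖² = (n+2) (‖f‖² ‖v‖² - (n+1) ‖f ⌟ v‖²)`, and the left
side is nonnegative. This makes the fermionic annihilation operators bounded by `‖f‖`. -/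
lemma norm_lower_sq_le {n : ℕ} (f : OneParticle d k) {v : Sector d k (n + 1)}
    (hv : IsAntisymm v) : (n + 1) * ‖lower n f v‖ ^ 2 ≤ ‖f‖ ^ 2 * ‖v‖ ^ 2 := by
  have h1 := inner_wedge f (lower n f v) hv
  have h2 := inner_wedge f v (hv.wedge f)
  have h3 := congrArg (fun u => inner ℂ v u) (lower_wedge_succ f f hv)
  simp only [inner_sub_right, inner_smul_right] at h3
  have h4 := congrArg conj h1
  rw [inner_conj_symm] at h4
  simp only [inner_self_eq_norm_sq_to_K, map_mul, map_add, map_natCast, map_one, map_pow] at h2 h3 h4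
  rw [h4] at h3
  rw [h3] at h2
  have h5 : ‖wedge (n + 1) f v‖ ^ 2
      = ((n + 1 : ℕ) + 1) * (‖f‖ ^ 2 * ‖v‖ ^ 2 - (n + 1) * ‖lower n f v‖ ^ 2) := by
    apply Complex.ofReal_injective
    push_cast
    push_cast at h2
    simpa using h2
  have h6 : 0 ≤ ((n + 1 : ℕ) + 1) * (‖f‖ ^ 2 * ‖v‖ ^ 2 - (n + 1) * ‖lower n f v‖ ^ 2) :=
    h5 ▸ sq_nonneg _
  have h7 := nonneg_of_mul_nonneg_right h6 (by positivity)
  linarith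

/-- The components of `a(f)ψ`. -/
def annComp (f : OneParticle d k) (ψ : Fock d k) (n : ℕ) : Sector d k n :=
  (√(n + 1) : ℂ) • lower n f (comp ψ (n + 1))

lemma isAntisymm_annComp (f : OneParticle d k) (ψ : Fock d k) (n : ℕ) :
    IsAntisymm (annComp f ψ n) := by
  intro π
  rw [annComp, map_smul, (isAntisymm_comp ψ (n + 1)).lower f π, smul_comm]

lemma norm_annComp_sq_le (f : OneParticle d k) (ψ : Fock d k) (n : ℕ) :
    ‖annComp f ψ n‖ ^ 2 ≤ ‖f‖ ^ 2 * ‖comp ψ (n + 1)‖ ^ 2 := by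
  refine le_trans (le_of_eq ?_) (norm_lower_sq_le f (isAntisymm_comp ψ (n + 1)))
  rw [annComp, norm_smul, mul_pow, Complex.norm_real, Real.norm_eq_abs, sq_abs,
    Real.sq_sqrt (by positivity)]

lemma sum_norm_annComp_sq_le (f : OneParticle d k) (ψ : Fock d k) (s : Finset ℕ) :
    ∑ n ∈ s, ‖annComp f ψ n‖ ^ 2 ≤ (‖f‖ * ‖ψ‖) ^ 2 := by
  calc ∑ n ∈ s, ‖annComp f ψ n‖ ^ 2 ≤ ∑ n ∈ s, ‖f‖ ^ 2 * ‖comp ψ (n + 1)‖ ^ 2 :=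
        Finset.sum_le_sum fun n _ => norm_annComp_sq_le f ψ n
    _ = ‖f‖ ^ 2 * ∑ n ∈ s.map (addRightEmbedding 1), ‖comp ψ n‖ ^ 2 := by
        rw [← Finset.mul_sum, Finset.sum_map]
        rfl
    _ ≤ ‖f‖ ^ 2 * ‖ψ‖ ^ 2 := by
        gcongr
        exact sum_le_hasSum _ (fun n _ => sq_nonneg _) (hasSum_norm_comp_sq ψ)
    _ = (‖f‖ * ‖ψ‖) ^ 2 := (mul_pow _ _ _).symm

lemma memℓp_annComp (f : OneParticle d k) (ψ : Fock d k) : Memℓp (annComp f ψ) 2 :=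
  memℓp_gen' (C := (‖f‖ * ‖ψ‖) ^ 2) fun s => by
    simpa only [ENNReal.toReal_ofNat, Real.rpow_ofNat] using sum_norm_annComp_sq_le f ψ s

/-- The vector `a(f)ψ`. -/
def annFun (f : OneParticle d k) (ψ : Fock d k) : Fock d k :=
  ⟨⟨annComp f ψ, memℓp_annComp f ψ⟩, mem_fock (isAntisymm_annComp f ψ)⟩

lemma comp_annFun (f : OneParticle d k) (ψ : Fock d k) (n : ℕ) :
    comp (annFun f ψ) n = (√(n + 1) : ℂ) • lower n f (comp ψ (n + 1)) := rfl

/-- The annihilation operator `a(f)`. -/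
def ann (f : OneParticle d k) : Op d k :=
  LinearMap.mkContinuous
    { toFun := annFun f
      map_add' := fun φ ψ => fock_ext fun n => by
        simp only [comp_add, comp_annFun, map_add, smul_add]
      map_smul' := fun c ψ => fock_ext fun n => by
        simp only [comp_smul, comp_annFun, map_smul, RingHom.id_apply, smul_comm c] }
    ‖f‖ fun ψ => by
      refine le_of_sq_le_sq ?_ (by positivity)
      exact hasSum_le_of_sum_le (hasSum_norm_comp_sq (annFun f ψ)) (sum_norm_annComp_sq_le f ψ)

lemma comp_ann (f : OneParticle d k) (ψ : Fock d k) (n : ℕ) :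
    comp (ann f ψ) n = (√(n + 1) : ℂ) • lower n f (comp ψ (n + 1)) := rfl

lemma norm_ann_le (f : OneParticle d k) : ‖ann f‖ ≤ ‖f‖ :=
  LinearMap.mkContinuous_norm_le _ (norm_nonneg f) _

lemma ann_sub (f g : OneParticle d k) : ann (f - g) = ann f - ann g := by
  ext1 ψ
  refine fock_ext fun n => ?_
  rw [sub_apply, comp_sub, comp_ann, comp_ann, comp_ann, lower, lower, lower, map_sub, map_sub,
    sub_apply, smul_sub]

lemma ann_smul (c : ℂ) (f : OneParticle d k) : ann (c • f) = conj c • ann f := by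
  ext1 ψ
  refine fock_ext fun n => ?_
  rw [smul_apply, comp_smul, comp_ann, comp_ann, lower, lower, map_smul, map_smulₛₗ, smul_apply,
    smul_comm]

lemma continuous_ann : Continuous (ann : OneParticle d k → Op d k) := by
  rw [Metric.continuous_iff]
  intro f ε hε
  refine ⟨ε, hε, fun g hg => ?_⟩
  rw [dist_eq_norm, ← ann_sub]
  exact (norm_ann_le _).trans_lt (by rwa [← dist_eq_norm])

lemma comp_star_ann_zero (f : OneParticle d k) (ψ : Fock d k) : comp (star (ann f) ψ) 0 = 0 := by
  have h := inner_ofSector (isAntisymm_comp (star (ann f) ψ) 0) (star (ann f) ψ)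
  rw [ContinuousLinearMap.star_eq_adjoint, ContinuousLinearMap.adjoint_inner_right] at h
  have h2 : ann f (ofSector 0 (isAntisymm_comp (star (ann f) ψ) 0)) = 0 :=
    fock_ext fun n => by
      rw [comp_ann, comp_ofSector_ne _ (Nat.succ_ne_zero n), map_zero, smul_zero, comp_zero]
  rw [ContinuousLinearMap.star_eq_adjoint] at h2
  rw [h2, inner_zero_left] at h
  exact inner_self_eq_zero.1 h.symm

/-- Test the adjoint on antisymmetric vectors of a single particle number. The operator brings
`√(n+1)` and the pairing with the unnormalized wedge brings `n + 1`, whence the inverse square root.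
-/
lemma comp_star_ann_succ (f : OneParticle d k) (ψ : Fock d k) (n : ℕ) :
    comp (star (ann f) ψ) (n + 1) = ((√(n + 1) : ℂ))⁻¹ • wedge n f (comp ψ n) := by
  have hc : (√(n + 1) : ℂ) ≠ 0 := by
    rw [Ne, Complex.ofReal_eq_zero, Real.sqrt_eq_zero']
    have : (0 : ℝ) < n + 1 := by positivity
    linarith
  have hcc : (√(n + 1) : ℂ) * (√(n + 1) : ℂ) = n + 1 := by
    rw [← Complex.ofReal_mul, Real.mul_self_sqrt (by positivity)]
    push_cast
    rfl
  have key : ∀ w : Sector d k (n + 1), IsAntisymm w →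
      inner ℂ w (comp (star (ann f) ψ) (n + 1))
        = inner ℂ w (((√(n + 1) : ℂ))⁻¹ • wedge n f (comp ψ n)) := by
    intro w hw
    rw [← inner_ofSector hw, ContinuousLinearMap.star_eq_adjoint,
      ContinuousLinearMap.adjoint_inner_right, inner_smul_right, ← inner_conj_symm w,
      inner_wedge f _ hw, ← inner_conj_symm, ← (hasSum_inner_comp ψ _).tsum_eq,
      tsum_eq_single n, comp_ann, comp_ofSector_self, inner_smul_right]
    · simp only [map_mul, map_add, map_natCast, map_one, Complex.conj_ofReal]
      rw [← hcc]
      field_simp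
    · intro m hm
      rw [comp_ann, comp_ofSector_ne hw (by omega), map_zero, smul_zero, inner_zero_right]
  -- The difference is itself antisymmetric and so may be tested against itself.
  have hd : IsAntisymm (comp (star (ann f) ψ) (n + 1)
      - ((√(n + 1) : ℂ))⁻¹ • wedge n f (comp ψ n)) := by
    intro π
    rw [map_sub, map_smul, isAntisymm_comp _ _ π, (isAntisymm_comp ψ n).wedge f π, smul_sub,
      smul_comm]
  rw [← sub_eq_zero, ← inner_self_eq_zero (𝕜 := ℂ), inner_sub_right, key _ hd, sub_self]

lemma sqrt_ne_zero (n : ℕ) : (√(n + 1) : ℂ) ≠ 0 := by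
  rw [Ne, Complex.ofReal_eq_zero, Real.sqrt_eq_zero']
  have : (0 : ℝ) < n + 1 := by positivity
  linarith

lemma op_mul_apply (S T : Op d k) (ψ : Fock d k) : (S * T) ψ = S (T ψ) := rfl

/-- The canonical anticommutation relations. -/
lemma ann_mul_star_ann_add (f g : OneParticle d k) :
    ann f * star (ann g) + star (ann g) * ann f = (inner ℂ f g : ℂ) • 1 := by
  ext1 ψ
  refine fock_ext fun n => ?_
  rw [add_apply, comp_add, op_mul_apply, op_mul_apply,
    smul_apply, comp_smul, one_apply_eq_self, comp_ann, comp_star_ann_succ, map_smul,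
    smul_smul, mul_inv_cancel₀ (sqrt_ne_zero n), one_smul]
  cases n with
  | zero => rw [lower_wedge_zero, comp_star_ann_zero, add_zero]
  | succ n =>
    rw [lower_wedge_succ f g (isAntisymm_comp ψ (n + 1)), comp_star_ann_succ, comp_ann]
    have : wedge n g ((√(n + 1) : ℂ) • lower n f (comp ψ (n + 1)))
        = (√(n + 1) : ℂ) • wedge n g (lower n f (comp ψ (n + 1))) := by
      simp only [wedge, map_smul, Finset.smul_sum]
      exact Finset.sum_congr rfl fun j _ => smul_comm _ _ _
    rw [this, smul_smul, inv_mul_cancel₀ (sqrt_ne_zero n), one_smul, sub_add_cancel]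

/-- Two contractions in the opposite order differ by the swap of the first two particles, which acts
as `-1`. -/
lemma ann_mul_ann_add (f g : OneParticle d k) : ann f * ann g + ann g * ann f = 0 := by
  ext1 ψ
  refine fock_ext fun n => ?_
  rw [add_apply, comp_add, op_mul_apply, op_mul_apply,
    comp_ann, comp_ann, comp_ann, comp_ann, zero_apply, comp_zero, map_smul, map_smul,
    ← lower_lower_perm_swap, isAntisymm_comp ψ (n + 1 + 1) (Equiv.swap 0 1), map_smul, map_smul]
  have : sgn (Equiv.swap 0 1 : Equiv.Perm (Fin (n + 1 + 1))) = -1 := sgn_swap_succ (n := n + 1) 0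
  rw [this]
  simp

lemma isAnnihilation_ann (f : OneParticle d k) : IsAnnihilation f (ann f) := by
  intro ψ n s
  have h1 : amplitude (ann f ψ) n s = (√(n + 1) : ℂ) •
      ∑ l : Label k, contract (consIdx d n) (f l) (amplitude ψ (n + 1) (Fin.cons l s)) := by
    rw [← comp_apply, comp_ann, PiLp.smul_apply, lower_apply]
    rfl
  rw [h1]
  have h2 : ∀ᵐ X : Conf d n, ∀ l : Label k,
      contract (consIdx d n) (f l) (amplitude ψ (n + 1) (Fin.cons l s)) X = ∫ x : Space d,
        conj (f l x) * amplitude ψ (n + 1) (Fin.cons l s : Fin (n + 1) → Label k) (cons x X) := by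
    rw [ae_all_iff]
    intro l
    simp only [cons_eq_glue]
    exact contract_coe _ _ _
  filter_upwards [h2, Lp.coeFn_smul (√(n + 1) : ℂ)
    (∑ l : Label k, contract (consIdx d n) (f l) (amplitude ψ (n + 1) (Fin.cons l s))),
    Lp.coeFn_finsetSum Finset.univ fun l : Label k =>
      contract (consIdx d n) (f l) (amplitude ψ (n + 1) (Fin.cons l s))] with X h3 h4 h5
  rw [h4, Pi.smul_apply, h5, Finset.sum_apply, smul_eq_mul]
  exact congrArg _ (Finset.sum_congr rfl fun l _ => h3 l)

lemma IsAnnihilation.unique {f : Label k → L2 (Space d)} {S T : Op d k} (hS : IsAnnihilation f S)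
    (hT : IsAnnihilation f T) : S = T := by
  ext1 ψ
  refine fock_ext fun n => ?_
  ext1 s
  apply Lp.ext
  filter_upwards [hS ψ n s, hT ψ n s] with X h1 h2
  exact h1.trans h2.symm

lemma isAnnihilation_iff {f : Label k → L2 (Space d)} {T : Op d k} :
    IsAnnihilation f T ↔ T = ann (WithLp.toLp 2 f) :=
  ⟨fun h => h.unique (isAnnihilation_ann (WithLp.toLp 2 f)),
    fun h => h ▸ isAnnihilation_ann (WithLp.toLp 2 f)⟩

end fock

/-! ### From weak to strong continuity -/

section continuity

variable {E : Type*} [NormedAddCommGroup E] [InnerProductSpace ℂ E]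

/-- For constant norm `c`, `‖u y - u x‖² = 2c² - 2 Re ⟨u x, u y⟩`. -/
lemma continuous_of_weakly_continuous {X : Type*} [TopologicalSpace X] {u : X → E} {c : ℝ}
    (hn : ∀ x, ‖u x‖ = c) (hw : ∀ φ, Continuous fun x => inner ℂ φ (u x)) : Continuous u := by
  rw [continuous_iff_continuousAt]
  intro x
  have h1 : ∀ y, ‖u y - u x‖ ^ 2 = 2 * c ^ 2 - 2 * RCLike.re (inner ℂ (u x) (u y)) := by
    intro y
    rw [norm_sub_sq (𝕜 := ℂ), hn, hn, inner_re_symm]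
    ring
  have h2 : Tendsto (fun y => ‖u y - u x‖ ^ 2) (𝓝 x) (𝓝 0) := by
    simp only [h1]
    have h3 : Tendsto (fun y => RCLike.re (inner ℂ (u x) (u y))) (𝓝 x) (𝓝 (c ^ 2)) := by
      have := (RCLike.continuous_re.comp (hw (u x))).tendsto x
      rwa [Function.comp_apply, inner_self_eq_norm_sq, hn] at this
    have h4 := (h3.const_mul 2).const_sub (2 * c ^ 2)
    rwa [sub_self] at h4
  rw [ContinuousAt, tendsto_iff_norm_sub_tendsto_zero]
  have h5 := h2.sqrt
  simpa using h5

end continuity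

/-! ### The free one-parameter group and translations on `L²` -/

section freeGroup

variable {V : Type} [NormedAddCommGroup V] [InnerProductSpace ℝ V] [FiniteDimensional ℝ V]
    [MeasurableSpace V] [BorelSpace V]

/-- Multiplication by the symbol of the free evolution. -/
abbrev mulFreePhase (t : ℝ) : L2 V →ₗᵢ[ℂ] L2 V :=
  mulPhase (freePhase t) (continuous_freePhase t) (norm_freePhase t)

lemma fourier_expLaplacian (t : ℝ) (f : L2 V) : 𝓕 (expLaplacian t f) = mulFreePhase t (𝓕 f) :=
  (Lp.fourierTransformₗᵢ V ℂ).apply_symm_apply _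

lemma eq_of_fourier_eq {f g : L2 V} (h : 𝓕 f = 𝓕 g) : f = g :=
  (Lp.fourierTransformₗᵢ V ℂ).injective h

lemma freePhase_add (s t : ℝ) (ξ : V) : freePhase (s + t) ξ = freePhase s ξ * freePhase t ξ := by
  simp only [freePhase, ← Complex.exp_add, ← add_mul, ← Complex.ofReal_add]

lemma freePhase_zero (ξ : V) : freePhase 0 ξ = 1 := by
  simp [freePhase]

lemma expLaplacian_add (s t : ℝ) (f : L2 V) :
    expLaplacian (s + t) f = expLaplacian s (expLaplacian t f) := by
  apply eq_of_fourier_eq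
  rw [fourier_expLaplacian, fourier_expLaplacian, fourier_expLaplacian]
  apply Lp.ext
  filter_upwards [mulPhase_coe (freePhase (s + t)) (continuous_freePhase _) (norm_freePhase _) (𝓕 f),
    mulPhase_coe (freePhase s) (continuous_freePhase _) (norm_freePhase _) (mulFreePhase t (𝓕 f)),
    mulPhase_coe (freePhase t) (continuous_freePhase _) (norm_freePhase _) (𝓕 f)] with x h1 h2 h3
  rw [h1, h2, h3, freePhase_add, mul_assoc]

lemma expLaplacian_zero (f : L2 V) : expLaplacian 0 f = f := by
  apply eq_of_fourier_eq
  rw [fourier_expLaplacian]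
  apply Lp.ext
  filter_upwards [mulPhase_coe (freePhase 0) (continuous_freePhase _) (norm_freePhase _) (𝓕 f)]
    with x h1
  rw [h1, freePhase_zero, one_mul]

lemma continuous_expLaplacian (f : L2 V) : Continuous fun t => expLaplacian t f := by
  have h : Continuous fun t => mulFreePhase t (𝓕 f) := by
    refine continuous_of_weakly_continuous (c := ‖𝓕 f‖)
      (fun t => (mulFreePhase t).norm_map _) fun φ => ?_
    have e : ∀ t, inner ℂ φ (mulFreePhase t (𝓕 f))
        = ∫ x, freePhase t x * inner ℂ (φ x) ((𝓕 f : L2 V) x) := by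
      intro t
      rw [L2.inner_def]
      refine integral_congr_ae ?_
      filter_upwards [mulPhase_coe (freePhase t) (continuous_freePhase _) (norm_freePhase _) (𝓕 f)]
        with x h1
      rw [h1, RCLike.inner_apply, RCLike.inner_apply]
      ring
    simp only [e]
    have hi := L2.integrable_inner (𝕜 := ℂ) φ (𝓕 f : L2 V)
    refine continuous_of_dominated (bound := fun x => ‖inner ℂ (φ x) ((𝓕 f : L2 V) x)‖) (fun t => ?_) (fun t => ?_)
      hi.norm ?_
    · exact (continuous_freePhase t).aestronglyMeasurable.mul hi.aestronglyMeasurable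
    · exact Eventually.of_forall fun x => by rw [norm_mul, norm_freePhase, one_mul]
    · refine Eventually.of_forall fun x => ?_
      unfold freePhase
      fun_prop
  exact (Lp.fourierTransformₗᵢ V ℂ).symm.continuous.comp h

lemma shift_shift (a b : V) (f : L2 V) : shift a (shift b f) = shift (a + b) f := by
  apply Lp.ext
  filter_upwards [shift_coe a (shift b f), shift_coe (a + b) f,
    (measurePreserving_sub_right (volume : Measure V) a).quasiMeasurePreserving.ae
      (shift_coe b f)] with x h1 h2 h3
  rw [h1, h2, h3, sub_sub]

lemma shift_zero (f : L2 V) : shift 0 f = f := by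
  apply Lp.ext
  filter_upwards [shift_coe 0 f] with x h1
  rw [h1, sub_zero]

/-- The symbol of the translation by `a`. -/
def shiftPhase (a ξ : V) : ℂ := (Real.fourierChar (-inner ℝ a ξ) : ℂ)

lemma continuous_shiftPhase (a : V) : Continuous (shiftPhase a) :=
  continuous_subtype_val.comp (Real.continuous_fourierChar.comp (by fun_prop))

lemma norm_shiftPhase (a ξ : V) : ‖shiftPhase a ξ‖ = 1 := Circle.norm_coe _

lemma fourier_shift (a : V) (f : L2 V) :
    𝓕 (shift a f) = mulPhase (shiftPhase a) (continuous_shiftPhase a) (norm_shiftPhase a) (𝓕 f) := by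
  let M := mulPhase (shiftPhase a) (continuous_shiftPhase a) (norm_shiftPhase a)
  refine DenseRange.induction_on (p := fun f : L2 V => 𝓕 (shift a f) = M (𝓕 f))
    (SchwartzMap.denseRange_toLpCLM (F := ℂ) (E := V) (p := 2) (μ := volume)
      ENNReal.ofNat_ne_top) f ?_ ?_
  · exact isClosed_eq
      ((Lp.fourierTransformₗᵢ V ℂ).continuous.comp (shift a).continuous)
      (M.continuous.comp (Lp.fourierTransformₗᵢ V ℂ).continuous)
  · intro g
    have h1 : shift a (g.toLp 2) = (SchwartzMap.compSubConstCLM ℂ a g).toLp 2 := by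
      apply Lp.ext
      have h2 := (measurePreserving_sub_right (volume : Measure V) a).quasiMeasurePreserving.ae
        (g.coeFn_toLp 2 volume)
      filter_upwards [shift_coe a (g.toLp 2),
        (SchwartzMap.compSubConstCLM ℂ a g).coeFn_toLp 2 volume, h2] with x e1 e2 e3
      rw [e1, e2, e3]
      rfl
    change 𝓕 (shift a (g.toLp 2)) = M (𝓕 (g.toLp 2))
    rw [h1, SchwartzMap.toLp_fourier_eq, SchwartzMap.toLp_fourier_eq]
    apply Lp.ext
    filter_upwards [SchwartzMap.coeFn_toLp (𝓕 (SchwartzMap.compSubConstCLM ℂ a g)) 2 volume,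
      mulPhase_coe _ (continuous_shiftPhase a) (norm_shiftPhase a) ((𝓕 g).toLp 2),
      SchwartzMap.coeFn_toLp (𝓕 g) 2 volume] with ξ e1 e2 e3
    rw [e1, e2, e3]
    simp only [SchwartzMap.fourier_coe, Real.fourier_eq]
    rw [← integral_const_mul, ← integral_add_right_eq_self _ a]
    refine integral_congr_ae (Eventually.of_forall fun v => ?_)
    simp only [SchwartzMap.compSubConstCLM_apply, add_sub_cancel_right, inner_add_left, neg_add,
      AddChar.map_add_eq_mul, Circle.smul_def, Circle.coe_mul, smul_eq_mul, shiftPhase]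
    ring

lemma expLaplacian_shift (t : ℝ) (a : V) (f : L2 V) :
    expLaplacian t (shift a f) = shift a (expLaplacian t f) := by
  apply eq_of_fourier_eq
  rw [fourier_expLaplacian, fourier_shift, fourier_shift, fourier_expLaplacian]
  apply Lp.ext
  filter_upwards [
    mulPhase_coe (freePhase t) (continuous_freePhase t) (norm_freePhase t)
      (mulPhase (shiftPhase a) (continuous_shiftPhase a) (norm_shiftPhase a) (𝓕 f)),
    mulPhase_coe _ (continuous_shiftPhase a) (norm_shiftPhase a) (mulFreePhase t (𝓕 f)),
    mulPhase_coe (freePhase t) (continuous_freePhase t) (norm_freePhase t) (𝓕 f),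
    mulPhase_coe _ (continuous_shiftPhase a) (norm_shiftPhase a) (𝓕 f)] with x h1 h2 h3 h4
  rw [h1, h2, h3, h4]
  ring

end freeGroup

/-! ### Second quantization of the free evolution and of translations -/

section secondQuantization

variable {d k : ℕ}

/-- A family of maps of the `n`-particle spaces that is multiplicative over tensor products. -/
structure IsMultiplicative (T : ∀ n, L2 (Conf d n) →ₗᵢ[ℂ] L2 (Conf d n))
    (T₁ : L2 (Space d) →ₗᵢ[ℂ] L2 (Space d)) : Prop where
  covariant : ∀ (n : ℕ) (π : Equiv.Perm (Fin n)) (f : L2 (Conf d n)),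
      T n (precomp (permute d π) f) = precomp (permute d π) (T n f)
  tprod : ∀ n f g, T (n + 1) (tprod (consIdx d n) f g) = tprod (consIdx d n) (T₁ f) (T n g)

/-- The action on one-particle functions. -/
def mapOne (T₁ : L2 (Space d) →ₗᵢ[ℂ] L2 (Space d)) (f : OneParticle d k) : OneParticle d k :=
  WithLp.toLp 2 fun l => T₁ (f l)

lemma norm_secondQuantize (T : ∀ n, L2 (Conf d n) →ₗᵢ[ℂ] L2 (Conf d n))
    (hT : ∀ (n : ℕ) (π : Equiv.Perm (Fin n)) (f : L2 (Conf d n)),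
      T n (precomp (permute d π) f) = precomp (permute d π) (T n f)) (ψ : Fock d k) :
    ‖secondQuantize k T hT ψ‖ = ‖ψ‖ :=
  (fullFockMap k T).norm_map ψ.1

lemma comp_secondQuantize (T : ∀ n, L2 (Conf d n) →ₗᵢ[ℂ] L2 (Conf d n))
    (hT : ∀ (n : ℕ) (π : Equiv.Perm (Fin n)) (f : L2 (Conf d n)),
      T n (precomp (permute d π) f) = precomp (permute d π) (T n f)) (ψ : Fock d k) (n : ℕ) :
    comp (secondQuantize k T hT ψ) n = sectorMap k T n (comp ψ n) := rfl

lemma inner_sectorMap (T : ∀ n, L2 (Conf d n) →ₗᵢ[ℂ] L2 (Conf d n)) (n : ℕ)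
    (v w : Sector d k n) : inner ℂ (sectorMap k T n v) (sectorMap k T n w) = inner ℂ v w := by
  simp only [PiLp.inner_apply, sectorMap, LinearIsometry.inner_map_map]

/-- Contraction is an adjoint, so isometry of `T` is not enough: the test vector has to lie in its
range, which the right inverse `T'` ensures. -/
lemma lower_sectorMap {T T' : ∀ n, L2 (Conf d n) →ₗᵢ[ℂ] L2 (Conf d n)}
    {T₁ : L2 (Space d) →ₗᵢ[ℂ] L2 (Space d)} (h : IsMultiplicative T T₁)
    (h' : ∀ n f, T n (T' n f) = f) {n : ℕ} (f : OneParticle d k) (v : Sector d k (n + 1)) :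
    lower n (mapOne T₁ f) (sectorMap k T (n + 1) v) = sectorMap k T n (lower n f v) := by
  refine ext_inner_left ℂ fun w => ?_
  have hw : w = sectorMap k T n (sectorMap k T' n w) := by
    ext1 s
    exact (h' n (w s)).symm
  have hr : ∀ u : Sector d k n, raise n (mapOne T₁ f) (sectorMap k T n u)
      = sectorMap k T (n + 1) (raise n f u) := by
    intro u
    ext1 s
    exact (h.tprod n _ _).symm
  rw [hw, inner_sectorMap, lower, lower, ContinuousLinearMap.adjoint_inner_right,
    ContinuousLinearMap.adjoint_inner_right, hr, inner_sectorMap]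

lemma secondQuantize_mul_ann {T T' : ∀ n, L2 (Conf d n) →ₗᵢ[ℂ] L2 (Conf d n)}
    {T₁ : L2 (Space d) →ₗᵢ[ℂ] L2 (Space d)} (h : IsMultiplicative T T₁)
    (h' : ∀ n f, T n (T' n f) = f) (f : OneParticle d k) :
    secondQuantize k T h.covariant * ann f = ann (mapOne T₁ f) * secondQuantize k T h.covariant := by
  ext1 ψ
  refine fock_ext fun n => ?_
  rw [op_mul_apply, op_mul_apply, comp_secondQuantize, comp_ann, comp_ann, comp_secondQuantize,
    lower_sectorMap h h']
  ext1 s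
  exact map_smul (T n) _ _

lemma star_secondQuantize {T T' : ∀ n, L2 (Conf d n) →ₗᵢ[ℂ] L2 (Conf d n)}
    (hT : ∀ (n : ℕ) (π : Equiv.Perm (Fin n)) (f : L2 (Conf d n)),
      T n (precomp (permute d π) f) = precomp (permute d π) (T n f))
    (hT' : ∀ (n : ℕ) (π : Equiv.Perm (Fin n)) (f : L2 (Conf d n)),
      T' n (precomp (permute d π) f) = precomp (permute d π) (T' n f))
    (h' : ∀ n f, T n (T' n f) = f) :
    star (secondQuantize k T hT) = secondQuantize k T' hT' := by
  ext1 ψ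
  refine ext_inner_left ℂ fun φ => ?_
  rw [ContinuousLinearMap.star_eq_adjoint, ContinuousLinearMap.adjoint_inner_right,
    ← (hasSum_inner_comp _ ψ).tsum_eq, ← (hasSum_inner_comp φ _).tsum_eq]
  refine tsum_congr fun n => ?_
  rw [comp_secondQuantize, comp_secondQuantize, ← inner_sectorMap T n (comp φ n)]
  congr 1
  ext1 s
  exact (h' n _).symm

lemma isMultiplicative_expLaplacian (t : ℝ) :
    IsMultiplicative (d := d) (fun _ => expLaplacian t) (expLaplacian t) where
  covariant _ π f := expLaplacian_precomp t (permute d π) f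
  tprod _ f g := expLaplacian_tprod _ t f g

lemma isMultiplicative_shift (x : Space d) :
    IsMultiplicative (d := d) (fun n => shift (diagonal n x)) (shift x) where
  covariant _ π f := shift_precomp (permute d π) _ (by ext p; rfl) f
  tprod n f g := shift_tprod _ _ _ _ (eq_glue _ _ _ (fun _ => rfl) fun _ => rfl) f g

lemma freePropagator_add (s t : ℝ) :
    freePropagator d k (s + t) = freePropagator d k s * freePropagator d k t := by
  ext1 ψ
  refine fock_ext fun n => ?_
  ext1 s'
  exact expLaplacian_add s t _

lemma freePropagator_zero : freePropagator d k 0 = 1 := by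
  ext1 ψ
  refine fock_ext fun n => ?_
  ext1 s'
  exact expLaplacian_zero _

lemma star_freePropagator (t : ℝ) : star (freePropagator d k t) = freePropagator d k (-t) :=
  star_secondQuantize _ _ fun n f => by rw [← expLaplacian_add, add_neg_cancel, expLaplacian_zero]

lemma freePropagator_mem_unitary (t : ℝ) : freePropagator d k t ∈ unitary (Op d k) := by
  rw [Unitary.mem_iff, star_freePropagator, ← freePropagator_add, ← freePropagator_add]
  simp [freePropagator_zero]

lemma continuous_freePropagator (ψ : Fock d k) : Continuous fun t => freePropagator d k t ψ := by
  refine continuous_of_weakly_continuous (c := ‖ψ‖) (fun t => norm_secondQuantize _ _ ψ) fun φ => ?_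
  have h : ∀ t, inner ℂ φ (freePropagator d k t ψ)
      = ∑' n, inner ℂ (comp φ n) (sectorMap k (fun _ => expLaplacian t) n (comp ψ n)) :=
    fun t => (hasSum_inner_comp _ _).tsum_eq.symm
  simp only [h]
  refine continuous_tsum (u := fun n => ‖comp φ n‖ * ‖comp ψ n‖) (fun n => ?_) ?_ fun n t => ?_
  · simp only [PiLp.inner_apply, sectorMap]
    exact continuous_finsetSum _ fun s _ => continuous_const.inner (continuous_expLaplacian _)
  · refine Summable.of_nonneg_of_le (fun n => by positivity) (fun n => ?_)
      ((hasSum_norm_comp_sq φ).summable.add (hasSum_norm_comp_sq ψ).summable)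
    nlinarith [sq_nonneg (‖comp φ n‖ - ‖comp ψ n‖), sq_nonneg ‖comp φ n‖, sq_nonneg ‖comp ψ n‖]
  · refine (norm_inner_le_norm _ _).trans_eq ?_
    rw [norm_sectorMap]

lemma translation_add (x y : Space d) :
    translation d k (x + y) = translation d k x * translation d k y := by
  ext1 ψ
  refine fock_ext fun n => ?_
  ext1 s'
  exact (shift_shift (diagonal n x) (diagonal n y) _).symm

lemma translation_zero : translation d k 0 = 1 := by
  ext1 ψ
  refine fock_ext fun n => ?_
  ext1 s'
  exact shift_zero _

lemma star_translation (x : Space d) : star (translation d k x) = translation d k (-x) :=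
  star_secondQuantize _ _ fun n f => by
    rw [shift_shift]
    have : diagonal n x + diagonal n (-x) = 0 := by
      ext p
      exact add_neg_cancel (x p.2)
    rw [this, shift_zero]

lemma translation_mem_unitary (x : Space d) : translation d k x ∈ unitary (Op d k) := by
  rw [Unitary.mem_iff, star_translation, ← translation_add, ← translation_add]
  simp [translation_zero]

lemma freePropagator_mul_translation (t : ℝ) (x : Space d) :
    freePropagator d k t * translation d k x = translation d k x * freePropagator d k t := by
  ext1 ψ
  refine fock_ext fun n => ?_
  ext1 s'
  exact expLaplacian_shift t _ _

end secondQuantization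

/-! ### Free dynamics and translations as automorphisms of the field algebra -/

section automorphisms

variable {d k : ℕ}

lemma Ad_one (a : Op d k) : Ad 1 a = a := by simp [Ad]

lemma Ad_Ad (U V a : Op d k) : Ad U (Ad V a) = Ad (U * V) a := by
  simp only [Ad, star_mul, mul_assoc]

lemma Ad_add (U a b : Op d k) : Ad U (a + b) = Ad U a + Ad U b := by
  simp only [Ad, mul_add, add_mul]

lemma Ad_sub (U a b : Op d k) : Ad U (a - b) = Ad U a - Ad U b := by
  simp only [Ad, mul_sub, sub_mul]

lemma Ad_smul (U : Op d k) (c : ℂ) (a : Op d k) : Ad U (c • a) = c • Ad U a := by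
  simp only [Ad, mul_smul_comm, smul_mul_assoc]

lemma Ad_star (U a : Op d k) : Ad U (star a) = star (Ad U a) := by
  simp only [Ad, star_mul, star_star, mul_assoc]

lemma Ad_mul {U : Op d k} (hU : U ∈ unitary (Op d k)) (a b : Op d k) :
    Ad U (a * b) = Ad U a * Ad U b := by
  have := Unitary.star_mul_self_of_mem hU
  calc U * (a * b) * star U = U * a * 1 * (b * star U) := by simp only [mul_one, mul_assoc]
    _ = _ := by rw [← this]; simp only [Ad, mul_assoc]

lemma Ad_map_one {U : Op d k} (hU : U ∈ unitary (Op d k)) : Ad U 1 = 1 := by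
  rw [Ad, mul_one, Unitary.mul_star_self_of_mem hU]

lemma norm_Ad {U : Op d k} (hU : U ∈ unitary (Op d k)) (a : Op d k) : ‖Ad U a‖ = ‖a‖ := by
  rw [Ad, CStarRing.norm_mul_mem_unitary _ (Unitary.star_mem hU), CStarRing.norm_mem_unitary_mul _ hU]

/-- Conjugation by a unitary, as a morphism of star algebras. -/
def AdHom (U : Op d k) (hU : U ∈ unitary (Op d k)) : Op d k →⋆ₐ[ℂ] Op d k where
  toFun := Ad U
  map_one' := Ad_map_one hU
  map_mul' := Ad_mul hU
  map_zero' := by simp [Ad]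
  map_add' := Ad_add U
  commutes' c := by rw [Algebra.algebraMap_eq_smul_one, Ad_smul, Ad_map_one hU]
  map_star' := Ad_star U

lemma continuous_Ad (U : Op d k) : Continuous (Ad U) := by
  unfold Ad
  fun_prop

lemma ann_mem_fieldAlgebra (f : OneParticle d k) : ann f ∈ fieldAlgebra d k :=
  StarSubalgebra.le_topologicalClosure _
    (StarAlgebra.subset_adjoin ℂ _ ⟨f, isAnnihilation_ann f⟩)

lemma isClosed_fieldAlgebra : IsClosed (fieldAlgebra d k : Set (Op d k)) :=
  StarSubalgebra.isClosed_topologicalClosure _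

lemma fieldAlgebra_le {S : StarSubalgebra ℂ (Op d k)} (hS : IsClosed (S : Set (Op d k)))
    (h : ∀ f : OneParticle d k, ann f ∈ S) : fieldAlgebra d k ≤ S :=
  StarSubalgebra.topologicalClosure_minimal (StarAlgebra.adjoin_le (by
    rintro T ⟨f, hf⟩
    rw [isAnnihilation_iff.1 hf]
    exact h _)) hS

lemma Ad_mem_fieldAlgebra {U : Op d k} (hU : U ∈ unitary (Op d k))
    (h : ∀ f : OneParticle d k, Ad U (ann f) ∈ fieldAlgebra d k) :
    ∀ a ∈ fieldAlgebra d k, Ad U a ∈ fieldAlgebra d k := by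
  have := fieldAlgebra_le (S := (fieldAlgebra d k).comap (AdHom U hU))
    (isClosed_fieldAlgebra.preimage (continuous_Ad U)) h
  exact this

lemma freeDynamics_ann (t : ℝ) (f : OneParticle d k) :
    freeDynamics t (ann f) = ann (mapOne (expLaplacian t) f) := by
  rw [freeDynamics, Ad, freePropagator]
  have := secondQuantize_mul_ann (k := k) (isMultiplicative_expLaplacian (d := d) t)
    (T' := fun _ => expLaplacian (-t))
    (fun n f => by rw [← expLaplacian_add, add_neg_cancel, expLaplacian_zero]) f
  rw [this, mul_assoc]
  have h2 := Unitary.mul_star_self_of_mem (freePropagator_mem_unitary (d := d) (k := k) t)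
  rw [freePropagator] at h2
  rw [h2, mul_one]

lemma spaceTranslate_ann (x : Space d) (f : OneParticle d k) :
    spaceTranslate x (ann f) = ann (mapOne (shift x) f) := by
  rw [spaceTranslate, Ad, translation]
  have := secondQuantize_mul_ann (k := k) (isMultiplicative_shift (d := d) x)
    (T' := fun n => shift (diagonal n (-x))) (fun n f => by
      rw [shift_shift]
      have : diagonal n x + diagonal n (-x) = 0 := by
        ext p
        exact add_neg_cancel (x p.2)
      rw [this, shift_zero]) f
  rw [this, mul_assoc]
  have h2 := Unitary.mul_star_self_of_mem (translation_mem_unitary (d := d) (k := k) x)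
  rw [translation] at h2
  rw [h2, mul_one]

lemma freeDynamics_mem_fieldAlgebra (t : ℝ) :
    ∀ a ∈ fieldAlgebra d k, freeDynamics t a ∈ fieldAlgebra d k :=
  Ad_mem_fieldAlgebra (freePropagator_mem_unitary t) fun f => by
    change freeDynamics t (ann f) ∈ _
    rw [freeDynamics_ann]
    exact ann_mem_fieldAlgebra _

lemma spaceTranslate_mem_fieldAlgebra (x : Space d) :
    ∀ a ∈ fieldAlgebra d k, spaceTranslate x a ∈ fieldAlgebra d k :=
  Ad_mem_fieldAlgebra (translation_mem_unitary x) fun f => by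
    change spaceTranslate x (ann f) ∈ _
    rw [spaceTranslate_ann]
    exact ann_mem_fieldAlgebra _

lemma freeDynamics_add (s t : ℝ) (a : Op d k) :
    freeDynamics (s + t) a = freeDynamics s (freeDynamics t a) := by
  simp only [freeDynamics, Ad_Ad, freePropagator_add]

lemma freeDynamics_zero (a : Op d k) : freeDynamics 0 a = a := by
  rw [freeDynamics, freePropagator_zero, Ad_one]

lemma spaceTranslate_add (x y : Space d) (a : Op d k) :
    spaceTranslate (x + y) a = spaceTranslate x (spaceTranslate y a) := by
  simp only [spaceTranslate, Ad_Ad, translation_add]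

lemma spaceTranslate_zero (a : Op d k) : spaceTranslate 0 a = a := by
  rw [spaceTranslate, translation_zero, Ad_one]

lemma norm_freeDynamics (t : ℝ) (a : Op d k) : ‖freeDynamics t a‖ = ‖a‖ :=
  norm_Ad (freePropagator_mem_unitary t) a

lemma norm_spaceTranslate (x : Space d) (a : Op d k) : ‖spaceTranslate x a‖ = ‖a‖ :=
  norm_Ad (translation_mem_unitary x) a

lemma freeDynamics_spaceTranslate (t : ℝ) (x : Space d) (a : Op d k) :
    freeDynamics t (spaceTranslate x a) = spaceTranslate x (freeDynamics t a) := by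
  simp only [freeDynamics, spaceTranslate, Ad_Ad, freePropagator_mul_translation]

/-- On the field algebra, the free dynamics is norm continuous in time. -/
lemma continuous_freeDynamics : ∀ a ∈ fieldAlgebra d k, Continuous fun t => freeDynamics t a := by
  let S : StarSubalgebra ℂ (Op d k) :=
    { carrier := {a | Continuous fun t => freeDynamics t a}
      mul_mem' := fun {a b} ha hb => by
        have : Continuous fun t => freeDynamics t a * freeDynamics t b := Continuous.mul ha hb
        change Continuous fun t => freeDynamics t (a * b)
        simpa only [← Ad_mul (freePropagator_mem_unitary _), freeDynamics] using this
      add_mem' := fun {a b} ha hb => by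
        have : Continuous fun t => freeDynamics t a + freeDynamics t b := Continuous.add ha hb
        change Continuous fun t => freeDynamics t (a + b)
        simpa only [← Ad_add, freeDynamics] using this
      algebraMap_mem' := fun c => by
        simp only [Set.mem_ofPred_eq, freeDynamics, Algebra.algebraMap_eq_smul_one, Ad_smul,
          Ad_map_one (freePropagator_mem_unitary _)]
        exact continuous_const
      star_mem' := fun {a} ha => by
        have : Continuous fun t => star (freeDynamics t a) := Continuous.star ha
        change Continuous fun t => freeDynamics t (star a)
        simpa only [← Ad_star, freeDynamics] using this }
  -- Conjugation by unitaries is isometric, so norm approximation of `a` is uniform in time.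
  have hc : IsClosed (S : Set (Op d k)) := by
    refine isClosed_of_closure_subset fun a ha => ?_
    obtain ⟨u, hu, hl⟩ := mem_closure_iff_seq_limit.1 ha
    have : TendstoUniformly (fun n t => freeDynamics t (u n)) (fun t => freeDynamics t a) atTop := by
      rw [Metric.tendstoUniformly_iff]
      intro ε hε
      filter_upwards [(Metric.tendsto_nhds.1 hl) ε hε] with n hn t
      rw [dist_eq_norm, freeDynamics, freeDynamics, ← Ad_sub, norm_Ad (freePropagator_mem_unitary t),
        ← dist_eq_norm, dist_comm]
      exact hn
    exact this.continuous (Frequently.of_forall hu)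
  refine fun a ha => fieldAlgebra_le (S := S) hc (fun f => ?_) ha
  change Continuous fun t => freeDynamics t (ann f)
  simp only [freeDynamics_ann]
  refine continuous_ann.comp ((PiLp.continuous_toLp 2 _).comp ?_)
  exact continuous_pi fun l => continuous_expLaplacian (f l)

end automorphisms

/-! ### The dispersive estimate -/

section dispersion

variable {V : Type} [NormedAddCommGroup V] [InnerProductSpace ℝ V] [FiniteDimensional ℝ V]
    [MeasurableSpace V] [BorelSpace V]

/-- With a regularization `Re b > 0` the Fourier transform can be moved from `g` to the Gaussian.
The transform of the Gaussian is explicit and its modulus is at most `(π/|b|)^{n/2}`, with `n` the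
dimension of `V`. -/
lemma norm_gaussian_evolution_le (g : 𝓢(V, ℂ)) {b : ℂ} (hb : 0 < b.re) (x : V) :
    ‖∫ ξ, 𝓕 (g : V → ℂ) ξ * Complex.exp (-b * ‖ξ‖ ^ 2 + 2 * Real.pi * Complex.I * inner ℝ x ξ)‖
      ≤ (Real.pi / ‖b‖) ^ (Module.finrank ℝ V / 2 : ℝ) * ∫ y, ‖g y‖ := by
  have hG : Integrable fun ξ : V =>
      Complex.exp (-b * ‖ξ‖ ^ 2 + 2 * Real.pi * Complex.I * inner ℝ x ξ) := by
    have := GaussianFourier.integrable_cexp_neg_mul_sq_norm_add hb (2 * Real.pi * Complex.I) x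
    exact this
  have h1 := VectorFourier.integral_fourierIntegral_smul_eq_flip (𝕜 := ℝ) (e := Real.fourierChar)
    (μ := volume) (ν := volume) (L := innerₗ V) (f := (g : V → ℂ)) (g := fun ξ : V =>
      Complex.exp (-b * ‖ξ‖ ^ 2 + 2 * Real.pi * Complex.I * inner ℝ x ξ))
    Real.continuous_fourierChar continuous_inner g.integrable hG
  have h2 : ∀ w, VectorFourier.fourierIntegral Real.fourierChar volume (innerₗ V).flip (fun ξ : V =>
      Complex.exp (-b * ‖ξ‖ ^ 2 + 2 * Real.pi * Complex.I * inner ℝ x ξ)) w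
      = (Real.pi / b) ^ (Module.finrank ℝ V / 2 : ℂ)
        * Complex.exp (-Real.pi ^ 2 * ‖x - w‖ ^ 2 / b) := by
    intro w
    rw [flip_innerₗ]
    exact fourier_gaussian_innerProductSpace' hb x w
  simp only [h2, smul_eq_mul] at h1
  change ∫ ξ, 𝓕 (g : V → ℂ) ξ * _ = _ at h1
  rw [h1]
  have hb0 : b ≠ 0 := by rintro rfl; simp at hb
  calc _ ≤ ∫ y, (Real.pi / ‖b‖) ^ (Module.finrank ℝ V / 2 : ℝ) * ‖g y‖ := by
        refine norm_integral_le_of_norm_le (g.integrable.norm.const_mul _)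
          (Eventually.of_forall fun y => ?_)
        rw [norm_mul, norm_mul, mul_comm ‖g y‖]
        refine mul_le_mul_of_nonneg_right ?_ (norm_nonneg _)
        have e1 : ‖((Real.pi : ℂ) / b) ^ (Module.finrank ℝ V / 2 : ℂ)‖
            = (Real.pi / ‖b‖) ^ (Module.finrank ℝ V / 2 : ℝ) := by
          have : (Module.finrank ℝ V / 2 : ℂ) = ((Module.finrank ℝ V / 2 : ℝ) : ℂ) := by
            push_cast; rfl
          rw [this, Complex.norm_cpow_real, norm_div, Complex.norm_real,
            Real.norm_of_nonneg Real.pi_pos.le]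
        have e2 : ‖Complex.exp (-Real.pi ^ 2 * ‖x - y‖ ^ 2 / b)‖ ≤ 1 := by
          rw [Complex.norm_exp, Real.exp_le_one_iff]
          have : (-Real.pi ^ 2 * ‖x - y‖ ^ 2 / b : ℂ)
              = ((-(Real.pi ^ 2 * ‖x - y‖ ^ 2) : ℝ) : ℂ) * b⁻¹ := by
            push_cast; ring
          rw [this, Complex.re_ofReal_mul, Complex.inv_re]
          refine mul_nonpos_of_nonpos_of_nonneg (by
            have : 0 ≤ Real.pi ^ 2 * ‖x - y‖ ^ 2 := by positivity
            linarith) (div_nonneg hb.le (Complex.normSq_nonneg _))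
        rw [e1]
        exact mul_le_of_le_one_right (by positivity) e2
    _ = _ := integral_const_mul _ _

/-- The free phase is the Gaussian with `b = -4π² i t`, approached by `ε - 4π² i t` as `ε ↓ 0`. The
regularized bound is uniform since `|b| ≥ 4π² |t|`, and the integrals converge by domination. -/
lemma norm_evolution_le (g : 𝓢(V, ℂ)) {t : ℝ} (ht : t ≠ 0) (x : V) :
    ‖∫ ξ, 𝓕 (g : V → ℂ) ξ * (freePhase t ξ * Complex.exp (2 * Real.pi * Complex.I * inner ℝ x ξ))‖
      ≤ (4 * Real.pi * |t|) ^ (-(Module.finrank ℝ V / 2 : ℝ)) * ∫ y, ‖g y‖ := by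
  let β : ℂ := ((-(4 * Real.pi ^ 2 * t) : ℝ) : ℂ) * Complex.I
  have hβ : β.re = 0 := by rw [Complex.re_ofReal_mul, Complex.I_re, mul_zero]
  have hgi : Integrable (𝓕 (g : V → ℂ)) := (𝓕 g).integrable
  have hlim : Tendsto (fun ε : ℝ => ∫ ξ, 𝓕 (g : V → ℂ) ξ *
      Complex.exp (-(ε + β) * ‖ξ‖ ^ 2 + 2 * Real.pi * Complex.I * inner ℝ x ξ)) (𝓝[>] 0)
      (𝓝 (∫ ξ, 𝓕 (g : V → ℂ) ξ *
        (freePhase t ξ * Complex.exp (2 * Real.pi * Complex.I * inner ℝ x ξ)))) := by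
    refine tendsto_integral_filter_of_dominated_convergence (fun ξ => ‖𝓕 (g : V → ℂ) ξ‖) ?_ ?_
      hgi.norm ?_
    · refine Eventually.of_forall fun ε => hgi.aestronglyMeasurable.mul
        (Continuous.aestronglyMeasurable ?_)
      fun_prop
    · filter_upwards [self_mem_nhdsWithin] with ε hε
      refine Eventually.of_forall fun ξ => ?_
      rw [norm_mul]
      refine mul_le_of_le_one_right (norm_nonneg _) ?_
      rw [Complex.norm_exp, Real.exp_le_one_iff]
      have e : ((-(ε + β) * ‖ξ‖ ^ 2 + 2 * Real.pi * Complex.I * inner ℝ x ξ : ℂ)).re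
          = -(ε * ‖ξ‖ ^ 2) := by
        have : (-(ε + β) * ‖ξ‖ ^ 2 + 2 * Real.pi * Complex.I * inner ℝ x ξ : ℂ)
          = ((-(ε * ‖ξ‖ ^ 2) : ℝ) : ℂ) +
            ((4 * Real.pi ^ 2 * t * ‖ξ‖ ^ 2 + 2 * Real.pi * inner ℝ x ξ : ℝ) : ℂ) * Complex.I := by
          simp only [β]; push_cast; ring
        rw [this, Complex.add_re, Complex.ofReal_re, Complex.re_ofReal_mul, Complex.I_re]
        ring
      rw [e]
      have : 0 < ε := hε
      have : 0 ≤ ε * ‖ξ‖ ^ 2 := by positivity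
      linarith
    · refine Eventually.of_forall fun ξ => ?_
      have hc : Continuous fun ε : ℝ => 𝓕 (g : V → ℂ) ξ *
          Complex.exp (-(ε + β) * ‖ξ‖ ^ 2 + 2 * Real.pi * Complex.I * inner ℝ x ξ) := by
        fun_prop
      have h0 := (hc.tendsto 0).mono_left (nhdsWithin_le_nhds (s := Set.Ioi 0))
      convert h0 using 3
      rw [freePhase, ← Complex.exp_add]
      congr 1
      simp only [β]; push_cast; ring
  have hbd : ∀ᶠ ε : ℝ in 𝓝[>] 0, ‖∫ ξ, 𝓕 (g : V → ℂ) ξ *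
      Complex.exp (-(ε + β) * ‖ξ‖ ^ 2 + 2 * Real.pi * Complex.I * inner ℝ x ξ)‖
      ≤ (4 * Real.pi * |t|) ^ (-(Module.finrank ℝ V / 2 : ℝ)) * ∫ y, ‖g y‖ := by
    filter_upwards [self_mem_nhdsWithin] with ε hε
    refine (norm_gaussian_evolution_le g (b := ε + β) ?_ x).trans ?_
    · rw [Complex.add_re, hβ, Complex.ofReal_re, add_zero]
      exact hε
    · refine mul_le_mul_of_nonneg_right ?_ (integral_nonneg fun _ => norm_nonneg _)
      have h4 : 4 * Real.pi ^ 2 * |t| ≤ ‖(ε + β : ℂ)‖ := by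
        refine le_trans (le_of_eq ?_) (Complex.abs_im_le_norm _)
        rw [Complex.add_im, Complex.ofReal_im, zero_add, Complex.im_ofReal_mul, Complex.I_im, mul_one,
          abs_neg, abs_mul, abs_of_pos (by positivity : (0 : ℝ) < 4 * Real.pi ^ 2)]
      have ht' : 0 < |t| := abs_pos.2 ht
      rw [Real.rpow_neg (by positivity), ← Real.inv_rpow (by positivity)]
      refine Real.rpow_le_rpow (by positivity) ?_ (by positivity)
      calc Real.pi / ‖(ε + β : ℂ)‖ ≤ Real.pi / (4 * Real.pi ^ 2 * |t|) := by gcongr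
        _ = (4 * Real.pi * |t|)⁻¹ := by field_simp
  exact le_of_tendsto hlim.norm hbd

/-- The dispersive estimate for the free evolution. -/
lemma norm_inner_expLaplacian_le (f g : 𝓢(V, ℂ)) {t : ℝ} (ht : t ≠ 0) :
    ‖inner ℂ (f.toLp 2 volume) (expLaplacian t (g.toLp 2 volume))‖
      ≤ (4 * Real.pi * |t|) ^ (-(Module.finrank ℝ V / 2 : ℝ)) * (∫ x, ‖f x‖) * ∫ x, ‖g x‖ := by
  have hgi : Integrable (𝓕 (g : V → ℂ)) := (𝓕 g).integrable
  have e1 : inner ℂ (f.toLp 2 volume) (expLaplacian t (g.toLp 2 volume))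
      = ∫ ξ, conj (𝓕 (f : V → ℂ) ξ) * (freePhase t ξ * 𝓕 (g : V → ℂ) ξ) := by
    rw [← (Lp.fourierTransformₗᵢ V ℂ).inner_map_map]
    change inner ℂ (𝓕 (f.toLp 2 volume)) (𝓕 (expLaplacian t (g.toLp 2 volume))) = _
    rw [fourier_expLaplacian, SchwartzMap.toLp_fourier_eq, SchwartzMap.toLp_fourier_eq,
      L2.inner_def]
    refine integral_congr_ae ?_
    filter_upwards [mulPhase_coe (freePhase t) (continuous_freePhase t) (norm_freePhase t)
      ((𝓕 g).toLp 2), SchwartzMap.coeFn_toLp (𝓕 g) 2 volume,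
      SchwartzMap.coeFn_toLp (𝓕 f) 2 volume] with ξ h1 h2 h3
    rw [h1, h2, h3, RCLike.inner_apply, mul_comm, SchwartzMap.fourier_coe, SchwartzMap.fourier_coe]
  have e2 : ∀ ξ, conj (𝓕 (f : V → ℂ) ξ)
      = ∫ x, conj (f x) * Complex.exp (2 * Real.pi * Complex.I * inner ℝ x ξ) := by
    intro ξ
    rw [Real.fourier_eq, ← integral_conj]
    refine integral_congr_ae (Eventually.of_forall fun x => ?_)
    simp only [Circle.smul_def, smul_eq_mul, map_mul, Real.fourierChar_apply, ← Complex.exp_conj,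
      Complex.conj_ofReal, Complex.conj_I]
    rw [mul_comm]
    congr 2
    push_cast
    ring
  have hint : Integrable (fun p : V × V => (conj (f p.2) * Complex.exp (2 * Real.pi * Complex.I *
      inner ℝ p.2 p.1)) * (freePhase t p.1 * 𝓕 (g : V → ℂ) p.1)) (volume.prod volume) := by
    have h1 : Integrable (fun p : V × V => 𝓕 (g : V → ℂ) p.1 * conj (f p.2))
        (volume.prod volume) := hgi.mul_prod (f := 𝓕 (g : V → ℂ)) (g := fun x => conj (f x))
          (by simpa using (LinearIsometryEquiv.integrable_comp_iff Complex.conjLIE).2 f.integrable)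
    refine (h1.bdd_mul (c := 1) (f := fun p : V × V => freePhase t p.1 *
      Complex.exp (2 * Real.pi * Complex.I * inner ℝ p.2 p.1)) ?_ ?_).congr ?_
    · refine Continuous.aestronglyMeasurable ?_
      have := (continuous_freePhase (V := V) t).comp (continuous_fst (Y := V))
      exact this.mul (by fun_prop)
    · refine Eventually.of_forall fun p => ?_
      rw [norm_mul, norm_freePhase, one_mul]
      have : (2 * Real.pi * Complex.I * inner ℝ p.2 p.1 : ℂ)
        = ((2 * Real.pi * inner ℝ p.2 p.1 : ℝ) : ℂ) * Complex.I := by push_cast; ring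
      rw [this, Complex.norm_exp_ofReal_mul_I]
    · exact Eventually.of_forall fun p => by ring
  have e3 : inner ℂ (f.toLp 2 volume) (expLaplacian t (g.toLp 2 volume))
      = ∫ x, conj (f x) * ∫ ξ, 𝓕 (g : V → ℂ) ξ *
        (freePhase t ξ * Complex.exp (2 * Real.pi * Complex.I * inner ℝ x ξ)) := by
    rw [e1]
    simp only [e2, ← integral_mul_const]
    rw [integral_integral_swap hint]
    refine integral_congr_ae (Eventually.of_forall fun x => ?_)
    change _ = conj (f x) * _
    rw [← integral_const_mul]
    refine integral_congr_ae (Eventually.of_forall fun ξ => ?_)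
    change _ * _ * (_ * _) = _ * (_ * (_ * _))
    ring
  rw [e3]
  calc _ ≤ ∫ x, ‖f x‖ * ((4 * Real.pi * |t|) ^ (-(Module.finrank ℝ V / 2 : ℝ)) * ∫ y, ‖g y‖) := by
        refine norm_integral_le_of_norm_le (f.integrable.norm.mul_const _)
          (Eventually.of_forall fun x => ?_)
        rw [norm_mul, RCLike.norm_conj]
        exact mul_le_mul_of_nonneg_left (norm_evolution_le g ht x) (norm_nonneg _)
    _ = _ := by rw [integral_mul_const]; ring

/-- A bound for the decay in time of the correlations of normalized one-particle functions. -/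
def decayBound (d : ℕ) (t : ℝ) : ℝ := if t ≤ Real.pi then 1 else (Real.pi / t) ^ (d / 2 : ℝ)

lemma measurable_decayBound (d : ℕ) : Measurable (decayBound d) :=
  Measurable.ite measurableSet_Iic measurable_const (by fun_prop)

/-- The time integral of `decayBound` is `π d / (d - 2)`. -/
lemma lintegral_decayBound {d : ℕ} (hd : 3 ≤ d) :
    ∫⁻ t in Set.Ioi (0 : ℝ), ENNReal.ofReal (decayBound d t)
      = ENNReal.ofReal (Real.pi * d / (d - 2)) := by
  have hd' : (3 : ℝ) ≤ d := by exact_mod_cast hd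
  have hp : 1 < (d / 2 : ℝ) := by linarith
  have h0 : Set.Ioi (0 : ℝ) = Set.Ioc 0 Real.pi ∪ Set.Ioi Real.pi :=
    (Set.Ioc_union_Ioi_eq_Ioi Real.pi_pos.le).symm
  -- At `t = π` the dispersive bound equals the trivial one. The initial interval contributes `π`
  -- and the tail `π / (d/2 - 1)`, which requires `d > 2`.
  rw [h0, lintegral_union measurableSet_Ioi (Set.Ioc_disjoint_Ioi le_rfl)]
  have h1 : ∫⁻ t in Set.Ioc (0 : ℝ) Real.pi, ENNReal.ofReal (decayBound d t)
      = ENNReal.ofReal Real.pi := by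
    rw [setLIntegral_congr_fun (g := fun _ => 1) measurableSet_Ioc]
    · simp
    · intro t ht
      simp only [decayBound]
      rw [if_pos ht.2, ENNReal.ofReal_one]
  have h2 : ∫⁻ t in Set.Ioi Real.pi, ENNReal.ofReal (decayBound d t)
      = ENNReal.ofReal (Real.pi * (1 / (d / 2 - 1))) := by
    have hi : IntegrableOn (fun t : ℝ => Real.pi ^ (d / 2 : ℝ) * t ^ (-(d / 2 : ℝ)))
        (Set.Ioi Real.pi) :=
      (integrableOn_Ioi_rpow_of_lt (by linarith) Real.pi_pos).const_mul _
    have e : Set.EqOn (fun t => ENNReal.ofReal (decayBound d t))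
        (fun t => ENNReal.ofReal (Real.pi ^ (d / 2 : ℝ) * t ^ (-(d / 2 : ℝ)))) (Set.Ioi Real.pi) := by
      intro t ht
      have ht0 : 0 < t := Real.pi_pos.trans ht
      simp only [decayBound]
      rw [if_neg (not_le.2 ht),
        Real.div_rpow Real.pi_pos.le ht0.le, Real.rpow_neg ht0.le, div_eq_mul_inv]
    rw [setLIntegral_congr_fun measurableSet_Ioi e, ← ofReal_integral_eq_lintegral_ofReal hi,
      integral_const_mul, integral_Ioi_rpow_of_lt (by linarith) Real.pi_pos]
    · congr 1
      have h5 : Real.pi ^ (d / 2 : ℝ) * Real.pi ^ (-(d / 2 : ℝ) + 1) = Real.pi := by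
        rw [← Real.rpow_add Real.pi_pos]
        simp
      have h6 : (-(d / 2 : ℝ) + 1) ≠ 0 := by linarith
      have h7 : (d / 2 - 1 : ℝ) ≠ 0 := by linarith
      rw [mul_div_assoc', mul_neg, h5, one_div, ← div_eq_mul_inv, div_eq_div_iff h6 h7]
      ring
    · refine (ae_restrict_mem measurableSet_Ioi).mono fun t ht => ?_
      have ht0 : 0 < t := Real.pi_pos.trans ht
      change 0 ≤ Real.pi ^ (d / 2 : ℝ) * t ^ (-(d / 2 : ℝ))
      positivity
  rw [h1, h2, ← ENNReal.ofReal_add Real.pi_pos.le]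
  · congr 1
    have h7 : (d / 2 - 1 : ℝ) ≠ 0 := by linarith
    have h8 : (d - 2 : ℝ) ≠ 0 := by linarith
    field_simp
    ring
  · have : 0 < (d / 2 - 1 : ℝ) := by linarith
    positivity

end dispersion

/-! ### Integrability of products of three square integrable kernels -/

section triple

variable {α β γ : Type} [MeasureSpace α] [MeasureSpace β] [MeasureSpace γ]
  [SigmaFinite (volume : Measure α)] [SigmaFinite (volume : Measure β)]
  [SigmaFinite (volume : Measure γ)]

lemma lintegral_mul_le_sq {X : Type} [MeasurableSpace X] {μ : Measure X} {f g : X → ℝ≥0∞}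
    (hf : AEMeasurable f μ) (hg : AEMeasurable g μ) :
    ∫⁻ x, f x * g x ∂μ ≤ (∫⁻ x, f x ^ (2 : ℝ) ∂μ) ^ (1 / 2 : ℝ) * (∫⁻ x, g x ^ (2 : ℝ) ∂μ) ^ (1 / 2 : ℝ) :=
  ENNReal.lintegral_mul_le_Lp_mul_Lq μ Real.HolderConjugate.two_two hf hg

lemma rpow_half_sq (x : ℝ≥0∞) : (x ^ (1 / 2 : ℝ)) ^ (2 : ℝ) = x := by
  rw [← ENNReal.rpow_mul]
  norm_num

/-- The Hilbert–Schmidt bound for a product of three kernels. -/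
lemma lintegral_triple_le {A : α × γ → ℝ≥0∞} {W : α × β → ℝ≥0∞} {B : β × γ → ℝ≥0∞}
    (hA : Measurable A) (hW : Measurable W) (hB : Measurable B) :
    ∫⁻ q : α × (β × γ), A (q.1, q.2.2) * W (q.1, q.2.1) * B q.2
      ≤ (∫⁻ p, A p ^ (2 : ℝ)) ^ (1 / 2 : ℝ) * (∫⁻ p, W p ^ (2 : ℝ)) ^ (1 / 2 : ℝ)
        * (∫⁻ p, B p ^ (2 : ℝ)) ^ (1 / 2 : ℝ) := by
  -- `P` and `Q` are the `L²` norms of the slices. One Cauchy–Schwarz inequality over `z` produces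
  -- them, a second one over `(x, y)` separates them from `W`.
  let P : α → ℝ≥0∞ := fun x => (∫⁻ z, A (x, z) ^ (2 : ℝ)) ^ (1 / 2 : ℝ)
  let Q : β → ℝ≥0∞ := fun y => (∫⁻ z, B (y, z) ^ (2 : ℝ)) ^ (1 / 2 : ℝ)
  have hP : Measurable P := ((hA.pow_const 2).lintegral_prod_right').pow_const _
  have hQ : Measurable Q := ((hB.pow_const 2).lintegral_prod_right').pow_const _
  have e1 : ∫⁻ q : α × (β × γ), A (q.1, q.2.2) * W (q.1, q.2.1) * B q.2
      = ∫⁻ x, ∫⁻ y, W (x, y) * ∫⁻ z, A (x, z) * B (y, z) := by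
    rw [Measure.volume_eq_prod, lintegral_prod _ (by fun_prop)]
    refine lintegral_congr fun x => ?_
    rw [Measure.volume_eq_prod, lintegral_prod _ (by fun_prop)]
    refine lintegral_congr fun y => ?_
    rw [← lintegral_const_mul _ (by fun_prop)]
    refine lintegral_congr fun z => ?_
    ring
  rw [e1]
  calc ∫⁻ x, ∫⁻ y, W (x, y) * ∫⁻ z, A (x, z) * B (y, z)
      ≤ ∫⁻ x, ∫⁻ y, W (x, y) * (P x * Q y) := by
        refine lintegral_mono fun x => lintegral_mono fun y => mul_le_mul_right ?_ _
        exact lintegral_mul_le_sq (by fun_prop) (by fun_prop)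
    _ = ∫⁻ p : α × β, W p * (P p.1 * Q p.2) := by
        rw [Measure.volume_eq_prod, lintegral_prod _ (by fun_prop)]
    _ ≤ (∫⁻ p, W p ^ (2 : ℝ)) ^ (1 / 2 : ℝ)
        * (∫⁻ p : α × β, (P p.1 * Q p.2) ^ (2 : ℝ)) ^ (1 / 2 : ℝ) :=
        lintegral_mul_le_sq (by fun_prop) (by fun_prop)
    _ = _ := by
        have e2 : ∫⁻ p : α × β, (P p.1 * Q p.2) ^ (2 : ℝ)
            = (∫⁻ p, A p ^ (2 : ℝ)) * ∫⁻ p, B p ^ (2 : ℝ) := by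
          simp only [ENNReal.mul_rpow_of_nonneg _ _ zero_le_two, P, Q, rpow_half_sq]
          rw [Measure.volume_eq_prod, lintegral_prod_mul
            ((hA.pow_const 2).lintegral_prod_right').aemeasurable
            ((hB.pow_const 2).lintegral_prod_right').aemeasurable, Measure.volume_eq_prod,
            Measure.volume_eq_prod, lintegral_prod _ (hA.pow_const 2).aemeasurable,
            lintegral_prod _ (hB.pow_const 2).aemeasurable]
        rw [e2, ENNReal.mul_rpow_of_nonneg _ _ (by norm_num)]
        ring

lemma lintegral_enorm_triple_le {a : α × γ → ℂ} {w : α × β → ℂ} {b : β × γ → ℂ}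
    (ha : StronglyMeasurable a) (hw : StronglyMeasurable w) (hb : StronglyMeasurable b) :
    ∫⁻ q : α × (β × γ), ‖conj (a (q.1, q.2.2)) * w (q.1, q.2.1) * b q.2‖ₑ
      ≤ eLpNorm a 2 volume * eLpNorm w 2 volume * eLpNorm b 2 volume := by
  have h := lintegral_triple_le ha.measurable.enorm hw.measurable.enorm hb.measurable.enorm
  simp only [eLpNorm_eq_lintegral_rpow_enorm_toReal two_ne_zero ENNReal.ofNat_ne_top, ENNReal.toReal_ofNat]
  refine le_trans (le_of_eq ?_) h
  refine lintegral_congr fun q => ?_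
  rw [enorm_mul, enorm_mul, RCLike.enorm_conj]

lemma integrable_triple {a : α × γ → ℂ} {w : α × β → ℂ} {b : β × γ → ℂ}
    (ha : StronglyMeasurable a) (hw : StronglyMeasurable w) (hb : StronglyMeasurable b)
    (ha' : MemLp a 2 volume) (hw' : MemLp w 2 volume) (hb' : MemLp b 2 volume) :
    Integrable fun q : α × (β × γ) => conj (a (q.1, q.2.2)) * w (q.1, q.2.1) * b q.2 := by
  refine ⟨?_, ?_⟩
  · have h1 : StronglyMeasurable fun q : α × (β × γ) => conj (a (q.1, q.2.2)) :=
      Complex.continuous_conj.comp_stronglyMeasurable (ha.comp_measurable (by fun_prop))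
    exact ((h1.mul (hw.comp_measurable (by fun_prop))).mul
      (hb.comp_measurable measurable_snd)).aestronglyMeasurable
  · exact (lintegral_enorm_triple_le ha hw hb).trans_lt
      (ENNReal.mul_lt_top (ENNReal.mul_lt_top ha'.2 hw'.2) hb'.2)

lemma ae_pair {P : α × β → Prop} (h : ∀ᵐ p, P p) : ∀ᵐ q : α × (β × γ), P (q.1, q.2.1) :=
  (measurePreserving_prodAssoc volume volume volume).symm.quasiMeasurePreserving.ae
    (ae_fst (β := γ) h)

end triple

/-! ### Matrix elements as functionals of the kernel -/

section trilinear

variable {κ κ₁ κ₃ : Type} [Fintype κ] [Fintype κ₁] [Fintype κ₃]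

/-- The integrand of the matrix elements of a normally ordered operator. -/
def triIntegrand (e : κ₁ ⊕ κ₃ ≃ κ) (R : EuclideanSpace ℝ κ₁ ≃ₗᵢ[ℝ] EuclideanSpace ℝ κ₁)
    (φ ψ : L2 (EuclideanSpace ℝ κ)) (w : L2 (EuclideanSpace ℝ (κ₁ ⊕ κ₁)))
    (q : EuclideanSpace ℝ κ₁ × (EuclideanSpace ℝ κ₁ × EuclideanSpace ℝ κ₃)) : ℂ :=
  conj (φ (glue e (q.1, q.2.2))) * w (glue (Equiv.refl _) (q.1, q.2.1))
    * ψ (glue e (R q.2.1, q.2.2))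

variable (e : κ₁ ⊕ κ₃ ≃ κ) (R : EuclideanSpace ℝ κ₁ ≃ₗᵢ[ℝ] EuclideanSpace ℝ κ₁)
  (φ ψ : L2 (EuclideanSpace ℝ κ))

lemma measurePreserving_glue_comp :
    MeasurePreserving fun p : EuclideanSpace ℝ κ₁ × EuclideanSpace ℝ κ₃ => glue e (R p.1, p.2) :=
  (measurePreserving_glue e).comp (R.measurePreserving.prod (MeasurePreserving.id _))

lemma integrable_triIntegrand (w : L2 (EuclideanSpace ℝ (κ₁ ⊕ κ₁))) :
    Integrable (triIntegrand e R φ ψ w) :=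
  integrable_triple (a := fun p => φ (glue e p)) (w := fun p => w (glue (Equiv.refl _) p))
    (b := fun p => ψ (glue e (R p.1, p.2)))
    ((Lp.stronglyMeasurable φ).comp_measurable (glue e).measurable)
    ((Lp.stronglyMeasurable w).comp_measurable (glue _).measurable)
    ((Lp.stronglyMeasurable ψ).comp_measurable (measurePreserving_glue_comp e R).measurable)
    ((Lp.memLp φ).comp_measurePreserving (measurePreserving_glue e))
    ((Lp.memLp w).comp_measurePreserving (measurePreserving_glue _))
    ((Lp.memLp ψ).comp_measurePreserving (measurePreserving_glue_comp e R))

lemma norm_integral_triIntegrand_le (w : L2 (EuclideanSpace ℝ (κ₁ ⊕ κ₁))) :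
    ‖∫ q, triIntegrand e R φ ψ w q‖ ≤ ‖φ‖ * ‖ψ‖ * ‖w‖ := by
  have h := lintegral_enorm_triple_le (a := fun p => φ (glue e p))
    (w := fun p => w (glue (Equiv.refl _) p)) (b := fun p => ψ (glue e (R p.1, p.2)))
    ((Lp.stronglyMeasurable φ).comp_measurable (glue e).measurable)
    ((Lp.stronglyMeasurable w).comp_measurable (glue _).measurable)
    ((Lp.stronglyMeasurable ψ).comp_measurable (measurePreserving_glue_comp e R).measurable)
  have e1 : eLpNorm (fun p => φ (glue e p)) 2 volume = ‖φ‖ₑ :=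
    (eLpNorm_comp_measurePreserving (Lp.aestronglyMeasurable φ) (measurePreserving_glue e)).trans
      (Lp.enorm_def φ).symm
  have e2 : eLpNorm (fun p => w (glue (Equiv.refl _) p)) 2 volume = ‖w‖ₑ :=
    (eLpNorm_comp_measurePreserving (Lp.aestronglyMeasurable w) (measurePreserving_glue _)).trans
      (Lp.enorm_def w).symm
  have e3 : eLpNorm (fun p : EuclideanSpace ℝ κ₁ × EuclideanSpace ℝ κ₃ => ψ (glue e (R p.1, p.2)))
      2 volume = ‖ψ‖ₑ :=
    (eLpNorm_comp_measurePreserving (Lp.aestronglyMeasurable ψ)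
      (measurePreserving_glue_comp e R)).trans (Lp.enorm_def ψ).symm
  rw [e1, e2, e3] at h
  have h2 : ‖∫ q, triIntegrand e R φ ψ w q‖ₑ ≤ ‖φ‖ₑ * ‖w‖ₑ * ‖ψ‖ₑ :=
    (enorm_integral_le_lintegral_enorm _).trans h
  rw [← ofReal_norm, ← ofReal_norm, ← ofReal_norm, ← ofReal_norm,
    ← ENNReal.ofReal_mul (norm_nonneg _), ← ENNReal.ofReal_mul (by positivity),
    ENNReal.ofReal_le_ofReal_iff (by positivity)] at h2
  linarith

/-- The integral of `triIntegrand`, as a bounded functional of the kernel. -/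
def tri : L2 (EuclideanSpace ℝ (κ₁ ⊕ κ₁)) →L[ℂ] ℂ :=
  LinearMap.mkContinuous
    { toFun := fun w => ∫ q, triIntegrand e R φ ψ w q
      map_add' := fun w w' => by
        rw [← integral_add (integrable_triIntegrand e R φ ψ w) (integrable_triIntegrand e R φ ψ w')]
        refine integral_congr_ae ?_
        filter_upwards [ae_pair (γ := EuclideanSpace ℝ κ₃)
          ((ae_glue_iff (Equiv.refl (κ₁ ⊕ κ₁))).1 (Lp.coeFn_add w w'))] with q hq
        rw [triIntegrand, hq, Pi.add_apply, triIntegrand, triIntegrand]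
        ring
      map_smul' := fun c w => by
        rw [RingHom.id_apply, smul_eq_mul, ← integral_const_mul]
        refine integral_congr_ae ?_
        filter_upwards [ae_pair (γ := EuclideanSpace ℝ κ₃)
          ((ae_glue_iff (Equiv.refl (κ₁ ⊕ κ₁))).1 (Lp.coeFn_smul c w))] with q hq
        rw [triIntegrand, hq, Pi.smul_apply, triIntegrand, smul_eq_mul]
        ring }
    (‖φ‖ * ‖ψ‖) (norm_integral_triIntegrand_le e R φ ψ)

lemma tri_eq_iterated (w : L2 (EuclideanSpace ℝ (κ₁ ⊕ κ₁))) :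
    tri e R φ ψ w = ∫ X, ∫ Y, ∫ Z, triIntegrand e R φ ψ w (X, (Y, Z)) := by
  change ∫ q, triIntegrand e R φ ψ w q = _
  have h := integrable_triIntegrand e R φ ψ w
  rw [Measure.volume_eq_prod] at h ⊢
  rw [integral_prod _ h]
  refine integral_congr_ae ?_
  filter_upwards [h.prod_right_ae] with X hX
  rw [Measure.volume_eq_prod] at hX ⊢
  exact integral_prod _ hX

/-- For a product kernel the `X` and `Y` integrals separate at fixed `Z` into two contractions, and
the `Z` integral is their inner product. The hypothesis on `G` accounts for the reversed order of
the annihilated variables and for the conjugation in a contraction. -/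
lemma tri_tprod (F G G' : L2 (EuclideanSpace ℝ κ₁)) (hG : ∀ᵐ Y, G Y = conj (G' (R Y))) :
    tri e R φ ψ (tprod (Equiv.refl _) F G) = inner ℂ (contract e F φ) (contract e G' ψ) := by
  have hi := integrable_triIntegrand e R φ ψ (tprod (Equiv.refl _) F G)
  have ha : MeasurePreserving (MeasurableEquiv.prodAssoc :
      (EuclideanSpace ℝ κ₁ × EuclideanSpace ℝ κ₁) × EuclideanSpace ℝ κ₃ ≃ᵐ _) :=
    measurePreserving_prodAssoc _ _ _
  change ∫ q, triIntegrand e R φ ψ (tprod (Equiv.refl _) F G) q = _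
  rw [← ha.integral_comp']
  have hi2 := (ha.integrable_comp_emb (MeasurableEquiv.measurableEmbedding _)).2 hi
  let J : (EuclideanSpace ℝ κ₁ × EuclideanSpace ℝ κ₁) × EuclideanSpace ℝ κ₃ → ℂ := fun p =>
    (conj (φ (glue e (p.1.1, p.2))) * F p.1.1) * (conj (G' (R p.1.2)) * ψ (glue e (R p.1.2, p.2)))
  have hJ : (fun p => triIntegrand e R φ ψ (tprod (Equiv.refl _) F G)
      (MeasurableEquiv.prodAssoc p)) =ᵐ[volume] J := by
    filter_upwards [ae_fst (β := EuclideanSpace ℝ κ₃) (tprod_coe (Equiv.refl (κ₁ ⊕ κ₁)) F G),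
      ae_fst (β := EuclideanSpace ℝ κ₃) (ae_snd (α := EuclideanSpace ℝ κ₁) hG)] with p h1 h2
    change conj (φ (glue e (p.1.1, p.2))) * (tprod (Equiv.refl _) F G) (glue (Equiv.refl _) p.1)
      * ψ (glue e (R p.1.2, p.2)) = _
    rw [h1, h2]
    simp only [J]
    ring
  rw [integral_congr_ae hJ, Measure.volume_eq_prod,
    integral_prod_symm _ (by rw [← Measure.volume_eq_prod]; exact hi2.congr hJ), L2.inner_def]
  refine integral_congr_ae ?_
  filter_upwards [contract_coe e F φ, contract_coe e G' ψ] with Z h1 h2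
  rw [h1, h2, RCLike.inner_apply, ← integral_conj, Measure.volume_eq_prod]
  simp only [J]
  rw [integral_prod_mul (fun X => conj (φ (glue e (X, Z))) * F X)
    fun Y => conj (G' (R Y)) * ψ (glue e (R Y, Z)), mul_comm]
  congr 1
  · exact R.measurePreserving.integral_comp R.toHomeomorph.measurableEmbedding
      (fun Y => conj (G' Y) * ψ (glue e (Y, Z)))
  · refine integral_congr_ae (Eventually.of_forall fun X => ?_)
    simp only [map_mul, Complex.conj_conj]
    ring

end trilinear

/-! ### Wick products of Hermite functions -/

section wick

variable {d k : ℕ}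

/-- The coordinates of `append X Z`. -/
def appendIdx (d : ℕ) {N m K : ℕ} (h : K = N + m) :
    (Fin N × Fin d) ⊕ (Fin m × Fin d) ≃ Fin K × Fin d :=
  (Equiv.sumProdDistrib (Fin N) (Fin m) (Fin d)).symm.trans
    (Equiv.prodCongr (finSumFinEquiv.trans (finCongr h.symm)) (Equiv.refl (Fin d)))

lemma appendIdx_inl {N m K : ℕ} (h : K = N + m) (p : Fin N × Fin d) :
    appendIdx d h (Sum.inl p) = (Fin.cast h.symm (Fin.castAdd m p.1), p.2) := rfl

lemma appendIdx_inr {N m K : ℕ} (h : K = N + m) (p : Fin m × Fin d) :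
    appendIdx d h (Sum.inr p) = (Fin.cast h.symm (Fin.natAdd N p.1), p.2) := rfl

lemma append_eq_glue {N m : ℕ} (X : Conf d N) (Z : Conf d m) :
    append X Z = glue (appendIdx d rfl) (X, Z) := by
  refine eq_glue _ _ _ (fun p => ?_) fun p => ?_
  · exact Fin.append_left (fun i => X (i, p.2)) (fun i => Z (i, p.2)) p.1
  · exact Fin.append_right (fun i => X (i, p.2)) (fun i => Z (i, p.2)) p.1

lemma joined_eq_glue {N : ℕ} (X Y : Conf d N) : joined X Y = glue (Equiv.refl _) (X, Y) :=
  eq_glue _ _ _ (fun _ => rfl) fun _ => rfl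

lemma reverse_eq_permute {N : ℕ} (X : Conf d N) : reverse X = permute d Fin.revPerm X := by
  ext p
  rfl

lemma wickForm_eq_tri (w : Kernel d k) (N m : ℕ) (φ ψ : Fock d k) :
    wickForm w N m φ ψ = ((N + m).descFactorial N : ℂ) *
      ∑ s : Fin N → Label k, ∑ s' : Fin N → Label k, ∑ u : Fin m → Label k,
        tri (appendIdx d rfl) (permute d Fin.revPerm) (amplitude φ (N + m) (Fin.append s u))
          (amplitude ψ (N + m) (Fin.append (s' ∘ Fin.rev) u)) (w N s s') := by
  simp only [wickForm, tri_eq_iterated, triIntegrand, append_eq_glue, joined_eq_glue,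
    reverse_eq_permute]

/-- A one-particle function with only one component. -/
def oneP (l : Label k) (h : L2 (Space d)) : OneParticle d k := WithLp.toLp 2 (Pi.single l h)

lemma lower_oneP {n : ℕ} (l : Label k) (h : L2 (Space d)) (v : Sector d k (n + 1))
    (s : Fin n → Label k) :
    lower n (oneP l h) v s = contract (consIdx d n) h (v (Fin.cons l s)) := by
  rw [lower_apply, Finset.sum_eq_single l]
  · simp [oneP]
  · intro l' _ hl
    have : oneP l h l' = 0 := Pi.single_eq_of_ne (M := fun _ => L2 (Space d)) hl h
    rw [this, contract, map_zero, map_zero, zero_apply]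
  · simp

lemma norm_oneP (l : Label k) (h : L2 (Space d)) : ‖oneP l h‖ = ‖h‖ := by
  rw [PiLp.norm_eq_of_L2, Finset.sum_eq_single l]
  · simp [oneP]
  · intro l' _ hl
    have : oneP l h l' = 0 := Pi.single_eq_of_ne (M := fun _ => L2 (Space d)) hl h
    simp [this]
  · simp

/-- Products of annihilation operators of Hermite functions. -/
def annProd : ∀ N : ℕ, (Fin N → Label k) → (Fin N × Fin d → ℝ) → (Fin N × Fin d → ℕ) → Op d k
  | 0, _, _, _ => 1
  | N + 1, s, y, n =>
    annProd N (Fin.tail s) (fun p => y (p.1.succ, p.2)) (fun p => n (p.1.succ, p.2)) *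
      ann (oneP (s 0) (hermiteBasis (fun j => y (0, j)) fun j => n (0, j)))

lemma hermiteBasis_eq_tprod {κ κ₁ κ₂ : Type} [Fintype κ] [Fintype κ₁] [Fintype κ₂]
    (e : κ₁ ⊕ κ₂ ≃ κ) (y : κ → ℝ) (n : κ → ℕ) :
    hermiteBasis y n
      = tprod e (hermiteBasis (fun i => y (e (Sum.inl i))) (fun i => n (e (Sum.inl i))))
        (hermiteBasis (fun i => y (e (Sum.inr i))) (fun i => n (e (Sum.inr i)))) := by
  simp only [hermiteBasis_apply]
  exact hermiteUnit_toLp_eq_tprod e y n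

lemma norm_hermiteBasis {κ : Type} [Fintype κ] (y : κ → ℝ) (n : κ → ℕ) :
    ‖hermiteBasis y n‖ = 1 := by
  rw [hermiteBasis_apply, norm_hermiteUnit]

lemma norm_annProd_le : ∀ (N : ℕ) (s : Fin N → Label k) (y : Fin N × Fin d → ℝ)
    (n : Fin N × Fin d → ℕ), ‖annProd N s y n‖ ≤ 1
  | 0, _, _, _ => ContinuousLinearMap.norm_id_le
  | N + 1, s, y, n => by
    rw [annProd]
    refine (norm_mul_le _ _).trans (mul_le_one₀ (norm_annProd_le N _ _ _) (norm_nonneg _) ?_)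
    refine (norm_ann_le _).trans ?_
    rw [norm_oneP, norm_hermiteBasis]

lemma contract_contract {κ κ₁ κ₂ κ₃ κ₁₂ κ₂₃ : Type} [Fintype κ] [Fintype κ₁] [Fintype κ₂]
    [Fintype κ₃] [Fintype κ₁₂] [Fintype κ₂₃]
    (e₁ : κ₁ ⊕ κ₂₃ ≃ κ) (e₂ : κ₂ ⊕ κ₃ ≃ κ₂₃) (e₃ : κ₁₂ ⊕ κ₃ ≃ κ)
    (e₄ : κ₁ ⊕ κ₂ ≃ κ₁₂)
    (h : ∀ x y z, glue e₃ (glue e₄ (x, y), z) = glue e₁ (x, glue e₂ (y, z)))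
    (f₁ : L2 (EuclideanSpace ℝ κ₁)) (f₂ : L2 (EuclideanSpace ℝ κ₂))
    (v : L2 (EuclideanSpace ℝ κ)) :
    contract e₂ f₂ (contract e₁ f₁ v) = contract e₃ (tprod e₄ f₁ f₂) v := by
  refine ext_inner_left ℂ fun u => ?_
  simp only [contract, ContinuousLinearMap.adjoint_inner_right]
  rw [tprod_assoc e₁ e₂ e₃ e₄ h]

lemma contract_hermiteBasis_isEmpty {κ κ₁ : Type} [Fintype κ] [Fintype κ₁] [IsEmpty κ₁]
    (e : κ₁ ⊕ κ ≃ κ) (he : ∀ i, e (Sum.inr i) = i) (y : κ₁ → ℝ) (n : κ₁ → ℕ)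
    (v : L2 (EuclideanSpace ℝ κ)) : contract e (hermiteBasis y n) v = v := by
  have h1 : ∀ x, hermiteUnit y n x = 1 := by
    intro x
    have h2 : ‖(hermite y n).toLp 2 volume‖ = 1 := by
      have := norm_hermite_sq y n
      rw [Fintype.prod_empty] at this
      exact (pow_eq_one_iff_of_nonneg (norm_nonneg _) two_ne_zero).1 this
    rw [hermiteUnit, smul_apply, h2, hermite_apply, Fintype.prod_empty]
    simp
  refine ext_inner_left ℂ fun u => ?_
  rw [contract, ContinuousLinearMap.adjoint_inner_right]
  congr 1
  symm
  refine eq_tprod e ?_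
  rw [hermiteBasis_apply]
  filter_upwards [ae_fst (SchwartzMap.coeFn_toLp (hermiteUnit y n) 2 volume)] with p hp
  rw [hp, h1, one_mul]
  congr 1
  ext i
  rw [← he i, glue_inr, he]

/-- The amplitudes of a product of annihilation operators applied to a vector. -/
lemma amplitude_annProd {m : ℕ} (u : Fin m → Label k) :
    ∀ (N : ℕ) (s : Fin N → Label k) (y : Fin N × Fin d → ℝ) (n : Fin N × Fin d → ℕ) (ψ : Fock d k)
      (K : ℕ) (hK : K = N + m),
      amplitude (annProd N s y n ψ) m u = (√(K.descFactorial N : ℝ) : ℂ) •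
        contract (appendIdx d hK) (hermiteBasis y n)
          (amplitude ψ K (Fin.append s u ∘ Fin.cast hK))
  | 0, s, y, n, ψ, K, hK => by
    obtain rfl : K = m := by omega
    have h1 : Fin.append s u ∘ Fin.cast hK = u := by
      ext1 i
      have : Fin.cast hK i = Fin.natAdd 0 i := by ext; simp
      rw [Function.comp_apply, this, Fin.append_right]
    rw [h1, contract_hermiteBasis_isEmpty]
    · simp [annProd]
    · rintro ⟨i, j⟩
      rw [appendIdx_inr]
      congr 1
      ext
      simp
  | N + 1, s, y, n, ψ, K, hK => by
    -- The total particle number `K` is kept free up to an equation, because `(N + 1) + m` has to be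
    -- read as `(N + m) + 1` in order to contract the first particle.
    obtain ⟨K, rfl⟩ : ∃ K', K = K' + 1 := ⟨K - 1, by omega⟩
    have hK' : K = N + m := by omega
    rw [annProd, op_mul_apply, amplitude_annProd u N _ _ _ _ K hK', ← comp_apply (ann _ ψ), comp_ann,
      PiLp.smul_apply, lower_oneP, map_smul, smul_smul, Nat.succ_descFactorial_succ]
    congr 1
    · push_cast
      rw [← Complex.ofReal_mul, ← Real.sqrt_mul (by positivity), mul_comm]
    · have h1 : (Fin.cons (s 0) (Fin.append (Fin.tail s) u ∘ Fin.cast hK') : Fin (K + 1) → Label k)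
          = Fin.append s u ∘ Fin.cast hK := by
        ext1 i
        cases i using Fin.cases with
        | zero =>
          have : Fin.cast hK 0 = Fin.castAdd m 0 := by ext; simp
          rw [Fin.cons_zero, Function.comp_apply, this, Fin.append_left]
        | succ i =>
          obtain ⟨i, rfl⟩ : ∃ i', i = Fin.cast hK'.symm i' := ⟨Fin.cast hK' i, by simp⟩
          rw [Fin.cons_succ, Function.comp_apply, Function.comp_apply]
          cases i using Fin.addCases with
          | left i =>
            have : Fin.cast hK (Fin.cast hK'.symm (Fin.castAdd m i)).succ = Fin.castAdd m i.succ := by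
              ext; simp
            rw [this, Fin.append_left, Fin.cast_cast, Fin.cast_eq_self, Fin.append_left]
            rfl
          | right i =>
            have : Fin.cast hK (Fin.cast hK'.symm (Fin.natAdd N i)).succ = Fin.natAdd (N + 1) i := by
              ext; simp; omega
            rw [this, Fin.append_right, Fin.cast_cast, Fin.cast_eq_self, Fin.append_right]
      rw [h1, contract_contract (consIdx d K) (appendIdx d hK') (appendIdx d hK) (consIdx d N),
        hermiteBasis_eq_tprod (consIdx d N)]
      · rfl
      · intro X Y Z
        refine eq_glue _ _ _ (fun j => ?_) fun p => ?_
        · have : consIdx d K (Sum.inl j) = appendIdx d hK (Sum.inl (consIdx d N (Sum.inl j))) := by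
            rw [appendIdx_inl]
            refine Prod.ext (Fin.ext ?_) rfl
            rfl
          rw [this, glue_inl, glue_inl]
        · obtain ⟨p, rfl⟩ := (appendIdx d hK').surjective p
          cases p with
          | inl p =>
            have : consIdx d K (Sum.inr (appendIdx d hK' (Sum.inl p)))
                = appendIdx d hK (Sum.inl (consIdx d N (Sum.inr p))) := by
              rw [appendIdx_inl, appendIdx_inl]
              refine Prod.ext (Fin.ext ?_) rfl
              rfl
            rw [this, glue_inl, glue_inr, glue_inl]
          | inr p =>
            have : consIdx d K (Sum.inr (appendIdx d hK' (Sum.inr p)))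
                = appendIdx d hK (Sum.inr p) := by
              rw [appendIdx_inr, appendIdx_inr]
              refine Prod.ext (Fin.ext ?_) rfl
              simp [consIdx]
              omega
            rw [this, glue_inr, glue_inr]

/-- Hermite functions are real, and a relabelling of the coordinates permutes centres and indices
without changing the normalization. This is the hypothesis on `G` in `tri_tprod`. -/
lemma hermiteBasis_comp_rev {N : ℕ} (y : Fin N × Fin d → ℝ) (n : Fin N × Fin d → ℕ) :
    ∀ᵐ Y : Conf d N, hermiteBasis y n Y
      = conj (hermiteBasis (fun p => y (p.1.rev, p.2)) (fun p => n (p.1.rev, p.2))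
        (permute d Fin.revPerm Y)) := by
  let y' : Fin N × Fin d → ℝ := fun p => y (p.1.rev, p.2)
  let n' : Fin N × Fin d → ℕ := fun p => n (p.1.rev, p.2)
  let r : Equiv.Perm (Fin N × Fin d) := Equiv.prodCongr Fin.revPerm (Equiv.refl _)
  have h1 : ‖(hermite y' n').toLp 2 volume‖ = ‖(hermite y n).toLp 2 volume‖ := by
    have h2 : ‖(hermite y' n').toLp 2 volume‖ ^ 2 = ‖(hermite y n).toLp 2 volume‖ ^ 2 := by
      rw [norm_hermite_sq, norm_hermite_sq]
      exact Equiv.prod_comp r fun p => ∫ x, hermiteFun (n p) x ^ 2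
    exact (pow_left_inj₀ (norm_nonneg _) (norm_nonneg _) two_ne_zero).1 h2
  simp only [hermiteBasis_apply]
  filter_upwards [SchwartzMap.coeFn_toLp (hermiteUnit y n) 2 volume,
    (permute d Fin.revPerm).measurePreserving.quasiMeasurePreserving.ae
      (SchwartzMap.coeFn_toLp (hermiteUnit y' n') 2 volume)] with Y e1 e2
  rw [e1, e2, hermiteUnit, hermiteUnit, smul_apply, smul_apply, h1, smul_eq_mul, smul_eq_mul,
    map_mul, map_inv₀, Complex.conj_ofReal, hermite_apply, hermite_apply, map_prod]
  congr 1
  simp only [Complex.conj_ofReal]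
  refine (Equiv.prod_comp r _).symm.trans (Finset.prod_congr rfl fun p _ => ?_)
  rfl

/-- The normally ordered product of creation and annihilation operators of Hermite functions,
whose kernel is a Hermite function. -/
def wickWord {N : ℕ} (s s' : Fin N → Label k) (y : KernelIndex d N → ℝ) (n : KernelIndex d N → ℕ) :
    Op d k :=
  -- `annProd` applies its letter `0` first, so its adjoint has the creation operators in the order
  -- `1, …, N`. To obtain `a(Y_1) ⋯ a(Y_N)` the annihilation data have to be reversed.
  star (annProd N s (fun p => y (Sum.inl p)) fun p => n (Sum.inl p)) *
    annProd N (s' ∘ Fin.rev) (fun p => y (Sum.inr (p.1.rev, p.2)))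
      fun p => n (Sum.inr (p.1.rev, p.2))

lemma norm_wickWord_le {N : ℕ} (s s' : Fin N → Label k) (y : KernelIndex d N → ℝ)
    (n : KernelIndex d N → ℕ) : ‖wickWord s s' y n‖ ≤ 1 := by
  rw [wickWord]
  refine (norm_mul_le _ _).trans (mul_le_one₀ ?_ (norm_nonneg _) (norm_annProd_le N _ _ _))
  rw [norm_star]
  exact norm_annProd_le N _ _ _

/-- The contribution of the `m`-particle component to a matrix element. -/
def wickWordForm {N : ℕ} (s s' : Fin N → Label k) (m : ℕ) (φ ψ : Fock d k)
    (f : L2 (EuclideanSpace ℝ (KernelIndex d N))) : ℂ :=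
  ((N + m).descFactorial N : ℂ) * ∑ u : Fin m → Label k,
    tri (appendIdx d rfl) (permute d Fin.revPerm) (amplitude φ (N + m) (Fin.append s u))
      (amplitude ψ (N + m) (Fin.append (s' ∘ Fin.rev) u)) f

/-- A Hermite function of `(X, Y)` is a product, so the matrix element splits into two contractions.
The falling factorial is the product of the square roots from the two strings of annihilation
operators. -/
lemma wickWordForm_hermiteBasis {N : ℕ} (s s' : Fin N → Label k) (m : ℕ) (φ ψ : Fock d k)
    (y : KernelIndex d N → ℝ) (n : KernelIndex d N → ℕ) :
    wickWordForm s s' m φ ψ (hermiteBasis y n)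
      = inner ℂ (comp (annProd N s (fun p => y (Sum.inl p)) (fun p => n (Sum.inl p)) φ) m)
        (comp (annProd N (s' ∘ Fin.rev) (fun p => y (Sum.inr (p.1.rev, p.2)))
          (fun p => n (Sum.inr (p.1.rev, p.2))) ψ) m) := by
  rw [PiLp.inner_apply, wickWordForm, Finset.mul_sum]
  refine Finset.sum_congr rfl fun u _ => ?_
  have h1 := tri_tprod (appendIdx d rfl) (permute d Fin.revPerm)
    (amplitude φ (N + m) (Fin.append s u)) (amplitude ψ (N + m) (Fin.append (s' ∘ Fin.rev) u))
    (hermiteBasis (fun p => y (Sum.inl p)) fun p => n (Sum.inl p)) _ _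
    (hermiteBasis_comp_rev (fun p => y (Sum.inr p)) fun p => n (Sum.inr p))
  rw [comp_apply, comp_apply, amplitude_annProd u N _ _ _ φ (N + m) rfl,
    amplitude_annProd u N _ _ _ ψ (N + m) rfl, hermiteBasis_eq_tprod (Equiv.refl _) y n]
  simp only [Fin.cast_refl, Function.comp_id]
  rw [inner_smul_left, inner_smul_right, Complex.conj_ofReal, ← mul_assoc, ← Complex.ofReal_mul,
    Real.mul_self_sqrt (Nat.cast_nonneg _), Complex.ofReal_natCast]
  exact congrArg _ h1

end wick

/-- Sums out the fibre variable while keeping the particle number. It is applied twice, first to the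
Hermite indices and then to the labels. -/
lemma HasSum.regroup {Q : Type} {F : Q → Type} {f : (Σ q, F q) × ℕ → ℂ} {a : ℂ} (h : HasSum f a)
    {g : Q × ℕ → ℂ} (hg : ∀ q m, HasSum (fun x : F q => f (⟨q, x⟩, m)) (g (q, m))) :
    HasSum g a := by
  let e : (Σ p : Q × ℕ, F p.1) ≃ (Σ q, F q) × ℕ :=
    { toFun := fun x => (⟨x.1.1, x.2⟩, x.1.2)
      invFun := fun x => ⟨(x.1.1, x.2), x.1.2⟩
      left_inv := fun _ => rfl
      right_inv := fun _ => rfl }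
  exact (e.hasSum_iff.2 h).sigma fun p => hg p.1 p.2

/-! ### Hermite expansion of operators given by kernels -/

section expansion

variable {d k : ℕ}

/-- The number of particles and the labels of a kernel. -/
abbrev KernelLabel (k : ℕ) : Type :=
  Σ N : ℕ, (Fin (N + 1) → Label k) × (Fin (N + 1) → Label k)

/-- The indices of the Hermite expansion of a family of kernels. -/
abbrev WickIndex (d k : ℕ) : Type := Σ q : KernelLabel k, (KernelIndex d (q.1 + 1) → ℕ)

/-- The coefficients of the Hermite expansion of a family of kernels. -/
def wickCoeff (a : Kernel d k) (Y : ∀ q : KernelLabel k, KernelIndex d (q.1 + 1) → ℝ)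
    (i : WickIndex d k) : ℂ :=
  inner ℂ (hermiteBasis (Y i.1) i.2) (a (i.1.1 + 1) i.1.2.1 i.1.2.2)

/-- The operators of the Hermite expansion of a family of kernels. -/
def wickOp (Y : ∀ q : KernelLabel k, KernelIndex d (q.1 + 1) → ℝ) (i : WickIndex d k) : Op d k :=
  wickWord i.1.2.1 i.1.2.2 (Y i.1) i.2

/-- The bounds on the coefficients in terms of the norm of the kernels. -/
lemma exists_centers (a : Kernel d k) : ∃ Y : ∀ q : KernelLabel k, KernelIndex d (q.1 + 1) → ℝ,
    ∑' i : WickIndex d k, ‖wickCoeff a Y i‖ₑ * ENNReal.ofReal √(∏ p, (i.2 p + 1 : ℝ)) *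
      ((i.1.1 + 1 : ℕ) * 2 ^ (2 * (i.1.1 + 1))) ≤ 2 * kernelNormInf a := by
  choose Y hY using fun q : KernelLabel k =>
    exists_center_tsum_coeff_le (a (q.1 + 1) q.2.1 q.2.2)
  refine ⟨Y, ?_⟩
  -- There are `2dN` coordinates, so Cauchy–Schwarz costs `√(2^{2dN}) = 2^{dN}`. Together with
  -- `2^{2N}` this gives the weight `2^{(d+2)N}`.
  have hs : ∀ N : ℕ, ENNReal.ofReal √(2 ^ Fintype.card (KernelIndex d N)) = 2 ^ (d * N) := by
    intro N
    have : Fintype.card (KernelIndex d N) = 2 * (d * N) := by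
      simp [KernelIndex]
      ring
    rw [this, pow_mul', Real.sqrt_sq (by positivity), ENNReal.ofReal_pow (by norm_num)]
    norm_num
  rw [ENNReal.tsum_sigma']
  calc ∑' q : KernelLabel k, ∑' n : KernelIndex d (q.1 + 1) → ℕ,
        ‖wickCoeff a Y ⟨q, n⟩‖ₑ * ENNReal.ofReal √(∏ p, (n p + 1 : ℝ)) *
          ((q.1 + 1 : ℕ) * 2 ^ (2 * (q.1 + 1)))
      ≤ ∑' q : KernelLabel k, 2 * ((q.1 + 1 : ℕ) * 2 ^ ((d + 2) * (q.1 + 1)) *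
          ⨅ y, weightedNorm y (a (q.1 + 1) q.2.1 q.2.2)) := by
        refine ENNReal.tsum_le_tsum fun q => ?_
        rw [ENNReal.tsum_mul_right]
        refine (mul_le_mul_left (hY q) _).trans (le_of_eq ?_)
        rw [hs]
        ring
    _ = 2 * ∑' N : ℕ, ((N + 1 : ℕ) : ℝ≥0∞) * 2 ^ ((d + 2) * (N + 1)) *
          ∑ s : Fin (N + 1) → Label k, ∑ s' : Fin (N + 1) → Label k,
            ⨅ y, weightedNorm y (a (N + 1) s s') := by
        rw [ENNReal.tsum_mul_left, ENNReal.tsum_sigma']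
        congr 1
        refine tsum_congr fun N => ?_
        dsimp only
        rw [ENNReal.tsum_mul_left, tsum_fintype, Fintype.sum_prod_type]
    _ ≤ 2 * kernelNormInf a := by
        -- The words start at `N = 1`; the sum over `N + 1` is a subsum of the one that defines the
        -- norm.
        refine mul_le_mul_right ?_ _
        exact ENNReal.tsum_comp_le_tsum_of_injective (add_left_injective 1) _

lemma kernelNormInf_le (a : Kernel d k) : kernelNormInf a ≤ kernelNorm a := by
  unfold kernelNormInf kernelNorm kernelSum
  refine ENNReal.tsum_le_tsum fun N => mul_le_mul_right (Finset.sum_le_sum fun s _ =>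
    Finset.sum_le_sum fun s' _ => iInf_le _ 0) _

lemma one_le_sqrt_prod {κ : Type} [Fintype κ] (n : κ → ℕ) : 1 ≤ √(∏ i, (n i + 1 : ℝ)) := by
  refine Real.le_sqrt_of_sq_le ?_
  calc (1 : ℝ) ^ 2 = ∏ _i : κ, (1 : ℝ) := by simp
    _ ≤ ∏ i, (n i + 1 : ℝ) := Finset.prod_le_prod (fun _ _ => zero_le_one) fun i _ => by
      have : (0 : ℝ) ≤ n i := Nat.cast_nonneg _
      linarith

lemma summable_wickCoeff {a : Kernel d k} {Y : ∀ q : KernelLabel k, KernelIndex d (q.1 + 1) → ℝ}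
    (h : ∑' i : WickIndex d k, ‖wickCoeff a Y i‖ₑ * ENNReal.ofReal √(∏ p, (i.2 p + 1 : ℝ)) *
      ((i.1.1 + 1 : ℕ) * 2 ^ (2 * (i.1.1 + 1))) ≠ ⊤) : Summable fun i => ‖wickCoeff a Y i‖ := by
  have h2 : ∑' i, ‖wickCoeff a Y i‖ₑ ≠ ⊤ := by
    refine ne_top_of_le_ne_top h (ENNReal.tsum_le_tsum fun i => ?_)
    have h1 : (1 : ℝ≥0∞) ≤ ENNReal.ofReal √(∏ p, (i.2 p + 1 : ℝ)) := by
      rw [← ENNReal.ofReal_one]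
      exact ENNReal.ofReal_le_ofReal (one_le_sqrt_prod _)
    have h2 : (1 : ℝ≥0∞) ≤ (i.1.1 + 1 : ℕ) := by
      exact_mod_cast Nat.succ_le_succ (Nat.zero_le _)
    have h3 : (1 : ℝ≥0∞) ≤ 2 ^ (2 * (i.1.1 + 1)) := one_le_pow₀ one_le_two
    calc ‖wickCoeff a Y i‖ₑ = ‖wickCoeff a Y i‖ₑ * 1 * (1 * 1) := by ring
      _ ≤ _ := by gcongr
  simpa only [toReal_enorm] using ENNReal.summable_toReal h2

lemma hasSum_wickWordForm {N : ℕ} (s s' : Fin N → Label k) (φ ψ : Fock d k)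
    (y : KernelIndex d N → ℝ) (n : KernelIndex d N → ℕ) :
    HasSum (fun m => wickWordForm s s' m φ ψ (hermiteBasis y n))
      (inner ℂ φ (wickWord s s' y n ψ)) := by
  refine HasSum.congr_fun (f := fun m =>
    inner ℂ (comp (annProd N s (fun p => y (Sum.inl p)) (fun p => n (Sum.inl p)) φ) m)
      (comp (annProd N (s' ∘ Fin.rev) (fun p => y (Sum.inr (p.1.rev, p.2)))
        (fun p => n (Sum.inr (p.1.rev, p.2))) ψ) m)) ?_ fun m =>
    wickWordForm_hermiteBasis s s' m φ ψ y n
  rw [wickWord, op_mul_apply, ContinuousLinearMap.star_eq_adjoint,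
    ContinuousLinearMap.adjoint_inner_right]
  exact hasSum_inner_comp _ _

/-- The bound does not depend on the Hermite index, since the products of annihilation operators are
contractions. Summability of the coefficients therefore gives absolute convergence in the index and
the particle number jointly. -/
lemma summable_wickWordForm {N : ℕ} (s s' : Fin N → Label k) (φ ψ : Fock d k)
    (y : KernelIndex d N → ℝ) (n : KernelIndex d N → ℕ) :
    Summable (fun m => ‖wickWordForm s s' m φ ψ (hermiteBasis y n)‖) ∧
      ∑' m, ‖wickWordForm s s' m φ ψ (hermiteBasis y n)‖ ≤ ‖φ‖ ^ 2 + ‖ψ‖ ^ 2 := by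
  set S₁ : Op d k := annProd N s (fun p => y (Sum.inl p)) fun p => n (Sum.inl p) with hS₁
  set S₂ : Op d k := annProd N (s' ∘ Fin.rev)
    (fun p => y (Sum.inr (p.1.rev, p.2))) fun p => n (Sum.inr (p.1.rev, p.2)) with hS₂
  have hle : ∀ (T : Op d k) (χ : Fock d k), ‖T‖ ≤ 1 → ‖T χ‖ ^ 2 ≤ ‖χ‖ ^ 2 := fun T χ hT =>
    pow_le_pow_left₀ (norm_nonneg _)
      ((T.le_of_opNorm_le_of_le hT le_rfl).trans_eq (one_mul _)) 2
  have hb : ∀ m, ‖wickWordForm s s' m φ ψ (hermiteBasis y n)‖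
      ≤ ‖comp (S₁ φ) m‖ ^ 2 + ‖comp (S₂ ψ) m‖ ^ 2 := by
    intro m
    rw [wickWordForm_hermiteBasis, ← hS₁, ← hS₂]
    refine (norm_inner_le_norm _ _).trans ?_
    nlinarith [sq_nonneg (‖comp (S₁ φ) m‖ - ‖comp (S₂ ψ) m‖), sq_nonneg ‖comp (S₁ φ) m‖,
      sq_nonneg ‖comp (S₂ ψ) m‖]
  have hsum := (hasSum_norm_comp_sq (S₁ φ)).add (hasSum_norm_comp_sq (S₂ ψ))
  have hsm := Summable.of_nonneg_of_le (fun _ => norm_nonneg _) hb hsum.summable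
  exact ⟨hsm, (hasSum_le hb hsm.hasSum hsum).trans
    (add_le_add (hle _ _ (norm_annProd_le _ _ _ _)) (hle _ _ (norm_annProd_le _ _ _ _)))⟩

/-- The matrix elements with a fixed kernel, as a functional of the kernel. -/
def wickWordCLM {N : ℕ} (s s' : Fin N → Label k) (m : ℕ) (φ ψ : Fock d k) :
    L2 (EuclideanSpace ℝ (KernelIndex d N)) →L[ℂ] ℂ :=
  ((N + m).descFactorial N : ℂ) • ∑ u : Fin m → Label k,
    tri (appendIdx d rfl) (permute d Fin.revPerm) (amplitude φ (N + m) (Fin.append s u))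
      (amplitude ψ (N + m) (Fin.append (s' ∘ Fin.rev) u))

lemma wickWordCLM_apply {N : ℕ} (s s' : Fin N → Label k) (m : ℕ) (φ ψ : Fock d k)
    (f : L2 (EuclideanSpace ℝ (KernelIndex d N))) :
    wickWordCLM s s' m φ ψ f = wickWordForm s s' m φ ψ f := by
  rw [wickWordCLM, wickWordForm, smul_apply, sum_apply, smul_eq_mul]

lemma hasSum_wickWordForm_expansion {N : ℕ} (s s' : Fin N → Label k) (m : ℕ) (φ ψ : Fock d k)
    (y : KernelIndex d N → ℝ) (f : L2 (EuclideanSpace ℝ (KernelIndex d N))) :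
    HasSum (fun n => inner ℂ (hermiteBasis y n) f * wickWordForm s s' m φ ψ (hermiteBasis y n))
      (wickWordForm s s' m φ ψ f) := by
  have h := ((hermiteBasis y).hasSum_repr f).mapL (wickWordCLM s s' m φ ψ)
  rw [wickWordCLM_apply] at h
  refine h.congr_fun fun n => ?_
  rw [map_smul, wickWordCLM_apply, (hermiteBasis y).repr_apply_apply, smul_eq_mul]

lemma wickForm_eq_sum (a : Kernel d k) (N m : ℕ) (φ ψ : Fock d k) :
    wickForm a N m φ ψ = ∑ x : (Fin N → Label k) × (Fin N → Label k),
      wickWordForm x.1 x.2 m φ ψ (a N x.1 x.2) := by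
  rw [wickForm_eq_tri, Fintype.sum_prod_type, Finset.mul_sum]
  refine Finset.sum_congr rfl fun s _ => ?_
  rw [Finset.mul_sum]
  refine Finset.sum_congr rfl fun s' _ => ?_
  rw [wickWordForm]

/-- The terms of the expansion of a matrix element. -/
def wickTerm (a : Kernel d k) (Y : ∀ q : KernelLabel k, KernelIndex d (q.1 + 1) → ℝ)
    (φ ψ : Fock d k) (x : WickIndex d k × ℕ) : ℂ :=
  wickCoeff a Y x.1 * wickWordForm x.1.1.2.1 x.1.1.2.2 x.2 φ ψ (hermiteBasis (Y x.1.1) x.1.2)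

lemma hasSum_wickTerm (a : Kernel d k) (Y : ∀ q : KernelLabel k, KernelIndex d (q.1 + 1) → ℝ)
    (φ ψ : Fock d k) (i : WickIndex d k) : HasSum (fun m => wickTerm a Y φ ψ (i, m))
      (wickCoeff a Y i * inner ℂ φ (wickOp Y i ψ)) := by
  have h := (hasSum_wickWordForm i.1.2.1 i.1.2.2 φ ψ (Y i.1) i.2).mul_left (wickCoeff a Y i)
  simpa only [wickTerm, wickOp] using h

lemma summable_wickTerm_fiber (a : Kernel d k)
    (Y : ∀ q : KernelLabel k, KernelIndex d (q.1 + 1) → ℝ) (φ ψ : Fock d k) (i : WickIndex d k) :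
    Summable (fun m => ‖wickTerm a Y φ ψ (i, m)‖) ∧
      ∑' m, ‖wickTerm a Y φ ψ (i, m)‖ ≤ ‖wickCoeff a Y i‖ * (‖φ‖ ^ 2 + ‖ψ‖ ^ 2) := by
  obtain ⟨h1, h2⟩ := summable_wickWordForm i.1.2.1 i.1.2.2 φ ψ (Y i.1) i.2
  simp only [wickTerm, norm_mul]
  refine ⟨h1.mul_left _, ?_⟩
  rw [tsum_mul_left]
  exact mul_le_mul_of_nonneg_left h2 (norm_nonneg _)

lemma hasSum_wickForm_of_hasSum {a : Kernel d k}
    (Y : ∀ q : KernelLabel k, KernelIndex d (q.1 + 1) → ℝ) {φ ψ : Fock d k} {c : ℂ}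
    (h : HasSum (wickTerm a Y φ ψ) c) :
    HasSum (fun p : ℕ × ℕ => wickForm a (p.1 + 1) p.2 φ ψ) c := by
  have hq : HasSum (fun x : KernelLabel k × ℕ =>
      wickWordForm x.1.2.1 x.1.2.2 x.2 φ ψ (a (x.1.1 + 1) x.1.2.1 x.1.2.2)) c := by
    refine HasSum.regroup (F := fun q : KernelLabel k => KernelIndex d (q.1 + 1) → ℕ) h
      fun q m => ?_
    dsimp only [wickTerm, wickCoeff]
    exact hasSum_wickWordForm_expansion q.2.1 q.2.2 m φ ψ (Y q) (a (q.1 + 1) q.2.1 q.2.2)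
  refine HasSum.regroup (F := fun N => (Fin (N + 1) → Label k) × (Fin (N + 1) → Label k)) hq
    fun N m => ?_
  dsimp only
  rw [wickForm_eq_sum]
  exact hasSum_fintype fun x : (Fin (N + 1) → Label k) × (Fin (N + 1) → Label k) =>
    wickWordForm x.1 x.2 m φ ψ (a (N + 1) x.1 x.2)

/-- One absolutely convergent double series is summed in two ways: over particle numbers first it
gives the matrix element of the operator series, over Hermite indices first it gives the form of the
kernel. -/
lemma hasSum_wickOp {a : Kernel d k} {Y : ∀ q : KernelLabel k, KernelIndex d (q.1 + 1) → ℝ}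
    (h : Summable fun i => ‖wickCoeff a Y i‖) :
    ∃ A : Op d k, HasSum (fun i => wickCoeff a Y i • wickOp Y i) A ∧ IsWickOperator a A := by
  have hs : Summable fun i => wickCoeff a Y i • wickOp Y i := by
    refine Summable.of_norm_bounded h fun i => ?_
    rw [norm_smul]
    exact mul_le_of_le_one_right (norm_nonneg _) (norm_wickWord_le _ _ _ _)
  refine ⟨_, hs.hasSum, fun φ ψ => ?_⟩
  obtain ⟨A, hA0⟩ := hs
  rw [hA0.tsum_eq]
  have hvs : Summable (wickTerm a Y φ ψ) := by
    refine Summable.of_norm ?_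
    rw [summable_prod_of_nonneg fun _ => norm_nonneg _]
    exact ⟨fun i => (summable_wickTerm_fiber a Y φ ψ i).1, Summable.of_nonneg_of_le
      (fun i => tsum_nonneg fun _ => norm_nonneg _)
      (fun i => (summable_wickTerm_fiber a Y φ ψ i).2) (h.mul_right _)⟩
  have hA : HasSum (fun i => wickCoeff a Y i * inner ℂ φ (wickOp Y i ψ)) (inner ℂ φ (A ψ)) := by
    have h1 := (hA0.mapL (ContinuousLinearMap.apply ℂ (Fock d k) ψ)).mapL (innerSL ℂ φ)
    refine h1.congr_fun fun i => ?_
    rw [ContinuousLinearMap.apply_apply, smul_apply, innerSL_apply_apply, inner_smul_right]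
  have h1 := hvs.hasSum.prod_fiberwise (hasSum_wickTerm a Y φ ψ)
  have h2 := hvs.hasSum
  rw [h1.unique hA] at h2
  exact hasSum_wickForm_of_hasSum Y h2

lemma IsWickOperator.unique {a : Kernel d k} {A B : Op d k} (hA : IsWickOperator a A)
    (hB : IsWickOperator a B) : A = B := by
  ext1 ψ
  exact ext_inner_left ℂ fun φ => (hA φ ψ).unique (hB φ ψ)

lemma annProd_mem_fieldAlgebra : ∀ (N : ℕ) (s : Fin N → Label k) (y : Fin N × Fin d → ℝ)
    (n : Fin N × Fin d → ℕ), annProd N s y n ∈ fieldAlgebra d k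
  | 0, _, _, _ => one_mem _
  | N + 1, _, _, _ => mul_mem (annProd_mem_fieldAlgebra N _ _ _) (ann_mem_fieldAlgebra _)

lemma wickOp_mem_fieldAlgebra (Y : ∀ q : KernelLabel k, KernelIndex d (q.1 + 1) → ℝ)
    (i : WickIndex d k) : wickOp Y i ∈ fieldAlgebra d k :=
  mul_mem (star_mem (annProd_mem_fieldAlgebra _ _ _ _)) (annProd_mem_fieldAlgebra _ _ _ _)

lemma exists_wickOperator {a : Kernel d k} (ha : kernelNormInf a < ⊤) :
    ∃ A ∈ fieldAlgebra d k, IsWickOperator a A := by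
  obtain ⟨Y, hY⟩ := exists_centers a
  have hs := summable_wickCoeff (ne_top_of_le_ne_top (ENNReal.mul_ne_top ENNReal.ofNat_ne_top ha.ne) hY)
  obtain ⟨A, hA, hw⟩ := hasSum_wickOp hs
  exact ⟨A, isClosed_fieldAlgebra.mem_of_tendsto hA (Eventually.of_forall fun s =>
    sum_mem fun i _ => (fieldAlgebra d k).smul_mem (wickOp_mem_fieldAlgebra Y i) _), hw⟩

end expansion

/-! ### The fields and the dispersive system of a family of kernels -/

section fields

variable {d k : ℕ}

/-- The indices of the normalized fields: creation or annihilation, label, and wave function. -/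
abbrev FieldLabel (d k : ℕ) : Type :=
  Bool × Label k × {g : 𝓢(Space d, ℂ) //
    ‖g.toLp 2 volume‖ ≤ 1 ∧ ∫ x, ‖g x‖ ≤ √((2 * Real.pi) ^ d)}

/-- The wave function of a field. -/
def waveOf (i : FieldLabel d k) : OneParticle d k := oneP i.2.1 (i.2.2.1.toLp 2 volume)

/-- The normalized fields. -/
def fieldOp (i : FieldLabel d k) : Op d k :=
  if i.1 then star (ann (waveOf i)) else ann (waveOf i)

lemma norm_waveOf_le (i : FieldLabel d k) : ‖waveOf i‖ ≤ 1 := by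
  rw [waveOf, norm_oneP]
  exact i.2.2.2.1

lemma norm_fieldOp_le (i : FieldLabel d k) : ‖fieldOp i‖ ≤ 1 := by
  have h := (norm_ann_le (waveOf i)).trans (norm_waveOf_le i)
  rw [fieldOp]
  split_ifs
  · rwa [norm_star]
  · exact h

lemma mapOne_oneP (T : L2 (Space d) →ₗᵢ[ℂ] L2 (Space d)) (l : Label k) (h : L2 (Space d)) :
    mapOne T (oneP l h) = oneP l (T h) := by
  ext1 l'
  by_cases hl : l' = l
  · subst hl
    simp [mapOne, oneP]
  · simp [mapOne, oneP, hl]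

lemma inner_oneP (l l' : Label k) (f g : L2 (Space d)) :
    inner ℂ (oneP l f) (oneP l' g) = if l = l' then inner ℂ f g else 0 := by
  rw [PiLp.inner_apply, Finset.sum_eq_single l]
  · split_ifs with h
    · subst h
      simp [oneP]
    · simp [oneP, h]
  · intro j _ hj
    simp [oneP, hj]
  · simp

lemma decayBound_nonneg (d : ℕ) {t : ℝ} (ht : 0 ≤ t) : 0 ≤ decayBound d t := by
  rw [decayBound]
  split_ifs
  · exact zero_le_one
  · positivity

/-- For `|t| ≤ π` this is Cauchy–Schwarz. Beyond, the dispersive estimate and the two `L¹` bounds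
give `(4π|t|)^{-d/2} (2π)^d = (π/|t|)^{d/2}`. -/
lemma norm_inner_waveOf_le (i j : FieldLabel d k) (t : ℝ) :
    ‖inner ℂ (waveOf i) (mapOne (expLaplacian t) (waveOf j))‖ ≤ decayBound d |t| := by
  rw [waveOf, waveOf, mapOne_oneP, inner_oneP]
  split_ifs
  swap
  · rw [norm_zero]
    exact decayBound_nonneg d (abs_nonneg t)
  obtain ⟨-, -, f, hf2, hf1⟩ := i
  obtain ⟨-, -, g, hg2, hg1⟩ := j
  dsimp only
  rw [decayBound]
  split_ifs with h
  · refine (norm_inner_le_norm _ _).trans ?_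
    rw [LinearIsometry.norm_map]
    exact mul_le_one₀ hf2 (norm_nonneg _) hg2
  have ht : 0 < |t| := Real.pi_pos.trans (not_le.1 h)
  refine (norm_inner_expLaplacian_le f g (abs_pos.1 ht)).trans ?_
  have h1 : (∫ x, ‖f x‖) * ∫ x, ‖g x‖ ≤ (2 * Real.pi) ^ d := by
    refine (mul_le_mul hf1 hg1 (integral_nonneg fun _ => norm_nonneg _)
      (Real.sqrt_nonneg _)).trans (le_of_eq (Real.mul_self_sqrt (by positivity)))
  rw [mul_assoc]
  refine (mul_le_mul_of_nonneg_left h1 (by positivity)).trans (le_of_eq ?_)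
  have h2 : (2 * Real.pi) ^ d = ((2 * Real.pi) ^ 2) ^ (d / 2 : ℝ) := by
    rw [← Real.rpow_natCast (2 * Real.pi) 2, ← Real.rpow_mul (by positivity),
      ← Real.rpow_natCast]
    congr 1
    push_cast
    ring
  rw [h2, finrank_euclideanSpace, Fintype.card_fin, Real.rpow_neg (by positivity),
    ← Real.inv_rpow (by positivity), ← Real.mul_rpow (by positivity) (by positivity)]
  congr 1
  field_simp
  ring

lemma freeDynamics_star (t : ℝ) (a : Op d k) : freeDynamics t (star a) = star (freeDynamics t a) :=
  Ad_star _ _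

lemma anticommutator_fieldOp (i j : FieldLabel d k) (t : ℝ) :
    ∃ c : ℂ, ‖c‖ ≤ decayBound d |t| ∧
      fieldOp i * freeDynamics t (fieldOp j) + freeDynamics t (fieldOp j) * fieldOp i
        = c • (1 : Op d k) := by
  have hz : ‖(0 : ℂ)‖ ≤ decayBound d |t| := by
    rw [norm_zero]
    exact decayBound_nonneg d (abs_nonneg t)
  have h := norm_inner_waveOf_le i j t
  unfold fieldOp
  split_ifs
  · refine ⟨0, hz, ?_⟩
    rw [freeDynamics_star, freeDynamics_ann, ← star_mul, ← star_mul, ← star_add, zero_smul,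
      ann_mul_ann_add, star_zero]
  · refine ⟨conj (inner ℂ (waveOf i) (mapOne (expLaplacian t) (waveOf j))), ?_, ?_⟩
    · rwa [RCLike.norm_conj]
    · rw [freeDynamics_ann, add_comm, ann_mul_star_ann_add, inner_conj_symm]
  · refine ⟨_, h, ?_⟩
    rw [freeDynamics_star, freeDynamics_ann, ann_mul_star_ann_add]
  · refine ⟨0, hz, ?_⟩
    rw [freeDynamics_ann, zero_smul, ann_mul_ann_add]

/-- A Hermite function, scaled to be the wave function of a field. -/
def scaledHermite (y : Fin d → ℝ) (n : Fin d → ℕ) : {g : 𝓢(Space d, ℂ) //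
    ‖g.toLp 2 volume‖ ≤ 1 ∧ ∫ x, ‖g x‖ ≤ √((2 * Real.pi) ^ d)} :=
  ⟨((√(∏ j, (n j + 1 : ℝ)) : ℂ)⁻¹) • hermiteUnit y n, by
    have h0 := one_le_sqrt_prod n
    have hp : 0 < √(∏ j, (n j + 1 : ℝ)) := zero_lt_one.trans_le h0
    constructor
    · rw [toLp_smul, norm_smul, norm_hermiteUnit, mul_one, norm_inv, Complex.norm_real,
        Real.norm_eq_abs, abs_of_pos hp]
      exact inv_le_one_of_one_le₀ h0
    · have h1 := integral_norm_hermite_le y n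
      have h2 := norm_hermite_pos y n
      rw [Fintype.card_fin] at h1
      have e : ∀ x, ‖((((√(∏ j, (n j + 1 : ℝ)) : ℂ)⁻¹) • hermiteUnit y n :
          𝓢(Space d, ℂ)) x)‖ = (√(∏ j, (n j + 1 : ℝ)))⁻¹ * ‖(hermite y n).toLp 2 volume‖⁻¹
            * ‖hermite y n x‖ := by
        intro x
        rw [hermiteUnit, smul_apply, smul_apply, norm_smul, norm_smul, norm_inv, norm_inv,
          Complex.norm_real, Complex.norm_real, norm_norm, Real.norm_eq_abs, abs_of_pos hp,
          mul_assoc]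
      simp only [e]
      rw [integral_const_mul]
      refine (mul_le_mul_of_nonneg_left h1 (by positivity)).trans (le_of_eq ?_)
      field_simp⟩

lemma ann_oneP_hermiteBasis (l : Label k) (y : Fin d → ℝ) (n : Fin d → ℕ) :
    ann (oneP l (hermiteBasis y n))
      = (√(∏ j, (n j + 1 : ℝ)) : ℂ) • fieldOp (false, l, scaledHermite y n) := by
  have hp : (√(∏ j, (n j + 1 : ℝ)) : ℂ) ≠ 0 := by
    exact_mod_cast (zero_lt_one.trans_le (one_le_sqrt_prod n)).ne'
  have h1 : oneP l (hermiteBasis y n)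
      = (√(∏ j, (n j + 1 : ℝ)) : ℂ) • waveOf (false, l, scaledHermite y n) := by
    rw [waveOf, scaledHermite]
    dsimp only
    rw [toLp_smul, hermiteBasis_apply]
    ext1 l'
    rw [PiLp.smul_apply]
    by_cases hl : l' = l
    · subst hl
      simp [oneP, smul_smul, mul_inv_cancel₀ hp]
    · simp [oneP, hl]
  rw [h1, ann_smul, Complex.conj_ofReal]
  rfl

/-- The word of fields of a product of annihilation operators of Hermite functions. -/
def annWord : ∀ N : ℕ, (Fin N → Label k) → (Fin N × Fin d → ℝ) → (Fin N × Fin d → ℕ) →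
    List (FieldLabel d k)
  | 0, _, _, _ => []
  | N + 1, s, y, n =>
    annWord N (Fin.tail s) (fun p => y (p.1.succ, p.2)) (fun p => n (p.1.succ, p.2)) ++
      [(false, s 0, scaledHermite (fun j => y (0, j)) fun j => n (0, j))]

lemma length_annWord : ∀ (N : ℕ) (s : Fin N → Label k) (y : Fin N × Fin d → ℝ)
    (n : Fin N × Fin d → ℕ), (annWord N s y n).length = N
  | 0, _, _, _ => rfl
  | N + 1, s, y, n => by
    rw [annWord, List.length_append, length_annWord N, List.length_singleton]

lemma annProd_eq : ∀ (N : ℕ) (s : Fin N → Label k) (y : Fin N × Fin d → ℝ)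
    (n : Fin N × Fin d → ℕ), annProd N s y n
      = (√(∏ p, (n p + 1 : ℝ)) : ℂ) • ((annWord N s y n).map fieldOp).prod
  | 0, _, _, _ => by simp [annProd, annWord]
  | N + 1, s, y, n => by
    have h1 : ∏ p : Fin (N + 1) × Fin d, (n p + 1 : ℝ)
        = (∏ p : Fin N × Fin d, (n (p.1.succ, p.2) + 1 : ℝ)) * ∏ j : Fin d, (n (0, j) + 1 : ℝ) := by
      rw [Fintype.prod_prod_type, Fin.prod_univ_succ, mul_comm, Fintype.prod_prod_type]
    rw [annProd, annProd_eq N, ann_oneP_hermiteBasis, annWord, List.map_append, List.prod_append,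
      smul_mul_smul_comm, h1, Real.sqrt_mul (Finset.prod_nonneg fun _ _ => by positivity),
      Complex.ofReal_mul]
    simp

/-- The adjoint of a field. -/
def adjointLabel (i : FieldLabel d k) : FieldLabel d k := (!i.1, i.2)

lemma fieldOp_adjointLabel (i : FieldLabel d k) : fieldOp (adjointLabel i) = star (fieldOp i) := by
  obtain ⟨b, i⟩ := i
  cases b
  · rfl
  · exact (star_star _).symm

lemma star_prod_fieldOp (L : List (FieldLabel d k)) : star (L.map fieldOp).prod
    = ((L.reverse.map adjointLabel).map fieldOp).prod := by
  induction L with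
  | nil => simp
  | cons i L ih =>
    simp only [List.map_cons, List.prod_cons, star_mul, ih, List.reverse_cons, List.map_append,
      List.prod_append, List.map_nil, List.prod_nil, mul_one, fieldOp_adjointLabel]

/-- The word of fields of a term of the Hermite expansion of a family of kernels. -/
def fieldWord (Y : ∀ q : KernelLabel k, KernelIndex d (q.1 + 1) → ℝ) (i : WickIndex d k) :
    List (FieldLabel d k) :=
  (annWord (i.1.1 + 1) i.1.2.1 (fun p => Y i.1 (Sum.inl p))
      fun p => i.2 (Sum.inl p)).reverse.map adjointLabel ++
    annWord (i.1.1 + 1) (i.1.2.2 ∘ Fin.rev) (fun p => Y i.1 (Sum.inr (p.1.rev, p.2)))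
      fun p => i.2 (Sum.inr (p.1.rev, p.2))

lemma length_fieldWord (Y : ∀ q : KernelLabel k, KernelIndex d (q.1 + 1) → ℝ)
    (i : WickIndex d k) : (fieldWord Y i).length = 2 * (i.1.1 + 1) := by
  rw [fieldWord, List.length_append, List.length_map, List.length_reverse, length_annWord,
    length_annWord, two_mul]

lemma wickOp_eq (Y : ∀ q : KernelLabel k, KernelIndex d (q.1 + 1) → ℝ) (i : WickIndex d k) :
    wickOp Y i = (√(∏ p, (i.2 p + 1 : ℝ)) : ℂ) • ((fieldWord Y i).map fieldOp).prod := by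
  have h1 : ∏ p : Fin (i.1.1 + 1) × Fin d, (i.2 (Sum.inr (p.1.rev, p.2)) + 1 : ℝ)
      = ∏ p : Fin (i.1.1 + 1) × Fin d, (i.2 (Sum.inr p) + 1 : ℝ) :=
    Equiv.prod_comp (Equiv.prodCongr Fin.revPerm (Equiv.refl (Fin d)))
      fun p : Fin (i.1.1 + 1) × Fin d => (i.2 (Sum.inr p) + 1 : ℝ)
  rw [wickOp, wickWord, annProd_eq, annProd_eq, h1, star_smul, star_prod_fieldOp,
    smul_mul_smul_comm, fieldWord, List.map_append, List.prod_append, Fintype.prod_sum_type,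
    Real.sqrt_mul (Finset.prod_nonneg fun _ _ => by positivity), Complex.ofReal_mul]
  congr 2
  exact Complex.conj_ofReal _

/-- Conjugation as a continuous linear map. -/
def AdCLM (U : Op d k) : Op d k →L[ℂ] Op d k where
  toFun := Ad U
  map_add' := Ad_add U
  map_smul' := Ad_smul U
  cont := continuous_Ad U

/-- The normalized coefficients of the Hermite expansion of a family of kernels. -/
def fieldCoeff (a : Kernel d k) (Y : ∀ q : KernelLabel k, KernelIndex d (q.1 + 1) → ℝ)
    (i : WickIndex d k) : ℂ := wickCoeff a Y i * (√(∏ p, (i.2 p + 1 : ℝ)) : ℂ)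

lemma fieldCoeff_smul (a : Kernel d k) (Y : ∀ q : KernelLabel k, KernelIndex d (q.1 + 1) → ℝ)
    (i : WickIndex d k) : fieldCoeff a Y i • ((fieldWord Y i).map fieldOp).prod
      = wickCoeff a Y i • wickOp Y i := by
  rw [wickOp_eq, smul_smul, fieldCoeff]

lemma enorm_fieldCoeff (a : Kernel d k) (Y : ∀ q : KernelLabel k, KernelIndex d (q.1 + 1) → ℝ)
    (i : WickIndex d k) : ‖fieldCoeff a Y i‖ₑ
      = ‖wickCoeff a Y i‖ₑ * ENNReal.ofReal √(∏ p, (i.2 p + 1 : ℝ)) := by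
  rw [fieldCoeff, enorm_mul]
  congr 1
  rw [← ofReal_norm, Complex.norm_real, Real.norm_eq_abs, abs_of_nonneg (Real.sqrt_nonneg _)]

/-- The words have length `L = 2N`, and `L 2^{L-1} = N 2^{2N}` is the weight already contained in
`exists_centers`. -/
lemma exists_fieldCoeff (a : Kernel d k) :
    ∃ Y : ∀ q : KernelLabel k, KernelIndex d (q.1 + 1) → ℝ,
      ∑' i, ‖fieldCoeff a Y i‖ₑ * ((fieldWord Y i).length * 2 ^ ((fieldWord Y i).length - 1))
        ≤ 2 * kernelNormInf a := by
  obtain ⟨Y, hY⟩ := exists_centers a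
  refine ⟨Y, le_trans (le_of_eq (tsum_congr fun i => ?_)) hY⟩
  rw [enorm_fieldCoeff, length_fieldWord]
  congr 1
  have : 2 * (i.1.1 + 1) = 2 * (i.1.1 + 1) - 1 + 1 := by omega
  conv_rhs => rw [this, pow_succ]
  push_cast
  ring

lemma hasSum_fieldWord {a : Kernel d k} {Y : ∀ q : KernelLabel k, KernelIndex d (q.1 + 1) → ℝ}
    {A : Op d k} (hA : IsWickOperator a A)
    (hY : ∑' i, ‖fieldCoeff a Y i‖ₑ *
      ((fieldWord Y i).length * 2 ^ ((fieldWord Y i).length - 1)) ≠ ⊤) :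
    HasSum (fun i => fieldCoeff a Y i • ((fieldWord Y i).map fieldOp).prod) A := by
  have hs : Summable fun i => ‖wickCoeff a Y i‖ := by
    have h1 : ∑' i, ‖wickCoeff a Y i‖ₑ ≠ ⊤ := by
      refine ne_top_of_le_ne_top hY (ENNReal.tsum_le_tsum fun i => ?_)
      rw [enorm_fieldCoeff, mul_assoc]
      refine le_mul_of_one_le_right' ?_
      refine one_le_mul (ENNReal.one_le_ofReal.2 (one_le_sqrt_prod i.2)) (one_le_mul ?_ ?_)
      · rw [length_fieldWord]
        exact_mod_cast (by omega : 1 ≤ 2 * (i.1.1 + 1))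
      · exact one_le_pow₀ one_le_two
    have := ENNReal.summable_toReal h1
    simpa using this
  obtain ⟨B, hB, hw⟩ := hasSum_wickOp hs
  obtain rfl := hw.unique hA
  exact hB.congr_fun fun i => fieldCoeff_smul a Y i

/-- The dispersive system of an interaction, in the time direction `ε`. -/
def wickSystem (hd : 3 ≤ d) {w : Kernel d k}
    {Y : ∀ q : KernelLabel k, KernelIndex d (q.1 + 1) → ℝ} {W : Op d k}
    (hW : HasSum (fun i => fieldCoeff w Y i • ((fieldWord Y i).map fieldOp).prod) W)
    (hc : Continuous fun t => freeDynamics t W)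
    (hsmall : ENNReal.ofReal (Real.pi * d / (d - 2)) * ∑' i, ‖fieldCoeff w Y i‖ₑ *
      ((fieldWord Y i).length * 2 ^ ((fieldWord Y i).length - 1)) ≤ 1)
    (htop : ∑' i, ‖fieldCoeff w Y i‖ₑ *
      ((fieldWord Y i).length * 2 ^ ((fieldWord Y i).length - 1)) ≠ ⊤)
    (ε : ℝ) (hε : |ε| = 1) : DispersiveSystem (Op d k) (FieldLabel d k) (WickIndex d k) where
  evol t := AdCLM (freePropagator d k (ε * t))
  evol_mul t := Ad_mul (freePropagator_mem_unitary _)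
  evol_add s t a := by
    rw [mul_add]
    exact freeDynamics_add _ _ a
  evol_zero a := by
    rw [mul_zero]
    exact freeDynamics_zero a
  norm_evol t a := norm_freeDynamics _ a
  norm_one_le := ContinuousLinearMap.norm_id_le
  field := fieldOp
  norm_field_le := norm_fieldOp_le
  decay := decayBound d
  measurable_decay := measurable_decayBound d
  decay_ne_top := by
    rw [lintegral_decayBound hd]
    exact ENNReal.ofReal_ne_top
  anticommutator i j t := by
    have := anticommutator_fieldOp i j (ε * t)
    rwa [abs_mul, hε, one_mul] at this
  -- For `ε = -1` time runs backwards, and each integral of the Dyson series changes its sign with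
  -- the substitution `s ↦ -s`. The sign is put on the interaction.
  perturb := (ε : ℂ) • W
  continuous_perturb := by
    have : Continuous fun t : ℝ => (ε : ℂ) • freeDynamics (ε * t) W :=
      Continuous.const_smul (hc.comp (continuous_const_mul ε)) (ε : ℂ)
    exact this.congr fun t => (Ad_smul _ _ _).symm
  coeff i := (ε : ℂ) * fieldCoeff w Y i
  word := fieldWord Y
  even_word i := by
    rw [length_fieldWord]
    exact even_two_mul _
  hasSum_perturb := (hW.const_smul (ε : ℂ)).congr_fun fun i => mul_smul _ _ _
  sum_ne_top := by
    have : ‖(ε : ℂ)‖ₑ = 1 := by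
      rw [← ofReal_norm, Complex.norm_real, Real.norm_eq_abs, hε, ENNReal.ofReal_one]
    simpa only [enorm_mul, this, one_mul] using htop
  small := by
    have : ‖(ε : ℂ)‖ₑ = 1 := by
      rw [← ofReal_norm, Complex.norm_real, Real.norm_eq_abs, hε, ENNReal.ofReal_one]
    rw [lintegral_decayBound hd]
    simpa only [enorm_mul, this, one_mul] using hsmall

/-- Substituting `s ↦ ε s` in every integral produces a factor `ε` each, absorbed in `ε W`. In this
way the limit `t → -∞` is a limit `t → +∞` of the reversed system. -/
lemma dysonTerm_eq_dyson {W : Op d k} (hc : Continuous fun t => freeDynamics t W) (ε : ℝ)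
    (a : Op d k) (m : ℕ) (t : ℝ) : dysonTerm W a m (ε * t)
      = dyson (fun s => freeDynamics (ε * -s) ((ε : ℂ) • W)) m 0 t a := by
  have hc' : Continuous fun s : ℝ => freeDynamics (ε * -s) ((ε : ℂ) • W) := by
    have : Continuous fun t : ℝ => (ε : ℂ) • freeDynamics (ε * -t) W :=
      Continuous.const_smul (hc.comp ((continuous_const_mul ε).comp continuous_neg)) (ε : ℂ)
    exact this.congr fun t => (Ad_smul _ _ _).symm
  induction m generalizing t with
  | zero => rfl
  | succ m ih =>
    rw [dyson_succ hc', dysonTerm]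
    have h := intervalIntegral.smul_integral_comp_mul_left (a := 0) (b := t)
      (fun s => ⁅freeDynamics (-s) W, dysonTerm W a m s⁆) ε
    rw [mul_zero] at h
    rw [← h, ← intervalIntegral.integral_smul]
    refine intervalIntegral.integral_congr fun s _ => ?_
    rw [ih, commutatorCLM_apply, Ring.lie_def, freeDynamics, freeDynamics, Ad_smul, mul_neg,
      smul_mul_assoc, mul_smul_comm, ← smul_sub]
    exact (Complex.coe_smul ε _).symm

end fields

/-! ### Linear differential equations and the interacting dynamics -/

section series

variable {B : Type*} [NormedRing B] [NormedAlgebra ℝ B] [CompleteSpace B] {K : ℝ → B}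

lemma volterra_neg (K : ℝ → B) (m : ℕ) (t : ℝ) :
    volterra K m 0 (-t) = volterra (fun s => -K (-s)) m 0 t := by
  induction m generalizing t with
  | zero => rfl
  | succ m ih =>
    have h := intervalIntegral.integral_comp_neg (a := 0) (b := t)
      fun u => K u * volterra K m 0 u
    rw [neg_zero] at h
    rw [volterra, volterra, intervalIntegral.integral_symm, ← h, ← intervalIntegral.integral_neg]
    refine intervalIntegral.integral_congr fun u _ => ?_
    rw [ih, neg_mul]

lemma norm_volterra_le_abs {C : ℝ} (hC : ∀ u, ‖K u‖ ≤ C) (h1 : ‖(1 : B)‖ ≤ 1) (m : ℕ) (t : ℝ) :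
    ‖volterra K m 0 t‖ ≤ (C * |t|) ^ m / m.factorial := by
  rcases le_total 0 t with ht | ht
  · rw [abs_of_nonneg ht]
    exact norm_volterra_le m (fun u _ => hC u) h1 ⟨ht, le_rfl⟩
  · rw [abs_of_nonpos ht, ← neg_neg t, volterra_neg, neg_neg]
    exact norm_volterra_le m (fun u _ => by rw [norm_neg]; exact hC _) h1
      ⟨neg_nonneg.2 ht, le_rfl⟩

/-- The solution of `G' = K G`, `G 0 = 1`. -/
def volterraSum (K : ℝ → B) (t : ℝ) : B := ∑' m, volterra K m 0 t

lemma summable_volterra {C : ℝ} (hC : ∀ u, ‖K u‖ ≤ C) (h1 : ‖(1 : B)‖ ≤ 1) (t : ℝ) : Summable fun m => volterra K m 0 t :=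
  Summable.of_norm_bounded (Real.summable_pow_div_factorial (C * |t|))
    fun m => norm_volterra_le_abs hC h1 m t

lemma volterraSum_eq {C : ℝ} (hC : ∀ u, ‖K u‖ ≤ C) (h1 : ‖(1 : B)‖ ≤ 1)
    (t : ℝ) : volterraSum K t = 1 + ∑' m, volterra K (m + 1) 0 t :=
  (summable_volterra hC h1 t).tsum_eq_zero_add

lemma volterraSum_zero {C : ℝ} (hC : ∀ u, ‖K u‖ ≤ C) (h1 : ‖(1 : B)‖ ≤ 1) :
    volterraSum K 0 = 1 := by
  rw [volterraSum_eq hC h1]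
  simp [volterra_self]

lemma hasDerivAt_volterraSum {C : ℝ} (hC : ∀ u, ‖K u‖ ≤ C) (h1 : ‖(1 : B)‖ ≤ 1)
    (hK : Continuous K) (t : ℝ) :
    HasDerivAt (volterraSum K) (K t * volterraSum K t) t := by
  have hC0 : 0 ≤ C := (norm_nonneg _).trans (hC 0)
  -- Termwise differentiation on the unit ball around `t`, where the exponential series at `|t| + 1`
  -- is a common majorant of the derivatives.
  have h := hasDerivAt_tsum_of_isPreconnected (g := fun m => volterra K (m + 1) 0)
    (g' := fun m y => K y * volterra K m 0 y) (y₀ := t)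
    (u := fun m => C * ((C * (|t| + 1)) ^ m / m.factorial))
    ((Real.summable_pow_div_factorial _).mul_left C) (Metric.isOpen_ball (x := t) (ε := 1))
    (convex_ball t 1).isPreconnected (fun m y _ => hasDerivAt_volterra hK m 0 y)
    (fun m y hy => by
      refine (norm_mul_le _ _).trans (mul_le_mul (hC y) ?_ (norm_nonneg _) hC0)
      refine (norm_volterra_le_abs hC h1 m y).trans ?_
      have : |y| ≤ |t| + 1 := by
        have h2 := Metric.mem_ball.1 hy
        rw [Real.dist_eq] at h2
        have h3 := abs_sub_abs_le_abs_sub y t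
        linarith
      gcongr)
    (Metric.mem_ball_self one_pos) ((summable_nat_add_iff 1).2 (summable_volterra hC h1 t))
    (Metric.mem_ball_self one_pos)
  rw [(summable_volterra hC h1 t).tsum_mul_left] at h
  have e : volterraSum K = fun t => 1 + ∑' m, volterra K (m + 1) 0 t :=
    funext fun t => volterraSum_eq hC h1 t
  have h2 := h.const_add 1
  rwa [← e] at h2

lemma eq_of_hasDerivAt {E : Type*} [NormedAddCommGroup E] [NormedSpace ℝ E]
    {L : ℝ → E →L[ℝ] E} {C : ℝ} (hL : ∀ t, ‖L t‖ ≤ C) {f g : ℝ → E}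
    (hf : ∀ t, HasDerivAt f (L t (f t)) t) (hg : ∀ t, HasDerivAt g (L t (g t)) t)
    (h0 : f 0 = g 0) : f = g := by
  refine ODE_solution_unique_univ (v := fun t x => L t x) (s := fun _ => Set.univ)
    (K := C.toNNReal) (fun t => ?_) (fun t => ⟨hf t, trivial⟩) (fun t => ⟨hg t, trivial⟩) h0
  refine ((L t).lipschitz.weaken ?_).lipschitzOnWith
  exact NNReal.le_toNNReal_of_coe_le (hL t)

lemma eq_of_hasDerivAt_mul {C : ℝ} (hC : ∀ t, ‖K t‖ ≤ C) {f g : ℝ → B}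
    (hf : ∀ t, HasDerivAt f (K t * f t) t) (hg : ∀ t, HasDerivAt g (K t * g t) t)
    (h0 : f 0 = g 0) : f = g :=
  eq_of_hasDerivAt (L := fun t => ContinuousLinearMap.mul ℝ B (K t)) (C := C)
    (fun t => (ContinuousLinearMap.opNorm_mul_apply_le ℝ B _).trans (hC t)) hf hg h0

lemma intervalIntegral_mem {E : Type*} [NormedAddCommGroup E] [NormedSpace ℝ E] [CompleteSpace E]
    {p : Submodule ℝ E} (hp : IsClosed (p : Set E)) {f : ℝ → E} (hf : Continuous f)
    (h : ∀ u, f u ∈ p) (a b : ℝ) : ∫ u in a..b, f u ∈ p := by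
  have : CompleteSpace p := hp.completeSpace_coe
  have hc : Continuous fun u => (⟨f u, h u⟩ : p) := hf.subtype_mk h
  have e := p.subtypeL.intervalIntegral_comp_comm (hc.intervalIntegrable (μ := volume) a b)
  simp only [Submodule.subtypeL_apply] at e
  rw [e]
  exact (∫ u in a..b, (⟨f u, h u⟩ : p)).2

end series

/-! ### The Heisenberg equation in a complex Banach algebra -/

section complexSeries

variable {A : Type*} [NormedRing A] [NormedAlgebra ℂ A] [CompleteSpace A]

lemma volterra_smul (c : ℂ) (K : ℝ → A) (m : ℕ) (s t : ℝ) :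
    volterra (fun u => c • K u) m s t = c ^ m • volterra K m s t := by
  induction m generalizing t with
  | zero => simp [volterra]
  | succ m ih =>
    rw [volterra, volterra, ← intervalIntegral.integral_smul]
    refine intervalIntegral.integral_congr fun u _ => ?_
    rw [ih, smul_mul_smul_comm, pow_succ']

lemma volterra_mem {S : Subalgebra ℂ A} (hS : IsClosed (S : Set A)) {K : ℝ → A}
    (hK : Continuous K) (h : ∀ u, K u ∈ S) (m : ℕ) (s t : ℝ) : volterra K m s t ∈ S := by
  induction m generalizing t with
  | zero => exact one_mem S
  | succ m ih =>
    exact intervalIntegral_mem (p := (Subalgebra.toSubmodule S).restrictScalars ℝ) hS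
      (hK.mul (continuous_volterra_right hK m s)) (fun u => S.mul_mem (h u) (ih u)) s t

lemma norm_commutatorCLM_le (w : A) : ‖commutatorCLM w‖ ≤ 2 * ‖w‖ := by
  refine ContinuousLinearMap.opNorm_le_bound _ (by positivity) fun a => ?_
  rw [commutatorCLM_apply]
  refine (norm_sub_le _ _).trans ?_
  have h1 := norm_mul_le w a
  have h2 := norm_mul_le a w
  linarith

/-- The Dyson series solves the Heisenberg equation. -/
lemma exists_hasSum_dyson {w : ℝ → A} (hw : Continuous w) {C : ℝ} (hC : ∀ t, ‖w t‖ ≤ C)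
    (a : A) : ∃ f : ℝ → A, f 0 = a ∧
      (∀ t, HasDerivAt f (Complex.I • commutatorCLM (w t) (f t)) t) ∧
      ∀ t, HasSum (fun m => Complex.I ^ m • dyson w m 0 t a) (f t) := by
  let K : ℝ → A →L[ℂ] A := fun t => Complex.I • commutatorCLM (w t)
  have hK : Continuous K := (continuous_commutatorCLM.comp hw).const_smul Complex.I
  have hKC : ∀ t, ‖K t‖ ≤ 2 * C := fun t => by
    rw [norm_smul, Complex.norm_I, one_mul]
    exact (norm_commutatorCLM_le _).trans (by linarith [hC t])
  have hid : ‖(1 : A →L[ℂ] A)‖ ≤ 1 := ContinuousLinearMap.norm_id_le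
  let ev : (A →L[ℂ] A) →L[ℂ] A := ContinuousLinearMap.apply ℂ A a
  refine ⟨fun t => ev (volterraSum K t), ?_, fun t => ?_, fun t => ?_⟩
  · simp only [volterraSum_zero hKC hid]
    rfl
  · exact (ev.restrictScalars ℝ).hasFDerivAt.comp_hasDerivAt t
      (hasDerivAt_volterraSum hKC hid hK t)
  · refine ((summable_volterra hKC hid t).hasSum.mapL ev).congr_fun fun m => ?_
    rw [volterra_smul, map_smul]
    rfl

end complexSeries

/-! ### Differentiation along strongly continuous families -/

section strong

variable {X : Type*} [NormedAddCommGroup X] [NormedSpace ℂ X] {U : ℝ → X →L[ℂ] X}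

lemma tendsto_strong {α : Type*} {l : Filter α} {V : α → X →L[ℂ] X} (hn : ∀ t x, ‖V t x‖ ≤ ‖x‖)
    {y : α → X} {y₀ z : X} (hy : Tendsto y l (𝓝 y₀)) (hV : Tendsto (fun t => V t y₀) l (𝓝 z)) :
    Tendsto (fun t => V t (y t)) l (𝓝 z) := by
  have h : Tendsto (fun t => V t (y t - y₀)) l (𝓝 0) :=
    squeeze_zero_norm (fun t => hn t _)
      (by simpa using (hy.sub (tendsto_const_nhds (x := y₀))).norm)
  have := h.add hV
  simpa only [map_sub, sub_add_cancel, zero_add] using this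

/-- The product rule for a strongly continuous family of contractions. -/
lemma hasDerivAt_strong (hn : ∀ t x, ‖U t x‖ ≤ ‖x‖) (hc : ∀ x, Continuous fun t => U t x)
    {v : ℝ → X} {v' η : X} {t₀ : ℝ} (hv : HasDerivAt v v' t₀)
    (hU : HasDerivAt (fun t => U t (v t₀)) η t₀) :
    HasDerivAt (fun t => U t (v t)) (η + U t₀ v') t₀ := by
  rw [hasDerivAt_iff_tendsto_slope] at hv hU ⊢
  have h2 := tendsto_strong hn hv (((hc v').tendsto t₀).mono_left nhdsWithin_le_nhds)
  refine (hU.add h2).congr fun t => ?_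
  simp only [slope, vsub_eq_sub]
  rw [(U t).map_smul_of_tower, map_sub, ← smul_add]
  congr 1
  abel

end strong

/-! ### The interacting propagator -/

section propagator

variable {d k : ℕ}

lemma norm_unitary_apply {U : Op d k} (hU : U ∈ unitary (Op d k)) (ψ : Fock d k) :
    ‖U ψ‖ = ‖ψ‖ := by
  have h : inner ℂ (U ψ) (U ψ) = inner ℂ ψ ψ := by
    rw [← ContinuousLinearMap.adjoint_inner_right, ← ContinuousLinearMap.star_eq_adjoint,
      ← op_mul_apply, Unitary.star_mul_self_of_mem hU, one_apply_eq_self]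
  rw [inner_self_eq_norm_sq_to_K, inner_self_eq_norm_sq_to_K] at h
  have h' : ‖U ψ‖ ^ 2 = ‖ψ‖ ^ 2 := by exact_mod_cast h
  exact (pow_left_inj₀ (norm_nonneg _) (norm_nonneg _) two_ne_zero).1 h'

/-- `i` times the interaction in the interaction picture. -/
def picture (W : Op d k) (t : ℝ) : Op d k := Complex.I • freeDynamics (-t) W

/-- The propagator in the interaction picture. -/
def wave (W : Op d k) (t : ℝ) : Op d k := volterraSum (picture W) t

lemma norm_picture (W : Op d k) (t : ℝ) : ‖picture W t‖ = ‖W‖ := by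
  rw [picture, norm_smul, Complex.norm_I, one_mul, norm_freeDynamics]

lemma picture_mem {W : Op d k} (hW : W ∈ fieldAlgebra d k) (t : ℝ) :
    picture W t ∈ fieldAlgebra d k :=
  (fieldAlgebra d k).smul_mem (freeDynamics_mem_fieldAlgebra _ _ hW) _

lemma continuous_picture {W : Op d k} (hW : W ∈ fieldAlgebra d k) : Continuous (picture W) :=
  ((continuous_freeDynamics W hW).comp continuous_neg).const_smul Complex.I

lemma star_picture {W : Op d k} (hs : IsSelfAdjoint W) (t : ℝ) :
    star (picture W t) = -picture W t := by
  rw [picture, star_smul, ← freeDynamics_star, hs.star_eq]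
  simp

lemma norm_one_le_op : ‖(1 : Op d k)‖ ≤ 1 := ContinuousLinearMap.norm_id_le

lemma wave_zero (W : Op d k) : wave W 0 = 1 :=
  volterraSum_zero (fun t => (norm_picture W t).le) norm_one_le_op

lemma hasDerivAt_wave {W : Op d k} (hW : W ∈ fieldAlgebra d k) (t : ℝ) :
    HasDerivAt (wave W) (picture W t * wave W t) t :=
  hasDerivAt_volterraSum (fun t => (norm_picture W t).le) norm_one_le_op (continuous_picture hW) t

lemma wave_mem {W : Op d k} (hW : W ∈ fieldAlgebra d k) (t : ℝ) : wave W t ∈ fieldAlgebra d k :=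
  isClosed_fieldAlgebra.mem_of_tendsto
    (summable_volterra (fun t => (norm_picture W t).le) norm_one_le_op t).hasSum
    (Eventually.of_forall fun _ => sum_mem fun m _ =>
      volterra_mem (S := (fieldAlgebra d k).toSubalgebra) isClosed_fieldAlgebra
        (continuous_picture hW) (picture_mem hW) m 0 t)

lemma hasDerivAt_wave_conj {W : Op d k} (hW : W ∈ fieldAlgebra d k) (hs : IsSelfAdjoint W)
    (a : Op d k) (t : ℝ) : HasDerivAt (fun t => wave W t * a * star (wave W t))
      (commutatorCLM (picture W t) (wave W t * a * star (wave W t))) t := by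
  have h := hasDerivAt_wave hW t
  refine ((h.mul_const a).mul h.star).congr_deriv ?_
  rw [star_mul, star_picture hs, commutatorCLM_apply]
  noncomm_ring

lemma eq_of_hasDerivAt_commutator {W : Op d k} {f g : ℝ → Op d k}
    (hf : ∀ t, HasDerivAt f (commutatorCLM (picture W t) (f t)) t)
    (hg : ∀ t, HasDerivAt g (commutatorCLM (picture W t) (g t)) t) (h0 : f 0 = g 0) : f = g :=
  eq_of_hasDerivAt (L := fun t => (commutatorCLM (picture W t)).restrictScalars ℝ)
    (C := 2 * ‖W‖) (fun t => by
      rw [ContinuousLinearMap.norm_restrictScalars]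
      exact (norm_commutatorCLM_le _).trans (by rw [norm_picture])) hf hg h0

lemma wave_mem_unitary {W : Op d k} (hW : W ∈ fieldAlgebra d k) (hs : IsSelfAdjoint W) (t : ℝ) :
    wave W t ∈ unitary (Op d k) := by
  rw [Unitary.mem_iff]
  constructor
  · have hD : ∀ t, HasDerivAt (fun t => star (wave W t) * wave W t) 0 t := fun t => by
      have h := hasDerivAt_wave hW t
      refine (h.star.mul h).congr_deriv ?_
      rw [star_mul, star_picture hs]
      noncomm_ring
    have := is_const_of_deriv_eq_zero (fun t => (hD t).differentiableAt) (fun t => (hD t).deriv) t 0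
    simpa [wave_zero] using this
  -- The product in this order is not obviously constant: it solves the commutator equation, of
  -- which `1` is also a solution, and uniqueness gives equality. In infinite dimension this does
  -- not follow from the isometry property.
  · have h := eq_of_hasDerivAt_commutator (W := W) (f := fun t => wave W t * 1 * star (wave W t))
      (g := fun _ => 1) (hasDerivAt_wave_conj hW hs 1)
      (fun t => (hasDerivAt_const t (1 : Op d k)).congr_deriv (by simp [commutatorCLM_apply]))
      (by simp [wave_zero])
    simpa using congrFun h t

lemma freeDynamics_mul (t : ℝ) (a b : Op d k) :
    freeDynamics t (a * b) = freeDynamics t a * freeDynamics t b :=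
  Ad_mul (freePropagator_mem_unitary t) a b

/-- The cocycle identity that makes `fullPropagator` a group. As functions of `s` both sides solve
the same linear equation with the interaction shifted by `t`. -/
lemma wave_add {W : Op d k} (hW : W ∈ fieldAlgebra d k) (s t : ℝ) :
    wave W (s + t) = freeDynamics (-t) (wave W s) * wave W t := by
  refine congrFun (eq_of_hasDerivAt_mul (K := fun s => picture W (s + t)) (C := ‖W‖)
    (f := fun s => wave W (s + t)) (g := fun s => freeDynamics (-t) (wave W s) * wave W t)
    (fun s => (norm_picture W _).le)
    (fun s => (hasDerivAt_wave hW (s + t)).comp_add_const s t) (fun s => ?_) ?_) s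
  · have h : HasDerivAt (fun s => freeDynamics (-t) (wave W s))
        (freeDynamics (-t) (picture W s * wave W s)) s :=
      ((AdCLM (freePropagator d k (-t))).restrictScalars ℝ).hasFDerivAt.comp_hasDerivAt s
        (hasDerivAt_wave hW s)
    refine (h.mul_const (wave W t)).congr_deriv ?_
    rw [freeDynamics_mul, mul_assoc, picture, picture, freeDynamics, Ad_smul]
    change Complex.I • freeDynamics (-t) (freeDynamics (-s) W) * _ = _
    rw [← freeDynamics_add, neg_add_rev]
  · rw [zero_add, wave_zero, freeDynamics, Ad_map_one (freePropagator_mem_unitary _), one_mul]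

/-- The interacting propagator. -/
def fullPropagator (W : Op d k) (t : ℝ) : Op d k := freePropagator d k t * wave W t

lemma norm_freePropagator_apply (t : ℝ) (ψ : Fock d k) : ‖freePropagator d k t ψ‖ = ‖ψ‖ :=
  norm_secondQuantize _ _ ψ

lemma hasDerivAt_op_apply {f : ℝ → Op d k} {f' : Op d k} {t : ℝ} (h : HasDerivAt f f' t)
    (ψ : Fock d k) : HasDerivAt (fun t => f t ψ) (f' ψ) t :=
  ((ContinuousLinearMap.apply ℂ (Fock d k) ψ).restrictScalars ℝ).hasFDerivAt.comp_hasDerivAt t h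

lemma hasDerivAt_wave_apply {W : Op d k} (hW : W ∈ fieldAlgebra d k) (ψ : Fock d k) :
    HasDerivAt (fun t => wave W t ψ) (Complex.I • W ψ) 0 := by
  have h := hasDerivAt_op_apply (hasDerivAt_wave hW 0) ψ
  rwa [wave_zero, mul_one, picture, neg_zero, freeDynamics_zero] at h

lemma isPropagator_fullPropagator {W : Op d k} (hW : W ∈ fieldAlgebra d k)
    (hs : IsSelfAdjoint W) : IsPropagator W (fullPropagator W) where
  mem_unitary t := mul_mem (freePropagator_mem_unitary t) (wave_mem_unitary hW hs t)
  map_zero := by rw [fullPropagator, freePropagator_zero, wave_zero, mul_one]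
  map_add s t := by
    have h1 : freePropagator d k t * freePropagator d k (-t) = 1 := by
      rw [← freePropagator_add, add_neg_cancel, freePropagator_zero]
    rw [fullPropagator, fullPropagator, fullPropagator, wave_add hW, freePropagator_add,
      freeDynamics, Ad, star_freePropagator, neg_neg]
    calc _ = freePropagator d k s * (freePropagator d k t * freePropagator d k (-t)) *
          wave W s * freePropagator d k t * wave W t := by simp only [mul_assoc]
      _ = _ := by rw [h1, mul_one]; simp only [mul_assoc]
  strongly_continuous ψ := by
    rw [continuous_iff_continuousAt]
    intro t
    have h : ContinuousAt (fun t => wave W t ψ) t :=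
      (hasDerivAt_op_apply (hasDerivAt_wave hW t) ψ).continuousAt
    exact tendsto_strong (V := fun t => freePropagator d k t)
      (fun t x => (norm_freePropagator_apply t x).le) h
      ((continuous_freePropagator (wave W t ψ)).tendsto t)
  generator ψ η h := by
    have h0 : HasDerivAt (fun t => freePropagator d k t (wave W 0 ψ)) η 0 := by
      rwa [wave_zero, one_apply_eq_self]
    have := hasDerivAt_strong (U := fun t => freePropagator d k t)
      (fun t x => (norm_freePropagator_apply t x).le) continuous_freePropagator
      (hasDerivAt_wave_apply hW ψ) h0
    rw [freePropagator_zero, one_apply_eq_self] at this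
    exact this

/-- The generator of the interacting propagator is not larger than that of the free one. -/
lemma hasDerivAt_freePropagator_of_fullPropagator {W : Op d k} (hW : W ∈ fieldAlgebra d k)
    {φ χ : Fock d k} (h : HasDerivAt (fun t => fullPropagator W t φ) χ 0) :
    HasDerivAt (fun t => freePropagator d k t φ) (χ - Complex.I • W φ) 0 := by
  have h1 : HasDerivAt (fun t => freePropagator d k t (wave W t φ - φ)) (Complex.I • W φ) 0 := by
    have h0 : HasDerivAt (fun t => freePropagator d k t (wave W 0 φ - φ)) 0 0 := by
      simpa [wave_zero] using hasDerivAt_const (0 : ℝ) (0 : Fock d k)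
    have := hasDerivAt_strong (U := fun t => freePropagator d k t)
      (fun t x => (norm_freePropagator_apply t x).le) continuous_freePropagator
      ((hasDerivAt_wave_apply hW φ).sub_const φ) h0
    rwa [freePropagator_zero, one_apply_eq_self, zero_add] at this
  refine (h.sub h1).congr_of_eventuallyEq (Eventually.of_forall fun t => ?_)
  rw [Pi.sub_apply, fullPropagator, op_mul_apply, map_sub, sub_sub_cancel]

/-- The domain of the free Hamiltonian is dense. -/
lemma dense_domain : Dense {ψ : Fock d k | ∃ η, HasDerivAt (fun t => freePropagator d k t ψ) η 0} := by
  intro ψ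
  let E : ℝ → Fock d k := fun t => freePropagator d k t ψ
  have hE : Continuous E := continuous_freePropagator ψ
  have hI : ∀ a b, IntervalIntegrable E volume a b := fun a b => hE.intervalIntegrable a b
  -- Time averages of an orbit lie in the domain of the generator, and over short intervals they
  -- approximate the vector.
  have h1 : Tendsto (fun ε : ℝ => ε⁻¹ • ∫ s in (0 : ℝ)..ε, E s) (𝓝[≠] 0) (𝓝 ψ) := by
    have h := (hE.integral_hasStrictDerivAt 0 0).hasDerivAt
    rw [hasDerivAt_iff_tendsto_slope] at h
    have h0 : E 0 = ψ := by
      change freePropagator d k 0 ψ = ψ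
      rw [freePropagator_zero, one_apply_eq_self]
    rw [h0] at h
    refine h.congr fun ε => ?_
    rw [slope_def_module, intervalIntegral.integral_same, sub_zero, sub_zero]
  refine mem_closure_of_tendsto h1 (Eventually.of_forall fun ε => ⟨ε⁻¹ • (E ε - E 0), ?_⟩)
  have h2 : ∀ t, freePropagator d k t (ε⁻¹ • ∫ s in (0 : ℝ)..ε, E s)
      = ε⁻¹ • ((∫ s in (0 : ℝ)..(t + ε), E s) - ∫ s in (0 : ℝ)..t, E s) := by
    intro t
    rw [intervalIntegral.integral_interval_sub_left (hI _ _) (hI _ _),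
      (freePropagator d k t).map_smul_of_tower,
      ← (freePropagator d k t).intervalIntegral_comp_comm (hI _ _)]
    have h3 := intervalIntegral.integral_comp_add_left (a := 0) (b := ε) E t
    rw [add_zero] at h3
    rw [← h3]
    congr 1
    refine intervalIntegral.integral_congr fun s _ => ?_
    change freePropagator d k t (freePropagator d k s ψ) = freePropagator d k (t + s) ψ
    rw [freePropagator_add, op_mul_apply]
  simp only [h2]
  have h4 : HasDerivAt (fun t => ∫ s in (0 : ℝ)..(t + ε), E s) (E ε) 0 := by
    have := (hE.integral_hasStrictDerivAt 0 (0 + ε)).hasDerivAt.comp_add_const 0 ε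
    rwa [zero_add] at this
  exact ((h4.sub (hE.integral_hasStrictDerivAt 0 0).hasDerivAt).const_smul ε⁻¹)

/-- The generator condition speaks only of vectors in the free domain. There `V(-s) U(s) ψ` has
derivative zero, with `U` the constructed propagator, so `U` and `V` agree on a dense set. -/
lemma IsPropagator.eq_fullPropagator {W : Op d k} (hW : W ∈ fieldAlgebra d k)
    (hs : IsSelfAdjoint W) {V : ℝ → Op d k} (hV : IsPropagator W V) : V = fullPropagator W := by
  have hU := isPropagator_fullPropagator hW hs
  have hinv : ∀ t φ, V t (V (-t) φ) = φ := fun t φ => by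
    rw [← op_mul_apply, ← hV.map_add, add_neg_cancel, hV.map_zero, one_apply_eq_self]
  have hnV : ∀ t x, ‖V (-t) x‖ ≤ ‖x‖ := fun t x => (norm_unitary_apply (hV.mem_unitary _) x).le
  have key : ∀ ψ ∈ {ψ : Fock d k | ∃ η, HasDerivAt (fun t => freePropagator d k t ψ) η 0},
      ∀ t, V t ψ = fullPropagator W t ψ := by
    rintro ψ ⟨η, hη⟩ t
    have h1 := hU.generator ψ η hη
    set χ := η + Complex.I • W ψ
    have hD : ∀ t, HasDerivAt (fun s => V (-s) (fullPropagator W s ψ)) 0 t := by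
      intro t
      have h2 : HasDerivAt (fun s => fullPropagator W s (fullPropagator W t ψ))
          (fullPropagator W t χ) 0 := by
        have := ((fullPropagator W t).restrictScalars ℝ).hasFDerivAt.comp_hasDerivAt 0 h1
        refine this.congr_of_eventuallyEq (Eventually.of_forall fun s => ?_)
        change fullPropagator W s (fullPropagator W t ψ)
          = fullPropagator W t (fullPropagator W s ψ)
        rw [← op_mul_apply, ← op_mul_apply, ← hU.map_add, ← hU.map_add, add_comm]
      -- The constructed propagator keeps `ψ` in the free domain, because its generator has no
      -- larger domain than the free one; so the condition on `V` applies at `U(t) ψ` too.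
      have h3 := hV.generator _ _ (hasDerivAt_freePropagator_of_fullPropagator hW h2)
      rw [sub_add_cancel] at h3
      have h4 : HasDerivAt (fun s => fullPropagator W s ψ) (fullPropagator W t χ) t := by
        have h5 : HasDerivAt (fun s => fullPropagator W s (fullPropagator W t ψ))
          (fullPropagator W t χ) (t + -t) := by rwa [add_neg_cancel]
        refine (h5.comp_add_const t (-t)).congr_of_eventuallyEq (Eventually.of_forall fun s => ?_)
        dsimp only
        rw [← op_mul_apply, ← hU.map_add, neg_add_cancel_right]
      have h5 : HasDerivAt (fun s => V (-s) (fullPropagator W t ψ))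
          (-(V (-t) (fullPropagator W t χ))) t := by
        have h6 : HasDerivAt (fun s => V s (fullPropagator W t ψ)) (fullPropagator W t χ)
          (t - t) := by rwa [sub_self]
        have h7 := ((V (-t)).restrictScalars ℝ).hasFDerivAt.comp_hasDerivAt t
          (h6.comp_const_sub t t)
        rw [map_neg] at h7
        refine h7.congr_of_eventuallyEq (Eventually.of_forall fun s => ?_)
        change V (-s) _ = V (-t) (V (t - s) _)
        have e : -s = -t + (t - s) := by ring
        rw [e, hV.map_add, op_mul_apply]
      have h8 := hasDerivAt_strong (U := fun s => V (-s)) hnV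
        (fun x => (hV.strongly_continuous x).comp continuous_neg) h4 h5
      rwa [neg_add_cancel] at h8
    have := is_const_of_deriv_eq_zero (fun t => (hD t).differentiableAt) (fun t => (hD t).deriv) t 0
    rw [neg_zero, hV.map_zero, hU.map_zero, one_apply_eq_self, one_apply_eq_self] at this
    rw [← hinv t (fullPropagator W t ψ), this]
  ext1 t
  exact ContinuousLinearMap.ext fun ψ => congrFun (Continuous.ext_on dense_domain
    (V t).continuous (fullPropagator W t).continuous fun ψ hψ => key ψ hψ t) ψ

lemma existsUnique_propagator {W : Op d k} (hW : W ∈ fieldAlgebra d k) (hs : IsSelfAdjoint W) :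
    ∃! U : ℝ → Op d k, IsPropagator W U :=
  ⟨fullPropagator W, isPropagator_fullPropagator hW hs, fun _ hV => hV.eq_fullPropagator hW hs⟩

lemma propagator_eq {W : Op d k} (hW : W ∈ fieldAlgebra d k) (hs : IsSelfAdjoint W) :
    propagator W = fullPropagator W :=
  IsPropagator.eq_fullPropagator hW hs
    (Classical.epsilon_spec ⟨fullPropagator W, isPropagator_fullPropagator hW hs⟩)

lemma dynamics_eq {W : Op d k} (hW : W ∈ fieldAlgebra d k) (hs : IsSelfAdjoint W) (t : ℝ)
    (a : Op d k) : dynamics W t a = freeDynamics t (Ad (wave W t) a) := by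
  rw [dynamics, propagator_eq hW hs, freeDynamics, Ad_Ad, fullPropagator]

/-- Reduces all assertions about the two dynamics to conjugation by `wave`, which solves an equation
with bounded coefficients. -/
lemma freeDynamics_neg_dynamics {W : Op d k} (hW : W ∈ fieldAlgebra d k) (hs : IsSelfAdjoint W)
    (t : ℝ) (a : Op d k) : freeDynamics (-t) (dynamics W t a) = Ad (wave W t) a := by
  rw [dynamics_eq hW hs, ← freeDynamics_add, neg_add_cancel, freeDynamics_zero]

lemma Ad_wave_mem {W : Op d k} (hW : W ∈ fieldAlgebra d k) (t : ℝ) :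
    ∀ a ∈ fieldAlgebra d k, Ad (wave W t) a ∈ fieldAlgebra d k := fun _ ha =>
  mul_mem (mul_mem (wave_mem hW t) ha) (star_mem (wave_mem hW t))

lemma dynamics_mem_fieldAlgebra {W : Op d k} (hW : W ∈ fieldAlgebra d k) (hs : IsSelfAdjoint W)
    (t : ℝ) : ∀ a ∈ fieldAlgebra d k, dynamics W t a ∈ fieldAlgebra d k := fun a ha => by
  rw [dynamics_eq hW hs]
  exact freeDynamics_mem_fieldAlgebra _ _ (Ad_wave_mem hW t a ha)

lemma wave_spaceTranslate {W : Op d k} (hW : W ∈ fieldAlgebra d k) (y : Space d) (t : ℝ) :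
    wave (spaceTranslate y W) t = spaceTranslate y (wave W t) := by
  have hW' := spaceTranslate_mem_fieldAlgebra y W hW
  refine congrFun (eq_of_hasDerivAt_mul (K := picture (spaceTranslate y W))
    (C := ‖spaceTranslate y W‖) (f := wave (spaceTranslate y W))
    (g := fun t => spaceTranslate y (wave W t))
    (fun t => (norm_picture _ t).le) (hasDerivAt_wave hW') (fun t => ?_) ?_) t
  · have h : HasDerivAt (fun s => spaceTranslate y (wave W s))
        (spaceTranslate y (picture W t * wave W t)) t :=
      ((AdCLM (translation d k y)).restrictScalars ℝ).hasFDerivAt.comp_hasDerivAt t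
        (hasDerivAt_wave hW t)
    refine h.congr_deriv ?_
    rw [spaceTranslate, Ad_mul (translation_mem_unitary y)]
    congr 1
    rw [picture, picture, freeDynamics_spaceTranslate, Ad_smul]
    rfl
  · rw [wave_zero, wave_zero, spaceTranslate, Ad_map_one (translation_mem_unitary y)]

/-- Covariance: translating the interaction by `y` amounts to translating the result by `y` and the
operator by `x - y`. As translations are isometric, uniformity in the pair follows from uniformity
in the difference. -/
lemma Ad_wave_spaceTranslate {W : Op d k} (hW : W ∈ fieldAlgebra d k) (x y : Space d) (t : ℝ)
    (a : Op d k) : Ad (wave (spaceTranslate y W) t) (spaceTranslate x a)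
      = spaceTranslate y (Ad (wave W t) (spaceTranslate (x - y) a)) := by
  have h : spaceTranslate x a = spaceTranslate y (spaceTranslate (x - y) a) := by
    rw [← spaceTranslate_add, add_sub_cancel]
  have hm := Ad_mul (translation_mem_unitary (k := k) y)
  rw [wave_spaceTranslate hW, h, Ad, Ad]
  simp only [spaceTranslate, hm, Ad_star]

/-- The Dyson series and the conjugation by `wave` solve the same Heisenberg equation with the same
initial value. -/
lemma hasSum_dysonTerm {W : Op d k} (hW : W ∈ fieldAlgebra d k) (hs : IsSelfAdjoint W)
    (a : Op d k) (t : ℝ) :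
    HasSum (fun m => Complex.I ^ m • dysonTerm W a m t) (Ad (wave W t) a) := by
  have hc := continuous_freeDynamics W hW
  obtain ⟨f, hf0, hf, hsum⟩ := exists_hasSum_dyson (w := fun t => freeDynamics (-t) W)
    (hc.comp continuous_neg) (C := ‖W‖) (fun t => (norm_freeDynamics _ W).le) a
  have he := eq_of_hasDerivAt_commutator (hasDerivAt_wave_conj hW hs a) (g := f)
    (fun t => (hf t).congr_deriv (by
      simp only [picture, commutatorCLM_apply, smul_mul_assoc, mul_smul_comm, smul_sub])) (by
    rw [hf0, wave_zero, star_one, one_mul, mul_one])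
  rw [Ad, congrFun he t]
  refine (hsum t).congr_fun fun m => ?_
  have h3 := dysonTerm_eq_dyson hc 1 a m t
  have h5 : (fun s : ℝ => freeDynamics (1 * -s) (((1 : ℝ) : ℂ) • W))
      = fun s => freeDynamics (-s) W := by
    ext1 s
    rw [one_mul, Complex.ofReal_one, one_smul]
  rw [one_mul, h5] at h3
  rw [h3]

end propagator

/-! ### The scattering endomorphism -/

section limits

variable {A : Type*} [NormedRing A] [StarRing A] [NormedStarGroup A] [NormedAlgebra ℂ A]
  [StarModule ℂ A] {T X : Type*}

/-- The elements on which a family of morphisms is Cauchy, uniformly in a parameter. -/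
def cauchySubalgebra (l : Filter T) (F : T → X → A →⋆ₐ[ℂ] A) (hF : ∀ t x a, ‖F t x a‖ ≤ ‖a‖) :
    StarSubalgebra ℂ A where
  carrier := {a | Tendsto (fun p : (T × T) × X => F p.1.1 p.2 a - F p.1.2 p.2 a)
    ((l ×ˢ l) ×ˢ ⊤) (𝓝 0)}
  mul_mem' {a b} ha hb := by
    -- The difference of products is split as `a (b - b') + (a - a') b'`; the morphisms are
    -- contractive, so the factors that are not differences stay bounded.
    have h1 : Tendsto (fun p : (T × T) × X => F p.1.1 p.2 a * (F p.1.1 p.2 b - F p.1.2 p.2 b))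
        ((l ×ˢ l) ×ˢ ⊤) (𝓝 0) := by
      refine squeeze_zero_norm (a := fun p : (T × T) × X =>
        ‖a‖ * ‖F p.1.1 p.2 b - F p.1.2 p.2 b‖) (fun p => ?_) ?_
      · exact (norm_mul_le _ _).trans (mul_le_mul_of_nonneg_right (hF _ _ _) (norm_nonneg _))
      · simpa using hb.norm.const_mul ‖a‖
    have h2 : Tendsto (fun p : (T × T) × X => (F p.1.1 p.2 a - F p.1.2 p.2 a) * F p.1.2 p.2 b)
        ((l ×ˢ l) ×ˢ ⊤) (𝓝 0) := by
      refine squeeze_zero_norm (a := fun p : (T × T) × X =>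
        ‖F p.1.1 p.2 a - F p.1.2 p.2 a‖ * ‖b‖) (fun p => ?_) ?_
      · exact (norm_mul_le _ _).trans (mul_le_mul_of_nonneg_left (hF _ _ _) (norm_nonneg _))
      · simpa using ha.norm.mul_const ‖b‖
    have h := h1.add h2
    rw [add_zero] at h
    refine h.congr fun p => ?_
    rw [map_mul, map_mul]
    noncomm_ring
  add_mem' {a b} ha hb := by
    have h := Tendsto.add ha hb
    rw [add_zero] at h
    refine h.congr fun p => ?_
    rw [map_add, map_add]
    abel
  algebraMap_mem' c := by
    refine tendsto_const_nhds.congr fun p => ?_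
    rw [AlgHomClass.commutes, AlgHomClass.commutes, sub_self]
  star_mem' {a} ha := by
    have h := Tendsto.star ha
    rw [star_zero] at h
    refine h.congr fun p => ?_
    rw [map_star, map_star, star_sub]

lemma mem_cauchySubalgebra {l : Filter T} {F : T → X → A →⋆ₐ[ℂ] A}
    {hF : ∀ t x a, ‖F t x a‖ ≤ ‖a‖} {a : A} : a ∈ cauchySubalgebra l F hF ↔
      Tendsto (fun p : (T × T) × X => F p.1.1 p.2 a - F p.1.2 p.2 a) ((l ×ˢ l) ×ˢ ⊤) (𝓝 0) :=
  Iff.rfl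

lemma isClosed_cauchySubalgebra (l : Filter T) (F : T → X → A →⋆ₐ[ℂ] A)
    (hF : ∀ t x a, ‖F t x a‖ ≤ ‖a‖) : IsClosed (cauchySubalgebra l F hF : Set A) := by
  refine isClosed_of_closure_subset fun a ha => ?_
  rw [SetLike.mem_coe, mem_cauchySubalgebra, Metric.tendsto_nhds]
  intro ε hε
  obtain ⟨b, hb, hab⟩ := Metric.mem_closure_iff.1 ha (ε / 3) (by positivity)
  filter_upwards [(Metric.tendsto_nhds.1 (mem_cauchySubalgebra.1 hb)) (ε / 3) (by positivity)]
    with p hp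
  rw [dist_zero_right] at hp ⊢
  rw [dist_eq_norm] at hab
  have e : F p.1.1 p.2 a - F p.1.2 p.2 a = F p.1.1 p.2 (a - b) - F p.1.2 p.2 (a - b)
      + (F p.1.1 p.2 b - F p.1.2 p.2 b) := by
    rw [map_sub, map_sub]
    abel
  rw [e]
  have h1 := norm_add_le (F p.1.1 p.2 (a - b) - F p.1.2 p.2 (a - b))
    (F p.1.1 p.2 b - F p.1.2 p.2 b)
  have h2 := norm_sub_le (F p.1.1 p.2 (a - b)) (F p.1.2 p.2 (a - b))
  have h3 := hF p.1.1 p.2 (a - b)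
  have h4 := hF p.1.2 p.2 (a - b)
  linarith

lemma uniformCauchySeqOn_of_mem {l : Filter T} {F : T → X → A →⋆ₐ[ℂ] A}
    {hF : ∀ t x a, ‖F t x a‖ ≤ ‖a‖} {a : A} (ha : a ∈ cauchySubalgebra l F hF) :
    UniformCauchySeqOn (fun t x => F t x a) l Set.univ := by
  intro u hu
  obtain ⟨ε, hε, hu⟩ := Metric.mem_uniformity_dist.1 hu
  have h := Metric.tendsto_nhds.1 (mem_cauchySubalgebra.1 ha) ε hε
  rw [← principal_univ, eventually_prod_principal_iff] at h
  filter_upwards [h] with m hm x hx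
  refine hu ?_
  rw [dist_eq_norm, ← dist_zero_right]
  exact hm x hx

lemma exists_tendsto_of_mem [CompleteSpace A] {l : Filter T} [l.NeBot] {F : T → X → A →⋆ₐ[ℂ] A}
    {hF : ∀ t x a, ‖F t x a‖ ≤ ‖a‖} {a : A} (ha : a ∈ cauchySubalgebra l F hF) (x : X) :
    ∃ b, Tendsto (fun t => F t x a) l (𝓝 b) := by
  refine cauchy_map_iff_exists_tendsto.1 (cauchy_map_iff.2 ⟨inferInstance, fun u hu => ?_⟩)
  have h := uniformCauchySeqOn_of_mem ha u hu
  rw [mem_map]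
  filter_upwards [h] with m hm
  exact hm x trivial

/-- The pointwise limit of morphisms, on an invariant closed subalgebra. -/
lemma exists_limit_starAlgHom {S : StarSubalgebra ℂ A} (hS : IsClosed (S : Set A)) {l : Filter T}
    [l.NeBot] (F : T → A →⋆ₐ[ℂ] A) (hF : ∀ t, ∀ a ∈ S, F t a ∈ S)
    (h : ∀ a ∈ S, ∃ b, Tendsto (fun t => F t a) l (𝓝 b)) :
    ∃ σ : S →⋆ₐ[ℂ] S, ∀ a : S, Tendsto (fun t => F t a) l (𝓝 (σ a : A)) := by
  choose f hf using fun a : S => h a a.2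
  have hu : ∀ (a : S) {b : A}, Tendsto (fun t => F t a) l (𝓝 b) → f a = b :=
    fun a _ hb => tendsto_nhds_unique (hf a) hb
  let σ : S →⋆ₐ[ℂ] A :=
    { toFun := f
      map_one' := hu 1 (tendsto_const_nhds.congr fun t => (map_one (F t)).symm)
      map_mul' := fun a b => hu _ (((hf a).mul (hf b)).congr fun t => (map_mul (F t) _ _).symm)
      map_zero' := hu 0 (tendsto_const_nhds.congr fun t => (map_zero (F t)).symm)
      map_add' := fun a b => hu _ (((hf a).add (hf b)).congr fun t => (map_add (F t) _ _).symm)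
      commutes' := fun c => hu _ (tendsto_const_nhds.congr fun t =>
        (AlgHomClass.commutes (F t) c).symm)
      map_star' := fun a => hu _ ((hf a).star.congr fun t => (map_star (F t) _).symm) }
  exact ⟨σ.codRestrict S fun a => hS.mem_of_tendsto (hf a)
    (Eventually.of_forall fun t => hF t a a.2), hf⟩

end limits

/-! ### Translations and totality of the normalized fields -/

section scattering

variable {d k : ℕ}

/-- Translations of the wave function of a field. -/
def translateLabel (x : Space d) (i : FieldLabel d k) : FieldLabel d k :=
  (i.1, i.2.1, ⟨SchwartzMap.compSubConstCLM ℂ x i.2.2.1, by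
    obtain ⟨-, -, g, h2, h1⟩ := i
    dsimp only
    constructor
    · have e : (SchwartzMap.compSubConstCLM ℂ x g).toLp 2 volume = shift x (g.toLp 2 volume) := by
        apply Lp.ext
        filter_upwards [(SchwartzMap.compSubConstCLM ℂ x g).coeFn_toLp 2 volume,
          shift_coe x (g.toLp 2 volume),
          (measurePreserving_sub_right (volume : Measure (Space d)) x).quasiMeasurePreserving.ae
            (g.coeFn_toLp 2 volume)] with z e1 e2 e3
        rw [e1, e2, e3, SchwartzMap.compSubConstCLM_apply]
      rwa [e, LinearIsometry.norm_map]
    · simp only [SchwartzMap.compSubConstCLM_apply]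
      rwa [integral_sub_right_eq_self (fun z => ‖g z‖) x]⟩)

lemma waveOf_translateLabel (x : Space d) (i : FieldLabel d k) :
    waveOf (translateLabel x i) = mapOne (shift x) (waveOf i) := by
  rw [waveOf, waveOf, mapOne_oneP]
  change oneP i.2.1 _ = _
  congr 1

lemma spaceTranslate_ann_waveOf (x : Space d) (i : FieldLabel d k) :
    spaceTranslate x (ann (waveOf i)) = ann (waveOf (translateLabel x i)) := by
  rw [spaceTranslate_ann, waveOf_translateLabel]

lemma ann_add (f g : OneParticle d k) : ann (f + g) = ann f + ann g := by
  have h1 := ann_sub (f + g) g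
  rw [add_sub_cancel_right] at h1
  rw [h1, sub_add_cancel]

/-- A closed subalgebra that contains the normalized annihilation operators contains the field
algebra. -/
lemma fieldAlgebra_le_of_waveOf {S : StarSubalgebra ℂ (Op d k)} (hS : IsClosed (S : Set (Op d k)))
    (h : ∀ i : FieldLabel d k, ann (waveOf i) ∈ S) : fieldAlgebra d k ≤ S := by
  refine fieldAlgebra_le hS fun f => ?_
  have h1 : ∀ (l : Label k) (g : 𝓢(Space d, ℂ)), ann (oneP l (g.toLp 2 volume)) ∈ S := by
    intro l g
    obtain ⟨c, hc, h2, hI⟩ : ∃ c : ℝ, 0 < c ∧ ‖g.toLp 2 volume‖ ≤ c ∧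
        ∫ x, ‖g x‖ ≤ c * √((2 * Real.pi) ^ d) := by
      have hp : 0 < √((2 * Real.pi) ^ d) := by positivity
      have h0 : 0 ≤ (∫ x, ‖g x‖) / √((2 * Real.pi) ^ d) :=
        div_nonneg (integral_nonneg fun _ => norm_nonneg _) hp.le
      -- Any constant above both norms serves for rescaling; the summand `1` keeps it positive when
      -- `g = 0`.
      refine ⟨‖g.toLp 2 volume‖ + (∫ x, ‖g x‖) / √((2 * Real.pi) ^ d) + 1,
        by positivity, by linarith, ?_⟩
      rw [← div_le_iff₀ hp]
      linarith [norm_nonneg (g.toLp 2 volume)]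
    have hcn : ‖(c : ℂ)⁻¹‖ = c⁻¹ := by
      rw [norm_inv, Complex.norm_real, Real.norm_eq_abs, abs_of_pos hc]
    let g' : {g : 𝓢(Space d, ℂ) // ‖g.toLp 2 volume‖ ≤ 1 ∧ ∫ x, ‖g x‖ ≤ √((2 * Real.pi) ^ d)} :=
      ⟨(c : ℂ)⁻¹ • g, by
        rw [toLp_smul, norm_smul, hcn]
        exact inv_mul_le_one_of_le₀ h2 hc.le, by
        have e : ∀ x, ‖((c : ℂ)⁻¹ • g : 𝓢(Space d, ℂ)) x‖ = c⁻¹ * ‖g x‖ := fun x => by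
          rw [smul_apply, norm_smul, hcn]
        simp only [e]
        rw [integral_const_mul]
        exact (inv_mul_le_iff₀ hc).2 hI⟩
    have e : oneP l (g.toLp 2 volume) = (c : ℂ) • waveOf (false, l, g') := by
      have hc' : (c : ℂ) ≠ 0 := by exact_mod_cast hc.ne'
      rw [waveOf]
      change _ = (c : ℂ) • oneP l (((c : ℂ)⁻¹ • g).toLp 2 volume)
      rw [toLp_smul]
      ext1 l'
      rw [PiLp.smul_apply]
      by_cases hl : l' = l
      · subst hl
        simp [oneP, smul_smul, mul_inv_cancel₀ hc']
      · simp [oneP, hl]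
    rw [e, ann_smul]
    exact S.smul_mem (h _) _
  have h2 : ∀ (l : Label k) (g : L2 (Space d)), ann (oneP l g) ∈ S := by
    intro l g
    have hcont : Continuous fun g : L2 (Space d) => ann (oneP l g) := by
      refine continuous_ann.comp ?_
      refine (PiLp.continuous_toLp 2 fun _ : Label k => L2 (Space d)).comp
        (continuous_pi fun l' => ?_)
      by_cases hl : l' = l
      · subst hl
        simpa using continuous_id'
      · simpa [hl] using continuous_const
    exact DenseRange.induction_on (p := fun g : L2 (Space d) => ann (oneP l g) ∈ S)
      (SchwartzMap.denseRange_toLpCLM (F := ℂ) (E := Space d) (p := 2) (μ := volume)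
        ENNReal.ofNat_ne_top) g (hS.preimage hcont) (h1 l)
  let P : AddSubmonoid (OneParticle d k) :=
    { carrier := {f | ann f ∈ S}
      add_mem' := fun {f g} hf hg => by
        change ann (f + g) ∈ S
        rw [ann_add]
        exact add_mem hf hg
      zero_mem' := by
        change ann 0 ∈ S
        rw [← zero_smul ℂ (0 : OneParticle d k), ann_smul, map_zero, zero_smul]
        exact zero_mem S }
  have e : f = ∑ l, oneP l (f l) := by
    ext1 l
    rw [WithLp.ofLp_sum, Finset.sum_apply, Finset.sum_eq_single l]
    · simp [oneP]
    · intro j _ hj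
      simp [oneP, hj.symm]
    · simp
  rw [e]
  exact P.sum_mem fun l _ => h2 l (f l)

end scattering

/-! ### Existence and uniformity of the scattering limits -/

section assembly

variable {d k : ℕ}

/-- Translation followed by the interacting dynamics in the interaction picture. -/
def waveHom {W : Op d k} (hW : W ∈ fieldAlgebra d k) (hs : IsSelfAdjoint W) (t : ℝ)
    (x : Space d) : Op d k →⋆ₐ[ℂ] Op d k :=
  AdHom (wave W t * translation d k x) (mul_mem (wave_mem_unitary hW hs t)
    (translation_mem_unitary x))

lemma waveHom_apply {W : Op d k} (hW : W ∈ fieldAlgebra d k) (hs : IsSelfAdjoint W) (t : ℝ)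
    (x : Space d) (a : Op d k) :
    waveHom hW hs t x a = Ad (wave W t) (spaceTranslate x a) := by
  rw [spaceTranslate, Ad_Ad]
  rfl

lemma norm_waveHom {W : Op d k} (hW : W ∈ fieldAlgebra d k) (hs : IsSelfAdjoint W) (t : ℝ)
    (x : Space d) (a : Op d k) : ‖waveHom hW hs t x a‖ ≤ ‖a‖ := by
  rw [waveHom_apply, norm_Ad (wave_mem_unitary hW hs t), norm_spaceTranslate]

lemma kernelNormInf_le_of_eq {nrm : Kernel d k → ℝ≥0∞}
    (hn : nrm = kernelNorm ∨ nrm = kernelNormInf) (a : Kernel d k) : kernelNormInf a ≤ nrm a := by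
  rcases hn with rfl | rfl
  · exact kernelNormInf_le a
  · exact le_rfl

/-- The estimate needs the constant `2πd/(d-2)`, so the hypothesis with `8` leaves a factor `4` to
spare. Finiteness of the norm is also read off, the constant being nonzero. -/
lemma small_of_norm (hd : 3 ≤ d) {x : ℝ≥0∞}
    (h : ENNReal.ofReal (8 * Real.pi * d / ((d : ℝ) - 2)) * x < 1) :
    ENNReal.ofReal (Real.pi * d / (d - 2)) * (2 * x) ≤ 1 ∧ x < ⊤ := by
  have hd' : (3 : ℝ) ≤ d := by exact_mod_cast hd
  have hpos : 0 < Real.pi * d / ((d : ℝ) - 2) :=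
    div_pos (mul_pos Real.pi_pos (by linarith)) (by linarith)
  have e : ENNReal.ofReal (8 * Real.pi * d / ((d : ℝ) - 2))
      = 8 * ENNReal.ofReal (Real.pi * d / (d - 2)) := by
    rw [mul_assoc, mul_div_assoc, ENNReal.ofReal_mul (by norm_num), ENNReal.ofReal_ofNat]
  rw [e] at h
  constructor
  · refine le_trans ?_ h.le
    rw [mul_left_comm, mul_assoc]
    gcongr
    norm_num
  · rw [lt_top_iff_ne_top]
    rintro rfl
    rw [ENNReal.mul_top (by simpa using hpos)] at h
    exact not_top_lt h

/-- Both time directions become a limit at `+∞` after multiplying time by a sign. -/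
lemma exists_sign {l : Filter ℝ} (hl : l = atTop ∨ l = atBot) :
    ∃ ε : ℝ, |ε| = 1 ∧ l = map (fun t => ε * t) atTop := by
  rcases hl with rfl | rfl
  · exact ⟨1, abs_one, by simp⟩
  · refine ⟨-1, by simp, ?_⟩
    simp only [neg_mul, one_mul]
    exact map_neg_atTop.symm

variable {w : Kernel d k} {W : Op d k}

lemma exists_wickSystem (hd : 3 ≤ d) (hw : IsWickOperator w W) (hW : W ∈ fieldAlgebra d k)
    (hs : IsSelfAdjoint W)
    (h : ENNReal.ofReal (8 * Real.pi * d / ((d : ℝ) - 2)) * kernelNormInf w < 1) {ε : ℝ}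
    (hε : |ε| = 1) : ∃ S : DispersiveSystem (Op d k) (FieldLabel d k) (WickIndex d k),
      S.field = fieldOp ∧ (∀ m t a, S.dys m 0 t a = dysonTerm W a m (ε * t)) ∧
      ∀ t a, HasSum (fun m => Complex.I ^ m • S.dys m 0 t a) (Ad (wave W (ε * t)) a) := by
  obtain ⟨hsm, htop⟩ := small_of_norm hd h
  obtain ⟨Y, hY⟩ := exists_fieldCoeff w
  have hYt := ne_top_of_le_ne_top (ENNReal.mul_ne_top ENNReal.ofNat_ne_top htop.ne) hY
  have hc := continuous_freeDynamics W hW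
  let S := wickSystem hd (hasSum_fieldWord hw hYt) hc ((mul_le_mul_right hY _).trans hsm) hYt ε hε
  have h1 : ∀ m t a, S.dys m 0 t a = dysonTerm W a m (ε * t) := fun m t a =>
    (dysonTerm_eq_dyson hc ε a m t).symm
  refine ⟨S, rfl, h1, fun t a => ?_⟩
  simp only [h1]
  exact hasSum_dysonTerm hW hs a (ε * t)

/-- A translate of a normalized field is a normalized field, so uniformity over fields contains
uniformity over translations. The Cauchy property passes to the closed `*`-subalgebra generated by
these fields. -/
lemma fieldAlgebra_le_cauchySubalgebra (hd : 3 ≤ d) (hw : IsWickOperator w W)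
    (hW : W ∈ fieldAlgebra d k) (hs : IsSelfAdjoint W)
    (h : ENNReal.ofReal (8 * Real.pi * d / ((d : ℝ) - 2)) * kernelNormInf w < 1) {l : Filter ℝ}
    (hl : l = atTop ∨ l = atBot) :
    fieldAlgebra d k ≤ cauchySubalgebra l (waveHom hW hs) (norm_waveHom hW hs) := by
  obtain ⟨ε, hε, rfl⟩ := exists_sign hl
  obtain ⟨S, hf, -, hγ⟩ := exists_wickSystem hd hw hW hs h hε
  have key := S.tendsto_sum_dys_sub (γ := fun t a => Ad (wave W (ε * t)) a) fun t _ i => hγ t _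
  rw [hf] at key
  refine fieldAlgebra_le_of_waveOf (isClosed_cauchySubalgebra _ _ _) fun i => ?_
  rw [mem_cauchySubalgebra]
  have h2 : Tendsto (fun p : (ℝ × ℝ) × Space d => (p.1, translateLabel p.2 ((false, i.2) :
      FieldLabel d k))) ((atTop ×ˢ atTop) ×ˢ ⊤) ((atTop ×ˢ atTop) ×ˢ ⊤) :=
    tendsto_fst.prodMk tendsto_top
  have h3 := key.comp h2
  have e : ((map (fun t => ε * t) atTop) ×ˢ (map (fun t => ε * t) atTop)) ×ˢ
      (⊤ : Filter (Space d)) = map (fun p : (ℝ × ℝ) × Space d => ((ε * p.1.1, ε * p.1.2), p.2))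
        ((atTop ×ˢ atTop) ×ˢ ⊤) := by
    rw [prod_map_map_eq]
    conv_lhs => rw [← map_id (f := (⊤ : Filter (Space d)))]
    rw [prod_map_map_eq]
    rfl
  rw [e, tendsto_map'_iff]
  refine h3.congr fun p => ?_
  simp only [Function.comp_apply, waveHom_apply, spaceTranslate_ann_waveOf]
  rfl

lemma exists_hasSum_dysonTerm_limit (hd : 3 ≤ d) (hw : IsWickOperator w W)
    (hW : W ∈ fieldAlgebra d k) (hs : IsSelfAdjoint W)
    (h : ENNReal.ofReal (8 * Real.pi * d / ((d : ℝ) - 2)) * kernelNormInf w < 1) {l : Filter ℝ}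
    (hl : l = atTop ∨ l = atBot) {a : Kernel d k} {A B : Op d k} (ha : kernelNormInf a < ⊤)
    (hA : IsWickOperator a A) (hB : Tendsto (fun t => Ad (wave W t) A) l (𝓝 B)) :
    ∃ D : ℕ → Op d k, (∀ m, Tendsto (fun t => dysonTerm W A m t) l (𝓝 (D m))) ∧
      (Summable fun m => ‖D m‖) ∧ HasSum (fun m => Complex.I ^ m • D m) B := by
  obtain ⟨ε, hε, rfl⟩ := exists_sign hl
  obtain ⟨S, hf, hdys, hγ⟩ := exists_wickSystem hd hw hW hs h hε
  obtain ⟨Y, hY⟩ := exists_fieldCoeff a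
  have hYt := ne_top_of_le_ne_top (ENNReal.mul_ne_top ENNReal.ofNat_ne_top ha.ne) hY
  have hsum := hasSum_fieldWord hA hYt
  rw [← hf] at hsum
  rw [tendsto_map'_iff] at hB
  -- The words have length `L ≥ 2`, hence `2^L ≤ L 2^{L-1}`: the weight used for interactions also
  -- controls observables.
  have hc : ∑' i, ‖fieldCoeff a Y i‖ₑ * 2 ^ (fieldWord Y i).length ≠ ⊤ := by
    refine ne_top_of_le_ne_top hYt (ENNReal.tsum_le_tsum fun i => mul_le_mul_right ?_ _)
    rw [length_fieldWord]
    have e : 2 * (i.1.1 + 1) = 2 * (i.1.1 + 1) - 1 + 1 := by omega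
    conv_lhs => rw [e, pow_succ']
    refine mul_le_mul_left ?_ _
    exact_mod_cast (by omega : 2 ≤ 2 * (i.1.1 + 1))
  obtain ⟨D, h1, h2, h3⟩ := S.hasSum_limit_dys hc hsum (fun t _ => hγ t A) hB
  refine ⟨D, fun m => ?_, h2, h3⟩
  rw [tendsto_map'_iff]
  exact (h1 m).congr fun t => hdys m t A

/-- The scattering endomorphism, as a locally uniform limit in the interaction picture. -/
lemma exists_scattering (hd : 3 ≤ d) (hw : IsWickOperator w W)
    (hW : W ∈ fieldAlgebra d k) (hs : IsSelfAdjoint W)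
    (h : ENNReal.ofReal (8 * Real.pi * d / ((d : ℝ) - 2)) * kernelNormInf w < 1) {l : Filter ℝ}
    (hl : l = atTop ∨ l = atBot) : ∃ σ : fieldAlgebra d k →⋆ₐ[ℂ] fieldAlgebra d k,
      (∀ a : fieldAlgebra d k,
        Tendsto (fun t => Ad (wave W t) (a : Op d k)) l (𝓝 (σ a : Op d k))) ∧
      ∀ a : fieldAlgebra d k, TendstoUniformly
        (fun (t : ℝ) (x : Space d) => Ad (wave W t) (spaceTranslate x (a : Op d k)))
        (fun x => (σ ⟨spaceTranslate x (a : Op d k),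
          spaceTranslate_mem_fieldAlgebra x (a : Op d k) a.2⟩ : Op d k)) l := by
  have : l.NeBot := by
    rcases hl with rfl | rfl
    · infer_instance
    · infer_instance
  have hzero : ∀ t a, waveHom hW hs t 0 a = Ad (wave W t) a := fun t a => by
    rw [waveHom_apply, spaceTranslate_zero]
  have hC : ∀ a ∈ fieldAlgebra d k, a ∈ cauchySubalgebra l (waveHom hW hs) (norm_waveHom hW hs) :=
    fun a ha => fieldAlgebra_le_cauchySubalgebra hd hw hW hs h hl ha
  have hmem : ∀ t, ∀ a ∈ fieldAlgebra d k, waveHom hW hs t 0 a ∈ fieldAlgebra d k :=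
    fun t a ha => by
      rw [hzero]
      exact Ad_wave_mem hW t a ha
  have hlim : ∀ a ∈ fieldAlgebra d k, ∃ b, Tendsto (fun t => waveHom hW hs t 0 a) l (𝓝 b) :=
    fun a ha => exists_tendsto_of_mem (hC a ha) 0
  obtain ⟨σ, hσ⟩ := exists_limit_starAlgHom (S := fieldAlgebra d k) isClosed_fieldAlgebra
    (fun t => waveHom hW hs t 0) hmem hlim
  have hσ' : ∀ a : fieldAlgebra d k,
      Tendsto (fun t => Ad (wave W t) (a : Op d k)) l (𝓝 (σ a : Op d k)) :=
    fun a => (hσ a).congr fun t => hzero t a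
  refine ⟨σ, hσ', fun a => tendstoUniformlyOn_univ.1 ?_⟩
  have h1 := uniformCauchySeqOn_of_mem (hC a a.2)
  simp only [waveHom_apply] at h1
  exact h1.tendstoUniformlyOn_of_tendsto fun x _ =>
    hσ' ⟨spaceTranslate x (a : Op d k), spaceTranslate_mem_fieldAlgebra x (a : Op d k) a.2⟩

lemma tendstoUniformly_dynamics (hW : W ∈ fieldAlgebra d k) (hs : IsSelfAdjoint W)
    {l : Filter ℝ} {a : Op d k} {f : Space d → Op d k}
    (h : TendstoUniformly (fun (t : ℝ) (x : Space d) => Ad (wave W t) (spaceTranslate x a)) f l) :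
    TendstoUniformly (fun (t : ℝ) (x : Space d) =>
      freeDynamics (-t) (dynamics W t (spaceTranslate x a))) f l := by
  simpa only [freeDynamics_neg_dynamics hW hs] using h

lemma tendstoUniformly_spaceTranslate (hW : W ∈ fieldAlgebra d k) (hs : IsSelfAdjoint W)
    {l : Filter ℝ} {a : Op d k} {f : Space d → Op d k}
    (h : TendstoUniformly (fun (t : ℝ) (x : Space d) => Ad (wave W t) (spaceTranslate x a)) f l) :
    TendstoUniformly (fun (t : ℝ) (p : Space d × Space d) =>
      freeDynamics (-t) (dynamics (spaceTranslate p.1 W) t (spaceTranslate p.2 a)))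
      (fun p => spaceTranslate p.1 (f (p.2 - p.1))) l := by
  rw [Metric.tendstoUniformly_iff] at h ⊢
  intro δ hδ
  filter_upwards [h δ hδ] with t ht p
  have hWy : IsSelfAdjoint (spaceTranslate p.1 W) := by
    rw [IsSelfAdjoint, spaceTranslate, ← Ad_star, hs.star_eq]
  rw [freeDynamics_neg_dynamics (spaceTranslate_mem_fieldAlgebra _ W hW) hWy,
    Ad_wave_spaceTranslate hW, dist_eq_norm, spaceTranslate, spaceTranslate, ← Ad_sub,
    norm_Ad (translation_mem_unitary _), ← dist_eq_norm]
  exact ht (p.2 - p.1)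

lemma mem_fieldAlgebra_of_isWickOperator (hw : IsWickOperator w W) (h : kernelNormInf w < ⊤) :
    W ∈ fieldAlgebra d k := by
  obtain ⟨A, hA, hA'⟩ := exists_wickOperator h
  rwa [hw.unique hA']

end assembly

end FermiJunction
end

theorem mainTheorem2 (d k : ℕ) (hd : 3 ≤ d) :
    -- The field algebra, the dynamics, and the operators with given kernels are well defined.
    (∀ f : Label k → L2 (Space d), ∃ T : Op d k, IsAnnihilation f T) ∧
    (∀ t : ℝ, ∀ a ∈ fieldAlgebra d k, freeDynamics t a ∈ fieldAlgebra d k) ∧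
    (∀ W ∈ fieldAlgebra d k, IsSelfAdjoint W →
      (∃! U : ℝ → Op d k, IsPropagator W U) ∧
      ∀ t : ℝ, ∀ a ∈ fieldAlgebra d k, dynamics W t a ∈ fieldAlgebra d k) ∧
    (∀ a : Kernel d k, kernelNormInf a < ⊤ → ∃ A ∈ fieldAlgebra d k, IsWickOperator a A) ∧
    ∃ hτ : ∀ x : Space d, ∀ a ∈ fieldAlgebra d k, spaceTranslate x a ∈ fieldAlgebra d k,
    -- For both versions of the norm of the interaction, and for both time directions:
    ∀ nrm : Kernel d k → ℝ≥0∞, (nrm = kernelNorm ∨ nrm = kernelNormInf) →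
    ∀ (w : Kernel d k) (W : Op d k), IsWickOperator w W → IsSelfAdjoint W →
      ENNReal.ofReal (8 * Real.pi * d / ((d : ℝ) - 2)) * nrm w < 1 →
    ∀ l : Filter ℝ, (l = atTop ∨ l = atBot) →
    ∃ σ : fieldAlgebra d k →⋆ₐ[ℂ] fieldAlgebra d k,
      -- the scattering endomorphism is the norm limit,
      (∀ a : fieldAlgebra d k,
        Tendsto (fun t : ℝ => ‖freeDynamics (-t) (dynamics W t (a : Op d k)) - (σ a : Op d k)‖)
          l (𝓝 0)) ∧
      -- it is given by a norm-convergent Dyson series,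
      (∀ (a : Kernel d k) (A : fieldAlgebra d k), nrm a < ⊤ → IsWickOperator a (A : Op d k) →
        ∃ D : ℕ → Op d k,
          (∀ m, Tendsto (fun t : ℝ => dysonTerm W (A : Op d k) m t) l (𝓝 (D m))) ∧
          (Summable fun m => ‖D m‖) ∧
          HasSum (fun m => Complex.I ^ m • D m) (σ A : Op d k)) ∧
      -- the limit is uniform in space translations of the operator,
      (∀ a : fieldAlgebra d k,
        TendstoUniformly
          (fun (t : ℝ) (x : Space d) =>
            freeDynamics (-t) (dynamics W t (spaceTranslate x (a : Op d k))))
          (fun x => (σ ⟨spaceTranslate x (a : Op d k), hτ x a a.2⟩ : Op d k)) l) ∧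
      -- and jointly in space translations of the interaction and of the operator.
      (∀ a : fieldAlgebra d k,
        TendstoUniformly
          (fun (t : ℝ) (p : Space d × Space d) =>
            freeDynamics (-t) (dynamics (spaceTranslate p.1 W) t (spaceTranslate p.2 (a : Op d k))))
          (fun p => spaceTranslate p.1
            (σ ⟨spaceTranslate (p.2 - p.1) (a : Op d k), hτ (p.2 - p.1) a a.2⟩ : Op d k)) l) := by
  refine ⟨fun f => ⟨ann (WithLp.toLp 2 f), isAnnihilation_iff.2 rfl⟩, freeDynamics_mem_fieldAlgebra,
    fun W hW hs => ⟨existsUnique_propagator hW hs, dynamics_mem_fieldAlgebra hW hs⟩,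
    fun a ha => exists_wickOperator ha, spaceTranslate_mem_fieldAlgebra, ?_⟩
  intro nrm hn w W hw hs hsmall l hl
  -- Both cases reduce to the smaller norm, the one with the infimum over centres; smallness and
  -- finiteness are used only in that form.
  have hle := kernelNormInf_le_of_eq hn
  have h : ENNReal.ofReal (8 * Real.pi * d / ((d : ℝ) - 2)) * kernelNormInf w < 1 :=
    (mul_le_mul_right (hle w) _).trans_lt hsmall
  have hW := mem_fieldAlgebra_of_isWickOperator hw (small_of_norm hd h).2
  obtain ⟨σ, hσ, hunif⟩ := exists_scattering hd hw hW hs h hl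
  refine ⟨σ, fun a => ?_, fun a A ha hA => ?_, fun a => ?_, fun a => ?_⟩
  · refine (tendsto_iff_norm_sub_tendsto_zero.1 (hσ a)).congr fun t => ?_
    rw [freeDynamics_neg_dynamics hW hs]
  · exact exists_hasSum_dysonTerm_limit hd hw hW hs h hl ((hle a).trans_lt ha) hA (hσ A)
  · exact tendstoUniformly_dynamics hW hs (hunif a)
  · exact tendstoUniformly_spaceTranslate hW hs (f := fun x => (σ ⟨spaceTranslate x (a : Op d k),
      spaceTranslate_mem_fieldAlgebra x (a : Op d k) a.2⟩ : Op d k)) (hunif a)
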